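/- **Setting.** Let $T\in\mathbb N$, let $(\Omega,\mathscr F,P)$ be a probability space with a filtration $(\mathscr F_s)_{s=0,\dots,T}$, and fix $t\in\{0,\dots,T\}$, weights $\mu_s>0$ ($s=t,\dots,T$) and $p,q\in[1,\infty]$ with $1/p+1/q=1$. Random variables are identified, and (in)equalities are understood, $P$-almost surely. Write $L^0(\mathscr F_t)$ and $\bar L^0(\mathscr F_t)$ for the $\mathscr F_t$-measurable random variables with values in $\mathbb R$ and in $[-\infty,\infty]$, $L^0_{++}(\mathscr F_t)=\{\varepsilon\in L^0(\mathscr F_t):\varepsilon>0\}$; $L^0(\mathscr F_t)$ carries the topology with neighbourhood bases $\{n:|m-n|\le\varepsilon\}$, $\varepsilon\in L^0_{++}(\mathscr F_t)$. Conditional expectations are understood in the generalized sense $E[Y|\mathscr F_t]=E[Y^+|\mathscr F_t]-E[Y^-|\mathscr F_t]$. For an adapted process $X=(X_s)_{s=0,\dots,T}$ let $X_{[0,t-1]}$ and $X_{[t,T]}$ be the processes obtained from $X$ by setting it to $0$ on $\{t,\dots,T\}$ and on $\{0,\dots,t-1\}$, respectively; $L^0(\mathscr O_{[0,t-1]})$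 is the set of all $X_{[0,t-1]}$ with $X$ adapted. Let $L^{t,p}=L^{t,p}(\mathscr O_{[t,T]})$ be the $L^0(\mathscr F_t)$-module of adapted processes $Y$ vanishing on $\{0,\dots,t-1\}$ with $\|Y\|_{t,p}:=E_P[\sum_{s\ge t}|Y_s|^p\mu_s\mid\mathscr F_t]^{1/p}<\infty$ if $p<\infty$, and $|Y|\le\xi$ for some $\xi\in L^0(\mathscr F_t)$ if $p=\infty$. Put $\langle Z,Y\rangle:=E_P[\sum_{s\ge t}Z_sY_s\mu_s\mid\mathscr F_t]$. For $p<\infty$, $L^{t,p}$ carries the topology with neighbourhood bases $\{Y':\|Y-Y'\|_{t,p}\le\varepsilon\}$, $\varepsilon\in L^0_{++}(\mathscr F_t)$; for $p=\infty$ the coarsest topology making $Y\mapsto\langle Z,Y\rangle\in L^0(\mathscr F_t)$ continuous for all $Z\in L^{t,1}$. Let $\mathcal X^p_t$ be the set of adapted $X$ with $X_{[t,T]}\in L^{t,p}$. A function $\alpha:\mathcal X^p_t\to\bar L^0(\mathscr F_t)$ is an *upper semicontinuous path dependent assessment index* if for every past path $\bar X\in L^0(\mathscr O_{[0,t-1]})$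 the function $F(Y)=\alpha(\bar X+Y)$ on $L^{t,p}$ is local ($F(1_AY+1_{A^c}Y')=1_AF(Y)+1_{A^c}F(Y')$ for $A\in\mathscr F_t$), quasiconcave ($F(\lambda Y+(1-\lambda)Y')\ge F(Y)\wedge F(Y')$ for $\lambda\in L^0(\mathscr F_t)$, $0\le\lambda\le1$), monotone ($Y\ge Y'$ implies $F(Y)\ge F(Y')$), and has closed upper level sets $\{F\ge m\}$ for all $m\in\bar L^0(\mathscr F_t)$. Let $\mathcal M_t$ be the set of probability measures $Q\ll P$ on $\mathscr F_T$ with $Q=P$ on $\mathscr F_t$. For $Q\in\mathcal M_t$ let $\mathcal D_t(Q)$ be the set of nonnegative predictable processes $D$ which are $Q$-a.s. decreasing with $D_0=\dots=D_t=1$ $Q$-a.s.; put $D_{T+1}:=0$. Let $Q\otimes D$ be the measure on $\Omega\times\{t,\dots,T\}$ with density $Z_s(D_s-D_{s+1})/\mu_s$, where $Z_s=dQ|_{\mathscr F_s}/dP|_{\mathscr F_s}$, with respect to $P\otimes\mu$; measures are identified with their densities. Let $\hat{\mathcal M}\otimes_{q,t}\hat{\mathcal D}$ be the set of all $Q\otimes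 D$, $Q\in\mathcal M_t$, $D\in\mathcal D_t(Q)$, with density in $L^q(P\otimes\mu)$, with the coarsest topology making $Z\mapsto\langle Z,Y\rangle\in L^0(\mathscr F_t)$ continuous for all $Y\in L^{t,p}$. A *minimal risk function* is a map $R:\hat{\mathcal M}\otimes_{q,t}\hat{\mathcal D}\times\bar L^0(\mathscr F_t)\to\bar L^0(\mathscr F_t)$ such that 1. $R$ is jointly local; 2. $s\mapsto R(Z,s)$ is increasing and right-continuous for every $Z$, i.e. $R(Z,s)=\operatorname{ess\,inf}\{R(Z,n): n>s\text{ on }\{s<\infty\}\}$ on $\{s<\infty\}$ and $R(Z,s)=\infty$ on $\{s=\infty\}$; 3. $R$ is jointly quasiconvex; 4. $\operatorname{ess\,sup}_{s\in L^0(\mathscr F_t)}R(Z,s)$ does not depend on $Z$; 5. with $R^-(Z,s):=\operatorname{ess\,sup}\{R(Z,n):n<s\text{ on }\{s>-\infty\}\}$ on $\{s>-\infty\}$ and $R^-(Z,s):=-\infty$ on $\{s=-\infty\}$, the set $\{(Z,s)\in\hat{\mathcal M}\otimes_{q,t}\hat{\mathcal D}\times L^0(\mathscr F_t):R^-(Z,s)\le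 m\}$ is closed for every $m\in\bar L^0(\mathscr F_t)$. **Theorem.** Let $\alpha:\mathcal X^p_t\to\bar L^0(\mathscr F_t)$ be an upper semicontinuous path dependent assessment index. Then there is a unique function $R:L^0(\mathscr O_{[0,t-1]})\times\hat{\mathcal M}\otimes_{q,t}\hat{\mathcal D}\times\bar L^0(\mathscr F_t)\to\bar L^0(\mathscr F_t)$ such that $R(\bar X;\cdot;\cdot)$ is a minimal risk function for every $\bar X\in L^0(\mathscr O_{[0,t-1]})$ and, for all $X\in\mathcal X^p_t$, $$\alpha(X)=\operatorname*{ess\,inf}_{Q\otimes D\in\hat{\mathcal M}\otimes_{q,t}\hat{\mathcal D}}R\Big(X_{[0,t-1]};\,Q\otimes D;\,E_Q\Big[X_t+\sum_{k=t+1}^TD_k(X_k-X_{k-1})\;\Big|\;\mathscr F_t\Big]\Big).$$ -/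

import Mathlib

open MeasureTheory Set
open scoped ENNReal Topology

noncomputable section

namespace PathAI

variable {Ω : Type*} {mΩ : MeasurableSpace Ω} {T : ℕ}

/-! ### Random variables and processes

The time set is `{0, …, T}`, i.e. `Fin (T + 1)`.  Random variables are identified when they agree
`P`-almost surely; all (in)equalities between them are meant almost surely. -/

/-- `L⁰(𝓕_t)`: classes of real random variables having an `𝓕_t`-measurable representative. -/
abbrev L0 (P : Measure Ω) (ℱ : Filtration (Fin (T + 1)) mΩ) (t : Fin (T + 1)) : Type _ :=
  {f : Ω →ₘ[P] ℝ // AEStronglyMeasurable[ℱ t] f P}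

/-- `L̄⁰(𝓕_t)`: classes of `[-∞, ∞]`-valued random variables having an `𝓕_t`-measurable
representative, with the order of almost sure dominance.  Essential infima and suprema of subsets
of `L̄⁰(𝓕_t)` are greatest lower bounds and least upper bounds for this order. -/
abbrev L0bar (P : Measure Ω) (ℱ : Filtration (Fin (T + 1)) mΩ) (t : Fin (T + 1)) : Type _ :=
  {f : Ω →ₘ[P] EReal // AEStronglyMeasurable[ℱ t] f P}

/-- The inclusion `L⁰(𝓕_t) ⊆ L̄⁰(𝓕_t)`. -/
def L0.toBar {P : Measure Ω} {ℱ : Filtration (Fin (T + 1)) mΩ} {t : Fin (T + 1)}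
    (f : L0 P ℱ t) : L0bar P ℱ t :=
  ⟨f.1.comp Real.toEReal continuous_coe_real_ereal,
    (continuous_coe_real_ereal.comp_aestronglyMeasurable f.2).congr
      (AEEqFun.coeFn_comp Real.toEReal continuous_coe_real_ereal f.1).symm⟩

/-- Families, indexed by `{0, …, T}`, of classes of real random variables. -/
abbrev Proc (T : ℕ) (P : Measure Ω) : Type _ := Fin (T + 1) → (Ω →ₘ[P] ℝ)

/-- `X` is adapted, i.e. `X ∈ L⁰(𝒪)`. -/
def Adapted {P : Measure Ω} (ℱ : Filtration (Fin (T + 1)) mΩ) (X : Proc T P) : Prop :=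
  ∀ s, AEStronglyMeasurable[ℱ s] (X s) P

/-- The part `X_{[0,t-1]}` of a process, set to `0` on `{t, …, T}`. -/
def before {P : Measure Ω} (t : Fin (T + 1)) (X : Proc T P) : Proc T P :=
  fun s => if s < t then X s else 0

/-- The part `X_{[t,T]}` of a process, set to `0` on `{0, …, t-1}`. -/
def after {P : Measure Ω} (t : Fin (T + 1)) (X : Proc T P) : Proc T P :=
  fun s => if t ≤ s then X s else 0

/-! ### Conditional expectations -/

/-- The conditional expectation `E_Q[Y | 𝓕_t] = E_Q[Y⁺ | 𝓕_t] - E_Q[Y⁻ | 𝓕_t]`, where the two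
terms are conditional expectations of nonnegative random variables.  It is the usual (generalized)
conditional expectation for all `Y` with `E_Q[|Y| | 𝓕_t] < ∞` almost surely, also if `Y` is not
integrable. -/
def condE (ℱ : Filtration (Fin (T + 1)) mΩ) (t : Fin (T + 1)) (Q : Measure Ω) (Y : Ω → ℝ) :
    Ω → ℝ :=
  fun ω => (condLExp (ℱ t) Q (fun ω' => ENNReal.ofReal (Y ω')) ω).toReal
    - (condLExp (ℱ t) Q (fun ω' => ENNReal.ofReal (-Y ω')) ω).toReal

theorem measurable_condE (ℱ : Filtration (Fin (T + 1)) mΩ) (t : Fin (T + 1)) (Q : Measure Ω)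
    (Y : Ω → ℝ) : Measurable[ℱ t] (condE ℱ t Q Y) :=
  (measurable_condLExp _ _ _).ennreal_toReal.sub (measurable_condLExp _ _ _).ennreal_toReal

/-- `E_Q[Y | 𝓕_t]` as an element of `L⁰(𝓕_t)`. -/
def condEL0 (P : Measure Ω) (ℱ : Filtration (Fin (T + 1)) mΩ) (t : Fin (T + 1)) (Q : Measure Ω)
    (Y : Ω → ℝ) : L0 P ℱ t :=
  ⟨AEEqFun.mk (condE ℱ t Q Y)
      ((measurable_condE ℱ t Q Y).mono (ℱ.le t) le_rfl).aestronglyMeasurable,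
    (measurable_condE ℱ t Q Y).stronglyMeasurable.aestronglyMeasurable.congr
      (AEEqFun.coeFn_mk _ _).symm⟩

/-- The pairing `⟨Z, X⟩ = E_P̂[Z X | 𝓕_t] = E_P[∑_{s ≥ t} Z_s X_s μ_s | 𝓕_t]`, `P̂ = P ⊗ μ`. -/
def pairing (P : Measure Ω) (ℱ : Filtration (Fin (T + 1)) mΩ) (t : Fin (T + 1))
    (μ : Fin (T + 1) → ℝ) (Z X : Proc T P) : L0 P ℱ t :=
  condEL0 P ℱ t P (fun ω => ∑ s ∈ Finset.Ici t, Z s ω * X s ω * μ s)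

/-! ### The conditional spaces and their topologies -/

/-- The conditional norm `‖X‖_{t,p} = E_P̂[|X|^p | 𝓕_t]^{1/p}` for `p < ∞`. -/
def condNorm {P : Measure Ω} (ℱ : Filtration (Fin (T + 1)) mΩ) (t : Fin (T + 1))
    (μ : Fin (T + 1) → ℝ) (p : ℝ≥0∞) (X : Proc T P) : Ω → ℝ≥0∞ :=
  fun ω => (condLExp (ℱ t) P
    (fun ω' => ∑ s ∈ Finset.Ici t, ‖X s ω'‖ₑ ^ p.toReal * ENNReal.ofReal (μ s)) ω) ^ (1 / p.toReal)

open Classical in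
/-- Membership in `L^{t,p}(𝒪_{[t,T]})`: adapted processes supported on `{t, …, T}` whose conditional
`p`-norm is finite; for `p = ∞` this says that `|X|` has an upper bound in `L⁰(𝓕_t)`. -/
def MemLtp {P : Measure Ω} (ℱ : Filtration (Fin (T + 1)) mΩ) (t : Fin (T + 1))
    (μ : Fin (T + 1) → ℝ) (p : ℝ≥0∞) (X : Proc T P) : Prop :=
  Adapted ℱ X ∧ (∀ s < t, X s = 0) ∧
    if p = ∞ then ∃ ξ : L0 P ℱ t, ∀ s, ∀ᵐ ω ∂P, |X s ω| ≤ ξ.1 ω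
    else ∀ᵐ ω ∂P, condNorm ℱ t μ p X ω < ∞

/-- The space `L^{t,p}(𝒪_{[t,T]})`. -/
abbrev Ltp (P : Measure Ω) (ℱ : Filtration (Fin (T + 1)) mΩ) (t : Fin (T + 1))
    (μ : Fin (T + 1) → ℝ) (p : ℝ≥0∞) : Type _ :=
  {X : Proc T P // MemLtp ℱ t μ p X}

/-- The topology on `E` in which the sets `{y | d x y ≤ ε}`, with `ε ∈ L⁰_{++}(𝓕_t)`, form a
neighbourhood base of `x`, for an `L⁰`-valued distance `d`. -/
@[reducible] def ballTopology {E : Type*} (P : Measure Ω) (ℱ : Filtration (Fin (T + 1)) mΩ) (t : Fin (T + 1))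
    (d : E → E → Ω → ℝ≥0∞) : TopologicalSpace E where
  IsOpen U := ∀ x ∈ U, ∃ ε : L0 P ℱ t, (∀ᵐ ω ∂P, 0 < ε.1 ω) ∧
    ∀ y, (∀ᵐ ω ∂P, d x y ω ≤ ENNReal.ofReal (ε.1 ω)) → y ∈ U
  isOpen_univ := fun x _ => ⟨⟨1, aestronglyMeasurable_one.congr AEEqFun.coeFn_one.symm⟩, by
    filter_upwards [AEEqFun.coeFn_one (α := Ω) (μ := P) (β := ℝ)] with ω hω
    simp [hω], fun y _ => mem_univ y⟩
  isOpen_inter := by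
    rintro U V hU hV x ⟨hxU, hxV⟩
    obtain ⟨ε, hε, hεU⟩ := hU x hxU
    obtain ⟨δ, hδ, hδV⟩ := hV x hxV
    refine ⟨⟨ε.1 ⊓ δ.1, (continuous_inf.comp_aestronglyMeasurable (ε.2.prodMk δ.2)).congr
      (AEEqFun.coeFn_inf ε.1 δ.1).symm⟩, ?_, ?_⟩
    · filter_upwards [AEEqFun.coeFn_inf ε.1 δ.1, hε, hδ] with ω h h1 h2
      rw [h]; exact lt_inf_iff.2 ⟨h1, h2⟩
    · intro y hy
      refine ⟨hεU y ?_, hδV y ?_⟩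
      · filter_upwards [AEEqFun.coeFn_inf ε.1 δ.1, hy] with ω h h1
        rw [h] at h1
        exact h1.trans (ENNReal.ofReal_le_ofReal inf_le_left)
      · filter_upwards [AEEqFun.coeFn_inf ε.1 δ.1, hy] with ω h h1
        rw [h] at h1
        exact h1.trans (ENNReal.ofReal_le_ofReal inf_le_right)
  isOpen_sUnion := by
    rintro S hS x ⟨U, hU, hx⟩
    obtain ⟨ε, hε, h⟩ := hS U hU x hx
    exact ⟨ε, hε, fun y hy => ⟨U, hU, h y hy⟩⟩

/-- The topology of `L⁰(𝓕_t)` induced by the balls `{n | |m - n| ≤ ε}`, `ε ∈ L⁰_{++}(𝓕_t)`. -/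
@[reducible] def l0Topology (P : Measure Ω) (ℱ : Filtration (Fin (T + 1)) mΩ) (t : Fin (T + 1)) :
    TopologicalSpace (L0 P ℱ t) :=
  ballTopology P ℱ t (fun m n ω => ‖m.1 ω - n.1 ω‖ₑ)

open Classical in
/-- The topology of `L^{t,p}(𝒪_{[t,T]})`: the topology of the conditional norm `‖·‖_{t,p}` if
`p < ∞`; if `p = ∞`, the conditional weak* topology, i.e. the coarsest topology for which
`X ↦ ⟨Z, X⟩` is continuous for all `Z ∈ L^{t,1}(𝒪_{[t,T]})`. -/
@[reducible] def ltpTopology (P : Measure Ω) (ℱ : Filtration (Fin (T + 1)) mΩ) (t : Fin (T + 1))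
    (μ : Fin (T + 1) → ℝ) (p : ℝ≥0∞) : TopologicalSpace (Ltp P ℱ t μ p) :=
  if p = ∞ then
    ⨅ Z : Ltp P ℱ t μ 1,
      TopologicalSpace.induced (fun X => pairing P ℱ t μ Z.1 X.1) (l0Topology P ℱ t)
  else ballTopology P ℱ t (fun X Y ω => condNorm ℱ t μ p (fun s => X.1 s - Y.1 s) ω)

/-! ### Path dependent assessment indices -/

/-- Upper semicontinuous conditional assessment indices on `L^{t,p}(𝒪_{[t,T]})`: functions with
values in `L̄⁰(𝓕_t)` that are `L⁰(𝓕_t)`-local, `L⁰(𝓕_t)`-quasiconcave, monotone with respect to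
almost sure dominance, and whose upper level sets are closed. -/
structure IsUSCAssessmentIndex {P : Measure Ω} {ℱ : Filtration (Fin (T + 1)) mΩ}
    {t : Fin (T + 1)} {μ : Fin (T + 1) → ℝ} {p : ℝ≥0∞}
    (F : Ltp P ℱ t μ p → L0bar P ℱ t) : Prop where
  isLocal : ∀ A : Set Ω, MeasurableSet[ℱ t] A → ∀ X Y W : Ltp P ℱ t μ p,
    (∀ s, ∀ᵐ ω ∂P, (ω ∈ A → W.1 s ω = X.1 s ω) ∧ (ω ∉ A → W.1 s ω = Y.1 s ω)) →
    ∀ᵐ ω ∂P, (ω ∈ A → (F W).1 ω = (F X).1 ω) ∧ (ω ∉ A → (F W).1 ω = (F Y).1 ω)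
  quasiconcave : ∀ l : L0 P ℱ t, (∀ᵐ ω ∂P, 0 ≤ l.1 ω ∧ l.1 ω ≤ 1) → ∀ X Y W : Ltp P ℱ t μ p,
    (∀ s, ∀ᵐ ω ∂P, W.1 s ω = l.1 ω * X.1 s ω + (1 - l.1 ω) * Y.1 s ω) →
    ∀ᵐ ω ∂P, min ((F X).1 ω) ((F Y).1 ω) ≤ (F W).1 ω
  mono : ∀ X Y : Ltp P ℱ t μ p, (∀ s, X.1 s ≤ Y.1 s) → F X ≤ F Y
  usc : ∀ m : L0bar P ℱ t, IsClosed[ltpTopology P ℱ t μ p] {X | m ≤ F X}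

/-- The space `𝒳^p_t` of adapted processes `X` with `X_{[t,T]} ∈ L^{t,p}(𝒪_{[t,T]})`. -/
abbrev XSpace (P : Measure Ω) (ℱ : Filtration (Fin (T + 1)) mΩ) (t : Fin (T + 1))
    (μ : Fin (T + 1) → ℝ) (p : ℝ≥0∞) : Type _ :=
  {X : Proc T P // Adapted ℱ X ∧ MemLtp ℱ t μ p (after t X)}

/-- The space `L⁰(𝒪_{[0,t-1]})` of past paths: adapted processes vanishing on `{t, …, T}`. -/
abbrev Past (P : Measure Ω) (ℱ : Filtration (Fin (T + 1)) mΩ) (t : Fin (T + 1)) : Type _ :=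
  {x : Proc T P // Adapted ℱ x ∧ ∀ s, t ≤ s → x s = 0}

/-- The past `X_{[0,t-1]}` of `X ∈ 𝒳^p_t`. -/
def pastOf {P : Measure Ω} {ℱ : Filtration (Fin (T + 1)) mΩ} {t : Fin (T + 1)}
    {μ : Fin (T + 1) → ℝ} {p : ℝ≥0∞} (X : XSpace P ℱ t μ p) : Past P ℱ t :=
  ⟨before t X.1, by
    refine ⟨fun s => ?_, fun s hs => ?_⟩
    · by_cases h : s < t
      · simpa [before, h] using X.2.1 s
      · simpa [before, h] using aestronglyMeasurable_zero.congr (AEEqFun.coeFn_zero).symm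
    · simp [before, not_lt.2 hs]⟩

/-- The process `X̄_{[0,t-1]} + X_{[t,T]} ∈ 𝒳^p_t`. -/
def concat {P : Measure Ω} {ℱ : Filtration (Fin (T + 1)) mΩ} {t : Fin (T + 1)}
    {μ : Fin (T + 1) → ℝ} {p : ℝ≥0∞} (x : Past P ℱ t) (Y : Ltp P ℱ t μ p) : XSpace P ℱ t μ p :=
  ⟨fun s => x.1 s + Y.1 s, by
    refine ⟨fun s => ((x.2.1 s).add (Y.2.1 s)).congr (AEEqFun.coeFn_add _ _).symm, ?_⟩
    have h : after t (fun s => x.1 s + Y.1 s) = Y.1 := by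
      funext s
      by_cases h : t ≤ s
      · simp [after, h, x.2.2 s h]
      · simp [after, h, Y.2.2.1 s (not_le.1 h)]
    rw [h]; exact Y.2⟩

/-- Upper semicontinuous path dependent assessment indices `α : 𝒳^p_t → L̄⁰(𝓕_t)`. -/
def IsUSCPathDependentAI {P : Measure Ω} {ℱ : Filtration (Fin (T + 1)) mΩ} {t : Fin (T + 1)}
    {μ : Fin (T + 1) → ℝ} {p : ℝ≥0∞} (α : XSpace P ℱ t μ p → L0bar P ℱ t) : Prop :=
  ∀ x : Past P ℱ t, IsUSCAssessmentIndex (fun Y : Ltp P ℱ t μ p => α (concat x Y))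

/-! ### The dual set -/

/-- `𝓜_t`: probability measures `Q ≪ P` on `𝓕_T` with `Q = P` on `𝓕_t`.  (A measure `Q ≪ P` on
`𝓕_T` is identified with its extension to the ambient σ-algebra having the same,
`𝓕_T`-measurable, density.) -/
structure MemM (P : Measure Ω) (ℱ : Filtration (Fin (T + 1)) mΩ) (t : Fin (T + 1))
    (Q : Measure Ω) : Prop where
  prob : IsProbabilityMeasure Q
  ac : Q ≪ P
  density : AEStronglyMeasurable[ℱ (Fin.last T)] (Q.rnDeriv P) P
  eq_on : ∀ A, MeasurableSet[ℱ t] A → Q A = P A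

/-- `𝓓_t(Q)`: predictable discounting processes from time `t`. -/
structure MemD {P : Measure Ω} (ℱ : Filtration (Fin (T + 1)) mΩ) (t : Fin (T + 1))
    (Q : Measure Ω) (D : Proc T P) : Prop where
  adapted : Adapted ℱ D
  nonneg : ∀ s, 0 ≤ D s
  one : ∀ s ≤ t, ∀ᵐ ω ∂Q, D s ω = 1
  predictable : ∀ s, AEStronglyMeasurable[ℱ (Order.pred s)] (D s) P
  decreasing : ∀ s s', s ≤ s' → ∀ᵐ ω ∂Q, D s' ω ≤ D s ω

/-- The density process `Z_s = dQ/dP` on `𝓕_s`. -/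
def densityProcess (P : Measure Ω) (ℱ : Filtration (Fin (T + 1)) mΩ) (Q : Measure Ω) : Proc T P :=
  fun s => AEEqFun.mk
    (fun ω => (@Measure.rnDeriv Ω (ℱ s) (Q.trim (ℱ.le s)) (P.trim (ℱ.le s)) ω).toReal)
    ((@Measure.measurable_rnDeriv Ω (ℱ s) (Q.trim (ℱ.le s))
      (P.trim (ℱ.le s))).ennreal_toReal.mono (ℱ.le s) le_rfl).aestronglyMeasurable

/-- `D_{s+1}`, with the convention `D_{T+1} = 0`. -/
def next {P : Measure Ω} (D : Proc T P) : Proc T P :=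
  fun s => if s = Fin.last T then 0 else D (Order.succ s)

/-- The density `Z_s (D_s - D_{s+1}) / μ_s`, `s ≥ t`, of `Q ⊗ D` with respect to `P̂ = P ⊗ μ`
(a measure on `Ω × {t, …, T}`; the density is extended by `0` to `s < t`).
The measure `Q ⊗ D` is identified with this density. -/
def otimes {P : Measure Ω} (ℱ : Filtration (Fin (T + 1)) mΩ) (t : Fin (T + 1))
    (μ : Fin (T + 1) → ℝ) (Q : Measure Ω) (D : Proc T P) : Proc T P :=
  fun s => if t ≤ s then (μ s)⁻¹ • (densityProcess P ℱ Q s * (D s - next D s)) else 0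

/-- The pairs `(Q, D)` with `Q ∈ 𝓜_t`, `D ∈ 𝓓_t(Q)` and `d(Q ⊗ D)/dP̂ ∈ L^q`.  As the weights `μ_s`
are positive constants, a process is in `L^q(P ⊗ μ)` iff all its coordinates are in `L^q(P)`. -/
structure Admissible {P : Measure Ω} (ℱ : Filtration (Fin (T + 1)) mΩ) (t : Fin (T + 1))
    (μ : Fin (T + 1) → ℝ) (q : ℝ≥0∞) (Q : Measure Ω) (D : Proc T P) : Prop where
  memM : MemM P ℱ t Q
  memD : MemD ℱ t Q D
  memLp : ∀ s, MemLp (otimes ℱ t μ Q D s) q P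

/-- The set `𝓜 ⊗_{q,t} 𝓓` of all `Q ⊗ D` for admissible pairs `(Q, D)`. -/
abbrev MD (P : Measure Ω) (ℱ : Filtration (Fin (T + 1)) mΩ) (t : Fin (T + 1))
    (μ : Fin (T + 1) → ℝ) (q : ℝ≥0∞) : Type _ :=
  {Z : Proc T P // ∃ (Q : Measure Ω) (D : Proc T P), Admissible ℱ t μ q Q D ∧ Z = otimes ℱ t μ Q D}

/-- The weak topology on `𝓜 ⊗_{q,t} 𝓓`, as a subset of the dual of `L^{t,p}(𝒪_{[t,T]})`: the coarsest
topology for which `Z ↦ ⟨Z, X⟩` is continuous for all `X ∈ L^{t,p}(𝒪_{[t,T]})`. -/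
@[reducible] def mdTopology (P : Measure Ω) (ℱ : Filtration (Fin (T + 1)) mΩ) (t : Fin (T + 1))
    (μ : Fin (T + 1) → ℝ) (p q : ℝ≥0∞) : TopologicalSpace (MD P ℱ t μ q) :=
  ⨅ X : Ltp P ℱ t μ p,
    TopologicalSpace.induced (fun Z => pairing P ℱ t μ Z.1 X.1) (l0Topology P ℱ t)

/-- The aggregated future `X_t + ∑_{k = t+1}^T D_k (X_k - X_{k-1})`. -/
def discountedFuture {P : Measure Ω} (t : Fin (T + 1)) (D X : Proc T P) : Ω →ₘ[P] ℝ :=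
  X t + ∑ k ∈ Finset.Ioi t, D k * (X k - X (Order.pred k))

/-! ### Minimal risk functions -/

/-- `G` is the left-continuous version of `F : L̄⁰ → L̄⁰`:
`G(m) = ess sup {F(n) : n < m on {m > -∞}}` on `{m > -∞}` and `G(m) = -∞` on `{m = -∞}`. -/
def IsLeftVersion {P : Measure Ω} {ℱ : Filtration (Fin (T + 1)) mΩ} {t : Fin (T + 1)}
    (F G : L0bar P ℱ t → L0bar P ℱ t) : Prop :=
  ∀ m, IsLUB {k | ∃ n : L0bar P ℱ t, (∀ᵐ ω ∂P, m.1 ω ≠ ⊥ → n.1 ω < m.1 ω) ∧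
    ∀ᵐ ω ∂P, (m.1 ω ≠ ⊥ → k.1 ω = (F n).1 ω) ∧ (m.1 ω = ⊥ → k.1 ω = ⊥)} (G m)

/-- `G` is the right-continuous version of `F : L̄⁰ → L̄⁰`:
`G(m) = ess inf {F(n) : n > m on {m < ∞}}` on `{m < ∞}` and `G(m) = ∞` on `{m = ∞}`. -/
def IsRightVersion {P : Measure Ω} {ℱ : Filtration (Fin (T + 1)) mΩ} {t : Fin (T + 1)}
    (F G : L0bar P ℱ t → L0bar P ℱ t) : Prop :=
  ∀ m, IsGLB {k | ∃ n : L0bar P ℱ t, (∀ᵐ ω ∂P, m.1 ω ≠ ⊤ → m.1 ω < n.1 ω) ∧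
    ∀ᵐ ω ∂P, (m.1 ω ≠ ⊤ → k.1 ω = (F n).1 ω) ∧ (m.1 ω = ⊤ → k.1 ω = ⊤)} (G m)

/-- Minimal risk functions on the normalized dual set `𝓜 ⊗_{q,t} 𝓓`: jointly local, increasing and
right-continuous in the second argument, jointly quasiconvex, with a uniform asymptotic maximum, and
with a jointly lower semicontinuous left-continuous version `R⁻`, i.e. the sets
`{(Z, s) : R⁻(Z, s) ≤ m}` are closed in `(𝓜 ⊗_{q,t} 𝓓) × L⁰(𝓕_t)`. -/
structure IsMinimalRiskFunction {P : Measure Ω} {ℱ : Filtration (Fin (T + 1)) mΩ}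
    {t : Fin (T + 1)} {μ : Fin (T + 1) → ℝ} (p : ℝ≥0∞) {q : ℝ≥0∞}
    (R : MD P ℱ t μ q → L0bar P ℱ t → L0bar P ℱ t) : Prop where
  isLocal : ∀ A : Set Ω, MeasurableSet[ℱ t] A →
    ∀ (Z₁ Z₂ Z : MD P ℱ t μ q) (s₁ s₂ s : L0bar P ℱ t),
    (∀ k, ∀ᵐ ω ∂P, (ω ∈ A → Z.1 k ω = Z₁.1 k ω) ∧ (ω ∉ A → Z.1 k ω = Z₂.1 k ω)) →
    (∀ᵐ ω ∂P, (ω ∈ A → s.1 ω = s₁.1 ω) ∧ (ω ∉ A → s.1 ω = s₂.1 ω)) →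
    ∀ᵐ ω ∂P, (ω ∈ A → (R Z s).1 ω = (R Z₁ s₁).1 ω) ∧ (ω ∉ A → (R Z s).1 ω = (R Z₂ s₂).1 ω)
  increasing : ∀ Z, Monotone (R Z)
  rightContinuous : ∀ Z, IsRightVersion (R Z) (R Z)
  quasiconvex : ∀ l : L0 P ℱ t, (∀ᵐ ω ∂P, 0 ≤ l.1 ω ∧ l.1 ω ≤ 1) →
    ∀ (Z₁ Z₂ Z : MD P ℱ t μ q) (s₁ s₂ s : L0bar P ℱ t),
    (∀ k, ∀ᵐ ω ∂P, Z.1 k ω = l.1 ω * Z₁.1 k ω + (1 - l.1 ω) * Z₂.1 k ω) →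
    (∀ᵐ ω ∂P, s.1 ω = (l.1 ω : EReal) * s₁.1 ω + ((1 - l.1 ω : ℝ) : EReal) * s₂.1 ω) →
    ∀ᵐ ω ∂P, (R Z s).1 ω ≤ max ((R Z₁ s₁).1 ω) ((R Z₂ s₂).1 ω)
  asymptoticMax : ∃ u : L0bar P ℱ t, ∀ Z, IsLUB (range fun s : L0 P ℱ t => R Z s.toBar) u
  lsc : ∃ Rminus : MD P ℱ t μ q → L0bar P ℱ t → L0bar P ℱ t,
    (∀ Z, IsLeftVersion (R Z) (Rminus Z)) ∧
    ∀ m : L0bar P ℱ t,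
      IsClosed[@instTopologicalSpaceProd _ _ (mdTopology P ℱ t μ p q) (l0Topology P ℱ t)]
        {z : MD P ℱ t μ q × L0 P ℱ t | Rminus z.1 z.2.toBar ≤ m}

end PathAI

end

/-! With the past path fixed, the claim concerns a single function F on L^{t,p} that is local,
quasiconcave, monotone and upper semicontinuous. Bayes' formula and Abel summation turn the
Q-conditional expectation of the discounted future into the pairing ⟨Q ⊗ D, X⟩
(`condE_discountedFuture`). A multiplicative decomposition shows that the densities Q ⊗ D are
exactly the nonnegative adapted L^q processes Z on {t, …, T} with E[∑ Z_s μ_s | 𝓕_t] = 1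
(`isDual_otimes`, `exists_admissible_of_isDual`). What remains is a conditional quasiconvex duality
on a normalized dual set.

Existence. Let M(Z, n) be the essential supremum of F X on {⟨Z, X⟩ ≤ n} (`maxRisk`) and R its
right-continuous version (`riskOf`). Quasiconvexity holds because a bound on a convex combination of
two pairings forces one of the two individual bounds. The supremum over s is ess sup F for every Z.
The condition R⁻(Z, v) ≤ m says that v ≤ ⟨Z, X⟩ on {F X > m} for every X, an intersection of closed
conditions. The bound F X ≤ R(Z, ⟨Z, X⟩) is immediate. If F X < c on some event, X is separated
there from {F ≥ c} by a process z; monotonicity of F makes z nonnegative, z can be normalized to an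
element Z of the dual set, and M(Z, ·) ≤ c slightly above ⟨Z, X⟩ (`isGLB_riskOf`).

Uniqueness. If R represents F, then M ≤ R since R is increasing. Conversely R(Z₀, s) ≤ M(Z₀, n) for
s < n (`le_maxRisk_of_lt`): otherwise (Z₀, n) is separated from the convex closed set {R⁻ ≤ c}. The
separating functional may have slope zero in the scalar direction. The uniform asymptotic maximum
yields a second functional of strictly negative slope, and adding a small multiple of it produces a
payoff Y' with ⟨Z₀, Y'⟩ ≤ n for which R(Z, ⟨Z, Y'⟩) ≤ c is impossible on a nonnull event, whatever Z
is. This contradicts the representation of F Y' and M(Z₀, n) < c. Right-continuity turns the two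
bounds into equality (`eq_riskOf`).

Analytic tools. The topologies belong to L⁰-modules and are too fine for plain sequences.
Concatenating a sequence along 𝓕_t-measurable indices (`glueFilter`) shows that the closed level
sets are stable under dominated almost sure limits. Convex sets with this stability are separated
from points by ordinary duality: Hahn-Banach and Riesz for finite exponent, a Krein-Smulian argument
through L² for exponent ∞ (`exists_separating`). An exhaustion argument then turns a strict
inequality of expectations into a uniform conditional inequality on an event of positive probability
(`exists_local_separation`). -/

open MeasureTheory Set Filter
open scoped ENNReal Topology

noncomputable section

namespace PathAI

section

/-! ### Riesz representation and separation in L^p for p < ∞. -/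

section Riesz

variable {α : Type*} {m : MeasurableSpace α} {ν : Measure α} [IsFiniteMeasure ν]

/-- The indicator functions of a sequence of disjoint sets sum up in `L^p` to the indicator function
of the union. -/
theorem hasSum_indicatorConstLp {p : ℝ≥0∞} [Fact (1 ≤ p)] (hp : p ≠ ∞) {A : ℕ → Set α}
    (hA : ∀ i, MeasurableSet (A i)) (hd : Pairwise (Function.onFun Disjoint A)) :
    HasSum (fun i => indicatorConstLp p (hA i) (measure_ne_top ν _) (1 : ℝ))
      (indicatorConstLp p (MeasurableSet.iUnion hA) (measure_ne_top ν _) (1 : ℝ)) := by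
  have h1 : ∀ s : Finset ℕ, ∑ i ∈ s, indicatorConstLp p (hA i) (measure_ne_top ν _) (1 : ℝ)
      = indicatorConstLp p (s.measurableSet_biUnion fun i _ => hA i) (measure_ne_top ν _)
        (1 : ℝ) := by
    intro s
    induction s using Finset.induction_on with
    | empty =>
      simp only [Finset.sum_empty]
      ext1
      filter_upwards [indicatorConstLp_coeFn (p := p) (μ := ν) (c := (1 : ℝ))
        (hs := (∅ : Finset ℕ).measurableSet_biUnion fun i _ => hA i) (hμs := measure_ne_top ν _),
        Lp.coeFn_zero ℝ p ν] with ω h h'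
      rw [h, h']; simp
    | insert a s ha ih =>
      rw [Finset.sum_insert ha, ih, ← indicatorConstLp_disjoint_union]
      · congr 1
        simp
      · rw [Set.disjoint_iUnion₂_right]
        intro i hi
        exact hd fun h => ha (h ▸ hi)
  rw [HasSum, SummationFilter.unconditional_filter]
  simp only [h1]
  refine tendsto_indicatorConstLp_set hp ?_
  have h2 : ∀ s : Finset ℕ, ν (symmDiff (⋃ i ∈ s, A i) (⋃ i, A i))
      ≤ ∑' i : {x // x ∉ s}, ν (A i) := by
    intro s
    refine (measure_mono ?_).trans (measure_iUnion_le fun i : {x // x ∉ s} => A i)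
    rintro ω (⟨h, h'⟩ | ⟨h, h'⟩)
    · exact absurd (Set.iUnion₂_subset_iUnion _ _ h) h'
    · obtain ⟨i, hi⟩ := Set.mem_iUnion.1 h
      exact Set.mem_iUnion.2 ⟨⟨i, fun his => h' (Set.mem_iUnion₂.2 ⟨i, his, hi⟩)⟩, hi⟩
  refine tendsto_of_tendsto_of_tendsto_of_le_of_le tendsto_const_nhds
    (ENNReal.tendsto_tsum_compl_atTop_zero (f := fun i => ν (A i)) ?_) (fun _ => zero_le) h2
  rw [← measure_iUnion hd hA]
  exact measure_ne_top _ _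

/-- A continuous functional on `L^p`, `p < ∞`, is given on indicator functions by an integrable
density. -/
theorem exists_integrable_repr_indicator {p : ℝ≥0∞} [Fact (1 ≤ p)] (hp : p ≠ ∞)
    (f : Lp ℝ p ν →L[ℝ] ℝ) :
    ∃ g : α → ℝ, Measurable g ∧ Integrable g ν ∧ ∀ (s : Set α) (hs : MeasurableSet s),
      f (indicatorConstLp p hs (measure_ne_top ν _) (1 : ℝ)) = ∫ ω in s, g ω ∂ν := by
  classical
  let V : SignedMeasure α :=
    { measureOf' := fun s => if hs : MeasurableSet s then
        f (indicatorConstLp p hs (measure_ne_top ν _) (1 : ℝ)) else 0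
      empty' := by simp
      not_measurable' := fun s hs => dif_neg hs
      m_iUnion' := by
        intro A hA hd
        simp only [hA, MeasurableSet.iUnion hA, dif_pos]
        exact (hasSum_indicatorConstLp hp hA hd).mapL f }
  have hV : ∀ s (hs : MeasurableSet s),
      V s = f (indicatorConstLp p hs (measure_ne_top ν _) (1 : ℝ)) := fun s hs => dif_pos hs
  have hac : V ≪ᵥ ν.toENNRealVectorMeasure := by
    refine VectorMeasure.AbsolutelyContinuous.mk fun s hs h => ?_
    rw [Measure.toENNRealVectorMeasure_apply_measurable hs] at h
    rw [hV s hs]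
    have : indicatorConstLp p hs (measure_ne_top ν _) (1 : ℝ) = 0 := by
      rw [← norm_eq_zero, norm_indicatorConstLp (zero_lt_one.trans_le Fact.out).ne' hp]
      have : p.toReal ≠ 0 := (ENNReal.toReal_pos (zero_lt_one.trans_le Fact.out).ne' hp).ne'
      simp [Measure.real, h, this]
    rw [this, map_zero]
  refine ⟨V.rnDeriv ν, SignedMeasure.measurable_rnDeriv _ _,
    SignedMeasure.integrable_rnDeriv _ _, fun s hs => ?_⟩
  rw [← hV s hs]
  conv_lhs => rw [← SignedMeasure.withDensityᵥ_rnDeriv_eq V ν hac]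
  rw [withDensityᵥ_apply (SignedMeasure.integrable_rnDeriv _ _) hs]

/-- Linearity carries the formula from indicators to simple functions. A bounded `y` is a pointwise
limit of simple functions with the same bound; the left side converges by Vitali's theorem and
continuity of `f`, the right side by dominated convergence. Boundedness matters because `g` is only
known to be integrable. -/
theorem apply_toLp_eq_integral_of_bounded {p : ℝ≥0∞} [Fact (1 ≤ p)] (hp : p ≠ ∞)
    (f : Lp ℝ p ν →L[ℝ] ℝ) {g : α → ℝ} (hg : Integrable g ν)
    (h : ∀ (s : Set α) (hs : MeasurableSet s),
      f (indicatorConstLp p hs (measure_ne_top ν _) (1 : ℝ)) = ∫ ω in s, g ω ∂ν)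
    {y : α → ℝ} (hy : Measurable y) {c : ℝ} (hc : ∀ ω, |y ω| ≤ c) (hyp : MemLp y p ν) :
    f (hyp.toLp y) = ∫ ω, g ω * y ω ∂ν := by
  have hs : ∀ φ : SimpleFunc α ℝ, ∀ hφ : MemLp φ p ν,
      Integrable (fun ω => g ω * φ ω) ν ∧ f (hφ.toLp φ) = ∫ ω, g ω * φ ω ∂ν := by
    intro φ
    induction φ using SimpleFunc.induction with
    | const a hs =>
      rename_i s
      intro hφ
      have e : (fun ω => g ω * (SimpleFunc.piecewise s hs (SimpleFunc.const α a)
          (SimpleFunc.const α 0)) ω) = s.indicator (fun ω => a * g ω) := by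
        funext ω
        by_cases hω : ω ∈ s <;> simp [hω, mul_comm]
      rw [e]
      refine ⟨(hg.const_mul a).indicator hs, ?_⟩
      rw [integral_indicator hs, integral_const_mul, ← h s hs, ← smul_eq_mul, ← map_smul]
      congr 1
      ext1
      filter_upwards [MemLp.coeFn_toLp hφ, Lp.coeFn_smul a
        (indicatorConstLp p hs (measure_ne_top ν _) (1 : ℝ)),
        indicatorConstLp_coeFn (p := p) (hs := hs) (hμs := measure_ne_top ν _) (c := (1 : ℝ))]
        with ω h1 h2 h3
      rw [h1, h2, Pi.smul_apply, h3]
      by_cases hω : ω ∈ s <;> simp [hω]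
    | add hd h1 h2 =>
      rename_i φ₁ φ₂
      intro hφ
      have m1 : MemLp φ₁ p ν := φ₁.memLp_of_isFiniteMeasure p ν
      have m2 : MemLp φ₂ p ν := φ₂.memLp_of_isFiniteMeasure p ν
      obtain ⟨i1, e1⟩ := h1 m1
      obtain ⟨i2, e2⟩ := h2 m2
      have e : (fun ω => g ω * (φ₁ + φ₂) ω) = fun ω => g ω * φ₁ ω + g ω * φ₂ ω := by
        funext ω; simp [mul_add]
      rw [e]
      refine ⟨i1.add i2, ?_⟩
      rw [integral_add i1 i2, ← e1, ← e2, ← map_add, ← MemLp.toLp_add]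
      rfl
  have hsm : StronglyMeasurable y := hy.stronglyMeasurable
  have hmem : ∀ n, MemLp (hsm.approxBounded c n) p ν := fun n =>
    (hsm.approxBounded c n).memLp_of_isFiniteMeasure p ν
  have hc0 : ∀ ω, 0 ≤ c := fun ω => (abs_nonneg _).trans (hc ω)
  rcases isEmpty_or_nonempty α with hα | ⟨⟨ω₀⟩⟩
  · have : ν = 0 := Measure.eq_zero_of_isEmpty ν
    subst this
    have : hyp.toLp y = 0 := by
      ext1; rw [Filter.EventuallyEq, ae_zero]; exact eventually_bot
    rw [this]; simp
  have hc0 := hc0 ω₀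
  have hbd : ∀ n ω, |hsm.approxBounded c n ω| ≤ c := fun n ω => hsm.norm_approxBounded_le hc0 n ω
  have hlim : ∀ ω, Tendsto (fun n => hsm.approxBounded c n ω) atTop (𝓝 (y ω)) := fun ω =>
    hsm.tendsto_approxBounded_of_norm_le (hc ω)
  have t1 : Tendsto (fun n => f ((hmem n).toLp _)) atTop (𝓝 (f (hyp.toLp y))) := by
    refine (f.continuous.tendsto _).comp ?_
    rw [Lp.tendsto_Lp_iff_tendsto_eLpNorm'' _ hmem]
    refine tendsto_Lp_finite_of_tendsto_ae (Fact.out) hp (fun n => (hmem n).1) hyp ?_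
      (Eventually.of_forall hlim)
    refine (unifIntegrable_of (Fact.out) hp (fun n => (hmem n).1) fun ε hε => ?_)
    -- The threshold `c + 1` exceeds the common bound `c`, so the sets in the uniform integrability
    -- criterion are empty.
    refine ⟨⟨c, hc0⟩ + 1, fun n => ?_⟩
    have : {x | (⟨c, hc0⟩ + 1 : NNReal) ≤ ‖hsm.approxBounded c n x‖₊} = ∅ := by
      ext x
      simp only [mem_ofPred_eq, mem_empty_iff_false, iff_false, not_le]
      rw [← NNReal.coe_lt_coe]
      have h1 := hbd n x
      have h2 : ((⟨c, hc0⟩ + 1 : NNReal) : ℝ) = c + 1 := rfl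
      rw [h2, coe_nnnorm, Real.norm_eq_abs]
      linarith
    rw [this]; simp
  have t2 : Tendsto (fun n => ∫ ω, g ω * hsm.approxBounded c n ω ∂ν) atTop
      (𝓝 (∫ ω, g ω * y ω ∂ν)) := by
    refine tendsto_integral_of_dominated_convergence (fun ω => |g ω| * c)
      (fun n => (hs _ (hmem n)).1.1) (hg.abs.mul_const c) ?_ ?_
    · intro n
      filter_upwards with ω
      rw [Real.norm_eq_abs, abs_mul]
      exact mul_le_mul_of_nonneg_left (hbd n ω) (abs_nonneg _)
    · filter_upwards with ω
      exact (hlim ω).const_mul _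
  refine tendsto_nhds_unique t1 ?_
  simp only [(hs _ (hmem _)).2]
  exact t2

theorem measurable_sign_cast : Measurable fun x : ℝ => (SignType.sign x : ℝ) := by
  have : (fun x : ℝ => (SignType.sign x : ℝ)) = fun x => if 0 < x then 1 else
      if x < 0 then -1 else 0 := by
    funext x
    rw [sign_apply]
    split_ifs <;> simp
  rw [this]
  exact Measurable.ite measurableSet_Ioi measurable_const
    (Measurable.ite measurableSet_Iio measurable_const measurable_const)

/-- Testing with the sign of `g` on `{C < |g|}` shows that the integral of `|g| - C` over this set
is at most 0. The integrand is positive there, so the set is null. -/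
theorem memLp_top_of_bounded_test {g : α → ℝ} (hgm : Measurable g) (hg : Integrable g ν)
    {C : ℝ} (h : ∀ y : α → ℝ, Measurable y → (∃ c, ∀ ω, |y ω| ≤ c) →
      |∫ ω, g ω * y ω ∂ν| ≤ C * (eLpNorm y 1 ν).toReal) (hC : 0 ≤ C) : MemLp g ∞ ν := by
  refine memLp_top_of_bound hgm.aestronglyMeasurable C ?_
  have hA : MeasurableSet {ω | C < |g ω|} := measurableSet_lt measurable_const hgm.abs
  set A := {ω | C < |g ω|} with hAdef
  have hs : Measurable fun ω => (SignType.sign (g ω) : ℝ) := measurable_sign_cast.comp hgm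
  have hb : ∀ ω, |A.indicator (fun ω => (SignType.sign (g ω) : ℝ)) ω| ≤ A.indicator 1 ω := by
    intro ω
    by_cases hω : ω ∈ A
    · simp only [hω, indicator_of_mem, Pi.one_apply]
      rcases lt_trichotomy (g ω) 0 with h | h | h <;> simp [h]
    · simp [hω]
  have h1 := h (A.indicator fun ω => (SignType.sign (g ω) : ℝ)) (hs.indicator hA)
    ⟨1, fun ω => (hb ω).trans (by by_cases hω : ω ∈ A <;> simp [hω])⟩
  have e1 : (fun ω => g ω * A.indicator (fun ω => (SignType.sign (g ω) : ℝ)) ω)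
      = A.indicator fun ω => |g ω| := by
    funext ω
    by_cases hω : ω ∈ A
    · simp [hω]
    · simp [hω]
  have e2 : (eLpNorm (A.indicator fun ω => (SignType.sign (g ω) : ℝ)) 1 ν).toReal ≤ ν.real A := by
    rw [Measure.real]
    refine ENNReal.toReal_mono (measure_ne_top _ _) ?_
    rw [eLpNorm_one_eq_lintegral_enorm, ← lintegral_indicator_one hA]
    refine lintegral_mono fun ω => ?_
    rw [← ofReal_norm, Real.norm_eq_abs]
    refine (ENNReal.ofReal_le_ofReal (hb ω)).trans ?_
    by_cases hω : ω ∈ A <;> simp [hω]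
  rw [e1, integral_indicator hA] at h1
  have h2 : ∫ ω in A, (|g ω| - C) ∂ν ≤ 0 := by
    rw [integral_sub hg.abs.integrableOn (integrable_const _), setIntegral_const, smul_eq_mul]
    have := (le_abs_self _).trans (h1.trans (mul_le_mul_of_nonneg_left e2 hC))
    linarith
  have h3 : ∫ ω in A, (|g ω| - C) ∂ν = 0 := le_antisymm h2
    (setIntegral_nonneg hA fun ω hω => sub_nonneg.2 (le_of_lt hω))
  have h4 := (setIntegral_eq_zero_iff_of_nonneg_ae
    ((ae_restrict_iff' hA).2 (Eventually.of_forall fun ω hω => sub_nonneg.2 (le_of_lt hω)))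
    (hg.abs.integrableOn.sub (integrable_const C).integrableOn)).1 h3
  filter_upwards [(ae_restrict_iff' hA).1 h4] with ω hω
  by_contra hlt
  have hmem : ω ∈ A := not_le.1 hlt
  have := hω hmem
  simp only [Pi.zero_apply] at this
  have h5 : C < |g ω| := hmem
  linarith

/-- Converse of Hölder's inequality. For finite `q`, with exponent r = q, the test functions are
sign(g) |g|^(r-1) on {|g| ≤ n}. If I is the integral of |g|^r over that set, the hypothesis reads I
≤ C I^(1/p), hence I ≤ C^r for every n. The truncation makes I finite, which is what allows the
cancellation. -/
theorem memLp_of_bounded_test {p q : ℝ≥0∞} [hpq : ENNReal.HolderConjugate p q] (hp : p ≠ ∞)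
    {g : α → ℝ} (hgm : Measurable g) (hg : Integrable g ν)
    {C : ℝ} (h : ∀ y : α → ℝ, Measurable y → (∃ c, ∀ ω, |y ω| ≤ c) →
      |∫ ω, g ω * y ω ∂ν| ≤ C * (eLpNorm y p ν).toReal) (hC : 0 ≤ C) : MemLp g q ν := by
  by_cases hq : q = ∞
  · subst hq
    have : p = 1 := by
      have := hpq.inv_add_inv_eq_one
      simpa using this
    subst this
    exact memLp_top_of_bounded_test hgm hg h hC
  have hr : p.toReal.HolderConjugate q.toReal := by
    exact ENNReal.HolderConjugate.toReal_of_ne_top hp hq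
  set r := q.toReal with hrdef
  have hq0 : q ≠ 0 := (ENNReal.HolderConjugate.pos q p).ne'
  have hr1 : 1 < r := hr.symm.lt
  let A : ℕ → Set α := fun n => {ω | |g ω| ≤ n}
  have hA : ∀ n, MeasurableSet (A n) := fun n => measurableSet_le hgm.abs measurable_const
  have hbound : ∀ n, ∫⁻ ω in A n, ‖g ω‖ₑ ^ r ∂ν ≤ ENNReal.ofReal (C ^ r) := by
    intro n
    let y : α → ℝ := (A n).indicator fun ω => (SignType.sign (g ω) : ℝ) * |g ω| ^ (r - 1)
    have hym : Measurable y := by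
      refine Measurable.indicator ?_ (hA n)
      have hs : Measurable fun ω => (SignType.sign (g ω) : ℝ) := measurable_sign_cast.comp hgm
      exact hs.mul (hgm.abs.pow_const _)
    have hyabs : ∀ ω, |y ω| = (A n).indicator (fun ω => |g ω| ^ (r - 1)) ω := by
      intro ω
      by_cases hω : ω ∈ A n
      · simp only [y, hω, indicator_of_mem, abs_mul]
        have hpos : 0 ≤ |g ω| ^ (r - 1) := Real.rpow_nonneg (abs_nonneg _) _
        rw [abs_of_nonneg hpos]
        rcases lt_trichotomy (g ω) 0 with h | h | h
        · simp [h]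
        · have : r - 1 ≠ 0 := by linarith
          simp [h, Real.zero_rpow this]
        · simp [h]
      · simp [y, hω]
    have hyb : ∃ c, ∀ ω, |y ω| ≤ c := by
      refine ⟨(n : ℝ) ^ (r - 1), fun ω => ?_⟩
      rw [hyabs]
      by_cases hω : ω ∈ A n
      · simp only [hω, indicator_of_mem]
        exact Real.rpow_le_rpow (abs_nonneg _) hω (by linarith)
      · simp only [hω, not_false_eq_true, indicator_of_notMem]
        positivity
    have h1 := h y hym hyb
    have e1 : ∀ ω, g ω * y ω = (A n).indicator (fun ω => |g ω| ^ r) ω := by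
      intro ω
      by_cases hω : ω ∈ A n
      · simp only [y, hω, indicator_of_mem]
        rw [← mul_assoc, self_mul_sign]
        rcases eq_or_ne (g ω) 0 with h | h
        · have : r ≠ 0 := by linarith
          simp [h, Real.zero_rpow this]
        · rw [← Real.rpow_one_add' (abs_nonneg _) (by linarith)]
          congr 1; ring
      · simp [y, hω]
    have e2 : ∀ ω, ‖y ω‖ₑ ^ p.toReal = (A n).indicator (fun ω => ‖g ω‖ₑ ^ r) ω := by
      intro ω
      rw [← ofReal_norm, Real.norm_eq_abs, hyabs]
      by_cases hω : ω ∈ A n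
      · simp only [hω, indicator_of_mem]
        rw [ENNReal.ofReal_rpow_of_nonneg (by positivity) hr.nonneg, ← Real.rpow_mul (abs_nonneg _),
          ← ofReal_norm, ENNReal.ofReal_rpow_of_nonneg (norm_nonneg _) (by linarith),
          Real.norm_eq_abs]
        congr 2
        have := hr.symm.sub_one_mul_conj
        linarith
      · simp [hω, hr.pos]
    set I := ∫⁻ ω in A n, ‖g ω‖ₑ ^ r ∂ν with hI
    have hIfin : I ≠ ∞ := by
      refine ne_of_lt ?_
      have : I ≤ ∫⁻ ω in A n, (n : ℝ≥0∞) ^ r ∂ν := by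
        refine setLIntegral_mono measurable_const fun ω hω => ?_
        refine ENNReal.rpow_le_rpow ?_ (by linarith)
        rw [← ofReal_norm, Real.norm_eq_abs, ← ENNReal.ofReal_natCast]
        exact ENNReal.ofReal_le_ofReal hω
      refine this.trans_lt ?_
      rw [lintegral_const]
      refine ENNReal.mul_lt_top (ENNReal.rpow_lt_top_of_nonneg (by linarith) (by simp))
        (measure_lt_top _ _)
    have e3 : ∫ ω, g ω * y ω ∂ν = I.toReal := by
      simp_rw [e1]
      rw [integral_indicator (hA n), integral_eq_lintegral_of_nonneg_ae
        (Eventually.of_forall fun ω => by positivity)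
        ((hgm.abs.pow_const _).aestronglyMeasurable)]
      congr 1
      refine lintegral_congr fun ω => ?_
      rw [← ofReal_norm, ENNReal.ofReal_rpow_of_nonneg (norm_nonneg _) (by linarith),
          Real.norm_eq_abs]
    have hp0 : p ≠ 0 := (ENNReal.HolderConjugate.pos p q).ne'
    have e4 : (eLpNorm y p ν).toReal = I.toReal ^ (1 / p.toReal) := by
      rw [eLpNorm_eq_lintegral_rpow_enorm_toReal hp0 hp]
      simp_rw [e2]
      rw [lintegral_indicator (hA n), ENNReal.toReal_rpow]
    rw [e3, e4, abs_of_nonneg ENNReal.toReal_nonneg] at h1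
    have h2 : I.toReal ≤ C ^ r := by
      rcases eq_or_lt_of_le (ENNReal.toReal_nonneg : 0 ≤ I.toReal) with h0 | h0
      · rw [← h0]; positivity
      · have h3 : I.toReal ^ (1 / r) ≤ C := by
          have h4 : I.toReal = I.toReal ^ (1 / r) * I.toReal ^ (1 / p.toReal) := by
            rw [← Real.rpow_add h0]
            have := hr.symm.inv_add_inv_eq_one
            rw [one_div, one_div, this, Real.rpow_one]
          rw [h4] at h1
          have h5 : 0 < I.toReal ^ (1 / p.toReal) := Real.rpow_pos_of_pos h0 _
          rw [← h4] at h1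
          nth_rewrite 1 [h4] at h1
          exact le_of_mul_le_mul_right h1 h5
        have h6 := Real.rpow_le_rpow (by positivity) h3 (by linarith : 0 ≤ r)
        rwa [← Real.rpow_mul h0.le, one_div, inv_mul_cancel₀ (by linarith), Real.rpow_one] at h6
    rw [← ENNReal.ofReal_toReal hIfin]
    exact ENNReal.ofReal_le_ofReal h2
  refine ⟨hgm.aestronglyMeasurable, ?_⟩
  rw [eLpNorm_lt_top_iff_lintegral_rpow_enorm_lt_top hq0 hq]
  have hlim : Tendsto (fun n => ∫⁻ ω in A n, ‖g ω‖ₑ ^ r ∂ν) atTop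
      (𝓝 (∫⁻ ω, ‖g ω‖ₑ ^ r ∂ν)) := by
    simp_rw [← lintegral_indicator (hA _)]
    refine lintegral_tendsto_of_tendsto_of_monotone
      (fun n => ((hgm.enorm.pow_const _).indicator (hA n)).aemeasurable) ?_ ?_
    · filter_upwards with ω a b hab
      refine indicator_le_indicator_of_subset (fun x (hx : |g x| ≤ a) => ?_) (fun _ => zero_le) ω
      exact hx.trans (by exact_mod_cast hab)
    · filter_upwards with ω
      obtain ⟨k, hk⟩ := exists_nat_ge |g ω|
      refine tendsto_const_nhds.congr' ?_
      filter_upwards [eventually_ge_atTop k] with n hn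
      have : ω ∈ A n := hk.trans (by exact_mod_cast hn)
      simp [this]
  exact (le_of_tendsto' hlim hbound).trans_lt ENNReal.ofReal_lt_top
/-- Riesz representation of continuous functionals on `L^p`, `p < ∞`. -/
theorem exists_memLp_repr {p q : ℝ≥0∞} [hpq : ENNReal.HolderConjugate p q] [Fact (1 ≤ p)]
    (hp : p ≠ ∞) (f : Lp ℝ p ν →L[ℝ] ℝ) :
    ∃ g : α → ℝ, MemLp g q ν ∧ ∀ y : Lp ℝ p ν, f y = ∫ ω, g ω * y ω ∂ν := by
  obtain ⟨g, hgm, hg, hind⟩ := exists_integrable_repr_indicator hp f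
  have hgq : MemLp g q ν := by
    refine memLp_of_bounded_test (C := ‖f‖) hp hgm hg (fun y hy ⟨c, hc⟩ => ?_) (norm_nonneg _)
    have hyp : MemLp y p ν := MemLp.of_bound hy.aestronglyMeasurable c (Eventually.of_forall hc)
    rw [← apply_toLp_eq_integral_of_bounded hp f hg hind hy hc hyp, ← Real.norm_eq_abs]
    refine (f.le_opNorm _).trans_eq ?_
    rw [Lp.norm_toLp]
  refine ⟨g, hgq, fun y => ?_⟩
  have hint : ∀ y : Lp ℝ p ν, Integrable (fun ω => g ω * y ω) ν := fun y => by
    have : ENNReal.HolderConjugate q p := hpq.symm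
    exact hgq.integrable_mul (Lp.memLp y)
  have hcont : Continuous fun y : Lp ℝ p ν => ∫ ω, g ω * y ω ∂ν := by
    let L : Lp ℝ p ν →ₗ[ℝ] ℝ :=
      { toFun := fun y => ∫ ω, g ω * y ω ∂ν
        map_add' := fun y z => by
          rw [← integral_add (hint y) (hint z)]
          refine integral_congr_ae ?_
          filter_upwards [Lp.coeFn_add y z] with ω h
          rw [h, Pi.add_apply, mul_add]
        map_smul' := fun c y => by
          rw [RingHom.id_apply, smul_eq_mul, ← integral_const_mul]
          refine integral_congr_ae ?_
          filter_upwards [Lp.coeFn_smul c y] with ω h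
          rw [h, Pi.smul_apply, smul_eq_mul]; ring }
    refine AddMonoidHomClass.continuous_of_bound L (eLpNorm g q ν).toReal fun y => ?_
    have : ENNReal.HolderTriple q p 1 := hpq.symm
    have h1 : eLpNorm (fun ω => g ω * y ω) 1 ν ≤ eLpNorm g q ν * eLpNorm y p ν :=
      eLpNorm_smul_le_mul_eLpNorm (φ := g) (Lp.memLp y).1 hgq.1
    calc ‖∫ ω, g ω * y ω ∂ν‖ ≤ (∫⁻ ω, ‖g ω * y ω‖ₑ ∂ν).toReal := by
          rw [← integral_norm_eq_lintegral_enorm (hint y).1]; exact norm_integral_le_integral_norm _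
      _ ≤ (eLpNorm g q ν * eLpNorm y p ν).toReal := by
          rw [← eLpNorm_one_eq_lintegral_enorm]
          exact ENNReal.toReal_mono (ENNReal.mul_ne_top hgq.2.ne (Lp.eLpNorm_ne_top y)) h1
      _ = _ := by rw [ENNReal.toReal_mul, Lp.norm_def]
  -- Both sides are linear and continuous in `y`, so agreement on indicators is enough.
  induction y using Lp.induction hp with
  | indicatorConst c hs hμs =>
    rename_i s
    have e : (Lp.simpleFunc.indicatorConst p hs hμs.ne c : Lp ℝ p ν)
        = c • indicatorConstLp p hs (measure_ne_top ν s) (1 : ℝ) := by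
      rw [Lp.simpleFunc.coe_indicatorConst]
      ext1
      filter_upwards [Lp.coeFn_smul c (indicatorConstLp p hs (measure_ne_top ν _) (1 : ℝ)),
        indicatorConstLp_coeFn (p := p) (hs := hs) (hμs := measure_ne_top ν _) (c := (1 : ℝ)),
        indicatorConstLp_coeFn (p := p) (hs := hs) (hμs := measure_ne_top ν _) (c := (c : ℝ))]
        with ω h1 h2 h3
      rw [h1, Pi.smul_apply, h2, h3]
      by_cases hω : ω ∈ s <;> simp [hω]
    rw [e, map_smul, hind s hs, smul_eq_mul, ← integral_const_mul, ← integral_indicator hs]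
    refine integral_congr_ae ?_
    filter_upwards [Lp.coeFn_smul c (indicatorConstLp p hs (measure_ne_top ν _) (1 : ℝ)),
        indicatorConstLp_coeFn (p := p) (hs := hs) (hμs := measure_ne_top ν _) (c := (1 : ℝ))]
        with ω h1 h2
    rw [h1, Pi.smul_apply, h2]
    by_cases hω : ω ∈ s <;> simp [hω, mul_comm]
  | add hf hg' _ h1 h2 =>
    rw [map_add, h1, h2, ← integral_add (hint _) (hint _)]
    refine integral_congr_ae ?_
    filter_upwards [Lp.coeFn_add (hf.toLp _) (hg'.toLp _)] with ω h
    rw [h, Pi.add_apply, mul_add]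
  | isClosed => exact isClosed_eq f.continuous hcont

omit [IsFiniteMeasure ν] in
/-- A norm convergent sequence in `L^p` has a subsequence that converges almost everywhere and is
dominated by an element of `L^p`. -/
theorem exists_subseq_dominated {p : ℝ≥0∞} [Fact (1 ≤ p)] {y : ℕ → Lp ℝ p ν}
    {z : Lp ℝ p ν} (h : Tendsto y atTop (𝓝 z)) :
    ∃ (φ : ℕ → ℕ) (k : α → ℝ), MemLp k p ν ∧ (∀ j, ∀ᵐ ω ∂ν, |y (φ j) ω| ≤ k ω) ∧
      ∀ᵐ ω ∂ν, Tendsto (fun j => y (φ j) ω) atTop (𝓝 (z ω)) := by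
  have hp0 : p ≠ 0 := (zero_lt_one.trans_le Fact.out).ne'
  obtain ⟨φ, hφ, hae⟩ := (tendstoInMeasure_of_tendsto_Lp h).exists_seq_tendsto_ae
  have h' : Tendsto (fun j => ‖y (φ j) - z‖) atTop (𝓝 0) :=
    (tendsto_iff_norm_sub_tendsto_zero.1 h).comp hφ.tendsto_atTop
  -- Geometric decay along a further subsequence makes the series of absolute differences converge
  -- in `L^p`; its sum plus `|z|` is the dominating function.
  have h2 : ∀ n : ℕ, ∃ j, n ≤ j ∧ ‖y (φ j) - z‖ ≤ (1 / 2 : ℝ) ^ n := by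
    intro n
    have := (h'.eventually (Iic_mem_nhds (show (0 : ℝ) < (1 / 2) ^ n by positivity))).and
      (eventually_ge_atTop n)
    obtain ⟨j, hj, hj'⟩ := this.exists
    exact ⟨j, hj', hj⟩
  choose ψ hψ1 hψ2 using h2
  have hψ : Tendsto ψ atTop atTop := tendsto_atTop_mono hψ1 tendsto_id
  have hsum : Summable fun n => |y (φ (ψ n)) - z| := by
    refine Summable.of_norm_bounded (g := fun n => (1 / 2 : ℝ) ^ n)
      (summable_geometric_of_lt_one (by norm_num) (by norm_num)) fun n => ?_
    rw [norm_abs_eq_norm]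
    exact hψ2 n
  refine ⟨φ ∘ ψ, fun ω => |z ω| + (∑' n, |y (φ (ψ n)) - z| : Lp ℝ p ν) ω,
    (Lp.memLp z).abs.add (Lp.memLp _), fun j => ?_, ?_⟩
  · have h3 : |y (φ (ψ j)) - z| ≤ ∑' n, |y (φ (ψ n)) - z| :=
      hsum.le_tsum j fun _ _ => abs_nonneg _
    rw [← Lp.coeFn_le] at h3
    filter_upwards [h3, Lp.coeFn_abs (y (φ (ψ j)) - z), Lp.coeFn_sub (y (φ (ψ j))) z]
      with ω a1 a2 a3
    rw [a2, a3, Pi.sub_apply] at a1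
    have := abs_sub_abs_le_abs_sub (y (φ (ψ j)) ω) (z ω)
    simp only [Function.comp]
    linarith
  · filter_upwards [hae] with ω hω
    exact hω.comp hψ

/-- Closedness under almost everywhere convergence of sequences dominated by an element of `L^p`. -/
def DominatedClosed (p : ℝ≥0∞) (ν : Measure α) (K : Set (α →ₘ[ν] ℝ)) : Prop :=
  ∀ (y : ℕ → α →ₘ[ν] ℝ) (h : α → ℝ), MemLp h p ν → (∀ j, y j ∈ K) →
    (∀ j, ∀ᵐ ω ∂ν, |y j ω| ≤ h ω) → ∀ z : α →ₘ[ν] ℝ,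
    (∀ᵐ ω ∂ν, Tendsto (fun j => y j ω) atTop (𝓝 (z ω))) → z ∈ K

/-- A norm convergent sequence has a dominated almost everywhere convergent subsequence, so
dominated closedness implies norm closedness. Hahn-Banach and the Riesz representation do the rest.
-/
theorem exists_separating_of_ne_top {p q : ℝ≥0∞} [hpq : ENNReal.HolderConjugate p q] (hp : p ≠ ∞)
    {K : Set (α →ₘ[ν] ℝ)} (hKp : ∀ y ∈ K, MemLp y p ν) (hconv : Convex ℝ K)
    (hcl : DominatedClosed p ν K) {x : α →ₘ[ν] ℝ} (hxp : MemLp x p ν) (hx : x ∉ K) :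
    ∃ g : α → ℝ, MemLp g q ν ∧ ∃ δ > 0, ∀ y ∈ K,
      ∫ ω, g ω * x ω ∂ν + δ ≤ ∫ ω, g ω * y ω ∂ν := by
  have : Fact (1 ≤ p) := ⟨ENNReal.HolderConjugate.one_le p q⟩
  let K' : Set (Lp ℝ p ν) := {y | (y : α →ₘ[ν] ℝ) ∈ K}
  have hK'conv : Convex ℝ K' := by
    intro y hy z hz a b ha hb hab
    exact hconv hy hz ha hb hab
  have hK'cl : IsClosed K' := by
    refine isClosed_of_closure_subset fun z hz => ?_
    obtain ⟨y, hy, hyz⟩ := mem_closure_iff_seq_limit.1 hz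
    obtain ⟨φ, k, hk, hdom, hlim⟩ := exists_subseq_dominated hyz
    exact hcl (fun j => y (φ j)) k hk (fun j => hy _) hdom _ hlim
  let x' : Lp ℝ p ν := ⟨x, Lp.mem_Lp_iff_eLpNorm_lt_top.2 hxp.2⟩
  obtain ⟨f, u, hfx, hfy⟩ := geometric_hahn_banach_point_closed hK'conv hK'cl (x := x') hx
  obtain ⟨g, hg, hfg⟩ := exists_memLp_repr (q := q) hp f
  refine ⟨g, hg, u - f x', by linarith, fun y hy => ?_⟩
  have h1 := hfy ⟨y, Lp.mem_Lp_iff_eLpNorm_lt_top.2 (hKp y hy).2⟩ hy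
  have h2 := hfg x'
  rw [hfg] at h1
  change _ = ∫ ω, g ω * x ω ∂ν at h2
  change _ < ∫ ω, g ω * y ω ∂ν at h1
  linarith
end Riesz

end

section

/-! ### Separation of bounded closed convex sets in Hilbert space. -/

section Hilbert

variable {E : Type*} [NormedAddCommGroup E] [InnerProductSpace ℝ E] [CompleteSpace E]

/-- A substitute for weak compactness: the elements of minimal norm in `C k` have increasing bounded
norms, so by the parallelogram law they form a Cauchy sequence, whose limit lies in every `C k`. -/
theorem nonempty_iInter_of_antitone_closed_convex {C : ℕ → Set E} (hanti : Antitone C)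
    (hne : ∀ k, (C k).Nonempty) (hcl : ∀ k, IsClosed (C k)) (hconv : ∀ k, Convex ℝ (C k))
    {R : ℝ} (hR : ∀ y ∈ C 0, ‖y‖ ≤ R) : (⋂ k, C k).Nonempty := by
  have h1 : ∀ k, ∃ e ∈ C k, ∀ y ∈ C k, ‖e‖ ≤ ‖y‖ := by
    intro k
    obtain ⟨e, he, h⟩ := exists_norm_eq_iInf_of_complete_convex (hne k)
      (hcl k).isComplete (hconv k) (0 : E)
    refine ⟨e, he, fun y hy => ?_⟩
    simp only [zero_sub, norm_neg] at h
    rw [h]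
    exact ciInf_le ⟨0, by rintro _ ⟨w, rfl⟩; positivity⟩ (⟨y, hy⟩ : C k)
  choose e heC hemin using h1
  have hmono : Monotone fun k => ‖e k‖ := fun a b hab => hemin a _ (hanti hab (heC b))
  have hmono2 : Monotone fun k => ‖e k‖ ^ 2 := fun a b hab =>
    pow_le_pow_left₀ (norm_nonneg _) (hmono hab) 2
  have hbdd : BddAbove (range fun k => ‖e k‖ ^ 2) := by
    refine ⟨R ^ 2, ?_⟩
    rintro _ ⟨k, rfl⟩
    exact pow_le_pow_left₀ (norm_nonneg _) (hR _ (hanti (Nat.zero_le k) (heC k))) 2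
  have hconvg := (tendsto_atTop_ciSup hmono2 hbdd).cauchySeq
  -- The midpoint of `e a` and `e b` lies in `C a`, so its norm is at least `‖e a‖`; inserting this
  -- into the parallelogram law gives the bound.
  have hkey : ∀ a b, a ≤ b → ‖e b - e a‖ ^ 2 ≤ 2 * (‖e b‖ ^ 2 - ‖e a‖ ^ 2) := by
    intro a b hab
    have hmid : (1 / 2 : ℝ) • e a + (1 / 2 : ℝ) • e b ∈ C a :=
      hconv a (heC a) (hanti hab (heC b)) (by norm_num) (by norm_num) (by norm_num)
    have h2 := hemin a _ hmid
    rw [← smul_add, norm_smul] at h2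
    have h3 := parallelogram_law_with_norm ℝ (e b) (e a)
    rw [add_comm (e a)] at h2
    norm_num at h2
    have h4 : 0 ≤ ‖e a‖ := norm_nonneg _
    nlinarith
  have hcauchy : CauchySeq e := by
    rw [Metric.cauchySeq_iff'] at hconvg ⊢
    intro ε hε
    obtain ⟨N, hN⟩ := hconvg (ε ^ 2 / 2) (by positivity)
    refine ⟨N, fun n hn => ?_⟩
    have h5 := hN n hn
    rw [Real.dist_eq] at h5
    have h6 := hkey N n hn
    rw [dist_eq_norm]
    have h7 := le_abs_self (‖e n‖ ^ 2 - ‖e N‖ ^ 2)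
    exact lt_of_pow_lt_pow_left₀ 2 hε.le (by linarith)
  obtain ⟨z, hz⟩ := cauchySeq_tendsto_of_complete hcauchy
  refine ⟨z, mem_iInter.2 fun k => (hcl k).mem_of_tendsto hz ?_⟩
  filter_upwards [eventually_ge_atTop k] with n hn using hanti hn (heC n)

/-- Disjoint closed convex subsets of a Hilbert space, one of which is bounded, have positive
distance. -/
theorem exists_pos_le_norm_sub {L B : Set E} (hL : IsClosed L) (hLc : Convex ℝ L)
    {R : ℝ} (hR : ∀ y ∈ L, ‖y‖ ≤ R) (hB : IsClosed B) (hBc : Convex ℝ B) (hd : Disjoint L B) :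
    ∃ δ > 0, Disjoint L (Metric.thickening δ B) := by
  by_contra! h
  let C : ℕ → Set E := fun k => L ∩ Metric.cthickening (1 / (k + 1)) B
  have h1 : (⋂ k, C k).Nonempty := by
    refine nonempty_iInter_of_antitone_closed_convex (R := R) ?_ ?_ ?_ ?_ ?_
    · intro a b hab
      refine inter_subset_inter_right _ (Metric.cthickening_mono ?_ _)
      exact one_div_le_one_div_of_le (by positivity) (by exact_mod_cast Nat.succ_le_succ hab)
    · intro k
      have := h (1 / (k + 1)) (by positivity)
      rw [not_disjoint_iff_nonempty_inter] at this
      exact this.mono (inter_subset_inter_right _ (Metric.thickening_subset_cthickening _ _))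
    · exact fun k => hL.inter Metric.isClosed_cthickening
    · exact fun k => hLc.inter (hBc.cthickening _)
    · exact fun y hy => hR y hy.1
  obtain ⟨z, hz⟩ := h1
  rw [mem_iInter] at hz
  refine hd.ne_of_mem (hz 0).1 ?_ rfl
  rw [← hB.closure_eq, Metric.closure_eq_iInter_cthickening]
  refine mem_iInter₂.2 fun ε hε => ?_
  obtain ⟨k, hk⟩ := exists_nat_one_div_lt hε
  exact Metric.cthickening_mono hk.le _ (hz k).2

/-- The positive distance between the sets allows separation of `L` from an open thickening of `B`,
which leaves a gap. As `0 ∈ B`, the separating level is positive and can be scaled to 1. -/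
theorem exists_inner_separating {L B : Set E} (hL : IsClosed L) (hLc : Convex ℝ L)
    {R : ℝ} (hR : ∀ y ∈ L, ‖y‖ ≤ R) (hB : IsClosed B) (hBc : Convex ℝ B) (hB0 : (0 : E) ∈ B)
    (hd : Disjoint L B) :
    ∃ x : E, (∀ b ∈ B, inner ℝ x b ≤ 1) ∧ ∀ y ∈ L, 1 < inner ℝ x y := by
  rcases L.eq_empty_or_nonempty with rfl | ⟨y₀, hy₀⟩
  · exact ⟨0, by simp, by simp⟩
  obtain ⟨δ, hδ, hdis⟩ := exists_pos_le_norm_sub hL hLc hR hB hBc hd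
  obtain ⟨f, u, hf1, hf2⟩ := geometric_hahn_banach_open (hBc.thickening δ)
    Metric.isOpen_thickening hLc hdis.symm
  have hu : 0 < u := by
    simpa using hf1 0 (Metric.self_subset_thickening hδ _ hB0)
  have hy0 : 0 < f y₀ := hu.trans_le (hf2 _ hy₀)
  have hyn : 0 < ‖y₀‖ := norm_pos_iff.2 fun h => by simp [h] at hy0
  -- A vector of norm δ/2 with `f v > 0`. Since `b + v` stays in the thickening, the bound on `B`
  -- improves from `u` to `u - f v`, while `f ≥ u` on `L`; dividing by `u - f v` makes the
  -- inequality on `L` strict.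
  set v : E := (δ / (2 * ‖y₀‖)) • y₀ with hv
  have hfv : 0 < f v := by
    rw [hv, map_smul, smul_eq_mul]; positivity
  have hb : ∀ b ∈ B, f b < u - f v := by
    intro b hb
    have : b + v ∈ Metric.thickening δ B := by
      rw [Metric.mem_thickening_iff]
      refine ⟨b, hb, ?_⟩
      rw [dist_eq_norm, add_sub_cancel_left, hv, norm_smul, Real.norm_eq_abs,
        abs_of_pos (by positivity)]
      have : δ / (2 * ‖y₀‖) * ‖y₀‖ = δ / 2 := by field_simp
      linarith
    have := hf1 _ this
    rw [map_add] at this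
    linarith
  have hu' : 0 < u - f v := by simpa using hb 0 hB0
  refine ⟨(u - f v)⁻¹ • (InnerProductSpace.toDual ℝ E).symm f, fun b hb' => ?_, fun y hy => ?_⟩
  · rw [inner_smul_left, InnerProductSpace.toDual_symm_apply]
    simp only [conj_trivial]
    rw [inv_mul_le_iff₀ hu']
    linarith [hb b hb']
  · rw [inner_smul_left, InnerProductSpace.toDual_symm_apply]
    simp only [conj_trivial]
    rw [lt_inv_mul_iff₀ hu']
    linarith [hf2 y hy]

/-- Inductive choice in the Krein-Smulian argument: if `0 ∉ K` and the intersections of a convex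
set `K` with the members of an increasing family of closed convex bounded sets `B n` are closed,
and `K` misses `B 0`, then there are vectors `x n` which are at most `1` on `B n`, and such that
every element of `K` that lies in some `B n` exceeds `1` at some of these vectors. -/
theorem exists_seq_inner_separating {K : Set E} (hK : Convex ℝ K) {B : ℕ → Set E}
    (hB : ∀ n, IsClosed (B n)) (hBc : ∀ n, Convex ℝ (B n)) (hB0 : ∀ n, (0 : E) ∈ B n)
    (hbd : ∀ n, ∃ R : ℝ, ∀ y ∈ B n, ‖y‖ ≤ R)
    (hcl : ∀ n, IsClosed (K ∩ B n)) (h0 : Disjoint K (B 0)) :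
    ∃ x : ℕ → E, (∀ n, ∀ b ∈ B n, inner ℝ (x n) b ≤ 1) ∧
      ∀ n, ∀ y ∈ K ∩ B n, ∃ j, 1 < inner ℝ (x j) y := by
  -- The state of the induction: a closed convex set, in practice a finite intersection of
  -- half-spaces, whose intersection with `K` misses `B n`. Each step cuts it by one half-space so
  -- that it also misses `B (n + 1)`.
  let S : ℕ → Type _ := fun n => {C : Set E // IsClosed C ∧ Convex ℝ C ∧ Disjoint (K ∩ C) (B n)}
  have hstep : ∀ n (C : S n), ∃ x : E, (∀ b ∈ B n, inner ℝ x b ≤ 1) ∧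
      Disjoint (K ∩ (C.1 ∩ {y | inner ℝ x y ≤ 1})) (B (n + 1)) := by
    intro n C
    obtain ⟨R, hR⟩ := hbd (n + 1)
    obtain ⟨x, hx1, hx2⟩ := exists_inner_separating (L := (K ∩ B (n + 1)) ∩ C.1) (B := B n)
      ((hcl _).inter C.2.1) ((hK.inter (hBc _)).inter C.2.2.1) (R := R)
      (fun y hy => hR y hy.1.2) (hB n) (hBc n) (hB0 n)
      (Set.disjoint_left.2 fun y hy hy' => Set.disjoint_left.1 C.2.2.2 ⟨hy.1.1, hy.2⟩ hy')
    refine ⟨x, hx1, Set.disjoint_left.2 ?_⟩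
    rintro y ⟨hyK, hyC, hyx⟩ hyB
    exact absurd (hx2 y ⟨⟨hyK, hyB⟩, hyC⟩) (not_lt.2 hyx)
  choose f hf1 hf2 using hstep
  have hclx : ∀ x : E, IsClosed {y : E | inner ℝ x y ≤ 1} := fun x =>
    isClosed_le (by fun_prop) continuous_const
  have hcvx : ∀ x : E, Convex ℝ {y : E | inner ℝ x y ≤ 1} := fun x =>
    convex_halfSpace_le (IsLinearMap.mk (fun a b => inner_add_right _ _ _)
      (fun c a => by rw [inner_smul_right, smul_eq_mul])) 1
  let C0 : S 0 := Subtype.mk univ ⟨isClosed_univ, convex_univ, by simpa using h0⟩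
  let next : ∀ n, S n → S (n + 1) := fun n C => Subtype.mk (C.1 ∩ {y | inner ℝ (f n C) y ≤ 1})
    ⟨C.2.1.inter (hclx _), C.2.2.1.inter (hcvx _), hf2 n C⟩
  let C : ∀ n, S n := fun n => Nat.rec (motive := S) C0 next n
  have hCsucc : ∀ n, (C (n + 1)).1 = (C n).1 ∩ {y | inner ℝ (f n (C n)) y ≤ 1} := fun n => rfl
  refine ⟨fun n => f n (C n), fun n => hf1 n _, fun n y hy => ?_⟩
  by_contra! hcon
  have hall : ∀ k, y ∈ (C k).1 := by
    intro k
    induction k with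
    | zero => exact mem_univ _
    | succ k ih => rw [hCsucc]; exact ⟨ih, hcon k⟩
  exact Set.disjoint_left.1 (C n).2.2.2 ⟨hy.1, hall n⟩ hy.2

end Hilbert

end

section

/-! ### The Krein-Smulian argument for exponent ∞. -/

section KreinSmulian

variable {α : Type*} {m : MeasurableSpace α} {ν : Measure α}

theorem integrable_tsum_of_summable_integral_abs {F : ℕ → α → ℝ} (hF : ∀ n, Integrable (F n) ν)
    (hs : Summable fun n => ∫ ω, |F n ω| ∂ν) : Integrable (fun ω => ∑' n, F n ω) ν := by
  have hfin : ∫⁻ ω, ∑' n, ‖F n ω‖ₑ ∂ν < ∞ := by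
    rw [lintegral_tsum fun n => (hF n).1.enorm]
    have : ∀ n, ∫⁻ ω, ‖F n ω‖ₑ ∂ν = ENNReal.ofReal (∫ ω, |F n ω| ∂ν) := fun n => by
      rw [← ofReal_integral_norm_eq_lintegral_enorm (hF n)]; rfl
    simp_rw [this]
    rw [← ENNReal.ofReal_tsum_of_nonneg (fun n => integral_nonneg fun ω => abs_nonneg _) hs]
    exact ENNReal.ofReal_lt_top
  have hsum : ∀ᵐ ω ∂ν, Summable fun n => F n ω := by
    filter_upwards [ae_lt_top' (AEMeasurable.tsum fun n => (hF n).1.enorm) hfin.ne]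
      with ω hω
    exact Summable.of_enorm hω.ne
  refine ⟨aestronglyMeasurable_of_tendsto_ae atTop
    (f := fun N ω => ∑ n ∈ Finset.range N, F n ω) (fun N => ?_) ?_, ?_⟩
  · exact Finset.aestronglyMeasurable_fun_sum _ fun n _ => (hF n).1
  · filter_upwards [hsum] with ω hω using hω.hasSum.tendsto_sum_nat
  · refine lt_of_le_of_lt (lintegral_mono_ae ?_) hfin
    filter_upwards [hsum] with ω hω
    exact enorm_tsum_le_tsum_enorm

variable [IsFiniteMeasure ν]

omit [IsFiniteMeasure ν] in
theorem isClosed_ae_abs_le (r : ℝ) : IsClosed {y : Lp ℝ 2 ν | ∀ᵐ ω ∂ν, |y ω| ≤ r} := by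
  refine isClosed_of_closure_subset fun z hz => ?_
  obtain ⟨y, hy, hyz⟩ := mem_closure_iff_seq_limit.1 hz
  obtain ⟨φ, k, hk, hdom, hlim⟩ := exists_subseq_dominated hyz
  filter_upwards [hlim, ae_all_iff.2 fun j => hy (φ j)] with ω h1 h2
  exact le_of_tendsto' h1.abs h2

omit [IsFiniteMeasure ν] in
theorem convex_ae_abs_le (r : ℝ) : Convex ℝ {y : Lp ℝ 2 ν | ∀ᵐ ω ∂ν, |y ω| ≤ r} := by
  intro y hy z hz a b ha hb hab
  filter_upwards [hy, hz, Lp.coeFn_add (a • y) (b • z), Lp.coeFn_smul a y, Lp.coeFn_smul b z]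
    with ω h1 h2 h3 h4 h5
  rw [h3, Pi.add_apply, h4, h5, Pi.smul_apply, Pi.smul_apply, smul_eq_mul, smul_eq_mul]
  calc |a * y ω + b * z ω| ≤ a * |y ω| + b * |z ω| := by
        refine (abs_add_le _ _).trans_eq ?_
        rw [abs_mul, abs_mul, abs_of_nonneg ha, abs_of_nonneg hb]
    _ ≤ a * r + b * r := by gcongr
    _ = r := by rw [← add_mul, hab, one_mul]

/-- The polar of a sup-norm ball is an L¹ ball: test with `r` times the sign of `x`. -/
theorem integral_abs_le_of_inner_le {x : Lp ℝ 2 ν} {r : ℝ} (hr : 0 < r)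
    (h : ∀ b ∈ {y : Lp ℝ 2 ν | ∀ᵐ ω ∂ν, |y ω| ≤ r}, inner ℝ x b ≤ 1) :
    ∫ ω, |x ω| ∂ν ≤ 1 / r := by
  have hm : AEStronglyMeasurable (fun ω => r * (SignType.sign (x ω) : ℝ)) ν :=
    ((measurable_sign_cast.comp (Lp.stronglyMeasurable x).measurable).const_mul
      r).aestronglyMeasurable
  have hb : ∀ ω, |r * (SignType.sign (x ω) : ℝ)| ≤ r := by
    intro ω
    rw [abs_mul, abs_of_pos hr]
    rcases lt_trichotomy (x ω) 0 with h | h | h <;> simp [h, hr.le]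
  have hmem : MemLp (fun ω => r * (SignType.sign (x ω) : ℝ)) 2 ν :=
    MemLp.of_bound hm r (Eventually.of_forall hb)
  have h1 := h (hmem.toLp _) (by
    filter_upwards [hmem.coeFn_toLp] with ω hω
    rw [hω]; exact hb ω)
  rw [L2.inner_def] at h1
  have h2 : ∫ ω, inner ℝ (x ω) (hmem.toLp _ ω) ∂ν = r * ∫ ω, |x ω| ∂ν := by
    rw [← integral_const_mul]
    refine integral_congr_ae ?_
    filter_upwards [hmem.coeFn_toLp] with ω hω
    rw [hω]
    simp only [RCLike.inner_apply, conj_trivial]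
    rw [mul_assoc, mul_comm (SignType.sign (x ω) : ℝ), self_mul_sign]
  rw [h2] at h1
  rw [le_div_iff₀ hr]
  linarith

/-- Each y ∈ K is sent to the sequence of its inner products with the x n. This lies in ℓ¹ because
the L¹ norms of x n are summable and y is bounded. Some coordinate exceeds 1, so the image of K
misses the unit ball of ℓ¹. A functional on ℓ¹ separating the two is a bounded sequence c, and g = ∑
c n x n, convergent in L¹, is the required density. -/
theorem exists_separating_zero_of_seq {K : Set (Lp ℝ 2 ν)} (hK : Convex ℝ K)
    (hbdd : ∀ y ∈ K, ∃ c : ℝ, ∀ᵐ ω ∂ν, |y ω| ≤ c) {r : ℝ} {x : ℕ → Lp ℝ 2 ν}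
    (hx1 : ∀ n, ∫ ω, |x n ω| ∂ν ≤ 1 / (r * 2 ^ n)) (hx : ∀ y ∈ K, ∃ j, 1 < inner ℝ (x j) y) :
    ∃ g : α → ℝ, Integrable g ν ∧ ∃ δ > 0, ∀ y ∈ K, δ ≤ ∫ ω, g ω * y ω ∂ν := by
  have hxint : ∀ n, Integrable (x n) ν := fun n => (Lp.memLp (x n)).integrable one_le_two
  have hgeom : Summable fun n : ℕ => 1 / (r * 2 ^ n) := by
    have : (fun n : ℕ => 1 / (r * 2 ^ n)) = fun n => (1 / r) * (1 / 2 : ℝ) ^ n := by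
      funext n; rw [one_div_pow, one_div_mul_one_div]
    rw [this]
    exact (summable_geometric_of_lt_one (by norm_num) (by norm_num)).mul_left _
  have hinner : ∀ n (y : Lp ℝ 2 ν), inner ℝ (x n) y = ∫ ω, x n ω * y ω ∂ν := by
    intro n y
    rw [L2.inner_def]
    simp only [RCLike.inner_apply, conj_trivial]
    simp_rw [mul_comm]
  have hmulint : ∀ n, ∀ y ∈ K, Integrable (fun ω => x n ω * y ω) ν := fun n y hy =>
    (Lp.memLp (x n)).integrable_mul (Lp.memLp y)
  have habs : ∀ y ∈ K, ∃ c : ℝ, 0 ≤ c ∧ ∀ n, ∫ ω, |x n ω * y ω| ∂ν ≤ c * (1 / (r * 2 ^ n)) := by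
    intro y hy
    obtain ⟨c, hc⟩ := hbdd y hy
    refine ⟨|c|, abs_nonneg c, fun n => ?_⟩
    refine le_trans ?_ (mul_le_mul_of_nonneg_left (hx1 n) (abs_nonneg _))
    rw [← integral_const_mul]
    refine integral_mono_ae (hmulint n y hy).abs ((hxint n).abs.const_mul _) ?_
    filter_upwards [hc] with ω hω
    rw [abs_mul, mul_comm]
    exact mul_le_mul_of_nonneg_right (hω.trans (le_abs_self c)) (abs_nonneg _)
  have hmem : ∀ y ∈ K, Memℓp (fun n => (inner ℝ (x n) y : ℝ)) 1 := by
    intro y hy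
    obtain ⟨c, hc0, hc⟩ := habs y hy
    refine memℓp_gen ?_
    simp only [ENNReal.toReal_one, Real.rpow_one]
    refine Summable.of_nonneg_of_le (fun n => norm_nonneg _) (fun n => ?_) (hgeom.mul_left c)
    rw [hinner]
    exact (norm_integral_le_integral_norm _).trans (hc n)
  let Tset : Set (lp (fun _ : ℕ => ℝ) 1) := {a | ∃ y ∈ K, ∀ n, a n = inner ℝ (x n) y}
  have hTc : Convex ℝ Tset := by
    rintro a ⟨y, hy, ha⟩ b ⟨z, hz, hb⟩ s t hs ht hst
    refine ⟨s • y + t • z, hK hy hz hs ht hst, fun n => ?_⟩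
    rw [inner_add_right, inner_smul_right, inner_smul_right, ← ha, ← hb]
    rfl
  have hdis : Disjoint (Metric.ball (0 : lp (fun _ : ℕ => ℝ) 1) 1) Tset := by
    rw [Set.disjoint_left]
    rintro a ha ⟨y, hy, hay⟩
    obtain ⟨j, hj⟩ := hx y hy
    have h1 := lp.norm_apply_le_norm one_ne_zero a j
    rw [mem_ball_zero_iff] at ha
    rw [hay j] at h1
    exact absurd (hj.trans_le ((le_abs_self _).trans h1)) (not_lt.2 ha.le)
  obtain ⟨f, u, hf1, hf2⟩ := geometric_hahn_banach_open (convex_ball _ _) Metric.isOpen_ball hTc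
    hdis
  have hu : 0 < u := by simpa using hf1 0 (Metric.mem_ball_self one_pos)
  let c : ℕ → ℝ := fun n => f (lp.single 1 n 1)
  have hc : ∀ n, |c n| ≤ ‖f‖ := by
    intro n
    have h1 := f.le_opNorm (lp.single 1 n (1 : ℝ))
    rw [lp.norm_single one_pos, norm_one, mul_one] at h1
    exact h1
  have hfa : ∀ a, HasSum (fun n => c n * a n) (f a) := by
    intro a
    have h1 := (lp.hasSum_single ENNReal.one_ne_top a).mapL f
    have h2 : (fun n => c n * a n) = fun n => f (lp.single 1 n (a n)) := by
      funext n
      have : lp.single 1 n (a n) = (a n) • lp.single (E := fun _ : ℕ => ℝ) 1 n (1 : ℝ) := by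
        rw [← lp.single_smul, smul_eq_mul, mul_one]
      rw [this, map_smul, smul_eq_mul, mul_comm]
    rw [h2]
    exact h1
  have hcx : ∀ n, ∫ ω, |c n * x n ω| ∂ν ≤ ‖f‖ * (1 / (r * 2 ^ n)) := by
    intro n
    simp_rw [abs_mul]
    rw [integral_const_mul]
    exact mul_le_mul (hc n) (hx1 n) (integral_nonneg fun _ => abs_nonneg _) (norm_nonneg _)
  refine ⟨fun ω => ∑' n, c n * x n ω,
    integrable_tsum_of_summable_integral_abs (fun n => (hxint n).const_mul _) ?_, u, hu,
    fun y hy => ?_⟩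
  · exact Summable.of_nonneg_of_le (fun n => integral_nonneg fun _ => abs_nonneg _) hcx
      (hgeom.mul_left _)
  · obtain ⟨b, hb0, hb⟩ := habs y hy
    have h1 : HasSum (fun n => ∫ ω, c n * x n ω * y ω ∂ν)
        (∫ ω, ∑' n, c n * x n ω * y ω ∂ν) := by
      refine hasSum_integral_of_summable_integral_norm (fun n => ?_) ?_
      · simp_rw [mul_assoc]; exact (hmulint n y hy).const_mul _
      · refine Summable.of_nonneg_of_le (fun n => integral_nonneg fun _ => norm_nonneg _)
          (fun n => ?_) ((hgeom.mul_left b).mul_left ‖f‖)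
        simp_rw [mul_assoc, norm_mul]
        rw [integral_const_mul]
        simp_rw [← norm_mul]
        exact mul_le_mul (hc n) (hb n) (integral_nonneg fun _ => norm_nonneg _) (norm_nonneg _)
    have h2 := hfa ⟨_, hmem y hy⟩
    have h3 : (fun n => ∫ ω, c n * x n ω * y ω ∂ν) = fun n => c n * inner ℝ (x n) y := by
      funext n
      simp_rw [mul_assoc]
      rw [integral_const_mul, hinner]
    rw [h3] at h1
    have h4 := h1.unique h2
    simp_rw [tsum_mul_right] at h4
    rw [h4]
    exact hf2 _ ⟨y, hy, fun n => rfl⟩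

/-- The norm dual of L^∞ is too large, so the separation is done by densities: K is translated by x
and viewed inside L². Its intersections with sup-norm balls are L²-closed, because a uniform bound
is an admissible dominating function. This is the hypothesis of the inductive choice of half-spaces
along balls of radius r 2^n. -/
theorem exists_separating_top {K : Set (α →ₘ[ν] ℝ)} (hKp : ∀ y ∈ K, MemLp y ∞ ν)
    (hconv : Convex ℝ K) (hcl : DominatedClosed ∞ ν K) {x : α →ₘ[ν] ℝ} (hxp : MemLp x ∞ ν)
    (hx : x ∉ K) :
    ∃ g : α → ℝ, Integrable g ν ∧ ∃ δ > 0, ∀ y ∈ K,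
      ∫ ω, g ω * x ω ∂ν + δ ≤ ∫ ω, g ω * y ω ∂ν := by
  let K' : Set (Lp ℝ 2 ν) := {y | (y : α →ₘ[ν] ℝ) + x ∈ K}
  let B : ℝ → Set (Lp ℝ 2 ν) := fun r => {y | ∀ᵐ ω ∂ν, |y ω| ≤ r}
  have hbound : ∀ z : α →ₘ[ν] ℝ, MemLp z ∞ ν → ∃ c : ℝ, ∀ᵐ ω ∂ν, |z ω| ≤ c := by
    intro z hz
    exact ⟨(eLpNormEssSup z ν).toReal, by
      have h1 := ae_le_eLpNormEssSup (f := z) (μ := ν)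
      have h2 := hz.2
      rw [eLpNorm_exponent_top] at h2
      filter_upwards [h1] with ω hω
      have := ENNReal.toReal_mono h2.ne hω
      rwa [toReal_enorm] at this⟩
  have hK'c : Convex ℝ K' := by
    intro y hy z hz a b ha hb hab
    have h1 := hconv hy hz ha hb hab
    have h2 : a • ((y : α →ₘ[ν] ℝ) + x) + b • ((z : α →ₘ[ν] ℝ) + x)
        = ((a • y + b • z : Lp ℝ 2 ν) : α →ₘ[ν] ℝ) + x := by
      have h3 : ((a • y + b • z : Lp ℝ 2 ν) : α →ₘ[ν] ℝ)
        = a • (y : α →ₘ[ν] ℝ) + b • (z : α →ₘ[ν] ℝ) := rfl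
      rw [h3, smul_add, smul_add, add_add_add_comm, ← add_smul, hab, one_smul]
    rw [h2] at h1
    exact h1
  obtain ⟨cx, hcx⟩ := hbound x hxp
  have hK'B : ∀ r, IsClosed (K' ∩ B r) := by
    intro r
    refine isClosed_of_closure_subset fun z hz => ?_
    obtain ⟨y, hy, hyz⟩ := mem_closure_iff_seq_limit.1 hz
    obtain ⟨φ, k, hk, hdom, hlim⟩ := exists_subseq_dominated hyz
    refine ⟨?_, (isClosed_ae_abs_le r).mem_of_tendsto hyz
      (Eventually.of_forall fun n => (hy n).2)⟩
    refine hcl (fun j => (y (φ j) : α →ₘ[ν] ℝ) + x) (fun _ => r + cx) (memLp_const _)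
      (fun j => (hy _).1) (fun j => ?_) _ ?_
    · filter_upwards [(hy (φ j)).2, hcx, AEEqFun.coeFn_add (y (φ j) : α →ₘ[ν] ℝ) x] with ω a1 a2 a3
      rw [a3, Pi.add_apply]
      exact (abs_add_le _ _).trans (add_le_add a1 a2)
    · filter_upwards [hlim, ae_all_iff.2 fun j => AEEqFun.coeFn_add (y (φ j) : α →ₘ[ν] ℝ) x,
        AEEqFun.coeFn_add (z : α →ₘ[ν] ℝ) x] with ω a1 a2 a3
      rw [a3]
      simp_rw [a2]
      exact a1.add_const _
  have hnorm : ∀ r, 0 ≤ r → ∀ y ∈ B r, ‖y‖ ≤ measureUnivNNReal ν ^ (2 : ℝ≥0∞).toReal⁻¹ * r :=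
    fun r hr y hy => Lp.norm_le_of_ae_bound hr hy
  set M : ℝ := measureUnivNNReal ν ^ (2 : ℝ≥0∞).toReal⁻¹ with hM
  have hM0 : 0 ≤ M := by positivity
  have h0 : (0 : Lp ℝ 2 ν) ∉ K' ∩ B 1 := by
    rintro ⟨h, -⟩
    have : ((0 : Lp ℝ 2 ν) : α →ₘ[ν] ℝ) + x = x := zero_add x
    exact hx (this ▸ h)
  obtain ⟨ρ, hρ, hρK⟩ := Metric.isOpen_iff.1 (hK'B 1).isOpen_compl 0 h0
  -- An `L²` ball of radius `ρ` around 0 misses `K' ∩ B 1`. A function bounded by `r` has `L²` norm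
  -- at most `M * r < ρ`, so `K'` misses the whole sup-norm ball of radius `r`.
  set r := min 1 (ρ / (2 * (M + 1))) with hr
  have hr0 : 0 < r := lt_min one_pos (by positivity)
  have hdis : Disjoint K' (B (r * 2 ^ 0)) := by
    rw [Set.disjoint_left]
    intro y hy hyB
    rw [pow_zero, mul_one] at hyB
    have h1 : y ∈ B 1 := by
      change ∀ᵐ ω ∂ν, |y ω| ≤ 1
      filter_upwards [hyB] with ω hω using hω.trans (min_le_left _ _)
    refine hρK ?_ ⟨hy, h1⟩
    rw [mem_ball_zero_iff]
    refine (hnorm r hr0.le y hyB).trans_lt ?_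
    have h2 : r * (2 * (M + 1)) ≤ ρ := by
      rw [← le_div_iff₀ (by positivity)]; exact min_le_right _ _
    nlinarith
  obtain ⟨xs, hxs1, hxs2⟩ := exists_seq_inner_separating hK'c (B := fun n => B (r * 2 ^ n))
    (fun n => isClosed_ae_abs_le _) (fun n => convex_ae_abs_le _)
    (fun n => by
      filter_upwards [Lp.coeFn_zero ℝ 2 ν] with ω hω
      rw [hω]; simp only [Pi.zero_apply, abs_zero]; positivity)
    (fun n => ⟨_, hnorm _ (by positivity)⟩) (fun n => hK'B _) hdis
  have hK'bdd : ∀ y ∈ K', ∃ c : ℝ, ∀ᵐ ω ∂ν, |y ω| ≤ c := by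
    intro y hy
    obtain ⟨c, hc⟩ := hbound _ (hKp _ hy)
    refine ⟨c + cx, ?_⟩
    filter_upwards [hc, hcx, AEEqFun.coeFn_add (y : α →ₘ[ν] ℝ) x] with ω a1 a2 a3
    rw [a3, Pi.add_apply] at a1
    have : y ω = (y ω + x ω) - x ω := by ring
    rw [this]
    exact (abs_sub _ _).trans (add_le_add a1 a2)
  obtain ⟨g, hg, δ, hδ, hgδ⟩ := exists_separating_zero_of_seq hK'c hK'bdd (r := r) (x := xs)
    (fun n => integral_abs_le_of_inner_le (by positivity) (hxs1 n)) (fun y hy => by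
      obtain ⟨c, hc⟩ := hK'bdd y hy
      -- Every element of `K'` is bounded, hence lies in one of the balls of radius `r 2^n`.
      obtain ⟨n, hn⟩ := pow_unbounded_of_one_lt (c / r) (one_lt_two : (1 : ℝ) < 2)
      refine hxs2 n y ⟨hy, ?_⟩
      rw [div_lt_iff₀ hr0] at hn
      filter_upwards [hc] with ω hω
      linarith)
  have hgint : ∀ z : α →ₘ[ν] ℝ, MemLp z ∞ ν → Integrable (fun ω => g ω * z ω) ν := by
    intro z hz
    have := (memLp_one_iff_integrable.2 hg).integrable_mul hz
    exact this
  refine ⟨g, hg, δ, hδ, fun y hy => ?_⟩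
  have hyx : MemLp (y - x : α →ₘ[ν] ℝ) 2 ν :=
    (((hKp y hy).sub hxp).mono_exponent le_top).ae_eq (AEEqFun.coeFn_sub y x).symm
  have h1 := hgδ ⟨y - x, Lp.mem_Lp_iff_eLpNorm_lt_top.2 hyx.2⟩ (by
    change y - x + x ∈ K
    rwa [sub_add_cancel])
  have h2 : ∫ ω, g ω * (y - x : α →ₘ[ν] ℝ) ω ∂ν
      = ∫ ω, g ω * y ω ∂ν - ∫ ω, g ω * x ω ∂ν := by
    rw [← integral_sub (hgint y (hKp y hy)) (hgint x hxp)]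
    refine integral_congr_ae ?_
    filter_upwards [AEEqFun.coeFn_sub y x] with ω hω
    rw [hω, Pi.sub_apply, mul_sub]
  change δ ≤ ∫ ω, g ω * (y - x : α →ₘ[ν] ℝ) ω ∂ν at h1
  linarith

/-- **Separation** of a point from a convex subset of `L^p`, `1 ≤ p ≤ ∞`, that is closed under
almost everywhere convergence of sequences dominated in `L^p`, by an element of `L^q`. -/
theorem exists_separating {p q : ℝ≥0∞} [hpq : ENNReal.HolderConjugate p q]
    {K : Set (α →ₘ[ν] ℝ)} (hKp : ∀ y ∈ K, MemLp y p ν) (hconv : Convex ℝ K)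
    (hcl : DominatedClosed p ν K) {x : α →ₘ[ν] ℝ} (hxp : MemLp x p ν) (hx : x ∉ K) :
    ∃ g : α → ℝ, MemLp g q ν ∧ ∃ δ > 0, ∀ y ∈ K,
      ∫ ω, g ω * x ω ∂ν + δ ≤ ∫ ω, g ω * y ω ∂ν := by
  by_cases hp : p = ∞
  · subst hp
    have : q = 1 := by
      have := hpq.inv_add_inv_eq_one
      simpa using this
    subst this
    obtain ⟨g, hg, h⟩ := exists_separating_top hKp hconv hcl hxp hx
    exact ⟨g, memLp_one_iff_integrable.2 hg, h⟩
  · exact exists_separating_of_ne_top hp hKp hconv hcl hxp hx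

end KreinSmulian

end

section

/-! ### Separation for finite families of random variables. -/

section Family

set_option linter.unusedSectionVars false

variable {Ω ι : Type*} [Fintype ι] {mΩ : MeasurableSpace Ω} (P : Measure Ω) [IsFiniteMeasure P]

/-- The sum of copies of `P` on `ι × Ω`. -/
def copies (ι : Type*) {Ω : Type*} [MeasurableSpace ι] {mΩ : MeasurableSpace Ω} (P : Measure Ω) :
    Measure (ι × Ω) :=
  Measure.sum fun i : ι => P.map (Prod.mk i)

variable [MeasurableSpace ι] [MeasurableSingletonClass ι]

theorem measurableEmbedding_prodMk (i : ι) : MeasurableEmbedding (Prod.mk i : Ω → ι × Ω) :=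
  MeasurableEmbedding.prodMk_left i MeasurableEmbedding.id

instance : IsFiniteMeasure (copies ι P) := by
  refine ⟨?_⟩
  rw [copies, Measure.sum_apply _ MeasurableSet.univ, tsum_fintype]
  exact ENNReal.sum_lt_top.2 fun i _ => measure_lt_top _ _

variable {P}

theorem ae_copies_iff {p : ι × Ω → Prop} :
    (∀ᵐ z ∂copies ι P, p z) ↔ ∀ i, ∀ᵐ ω ∂P, p (i, ω) := by
  rw [copies, Measure.ae_sum_iff]
  simp_rw [(measurableEmbedding_prodMk _).ae_map_iff]

theorem map_prodMk_le (i : ι) : P.map (Prod.mk i) ≤ copies ι P := Measure.le_sum _ i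

theorem memLp_copies {p : ℝ≥0∞} {f : ι → Ω → ℝ} (h : ∀ i, MemLp (f i) p P) :
    MemLp (fun z : ι × Ω => f z.1 z.2) p (copies ι P) := by
  classical
  have hmap : (copies ι P).map Prod.snd = (Fintype.card ι : ℝ≥0∞) • P := by
    ext s hs
    rw [Measure.map_apply measurable_snd hs, copies, Measure.sum_apply _ (measurable_snd hs),
      tsum_fintype]
    have : ∀ i : ι, P.map (Prod.mk i) (Prod.snd ⁻¹' s) = P s := fun i => by
      rw [Measure.map_apply (measurableEmbedding_prodMk i).measurable (measurable_snd hs)]; rfl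
    simp_rw [this]
    simp
  have hcomp : ∀ i, MemLp (f i ∘ (Prod.snd : ι × Ω → Ω)) p (copies ι P) := by
    intro i
    have h1 : MemLp (f i) p ((copies ι P).map Prod.snd) := by
      rw [hmap]; exact (h i).smul_measure (by simp)
    exact h1.comp_of_map measurable_snd.aemeasurable
  have e : (fun z : ι × Ω => f z.1 z.2) = fun z => ∑ i, (Prod.fst ⁻¹' {i}).indicator
      (f i ∘ (Prod.snd : ι × Ω → Ω)) z := by
    funext z
    rw [Finset.sum_eq_single z.1]
    · simp
    · intro b _ hb
      rw [indicator_of_notMem]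
      simpa using hb.symm
    · simp
  rw [e]
  exact memLp_finsetSum _ fun i _ => (hcomp i).indicator (measurable_fst (measurableSet_singleton i))

theorem MemLp.copies_section {p : ℝ≥0∞} {f : ι × Ω → ℝ} (h : MemLp f p (copies ι P)) (i : ι) :
    MemLp (fun ω => f (i, ω)) p P :=
  (measurableEmbedding_prodMk i).memLp_map_measure_iff.1 (h.mono_measure (map_prodMk_le i))

theorem integral_copies {f : ι × Ω → ℝ} (h : Integrable f (copies ι P)) :
    ∫ z, f z ∂copies ι P = ∑ i, ∫ ω, f (i, ω) ∂P := by
  rw [copies, integral_sum_measure h, tsum_fintype]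
  exact Finset.sum_congr rfl fun i _ => (measurableEmbedding_prodMk i).integral_map _

theorem quasiMeasurePreserving_prodMk (i : ι) :
    Measure.QuasiMeasurePreserving (Prod.mk i : Ω → ι × Ω) P (copies ι P) :=
  ⟨(measurableEmbedding_prodMk i).measurable, (map_prodMk_le i).absolutelyContinuous⟩

/-- A family indexed by ι is one function on ι × Ω under the sum of copies of P. Sections and this
joint function translate integrability, convex combinations and almost sure limits into each other,
so the scalar separation theorem applies on ι × Ω. -/
theorem exists_separating_family' {p q : ℝ≥0∞} [hpq : ENNReal.HolderConjugate p q]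
    {K : Set (ι → Ω →ₘ[P] ℝ)} (hKp : ∀ y ∈ K, ∀ i, MemLp (y i) p P) (hconv : Convex ℝ K)
    (hcl : ∀ (y : ℕ → ι → Ω →ₘ[P] ℝ) (h : Ω → ℝ), MemLp h p P → (∀ j, y j ∈ K) →
      (∀ j i, ∀ᵐ ω ∂P, |y j i ω| ≤ h ω) → ∀ z : ι → Ω →ₘ[P] ℝ,
      (∀ i, ∀ᵐ ω ∂P, Tendsto (fun j => y j i ω) atTop (𝓝 (z i ω))) → z ∈ K)
    {x : ι → Ω →ₘ[P] ℝ} (hxp : ∀ i, MemLp (x i) p P) (hx : x ∉ K) :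
    ∃ g : ι → Ω → ℝ, (∀ i, MemLp (g i) q P) ∧ ∃ δ > 0, ∀ y ∈ K,
      (∑ i, ∫ ω, g i ω * x i ω ∂P) + δ ≤ ∑ i, ∫ ω, g i ω * y i ω ∂P := by
  let sec : (ι × Ω →ₘ[copies ι P] ℝ) → ι → Ω →ₘ[P] ℝ := fun y i =>
    y.compQuasiMeasurePreserving (Prod.mk i) (quasiMeasurePreserving_prodMk i)
  have hsec : ∀ y i, ∀ᵐ ω ∂P, sec y i ω = y (i, ω) := fun y i =>
    AEEqFun.coeFn_compQuasiMeasurePreserving _ _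
  let J : (y : ι → Ω →ₘ[P] ℝ) → (ι × Ω →ₘ[copies ι P] ℝ) := fun y =>
    AEEqFun.mk (fun z => y z.1 z.2)
      (measurable_from_prod_countable_right fun i => (y i).measurable).aestronglyMeasurable
  have hJ : ∀ y i, ∀ᵐ ω ∂P, J y (i, ω) = y i ω := by
    intro y
    exact ae_copies_iff.1 (AEEqFun.coeFn_mk (fun z : ι × Ω => y z.1 z.2) _)
  have hsecJ : ∀ y, sec (J y) = y := by
    intro y
    funext i
    ext1
    filter_upwards [hsec (J y) i, hJ y i] with ω h1 h2
    rw [h1, h2]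
  have hJmem : ∀ y : ι → Ω →ₘ[P] ℝ, (∀ i, MemLp (y i) p P) → MemLp (J y) p (copies ι P) := by
    intro y hy
    exact (memLp_copies hy).ae_eq (AEEqFun.coeFn_mk _ _).symm
  have hpq' : ENNReal.HolderConjugate q p := hpq.symm
  let K' : Set (ι × Ω →ₘ[copies ι P] ℝ) := {y | sec y ∈ K}
  have hK'p : ∀ y ∈ K', MemLp y p (copies ι P) := by
    intro y hy
    refine (memLp_copies (hKp _ hy)).ae_eq (ae_copies_iff.2 fun i => ?_)
    exact hsec y i
  have hK'c : Convex ℝ K' := by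
    intro y hy z hz a b ha hb hab
    have h1 := hconv hy hz ha hb hab
    have h2 : a • sec y + b • sec z = sec (a • y + b • z) := by
      funext i
      ext1
      have e1 := ae_copies_iff.1 (AEEqFun.coeFn_add (a • y) (b • z)) i
      have e2 := ae_copies_iff.1 (AEEqFun.coeFn_smul a y) i
      have e3 := ae_copies_iff.1 (AEEqFun.coeFn_smul b z) i
      filter_upwards [e1, e2, e3, hsec y i, hsec z i, hsec (a • y + b • z) i,
        AEEqFun.coeFn_add (a • sec y i) (b • sec z i), AEEqFun.coeFn_smul a (sec y i),
        AEEqFun.coeFn_smul b (sec z i)] with ω a1 a2 a3 a4 a5 a6 a7 a8 a9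
      simp only [Pi.add_apply, Pi.smul_apply] at *
      rw [a7, a8, a9, a6, a1, a2, a3, a4, a5]
    rw [h2] at h1
    exact h1
  have hK'cl : DominatedClosed p (copies ι P) K' := by
    intro y h hh hy hdom z hz
    have hm : ∀ i, MemLp (fun ω => |h (i, ω)|) p P := fun i => (MemLp.copies_section hh i).abs
    -- The sum of the sections of `h` dominates all coordinates at once.
    refine hcl (fun j => sec (y j)) (fun ω => ∑ i, |h (i, ω)|)
      (memLp_finsetSum _ fun i _ => hm i) hy (fun j i => ?_) _ (fun i => ?_)
    · filter_upwards [hsec (y j) i, ae_copies_iff.1 (hdom j) i] with ω a1 a2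
      rw [a1]
      refine (a2.trans (le_abs_self _)).trans ?_
      exact Finset.single_le_sum (f := fun i => |h (i, ω)|) (fun i _ => abs_nonneg _)
        (Finset.mem_univ i)
    · filter_upwards [hsec z i, ae_all_iff.2 fun j => hsec (y j) i, ae_copies_iff.1 hz i]
        with ω a1 a2 a3
      rw [a1]
      simp_rw [a2]
      exact a3
  obtain ⟨g, hg, δ, hδ, hgδ⟩ := exists_separating (q := q) hK'p hK'c hK'cl (x := J x) (hJmem x hxp)
    (fun h => hx (by have : sec (J x) ∈ K := h; rwa [hsecJ] at this))
  have hint : ∀ y : ι → Ω →ₘ[P] ℝ, (∀ i, MemLp (y i) p P) →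
      ∫ z, g z * J y z ∂copies ι P = ∑ i, ∫ ω, g (i, ω) * y i ω ∂P := by
    intro y hy
    have hi : Integrable (fun z => g z * J y z) (copies ι P) := hg.integrable_mul (hJmem y hy)
    rw [integral_copies hi]
    refine Finset.sum_congr rfl fun i _ => integral_congr_ae ?_
    filter_upwards [hJ y i] with ω hω
    rw [hω]
  refine ⟨fun i ω => g (i, ω), fun i => MemLp.copies_section hg i, δ, hδ, fun y hy => ?_⟩
  rw [← hint x hxp, ← hint y (hKp y hy)]
  exact hgδ (J y) (by change sec (J y) ∈ K; rwa [hsecJ])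

end Family

/-- Separation of a point from a convex set of finite families of random variables that is closed
under almost everywhere convergence of sequences dominated in `L^p`. -/
theorem exists_separating_family {Ω ι : Type*} [Fintype ι] {mΩ : MeasurableSpace Ω} {P : Measure Ω}
    [IsFiniteMeasure P] {p q : ℝ≥0∞} [hpq : ENNReal.HolderConjugate p q]
    {K : Set (ι → Ω →ₘ[P] ℝ)} (hKp : ∀ y ∈ K, ∀ i, MemLp (y i) p P) (hconv : Convex ℝ K)
    (hcl : ∀ (y : ℕ → ι → Ω →ₘ[P] ℝ) (h : Ω → ℝ), MemLp h p P → (∀ j, y j ∈ K) →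
      (∀ j i, ∀ᵐ ω ∂P, |y j i ω| ≤ h ω) → ∀ z : ι → Ω →ₘ[P] ℝ,
      (∀ i, ∀ᵐ ω ∂P, Tendsto (fun j => y j i ω) atTop (𝓝 (z i ω))) → z ∈ K)
    {x : ι → Ω →ₘ[P] ℝ} (hxp : ∀ i, MemLp (x i) p P) (hx : x ∉ K) :
    ∃ g : ι → Ω → ℝ, (∀ i, MemLp (g i) q P) ∧ ∃ δ > 0, ∀ y ∈ K,
      (∑ i, ∫ ω, g i ω * x i ω ∂P) + δ ≤ ∑ i, ∫ ω, g i ω * y i ω ∂P := by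
  let _ : MeasurableSpace ι := ⊤
  exact exists_separating_family' hKp hconv hcl hxp hx

end

section

/-! ### Exhaustion and localization of strict inequalities. -/

section Exhaustion

variable {Ω : Type*} {mΩ : MeasurableSpace Ω} {P : Measure Ω} [IsFiniteMeasure P]

/-- A nonempty family of sets has a countable subfamily whose union contains every member of the
family almost surely. -/
theorem exists_seq_ae_le_iUnion {𝒜 : Set (Set Ω)} (hne : 𝒜.Nonempty)
    (hm : ∀ A ∈ 𝒜, MeasurableSet A) :
    ∃ A : ℕ → Set Ω, (∀ n, A n ∈ 𝒜) ∧ ∀ B ∈ 𝒜, P (B \ ⋃ n, A n) = 0 := by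
  -- The supremum of the measures of countable unions is attained by merging a maximizing sequence
  -- of subfamilies through `Nat.unpair`. Adding one more member cannot increase the measure of this
  -- union.
  let V : Set ℝ≥0∞ := {v | ∃ A : ℕ → Set Ω, (∀ n, A n ∈ 𝒜) ∧ v = P (⋃ n, A n)}
  obtain ⟨A₀, hA₀⟩ := hne
  have hVne : V.Nonempty := ⟨_, fun _ => A₀, fun _ => hA₀, rfl⟩
  obtain ⟨v, -, hv, hvV⟩ := exists_seq_tendsto_sSup hVne (OrderTop.bddAbove V)
  choose A hA hvA using hvV
  let A' : ℕ → Set Ω := fun n => A n.unpair.1 n.unpair.2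
  have hA' : ∀ n, A' n ∈ 𝒜 := fun n => hA _ _
  have hsub : ∀ k, (⋃ n, A k n) ⊆ ⋃ n, A' n := by
    intro k
    refine iUnion_subset fun n => ?_
    have : A' (Nat.pair k n) = A k n := by simp [A']
    exact this ▸ subset_iUnion A' _
  have hge : sSup V ≤ P (⋃ n, A' n) :=
    le_of_tendsto' hv fun k => hvA k ▸ measure_mono (hsub k)
  refine ⟨A', hA', fun B hB => ?_⟩
  have h1 : P ((⋃ n, A' n) ∪ B) ≤ sSup V := by
    refine le_sSup ⟨fun n => Nat.casesOn n B A', fun n => ?_, ?_⟩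
    · cases n
      · exact hB
      · exact hA' _
    · congr 1
      ext ω
      simp only [mem_union, mem_iUnion]
      constructor
      · rintro (⟨n, hn⟩ | h)
        · exact ⟨n + 1, hn⟩
        · exact ⟨0, h⟩
      · rintro ⟨_ | n, h⟩
        · exact Or.inr h
        · exact Or.inl ⟨n, h⟩
  have hmU : MeasurableSet (⋃ n, A' n) := MeasurableSet.iUnion fun n => hm _ (hA' n)
  rw [← union_sdiff_self, measure_union disjoint_sdiff_right ((hm B hB).diff hmU)] at h1
  have h2 := h1.trans hge
  have h3 : P (⋃ n, A' n) + P (B \ ⋃ n, A' n) ≤ P (⋃ n, A' n) + 0 := by simpa using h2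
  exact le_antisymm (ENNReal.le_of_add_le_add_left (measure_ne_top _ _) h3) zero_le

/-- A family of `m`-measurable integrable functions that is stable under concatenation along
`m`-measurable sets, and whose expectations are bounded below by a positive constant, is bounded
below by a positive constant on some set of positive measure. -/
theorem exists_set_forall_le_of_forall_le_integral {m : MeasurableSpace Ω} (hm : m ≤ mΩ)
    [IsProbabilityMeasure P] {𝒢 : Set (Ω → ℝ)} (hne : 𝒢.Nonempty)
    (hmeas : ∀ g ∈ 𝒢, Measurable[m] g) (hint : ∀ g ∈ 𝒢, Integrable g P)
    (hcat : ∀ A, MeasurableSet[m] A → ∀ g ∈ 𝒢, ∀ h ∈ 𝒢, ∃ k ∈ 𝒢,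
      (∀ᵐ ω ∂P, ω ∈ A → k ω = g ω) ∧ ∀ᵐ ω ∂P, ω ∉ A → k ω = h ω)
    {δ : ℝ} (hδ : 0 < δ) (hE : ∀ g ∈ 𝒢, δ ≤ ∫ ω, g ω ∂P) :
    ∃ B, MeasurableSet[m] B ∧ P B ≠ 0 ∧ ∃ η > 0, ∀ g ∈ 𝒢, ∀ᵐ ω ∂P, ω ∈ B → η ≤ g ω := by
  have hlt : ∀ g ∈ 𝒢, MeasurableSet[m] {ω | g ω < δ / 2} := fun g hg =>
    measurableSet_lt (hmeas g hg) measurable_const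
  obtain ⟨A, hA, hAsup⟩ := exists_seq_ae_le_iUnion (P := P)
    (𝒜 := (fun g : Ω → ℝ => {ω | g ω < δ / 2}) '' 𝒢) (hne.image _)
    (by rintro _ ⟨g, hg, rfl⟩; exact hm _ (hlt g hg))
  choose g hg hgA using hA
  have hgA' : ∀ n, A n = {ω | g n ω < δ / 2} := fun n => (hgA n).symm
  have hAm : ∀ n, MeasurableSet[m] (A n) := fun n => (hgA' n) ▸ hlt _ (hg n)
  -- Off the exhausting union of the sets {g < δ/2}, every member is at least δ/2. If the complement
  -- were null, pasting would produce members below δ/2 on increasing sets C n that equal g 0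
  -- elsewhere; their expectations are at most δ/2 plus a remainder tending to 0, contradicting the
  -- lower bound δ.
  refine ⟨(⋃ n, A n)ᶜ, (MeasurableSet.iUnion hAm).compl, ?_, δ / 2, by positivity,
    fun k hk => ?_⟩
  · intro h0
    have hstep : ∀ n, ∃ k ∈ 𝒢, ∀ᵐ ω ∂P, (∃ i ≤ n, ω ∈ A i) → k ω < δ / 2 := by
      intro n
      induction n with
      | zero =>
        refine ⟨g 0, hg 0, Eventually.of_forall ?_⟩
        rintro ω ⟨i, hi, hω⟩
        rw [Nat.le_zero.1 hi, hgA'] at hω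
        exact hω
      | succ n ih =>
        obtain ⟨k, hk, hkA⟩ := ih
        obtain ⟨l, hl, hl1, hl2⟩ := hcat (A (n + 1)) (hAm _) _ (hg (n + 1)) k hk
        refine ⟨l, hl, ?_⟩
        filter_upwards [hkA, hl1, hl2] with ω a1 a2 a3
        rintro ⟨i, hi, hω⟩
        by_cases hωn : ω ∈ A (n + 1)
        · rw [a2 hωn]; rw [hgA'] at hωn; exact hωn
        · rw [a3 hωn]
          refine a1 ⟨i, ?_, hω⟩
          rcases Nat.le_or_eq_of_le_succ hi with h | h
          · exact h
          · subst h; exact absurd hω hωn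
    choose k hk hkA using hstep
    let C : ℕ → Set Ω := fun n => ⋃ i ∈ Finset.range (n + 1), A i
    have hCm : ∀ n, MeasurableSet[m] (C n) := fun n =>
      Finset.measurableSet_biUnion _ fun i _ => hAm i
    have hbound : ∀ n, δ ≤ δ / 2 + ∫ ω in (C n)ᶜ, |g 0 ω| ∂P := by
      intro n
      obtain ⟨l, hl, hl1, hl2⟩ := hcat (C n) (hCm n) _ (hk n) _ (hg 0)
      refine (hE l hl).trans ?_
      rw [← integral_add_compl (hm _ (hCm n)) (hint l hl)]
      refine add_le_add ?_ ?_
      · have h1 : ∫ ω in C n, l ω ∂P ≤ ∫ ω in C n, δ / 2 ∂P := by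
          refine setIntegral_mono_on_ae (hint l hl).integrableOn (integrable_const _).integrableOn
            (hm _ (hCm n)) ?_
          filter_upwards [hl1, hkA n] with ω a1 a2 hω
          rw [a1 hω]
          refine (a2 ?_).le
          simp only [C, mem_iUnion, Finset.mem_range] at hω
          obtain ⟨i, hi, hω⟩ := hω
          exact ⟨i, Nat.lt_succ_iff.1 hi, hω⟩
        refine h1.trans ?_
        rw [setIntegral_const, smul_eq_mul]
        have : P.real (C n) ≤ 1 := measureReal_le_one
        nlinarith
      · refine setIntegral_mono_on_ae (hint l hl).integrableOn (hint _ (hg 0)).abs.integrableOn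
            (hm _ (hCm n)).compl ?_
        filter_upwards [hl2] with ω a1 hω
        rw [a1 hω]
        exact le_abs_self _
    have hanti : Antitone fun n => (C n)ᶜ := by
      intro a b hab
      refine compl_subset_compl.2 ?_
      refine biUnion_subset_biUnion_left fun i hi => ?_
      simp only [Finset.coe_range, mem_Iio] at *
      omega
    have hlim := tendsto_setIntegral_of_antitone (μ := P) (f := fun ω => |g 0 ω|)
      (fun n => (hm _ (hCm n)).compl) hanti ⟨0, (hint _ (hg 0)).abs.integrableOn⟩
    have hint0 : ⋂ n, (C n)ᶜ = (⋃ n, A n)ᶜ := by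
      rw [← compl_iUnion]
      congr 1
      ext ω
      simp only [C, mem_iUnion, Finset.mem_range]
      exact ⟨fun ⟨_, i, _, h⟩ => ⟨i, h⟩, fun ⟨i, h⟩ => ⟨i, i, Nat.lt_succ_self i, h⟩⟩
    rw [hint0, Measure.restrict_eq_zero.2 h0, integral_zero_measure] at hlim
    have := ge_of_tendsto' (hlim.const_add (δ / 2)) hbound
    linarith
  · have h1 := hAsup _ ⟨k, hk, rfl⟩
    rw [measure_eq_zero_iff_ae_notMem] at h1
    filter_upwards [h1] with ω hω hωB
    by_contra hlt'
    exact hω ⟨not_le.1 hlt', hωB⟩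

end Exhaustion

/-! ### Concatenation along measurable indices. -/

section Glue

variable {Ω : Type*} {mΩ : MeasurableSpace Ω} {P : Measure Ω}

theorem aestronglyMeasurable_glue {β : Type*} [TopologicalSpace β]
    [TopologicalSpace.PseudoMetrizableSpace β] [SecondCountableTopology β]
    {m : MeasurableSpace Ω} {N : Ω → ℕ} (hN : Measurable[m] N) {f : ℕ → Ω → β}
    (hf : ∀ n, AEStronglyMeasurable[m] (f n) P) :
    AEStronglyMeasurable[m] (fun ω => f (N ω) ω) P := by
  borelize β
  refine ⟨fun ω => (hf (N ω)).mk _ ω, ?_, ?_⟩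
  · refine Measurable.stronglyMeasurable ?_
    have h1 : @Measurable (ℕ × Ω) β (@Prod.instMeasurableSpace _ _ _ m) _
        (fun z : ℕ × Ω => (hf z.1).mk _ z.2) :=
      @measurable_from_prod_countable_right ℕ Ω β _ m _ _ _ _
        fun n => (hf n).stronglyMeasurable_mk.measurable
    exact h1.comp (hN.prodMk measurable_id)
  · filter_upwards [ae_all_iff.2 fun n => (hf n).ae_eq_mk] with ω hω using hω _

variable {T : ℕ} {ℱ : Filtration (Fin (T + 1)) mΩ} {t : Fin (T + 1)}

/-- The process that coincides with `Y n` on `{N = n}`. -/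
def glue {N : Ω → ℕ} (hN : Measurable N) (Y : ℕ → Proc T P) : Proc T P := fun s =>
  AEEqFun.mk (fun ω => Y (N ω) s ω)
    (aestronglyMeasurable_glue hN fun n => (Y n s).aestronglyMeasurable)

theorem coeFn_glue {N : Ω → ℕ} (hN : Measurable N) (Y : ℕ → Proc T P) (s : Fin (T + 1)) :
    ∀ᵐ ω ∂P, glue hN Y s ω = Y (N ω) s ω :=
  AEEqFun.coeFn_mk _ _

theorem adapted_glue {N : Ω → ℕ} (hN : Measurable[ℱ t] N) {Y : ℕ → Proc T P}
    (hY : ∀ n, Adapted ℱ (Y n)) (h0 : ∀ n, ∀ s < t, Y n s = 0) :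
    Adapted ℱ (glue (hN.mono (ℱ.le t) le_rfl) Y) ∧
      ∀ s < t, glue (hN.mono (ℱ.le t) le_rfl) Y s = 0 := by
  have hz : ∀ s < t, glue (hN.mono (ℱ.le t) le_rfl) Y s = 0 := by
    intro s hs
    ext1
    filter_upwards [coeFn_glue (hN.mono (ℱ.le t) le_rfl) Y s,
      AEEqFun.coeFn_zero (α := Ω) (β := ℝ) (μ := P)] with ω h1 h2
    rw [h1, h0 _ s hs]
  refine ⟨fun s => ?_, hz⟩
  rcases lt_or_ge s t with hs | hs
  · rw [hz s hs]
    exact aestronglyMeasurable_zero.congr AEEqFun.coeFn_zero.symm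
  · exact (aestronglyMeasurable_glue (hN.mono (ℱ.mono hs) le_rfl) fun n => hY n s).congr
      (AEEqFun.coeFn_mk _ _).symm

end Glue

/-! ### Measurable representatives and essential suprema in L⁰ and L̄⁰. -/

section Bar

variable {Ω : Type*} {mΩ : MeasurableSpace Ω} {P : Measure Ω} {T : ℕ}
  {ℱ : Filtration (Fin (T + 1)) mΩ} {t : Fin (T + 1)}

/-- An `𝓕_t`-measurable representative. -/
def L0.rep (f : L0 P ℱ t) : Ω → ℝ := f.2.mk f.1

theorem L0.measurable_rep (f : L0 P ℱ t) : Measurable[ℱ t] f.rep :=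
  f.2.stronglyMeasurable_mk.measurable

theorem L0.coeFn_eq_rep (f : L0 P ℱ t) : ∀ᵐ ω ∂P, f.1 ω = f.rep ω := f.2.ae_eq_mk

/-- The class of an `𝓕_t`-measurable function. -/
def L0.of (P : Measure Ω) (f : Ω → ℝ) (hf : Measurable[ℱ t] f) : L0 P ℱ t :=
  ⟨AEEqFun.mk f (hf.mono (ℱ.le t) le_rfl).aestronglyMeasurable,
    hf.stronglyMeasurable.aestronglyMeasurable.congr (AEEqFun.coeFn_mk _ _).symm⟩

theorem L0.coeFn_of (f : Ω → ℝ) (hf : Measurable[ℱ t] f) :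
    ∀ᵐ ω ∂P, (L0.of P f hf).1 ω = f ω := AEEqFun.coeFn_mk _ _

/-- An `𝓕_t`-measurable representative. -/
def L0bar.rep (f : L0bar P ℱ t) : Ω → EReal := f.2.mk f.1

theorem L0bar.measurable_rep (f : L0bar P ℱ t) : Measurable[ℱ t] f.rep :=
  f.2.stronglyMeasurable_mk.measurable

theorem L0bar.coeFn_eq_rep (f : L0bar P ℱ t) : ∀ᵐ ω ∂P, f.1 ω = f.rep ω := f.2.ae_eq_mk

/-- The class of an `𝓕_t`-measurable function. -/
def L0bar.of (P : Measure Ω) (f : Ω → EReal) (hf : Measurable[ℱ t] f) : L0bar P ℱ t :=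
  ⟨AEEqFun.mk f (hf.mono (ℱ.le t) le_rfl).aestronglyMeasurable,
    hf.stronglyMeasurable.aestronglyMeasurable.congr (AEEqFun.coeFn_mk _ _).symm⟩

theorem L0bar.coeFn_of (f : Ω → EReal) (hf : Measurable[ℱ t] f) :
    ∀ᵐ ω ∂P, (L0bar.of P f hf).1 ω = f ω := AEEqFun.coeFn_mk _ _

theorem L0.coeFn_toBar (f : L0 P ℱ t) : ∀ᵐ ω ∂P, f.toBar.1 ω = (f.1 ω : EReal) :=
  AEEqFun.coeFn_comp _ continuous_coe_real_ereal _

theorem L0bar.le_iff {f g : L0bar P ℱ t} : f ≤ g ↔ ∀ᵐ ω ∂P, f.1 ω ≤ g.1 ω :=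
  AEEqFun.coeFn_le.symm

theorem L0bar.ext_ae {f g : L0bar P ℱ t} (h : ∀ᵐ ω ∂P, f.1 ω = g.1 ω) : f = g :=
  Subtype.ext (AEEqFun.ext h)

theorem L0.ext_ae {f g : L0 P ℱ t} (h : ∀ᵐ ω ∂P, f.1 ω = g.1 ω) : f = g :=
  Subtype.ext (AEEqFun.ext h)

variable [IsFiniteMeasure P]

/-- For each rational c, a countable subfamily exhausts the events {g > c}, g ∈ S. The pointwise
supremum of these countably many functions over all rational c dominates every member, because a
strict excess would be visible at some rational level. -/
theorem L0bar.exists_isLUB (S : Set (L0bar P ℱ t)) : ∃ u, IsLUB S u := by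
  rcases S.eq_empty_or_nonempty with rfl | hne
  · refine ⟨L0bar.of P (fun _ => ⊥) measurable_const, by simp, fun v _ => ?_⟩
    rw [L0bar.le_iff]
    filter_upwards [L0bar.coeFn_of (P := P) (ℱ := ℱ) (t := t) (fun _ => ⊥) measurable_const]
      with ω h
    rw [h]; exact bot_le
  have h1 : ∀ c : ℚ, ∃ f : ℕ → L0bar P ℱ t, (∀ n, f n ∈ S) ∧ ∀ g ∈ S,
      ∀ᵐ ω ∂P, ((c : ℝ) : EReal) < g.rep ω → ∃ n, ((c : ℝ) : EReal) < (f n).rep ω := by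
    intro c
    obtain ⟨A, hA, hA'⟩ := exists_seq_ae_le_iUnion (P := P)
      (𝒜 := (fun g : L0bar P ℱ t => {ω | ((c : ℝ) : EReal) < g.rep ω}) '' S) (hne.image _)
      (by
        rintro _ ⟨g, -, rfl⟩
        exact ℱ.le t _ (measurableSet_lt measurable_const g.measurable_rep))
    choose f hf hfA using hA
    refine ⟨f, hf, fun g hg => ?_⟩
    have h2 := hA' _ ⟨g, hg, rfl⟩
    rw [measure_eq_zero_iff_ae_notMem] at h2
    filter_upwards [h2] with ω hω hc
    by_contra hcon
    refine hω ⟨hc, fun h => hcon ?_⟩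
    obtain ⟨n, hn⟩ := mem_iUnion.1 h
    rw [← hfA n] at hn
    exact ⟨n, hn⟩
  choose f hf hfs using h1
  have hum : Measurable[ℱ t] fun ω => ⨆ c, ⨆ n, (f c n).rep ω :=
    Measurable.iSup fun c =>
      Measurable.iSup fun n => (f c n).measurable_rep
  refine ⟨L0bar.of P _ hum, fun g hg => ?_, fun v hv => ?_⟩
  · rw [L0bar.le_iff]
    filter_upwards [L0bar.coeFn_of _ hum, ae_all_iff.2 fun c => hfs c g hg, g.coeFn_eq_rep]
      with ω a1 a2 a3
    rw [a1, a3]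
    by_contra hcon
    obtain ⟨c, hc1, hc2⟩ := EReal.lt_iff_exists_rat_btwn.1 (not_le.1 hcon)
    obtain ⟨n, hn⟩ := a2 c hc2
    exact absurd (hn.trans_le (le_iSup₂ (f := fun c n => (f c n).rep ω) c n)) hc1.not_gt
  · rw [L0bar.le_iff]
    have : ∀ c n, ∀ᵐ ω ∂P, (f c n).1 ω ≤ v.1 ω := fun c n => L0bar.le_iff.1 (hv (hf c n))
    filter_upwards [L0bar.coeFn_of _ hum, ae_all_iff.2 fun c => ae_all_iff.2 (this c),
      ae_all_iff.2 fun c => ae_all_iff.2 fun n => (f c n).coeFn_eq_rep] with ω a1 a2 a3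
    rw [a1]
    exact iSup₂_le fun c n => a3 c n ▸ a2 c n

theorem L0bar.exists_isGLB (S : Set (L0bar P ℱ t)) : ∃ u, IsGLB S u := by
  obtain ⟨u, hu⟩ := L0bar.exists_isLUB (lowerBounds S)
  exact ⟨u, isLUB_lowerBounds.1 hu⟩

omit [IsFiniteMeasure P] in
/-- Bounds of essential suprema on measurable sets. -/
theorem L0bar.isLUB_le_on {S : Set (L0bar P ℱ t)} {u : L0bar P ℱ t} (hu : IsLUB S u)
    {A : Set Ω} (hA : MeasurableSet[ℱ t] A) (c : L0bar P ℱ t)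
    (h : ∀ k ∈ S, ∀ᵐ ω ∂P, ω ∈ A → k.1 ω ≤ c.1 ω) : ∀ᵐ ω ∂P, ω ∈ A → u.1 ω ≤ c.1 ω := by
  classical
  -- The value ⊤ off `A` turns the bound on `A` into a global upper bound.
  let v : Ω → EReal := fun ω => if ω ∈ A then c.rep ω else ⊤
  have hv : Measurable[ℱ t] v := Measurable.ite hA c.measurable_rep measurable_const
  have h1 : u ≤ L0bar.of P v hv := by
    refine hu.2 fun k hk => ?_
    rw [L0bar.le_iff]
    filter_upwards [h k hk, L0bar.coeFn_of v hv, c.coeFn_eq_rep] with ω a1 a2 a3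
    rw [a2]
    by_cases hω : ω ∈ A
    · simp only [v, hω, if_true]; rw [← a3]; exact a1 hω
    · simp [v, hω]
  rw [L0bar.le_iff] at h1
  filter_upwards [h1, L0bar.coeFn_of v hv, c.coeFn_eq_rep] with ω a1 a2 a3 hω
  rw [a2] at a1
  simp only [v, hω, if_true] at a1
  rwa [a3]

omit [IsFiniteMeasure P] in
/-- Bounds of essential infima on measurable sets. -/
theorem L0bar.le_isGLB_on {S : Set (L0bar P ℱ t)} {u : L0bar P ℱ t} (hu : IsGLB S u)
    {A : Set Ω} (hA : MeasurableSet[ℱ t] A) (c : L0bar P ℱ t)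
    (h : ∀ k ∈ S, ∀ᵐ ω ∂P, ω ∈ A → c.1 ω ≤ k.1 ω) : ∀ᵐ ω ∂P, ω ∈ A → c.1 ω ≤ u.1 ω := by
  classical
  let v : Ω → EReal := fun ω => if ω ∈ A then c.rep ω else ⊥
  have hv : Measurable[ℱ t] v := Measurable.ite hA c.measurable_rep measurable_const
  have h1 : L0bar.of P v hv ≤ u := by
    refine hu.2 fun k hk => ?_
    rw [L0bar.le_iff]
    filter_upwards [h k hk, L0bar.coeFn_of v hv, c.coeFn_eq_rep] with ω a1 a2 a3
    rw [a2]
    by_cases hω : ω ∈ A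
    · simp only [v, hω, if_true]; rw [← a3]; exact a1 hω
    · simp [v, hω]
  rw [L0bar.le_iff] at h1
  filter_upwards [h1, L0bar.coeFn_of v hv, c.coeFn_eq_rep] with ω a1 a2 a3 hω
  rw [a2] at a1
  simp only [v, hω, if_true] at a1
  rwa [a3]

end Bar

end

section

/-! ### Conditional expectations of nonnegative functions. -/

section CondLExp

variable {Ω : Type*} {m mΩ : MeasurableSpace Ω} {P : Measure Ω} [IsFiniteMeasure P]

theorem lintegral_mul_condLExp (hm : m ≤ mΩ) {f : Ω → ℝ≥0∞} (hf : AEMeasurable f P)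
    {g : Ω → ℝ≥0∞} (hg : Measurable[m] g) :
    ∫⁻ ω, g ω * condLExp m P f ω ∂P = ∫⁻ ω, g ω * f ω ∂P := by
  refine @Measurable.ennreal_induction Ω m
    (fun g => ∫⁻ ω, g ω * condLExp m P f ω ∂P = ∫⁻ ω, g ω * f ω ∂P) ?_ ?_ ?_ g hg
  · intro c s hs
    have h1 : ∀ F : Ω → ℝ≥0∞, (fun ω => s.indicator (fun _ => c) ω * F ω)
        = s.indicator fun ω => c * F ω := by
      intro F; funext ω; by_cases hω : ω ∈ s <;> simp [hω]
    rw [h1, h1, lintegral_indicator (hm s hs), lintegral_indicator (hm s hs),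
      lintegral_const_mul'' _ (measurable_condLExp' m P f).aemeasurable,
      lintegral_const_mul'' _ hf.restrict, setLIntegral_condLExp hm P f hs]
  · intro a b _ ha hb h1 h2
    simp only [Pi.add_apply, add_mul]
    rw [lintegral_add_left' (f := fun ω => a ω * condLExp m P f ω)
      (((ha.mono hm le_rfl).aemeasurable).mul (measurable_condLExp' m P f).aemeasurable),
      lintegral_add_left' (f := fun ω => a ω * f ω)
      (((ha.mono hm le_rfl).aemeasurable).mul hf), h1, h2]
  · intro a ha hmono h
    simp only [ENNReal.iSup_mul]
    have key : ∀ F : Ω → ℝ≥0∞, AEMeasurable F P →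
        ∫⁻ ω, ⨆ n, a n ω * F ω ∂P = ⨆ n, ∫⁻ ω, a n ω * F ω ∂P := fun F hF =>
      lintegral_iSup' (fun n => ((ha n).mono hm le_rfl).aemeasurable.mul hF)
        (Eventually.of_forall fun ω i j hij => mul_le_mul_left (hmono hij ω) _)
    rw [key _ (measurable_condLExp' m P f).aemeasurable, key _ hf]
    simp_rw [h]

theorem condLExp_mul_left (hm : m ≤ mΩ) {f : Ω → ℝ≥0∞} (hf : AEMeasurable f P)
    {g : Ω → ℝ≥0∞} (hg : Measurable[m] g) :
    ∀ᵐ ω ∂P, condLExp m P (fun ω => g ω * f ω) ω = g ω * condLExp m P f ω := by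
  refine (ae_eq_condLExp hm P (fun ω => g ω * f ω) (hg.mul (measurable_condLExp m P f))
    fun s hs => ?_).symm
  rw [← lintegral_indicator (hm s hs), ← lintegral_indicator (hm s hs)]
  have h1 : ∀ F : Ω → ℝ≥0∞, (s.indicator fun ω => g ω * F ω)
      = fun ω => s.indicator g ω * F ω := by
    intro F; funext ω; by_cases hω : ω ∈ s <;> simp [hω]
  have h2 := h1 (condLExp m P f)
  change ∫⁻ ω, s.indicator (fun ω => g ω * condLExp m P f ω) ω ∂P = _
  rw [h2, h1 f, lintegral_mul_condLExp hm hf (hg.indicator hs)]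

theorem condLExp_indicator (hm : m ≤ mΩ) {f : Ω → ℝ≥0∞} (hf : AEMeasurable f P) {A : Set Ω}
    (hA : MeasurableSet[m] A) :
    ∀ᵐ ω ∂P, condLExp m P (A.indicator f) ω = A.indicator (condLExp m P f) ω := by
  have h := condLExp_mul_left hm hf ((measurable_const (a := (1 : ℝ≥0∞))).indicator hA)
  have h1 : ∀ F : Ω → ℝ≥0∞, (fun ω => A.indicator (fun _ => (1 : ℝ≥0∞)) ω * F ω)
      = A.indicator F := by
    intro F; funext ω; by_cases hω : ω ∈ A <;> simp [hω]
  have h2 := congrFun (h1 (condLExp m P f))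
  rw [h1] at h
  filter_upwards [h] with ω hω
  rw [hω, ← h2]

theorem condLExp_congr_on (hm : m ≤ mΩ) {f g : Ω → ℝ≥0∞} (hf : AEMeasurable f P)
    (hg : AEMeasurable g P) {A : Set Ω} (hA : MeasurableSet[m] A)
    (h : ∀ᵐ ω ∂P, ω ∈ A → f ω = g ω) :
    ∀ᵐ ω ∂P, ω ∈ A → condLExp m P f ω = condLExp m P g ω := by
  have h1 : A.indicator f =ᵐ[P] A.indicator g := by
    filter_upwards [h] with ω hω
    by_cases hA : ω ∈ A
    · simp [hA, hω hA]
    · simp [hA]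
  filter_upwards [condLExp_indicator hm hf hA, condLExp_indicator hm hg hA,
    condLExp_congr_ae (mΩ := m) h1] with ω a1 a2 a3 hω
  rw [a1, a2] at a3
  simpa [hω] using a3

/-- The conditional expectation of `f` is almost surely finite iff `f` has finite integral over the
members of an exhausting sequence of `m`-measurable sets. -/
theorem condLExp_lt_top_iff (hm : m ≤ mΩ) {f : Ω → ℝ≥0∞} (hf : AEMeasurable f P) :
    (∀ᵐ ω ∂P, condLExp m P f ω < ∞) ↔ ∃ κ : Ω → ℝ, Measurable[m] κ ∧
      ∀ k : ℕ, ∫⁻ ω in {ω | κ ω ≤ k}, f ω ∂P < ∞ := by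
  constructor
  · intro h
    have hκ : Measurable[m] fun ω => (condLExp m P f ω).toReal :=
      (measurable_condLExp m P f).ennreal_toReal
    refine ⟨_, hκ, fun k => ?_⟩
    have hs : MeasurableSet[m] {ω | (condLExp m P f ω).toReal ≤ k} :=
      measurableSet_le hκ measurable_const
    rw [← setLIntegral_condLExp hm P f hs]
    refine (setLIntegral_mono_ae' (g := fun _ => (k : ℝ≥0∞)) (hm _ hs) ?_).trans_lt ?_
    · filter_upwards [h] with ω hω hk
      rw [← ENNReal.ofReal_toReal hω.ne, ← ENNReal.ofReal_natCast]
      exact ENNReal.ofReal_le_ofReal hk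
    · rw [lintegral_const]
      exact ENNReal.mul_lt_top (by simp) (measure_lt_top _ _)
  · rintro ⟨κ, hκ, h⟩
    have hs : ∀ k : ℕ, MeasurableSet[m] {ω | κ ω ≤ k} := fun k =>
      measurableSet_le hκ measurable_const
    have h1 : ∀ k : ℕ, ∀ᵐ ω ∂P, condLExp m P ({ω | κ ω ≤ k}.indicator f) ω < ∞ := fun k =>
      condLExp_lt_top (by rw [lintegral_indicator (hm _ (hs k))]; exact (h k).ne)
    filter_upwards [ae_all_iff.2 h1, ae_all_iff.2 fun k => condLExp_indicator hm hf (hs k)]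
      with ω a1 a2
    obtain ⟨k, hk⟩ := exists_nat_ge (κ ω)
    have := a1 k
    rw [a2 k, indicator_of_mem (show ω ∈ {ω | κ ω ≤ k} from hk)] at this
    exact this

end CondLExp

/-! ### Local L^p integrability with respect to the conditioning σ-algebra. -/

section LocLp


/-- `f` belongs to `L^p` on each member of an exhausting sequence of `m`-measurable sets. -/
def LocLp {Ω : Type*} (m : MeasurableSpace Ω) {mΩ : MeasurableSpace Ω} (p : ℝ≥0∞) (f : Ω → ℝ)
    (P : Measure Ω) : Prop :=
  ∃ κ : Ω → ℝ, Measurable[m] κ ∧ ∀ k : ℕ, MemLp ({ω | κ ω ≤ k}.indicator f) p P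

variable {Ω : Type*} {m mΩ : MeasurableSpace Ω} {P : Measure Ω}

theorem LocLp.aestronglyMeasurable {p : ℝ≥0∞} {f : Ω → ℝ} (h : LocLp m p f P) :
    AEStronglyMeasurable f P := by
  obtain ⟨κ, hκ, h⟩ := h
  refine aestronglyMeasurable_of_tendsto_ae atTop (fun k : ℕ => (h k).1) ?_
  filter_upwards with ω
  obtain ⟨k, hk⟩ := exists_nat_ge (κ ω)
  refine tendsto_const_nhds.congr' ?_
  filter_upwards [eventually_ge_atTop k] with n hn
  have : κ ω ≤ n := hk.trans (by exact_mod_cast hn)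
  rw [indicator_of_mem (show ω ∈ {ω | κ ω ≤ n} from this)]

theorem LocLp.of_memLp {p : ℝ≥0∞} {f : Ω → ℝ} (h : MemLp f p P) : LocLp m p f P :=
  ⟨fun _ => 0, measurable_const, fun k => by simpa using h⟩

theorem LocLp.mono {p : ℝ≥0∞} {f g : Ω → ℝ} (hg : LocLp m p g P) (hf : AEStronglyMeasurable f P)
    (hm : m ≤ mΩ) (h : ∀ᵐ ω ∂P, |f ω| ≤ |g ω|) : LocLp m p f P := by
  obtain ⟨κ, hκ, hk⟩ := hg
  refine ⟨κ, hκ, fun k => (hk k).mono (hf.indicator (hm _ (measurableSet_le hκ measurable_const)))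
    ?_⟩
  filter_upwards [h] with ω hω
  rw [norm_indicator_eq_indicator_norm, norm_indicator_eq_indicator_norm]
  exact indicator_le_indicator hω

theorem LocLp.congr {p : ℝ≥0∞} {f g : Ω → ℝ} (hg : LocLp m p g P) (hm : m ≤ mΩ)
    (h : ∀ᵐ ω ∂P, f ω = g ω) : LocLp m p f P :=
  hg.mono (hg.aestronglyMeasurable.congr (h.mono fun _ h => h.symm)) hm
    (h.mono fun _ h => by rw [h])

theorem MemLp.mono_indicator {p : ℝ≥0∞} {f : Ω → ℝ} {A B : Set Ω} (h : MemLp (B.indicator f) p P)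
    (hA : MeasurableSet A) (hAB : A ⊆ B) : MemLp (A.indicator f) p P := by
  have := h.indicator hA
  rwa [indicator_indicator, inter_eq_left.2 hAB] at this

theorem LocLp.add {p : ℝ≥0∞} {f g : Ω → ℝ} (hm : m ≤ mΩ) (hf : LocLp m p f P)
    (hg : LocLp m p g P) : LocLp m p (fun ω => f ω + g ω) P := by
  obtain ⟨κ, hκ, h1⟩ := hf
  obtain ⟨l, hl, h2⟩ := hg
  have hκl : Measurable[m] fun ω => max (κ ω) (l ω) := hκ.max hl
  refine ⟨_, hκl, fun k => ?_⟩
  have hs : MeasurableSet[m] {ω | max (κ ω) (l ω) ≤ k} := measurableSet_le hκl measurable_const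
  have e : {ω | max (κ ω) (l ω) ≤ k}.indicator (fun ω => f ω + g ω)
      = {ω | max (κ ω) (l ω) ≤ k}.indicator f + {ω | max (κ ω) (l ω) ≤ k}.indicator g :=
    indicator_add _ _ _
  rw [e]
  exact (MemLp.mono_indicator (h1 k) (hm _ hs) fun ω hω => (le_max_left _ _).trans (mem_ofPred.1 hω)).add
    (MemLp.mono_indicator (h2 k) (hm _ hs) fun ω hω => (le_max_right _ _).trans (mem_ofPred.1 hω))

theorem LocLp.mul_left {p : ℝ≥0∞} {f g : Ω → ℝ} (hm : m ≤ mΩ) (hf : LocLp m p f P)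
    (hg : Measurable[m] g) : LocLp m p (fun ω => g ω * f ω) P := by
  obtain ⟨κ, hκ, h1⟩ := hf
  have hκl : Measurable[m] fun ω => max (κ ω) |g ω| := hκ.max (continuous_abs.measurable.comp hg)
  refine ⟨_, hκl, fun k => ?_⟩
  have hs : MeasurableSet[m] {ω | max (κ ω) |g ω| ≤ k} := measurableSet_le hκl measurable_const
  have h2 := MemLp.mono_indicator (h1 k) (hm _ hs)
    fun ω hω => (le_max_left _ _).trans (mem_ofPred.1 hω)
  have h3 := h2.const_mul (k : ℝ)
  have hgM : @Measurable Ω ℝ mΩ _ g := hg.mono hm le_rfl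
  have hgM' : AEStronglyMeasurable g P := hgM.aestronglyMeasurable
  have hfM : LocLp m p f P := ⟨κ, hκ, h1⟩
  refine h3.mono ((hgM'.mul hfM.aestronglyMeasurable).indicator (hm _ hs)) ?_
  filter_upwards with ω
  by_cases hω : ω ∈ {ω | max (κ ω) |g ω| ≤ k}
  · simp only [hω, indicator_of_mem, Real.norm_eq_abs, abs_mul, Nat.abs_cast]
    exact mul_le_mul_of_nonneg_right ((le_max_right _ _).trans hω) (abs_nonneg _)
  · rw [indicator_of_notMem hω, indicator_of_notMem hω, mul_zero]

theorem LocLp.sub {p : ℝ≥0∞} {f g : Ω → ℝ} (hm : m ≤ mΩ) (hf : LocLp m p f P)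
    (hg : LocLp m p g P) : LocLp m p (fun ω => f ω - g ω) P := by
  have := hf.add hm (hg.mul_left hm (g := fun _ => -1) measurable_const)
  simpa only [neg_one_mul, ← sub_eq_add_neg] using this

theorem LocLp.mul {p q : ℝ≥0∞} [hpq : ENNReal.HolderConjugate p q] {f g : Ω → ℝ} (hm : m ≤ mΩ)
    (hf : LocLp m p f P) (hg : LocLp m q g P) : LocLp m 1 (fun ω => f ω * g ω) P := by
  obtain ⟨κ, hκ, h1⟩ := hf
  obtain ⟨l, hl, h2⟩ := hg
  have hκl : Measurable[m] fun ω => max (κ ω) (l ω) := hκ.max hl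
  refine ⟨_, hκl, fun k => ?_⟩
  have hs : MeasurableSet[m] {ω | max (κ ω) (l ω) ≤ k} := measurableSet_le hκl measurable_const
  have e : {ω | max (κ ω) (l ω) ≤ k}.indicator (fun ω => f ω * g ω)
      = fun ω => {ω | max (κ ω) (l ω) ≤ k}.indicator f ω
        * {ω | max (κ ω) (l ω) ≤ k}.indicator g ω := by
    funext ω
    by_cases hω : ω ∈ {ω | max (κ ω) (l ω) ≤ k}
    · rw [indicator_of_mem hω, indicator_of_mem hω, indicator_of_mem hω]
    · rw [indicator_of_notMem hω, indicator_of_notMem hω, zero_mul]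
  rw [e, memLp_one_iff_integrable]
  exact (MemLp.mono_indicator (h1 k) (hm _ hs) fun ω hω =>
    (le_max_left _ _).trans (mem_ofPred.1 hω)).integrable_mul
    (MemLp.mono_indicator (h2 k) (hm _ hs) fun ω hω => (le_max_right _ _).trans (mem_ofPred.1 hω))

theorem LocLp.sum {p : ℝ≥0∞} {ι : Type*} (s : Finset ι) {f : ι → Ω → ℝ} (hm : m ≤ mΩ)
    (hf : ∀ i ∈ s, LocLp m p (f i) P) : LocLp m p (fun ω => ∑ i ∈ s, f i ω) P := by
  classical
  induction s using Finset.induction_on with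
  | empty => simpa using LocLp.of_memLp (m := m) (MemLp.zero' (ε := ℝ) (μ := P))
  | insert a s ha ih =>
    simp_rw [Finset.sum_insert ha]
    exact (hf a (Finset.mem_insert_self _ _)).add hm
      (ih fun i hi => hf i (Finset.mem_insert_of_mem hi))

/-- Adding `N` itself to the exhausting function through a maximum leaves only finitely many indices
on each exhausting set, so the concatenation is there a finite sum of restricted members. -/
theorem LocLp.glue {p : ℝ≥0∞} {f : ℕ → Ω → ℝ} (hm : m ≤ mΩ) (hf : ∀ n, LocLp m p (f n) P)
    {N : Ω → ℕ} (hN : Measurable[m] N) : LocLp m p (fun ω => f (N ω) ω) P := by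
  have hfm := fun n => (hf n).aestronglyMeasurable
  choose κ hκ h using hf
  have hκN : Measurable[m] fun ω => max (κ (N ω) ω) (N ω : ℝ) := by
    have h1 : @Measurable (ℕ × Ω) ℝ (@Prod.instMeasurableSpace _ _ _ m) _
        (fun z : ℕ × Ω => κ z.1 z.2) :=
      @measurable_from_prod_countable_right ℕ Ω ℝ _ m _ _ _ _ hκ
    exact (h1.comp (hN.prodMk measurable_id)).max (measurable_from_nat.comp hN)
  refine ⟨_, hκN, fun k => ?_⟩
  set S := {ω | max (κ (N ω) ω) (N ω : ℝ) ≤ k} with hS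
  have hs : MeasurableSet[m] S := measurableSet_le hκN measurable_const
  have e : S.indicator (fun ω => f (N ω) ω)
      = fun ω => ∑ n ∈ Finset.range (k + 1), (S ∩ {ω | N ω = n}).indicator (f n) ω := by
    funext ω
    by_cases hω : ω ∈ S
    · rw [Finset.sum_eq_single (N ω)]
      · rw [indicator_of_mem hω, indicator_of_mem (show ω ∈ S ∩ {ω' | N ω' = N ω} from ⟨hω, rfl⟩)]
      · intro b _ hb
        exact indicator_of_notMem (fun h : ω ∈ S ∩ {ω | N ω = b} => hb h.2.symm) _
      · intro h
        have h1 : (N ω : ℝ) ≤ k := (le_max_right _ _).trans hω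
        simp only [Finset.mem_range, not_lt] at h
        have h2 : N ω ≤ k := by exact_mod_cast h1
        omega
    · rw [indicator_of_notMem hω]
      refine (Finset.sum_eq_zero fun n _ =>
        indicator_of_notMem (fun h : ω ∈ S ∩ {ω | N ω = n} => hω h.1) _).symm
  rw [e]
  refine memLp_finsetSum _ fun n _ => ?_
  refine MemLp.mono_indicator (h n k) (hm _ (hs.inter (hN (measurableSet_singleton n)))) ?_
  rintro ω ⟨h1, h2⟩
  have h2' : N ω = n := h2
  have h3 := (le_max_left _ _).trans (show max (κ (N ω) ω) (N ω : ℝ) ≤ k from h1)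
  rw [h2'] at h3
  exact h3

variable [IsFiniteMeasure P]

theorem LocLp.of_measurable {p : ℝ≥0∞} {g : Ω → ℝ} (hm : m ≤ mΩ) (hg : Measurable[m] g) :
    LocLp m p g P := by
  have := (LocLp.of_memLp (m := m) (memLp_const (μ := P) (p := p) (1 : ℝ))).mul_left hm hg
  simpa using this

/-- On each exhausting set, membership in L^p is finiteness of the integral of the p-th power, so
both sides describe the same exhaustion. -/
theorem locLp_iff_condLExp {p : ℝ≥0∞} (hm : m ≤ mΩ) (hp0 : p ≠ 0) (hp : p ≠ ∞) {f : Ω → ℝ}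
    (hf : AEStronglyMeasurable f P) :
    LocLp m p f P ↔ ∀ᵐ ω ∂P, condLExp m P (fun ω => ‖f ω‖ₑ ^ p.toReal) ω < ∞ := by
  rw [condLExp_lt_top_iff hm (hf.enorm.pow_const _), LocLp]
  refine exists_congr fun κ => and_congr_right fun hκ => forall_congr' fun k => ?_
  have hs : MeasurableSet[m] {ω | κ ω ≤ k} := measurableSet_le hκ measurable_const
  rw [MemLp, eLpNorm_lt_top_iff_lintegral_rpow_enorm_lt_top hp0 hp,
    and_iff_right (hf.indicator (hm _ hs)), ← lintegral_indicator (hm _ hs)]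
  have : ∀ ω, ‖{ω | κ ω ≤ k}.indicator f ω‖ₑ ^ p.toReal
      = {ω | κ ω ≤ k}.indicator (fun ω => ‖f ω‖ₑ ^ p.toReal) ω := by
    intro ω
    by_cases hω : ω ∈ {ω | κ ω ≤ k}
    · simp only [hω, indicator_of_mem]
    · simp only [hω, not_false_eq_true, indicator_of_notMem, enorm_zero]
      exact ENNReal.zero_rpow_of_pos (ENNReal.toReal_pos hp0 hp)
  simp_rw [this]

theorem LocLp.condLExp_lt_top {f : Ω → ℝ} (hm : m ≤ mΩ) (hf : LocLp m 1 f P) :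
    ∀ᵐ ω ∂P, condLExp m P (fun ω => ‖f ω‖ₑ) ω < ∞ := by
  have := (locLp_iff_condLExp hm one_ne_zero ENNReal.one_ne_top hf.aestronglyMeasurable).1 hf
  simpa using this

theorem LocLp.ofReal_lt_top {f : Ω → ℝ} (hm : m ≤ mΩ) (hf : LocLp m 1 f P) :
    ∀ᵐ ω ∂P, condLExp m P (fun ω => ENNReal.ofReal (f ω)) ω < ∞ := by
  have h : (fun ω => ENNReal.ofReal (f ω)) ≤ᵐ[P] fun ω => ‖f ω‖ₑ :=
    Eventually.of_forall fun ω => by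
      simp only [← ofReal_norm]; exact ENNReal.ofReal_le_ofReal (le_abs_self _)
  filter_upwards [hf.condLExp_lt_top hm, condLExp_mono (mΩ := m) h] with ω a1 a2
  exact a2.trans_lt a1

omit [IsFiniteMeasure P] in
theorem LocLp.neg {p : ℝ≥0∞} {f : Ω → ℝ} (hm : m ≤ mΩ) (hf : LocLp m p f P) :
    LocLp m p (fun ω => - f ω) P := by
  have := hf.mul_left hm (g := fun _ => -1) measurable_const
  simpa only [neg_one_mul] using this

end LocLp

/-! ### Generalized conditional expectations of real functions. -/

section CondE

variable {Ω : Type*} {mΩ : MeasurableSpace Ω} {P : Measure Ω} [IsFiniteMeasure P] {T : ℕ}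
  {ℱ : Filtration (Fin (T + 1)) mΩ} {t : Fin (T + 1)}

theorem condE_congr_on {f g : Ω → ℝ} (hf : AEStronglyMeasurable f P)
    (hg : AEStronglyMeasurable g P) {A : Set Ω} (hA : MeasurableSet[ℱ t] A)
    (h : ∀ᵐ ω ∂P, ω ∈ A → f ω = g ω) :
    ∀ᵐ ω ∂P, ω ∈ A → condE ℱ t P f ω = condE ℱ t P g ω := by
  filter_upwards [condLExp_congr_on (ℱ.le t) hf.aemeasurable.ennreal_ofReal
      hg.aemeasurable.ennreal_ofReal hA (h.mono fun ω h hω => by rw [h hω]),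
    condLExp_congr_on (ℱ.le t) hf.neg.aemeasurable.ennreal_ofReal
      hg.neg.aemeasurable.ennreal_ofReal hA
      (h.mono fun ω h hω => by rw [Pi.neg_apply, Pi.neg_apply, h hω])] with ω a1 a2 hω
  simp only [condE]
  rw [a1 hω]
  simp only [Pi.neg_apply] at a2
  rw [a2 hω]

omit [IsFiniteMeasure P] in
theorem condE_congr {f g : Ω → ℝ} (h : ∀ᵐ ω ∂P, f ω = g ω) :
    ∀ᵐ ω ∂P, condE ℱ t P f ω = condE ℱ t P g ω := by
  have h1 : (fun ω => ENNReal.ofReal (f ω)) =ᵐ[P] fun ω => ENNReal.ofReal (g ω) :=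
    h.mono fun ω h => by simp only [h]
  have h2 : (fun ω => ENNReal.ofReal (-f ω)) =ᵐ[P] fun ω => ENNReal.ofReal (-g ω) :=
    h.mono fun ω h => by simp only [h]
  filter_upwards [condLExp_congr_ae (mΩ := ℱ t) h1, condLExp_congr_ae (mΩ := ℱ t) h2]
    with ω a1 a2
  simp only [condE, a1, a2]

theorem condE_add {f g : Ω → ℝ} (hf : LocLp (ℱ t) 1 f P) (hg : LocLp (ℱ t) 1 g P) :
    ∀ᵐ ω ∂P, condE ℱ t P (fun ω => f ω + g ω) ω = condE ℱ t P f ω + condE ℱ t P g ω := by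
  have hfg := hf.add (ℱ.le t) hg
  have mf := hf.aestronglyMeasurable.aemeasurable
  have mg := hg.aestronglyMeasurable.aemeasurable
  have mfg := hfg.aestronglyMeasurable.aemeasurable
  -- The identity (f+g)⁺ + f⁻ + g⁻ = (f+g)⁻ + f⁺ + g⁺ contains no subtraction, so it passes through
  -- conditional expectations with values in [0, ∞]. Differences are taken only afterwards, all
  -- terms being finite.
  have e : (fun ω => ENNReal.ofReal (f ω + g ω)) + ((fun ω => ENNReal.ofReal (-f ω))
      + fun ω => ENNReal.ofReal (-g ω)) = (fun ω => ENNReal.ofReal (-(f ω + g ω)))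
      + ((fun ω => ENNReal.ofReal (f ω)) + fun ω => ENNReal.ofReal (g ω)) := by
    funext ω
    simp only [Pi.add_apply]
    rw [← ENNReal.toReal_eq_toReal_iff' (by finiteness) (by finiteness)]
    repeat rw [ENNReal.toReal_add (by finiteness) (by finiteness)]
    simp only [ENNReal.toReal_ofReal']
    have h : ∀ x : ℝ, max x 0 - max (-x) 0 = x := fun x => by
      rcases le_total x 0 with h | h
      · rw [max_eq_right h, max_eq_left (by linarith)]; ring
      · rw [max_eq_left h, max_eq_right (by linarith)]; ring
    have h1 := h (f ω); have h2 := h (g ω); have h3 := h (f ω + g ω)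
    linarith
  have c1 := condLExp_add_left (mΩ := ℱ t) ((fun ω => ENNReal.ofReal (-f ω))
      + fun ω => ENNReal.ofReal (-g ω)) mfg.ennreal_ofReal
  have c2 := condLExp_add_left (mΩ := ℱ t) (fun ω => ENNReal.ofReal (-g ω)) mf.neg.ennreal_ofReal
  have c3 := condLExp_add_left (mΩ := ℱ t) ((fun ω => ENNReal.ofReal (f ω))
      + fun ω => ENNReal.ofReal (g ω)) mfg.neg.ennreal_ofReal
  have c4 := condLExp_add_left (mΩ := ℱ t) (fun ω => ENNReal.ofReal (g ω)) mf.ennreal_ofReal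
  simp only [Pi.neg_apply] at c1 c2 c3 c4
  rw [e] at c1
  filter_upwards [c1, c2, c3, c4, hf.ofReal_lt_top (ℱ.le t), hg.ofReal_lt_top (ℱ.le t),
    hfg.ofReal_lt_top (ℱ.le t), (hf.neg (ℱ.le t)).ofReal_lt_top (ℱ.le t),
    (hg.neg (ℱ.le t)).ofReal_lt_top (ℱ.le t), (hfg.neg (ℱ.le t)).ofReal_lt_top (ℱ.le t)]
    with ω a1 a2 a3 a4 f1 f2 f3 f4 f5 f6
  simp only [Pi.add_apply] at a1 a2 a3 a4
  rw [a3, a2, a4] at a1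
  have h := congrArg ENNReal.toReal a1
  rw [ENNReal.toReal_add f6.ne (ENNReal.add_lt_top.2 ⟨f1, f2⟩).ne, ENNReal.toReal_add f1.ne f2.ne,
    ENNReal.toReal_add f3.ne (ENNReal.add_lt_top.2 ⟨f4, f5⟩).ne, ENNReal.toReal_add f4.ne f5.ne] at h
  simp only [condE]
  linarith

theorem condE_mul_left {f g : Ω → ℝ} (hf : LocLp (ℱ t) 1 f P) (hg : Measurable[ℱ t] g) :
    ∀ᵐ ω ∂P, condE ℱ t P (fun ω => g ω * f ω) ω = g ω * condE ℱ t P f ω := by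
  have mf := hf.aestronglyMeasurable.aemeasurable
  have hn := hf.neg (ℱ.le t)
  -- The positive part of a product is a⁺b⁺ + a⁻b⁻; each term has a nonnegative measurable factor
  -- that can be pulled out.
  have ha : ∀ a b : ℝ, ENNReal.ofReal (a * b) = ENNReal.ofReal a * ENNReal.ofReal b
      + ENNReal.ofReal (-a) * ENNReal.ofReal (-b) := by
    intro a b
    rcases le_total 0 a with h | h
    · rw [ENNReal.ofReal_mul h, ENNReal.ofReal_of_nonpos (p := -a) (by linarith), zero_mul, add_zero]
    · rw [← neg_mul_neg, ENNReal.ofReal_mul (by linarith), ENNReal.ofReal_of_nonpos h, zero_mul,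
        zero_add]
  have hp : Measurable[ℱ t] fun ω => ENNReal.ofReal (g ω) := hg.ennreal_ofReal
  have hnn : Measurable[ℱ t] fun ω => ENNReal.ofReal (-g ω) := hg.neg.ennreal_ofReal
  have e1 : (fun ω => ENNReal.ofReal (g ω * f ω))
      = (fun ω => ENNReal.ofReal (g ω) * ENNReal.ofReal (f ω))
        + fun ω => ENNReal.ofReal (-g ω) * ENNReal.ofReal (-f ω) := funext fun ω => ha _ _
  have e2 : (fun ω => ENNReal.ofReal (-(g ω * f ω)))
      = (fun ω => ENNReal.ofReal (g ω) * ENNReal.ofReal (-f ω))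
        + fun ω => ENNReal.ofReal (-g ω) * ENNReal.ofReal (f ω) := funext fun ω => by
    rw [← mul_neg, ha, neg_neg]; rfl
  have mp := (hp.mono (ℱ.le t) le_rfl).aemeasurable (μ := P)
  have c1 := condLExp_add_left (mΩ := ℱ t) (fun ω => ENNReal.ofReal (-g ω) * ENNReal.ofReal (-f ω))
    (mp.mul mf.ennreal_ofReal)
  have c2 := condLExp_add_left (mΩ := ℱ t) (fun ω => ENNReal.ofReal (-g ω) * ENNReal.ofReal (f ω))
    (mp.mul mf.neg.ennreal_ofReal)
  simp only [Pi.neg_apply] at c2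
  filter_upwards [c1, c2, condLExp_mul_left (ℱ.le t) mf.ennreal_ofReal hp,
    condLExp_mul_left (ℱ.le t) mf.ennreal_ofReal hnn,
    condLExp_mul_left (ℱ.le t) mf.neg.ennreal_ofReal hp,
    condLExp_mul_left (ℱ.le t) mf.neg.ennreal_ofReal hnn, hf.ofReal_lt_top (ℱ.le t),
    hn.ofReal_lt_top (ℱ.le t)] with ω a1 a2 b1 b2 b3 b4 f1 f2
  simp only [Pi.neg_apply] at b3 b4
  simp only [condE]
  rw [e1, e2]
  have a1' : condLExp (ℱ t) P ((fun ω => ENNReal.ofReal (g ω) * ENNReal.ofReal (f ω))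
        + fun ω => ENNReal.ofReal (-g ω) * ENNReal.ofReal (-f ω)) ω
      = condLExp (ℱ t) P (fun ω => ENNReal.ofReal (g ω) * ENNReal.ofReal (f ω)) ω
        + condLExp (ℱ t) P (fun ω => ENNReal.ofReal (-g ω) * ENNReal.ofReal (-f ω)) ω := a1
  have a2' : condLExp (ℱ t) P ((fun ω => ENNReal.ofReal (g ω) * ENNReal.ofReal (-f ω))
        + fun ω => ENNReal.ofReal (-g ω) * ENNReal.ofReal (f ω)) ω
      = condLExp (ℱ t) P (fun ω => ENNReal.ofReal (g ω) * ENNReal.ofReal (-f ω)) ω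
        + condLExp (ℱ t) P (fun ω => ENNReal.ofReal (-g ω) * ENNReal.ofReal (f ω)) ω := a2
  rw [a1', a2']
  rw [b1, b2, b3, b4, ENNReal.toReal_add (ENNReal.mul_lt_top (by simp) f1).ne
    (ENNReal.mul_lt_top (by simp) f2).ne, ENNReal.toReal_add (ENNReal.mul_lt_top (by simp) f2).ne
    (ENNReal.mul_lt_top (by simp) f1).ne]
  simp only [ENNReal.toReal_mul, ENNReal.toReal_ofReal']
  have h : ∀ x : ℝ, max x 0 - max (-x) 0 = x := fun x => by
    rcases le_total x 0 with h | h
    · rw [max_eq_right h, max_eq_left (by linarith)]; ring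
    · rw [max_eq_left h, max_eq_right (by linarith)]; ring
  nth_rewrite 5 [← h (g ω)]
  ring

theorem condE_sub {f g : Ω → ℝ} (hf : LocLp (ℱ t) 1 f P) (hg : LocLp (ℱ t) 1 g P) :
    ∀ᵐ ω ∂P, condE ℱ t P (fun ω => f ω - g ω) ω = condE ℱ t P f ω - condE ℱ t P g ω := by
  have h1 := condE_add hf (hg.mul_left (ℱ.le t) (g := fun _ => -1) measurable_const)
  filter_upwards [h1, condE_mul_left hg (g := fun _ => -1) measurable_const] with ω a1 a2
  rw [a2] at a1
  simp only [neg_one_mul, ← sub_eq_add_neg] at a1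
  exact a1

omit [IsFiniteMeasure P] in
theorem condE_eq_condExp {f : Ω → ℝ} (hf : Integrable f P) :
    ∀ᵐ ω ∂P, condE ℱ t P f ω = condExp (ℱ t) P f ω := by
  have h1 := toReal_condLExp (ℱ t) hf.1.aemeasurable.ennreal_ofReal (μ := P)
    (hf.lintegral_lt_top).ne
  have h2 := toReal_condLExp (ℱ t) hf.neg.1.aemeasurable.ennreal_ofReal (μ := P)
    (hf.neg.lintegral_lt_top).ne
  have i1 : Integrable (fun ω => (ENNReal.ofReal (f ω)).toReal) P := by
    simp only [ENNReal.toReal_ofReal']; exact hf.pos_part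
  have i2 : Integrable (fun ω => (ENNReal.ofReal ((-f) ω)).toReal) P := by
    simp only [ENNReal.toReal_ofReal']; exact hf.neg.pos_part
  have e : (fun ω => (ENNReal.ofReal (f ω)).toReal) - (fun ω => (ENNReal.ofReal ((-f) ω)).toReal)
      = f := by
    funext ω
    simp only [Pi.sub_apply, Pi.neg_apply, ENNReal.toReal_ofReal']
    rcases le_total (f ω) 0 with h | h
    · rw [max_eq_right h, max_eq_left (by linarith)]; ring
    · rw [max_eq_left h, max_eq_right (by linarith)]; ring
  have h3 := condExp_sub i1 i2 (ℱ t)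
  rw [e] at h3
  filter_upwards [h1, h2, h3] with ω a1 a2 a3
  rw [a3, Pi.sub_apply, ← a1, ← a2]
  rfl

theorem condE_of_measurable {g : Ω → ℝ} (hg : Measurable[ℱ t] g) :
    ∀ᵐ ω ∂P, condE ℱ t P g ω = g ω := by
  filter_upwards with ω
  simp only [condE]
  rw [condLExp_eq_self (ℱ.le t) P hg.ennreal_ofReal, condLExp_eq_self (ℱ.le t) P
    (X := fun ω => ENNReal.ofReal (-g ω)) hg.neg.ennreal_ofReal]
  simp only [ENNReal.toReal_ofReal']
  rcases le_total (g ω) 0 with h | h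
  · rw [max_eq_right h, max_eq_left (by linarith)]; ring
  · rw [max_eq_left h, max_eq_right (by linarith)]; ring

theorem abs_condE_le {f : Ω → ℝ} (hf : LocLp (ℱ t) 1 f P) :
    ∀ᵐ ω ∂P, |condE ℱ t P f ω| ≤ (condLExp (ℱ t) P (fun ω => ‖f ω‖ₑ) ω).toReal := by
  have h1 : (fun ω => ENNReal.ofReal (f ω)) ≤ᵐ[P] fun ω => ‖f ω‖ₑ :=
    Eventually.of_forall fun ω => by
      simp only [← ofReal_norm]; exact ENNReal.ofReal_le_ofReal (le_abs_self _)
  have h2 : (fun ω => ENNReal.ofReal (-f ω)) ≤ᵐ[P] fun ω => ‖f ω‖ₑ :=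
    Eventually.of_forall fun ω => by
      simp only [← ofReal_norm]; exact ENNReal.ofReal_le_ofReal (neg_le_abs _)
  filter_upwards [hf.condLExp_lt_top (ℱ.le t), condLExp_mono (mΩ := ℱ t) h1,
    condLExp_mono (mΩ := ℱ t) h2] with ω a1 a2 a3
  have b1 := ENNReal.toReal_mono a1.ne a2
  have b2 := ENNReal.toReal_mono a1.ne a3
  simp only [condE]
  rw [abs_le]
  constructor <;> linarith [ENNReal.toReal_nonneg (a := condLExp (ℱ t) P
    (fun ω => ENNReal.ofReal (f ω)) ω), ENNReal.toReal_nonneg (a := condLExp (ℱ t) P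
    (fun ω => ENNReal.ofReal (-f ω)) ω)]

/-- Conditional dominated convergence for nonnegative functions tending to `0`. -/
theorem tendsto_condLExp_zero {Ω : Type*} {m mΩ : MeasurableSpace Ω} {P : Measure Ω}
    [IsFiniteMeasure P] (hm : m ≤ mΩ) {f : ℕ → Ω → ℝ≥0∞}
    (hf : ∀ n, AEMeasurable (f n) P) {G : Ω → ℝ≥0∞} (hG : AEMeasurable G P)
    (hGfin : ∀ᵐ ω ∂P, condLExp m P G ω < ∞) (hfG : ∀ n, ∀ᵐ ω ∂P, f n ω ≤ G ω)
    (hlim : ∀ᵐ ω ∂P, Tendsto (fun n => f n ω) atTop (𝓝 0)) :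
    ∀ᵐ ω ∂P, Tendsto (fun n => condLExp m P (f n) ω) atTop (𝓝 0) := by
  -- Tail suprema decrease to 0, so their conditional expectations decrease too. Ordinary dominated
  -- convergence on the exhausting sets, where `G` is integrable, identifies the limit as 0.
  let g : ℕ → Ω → ℝ≥0∞ := fun n ω => ⨆ i, f (n + i) ω
  have hg : ∀ n, AEMeasurable (g n) P := fun n => AEMeasurable.iSup fun i => hf _
  have hgG : ∀ n, ∀ᵐ ω ∂P, g n ω ≤ G ω := fun n => by
    filter_upwards [ae_all_iff.2 hfG] with ω hω using iSup_le fun i => hω _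
  have hganti : ∀ ω, Antitone fun n => g n ω := by
    intro ω a b hab
    refine iSup_le fun i => ?_
    have : b + i = a + (b - a + i) := by omega
    rw [this]
    exact le_iSup (fun i => f (a + i) ω) _
  have hglim : ∀ᵐ ω ∂P, Tendsto (fun n => g n ω) atTop (𝓝 0) := by
    filter_upwards [hlim] with ω hω
    rw [ENNReal.tendsto_atTop_zero] at hω ⊢
    intro ε hε
    obtain ⟨N, hN⟩ := hω ε hε
    exact ⟨N, fun n hn => iSup_le fun i => hN _ (by omega)⟩
  obtain ⟨κ, hκ, hκG⟩ := (condLExp_lt_top_iff hm hG).1 hGfin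
  have hs : ∀ k : ℕ, MeasurableSet[m] {ω | κ ω ≤ k} := fun k =>
    measurableSet_le hκ measurable_const
  have hzero : ∀ k : ℕ, ∀ᵐ ω ∂P, ω ∈ {ω | κ ω ≤ k} → ⨅ n, condLExp m P (g n) ω = 0 := by
    intro k
    rw [← ae_restrict_iff' (hm _ (hs k))]
    have hmeas : Measurable fun ω => ⨅ n, condLExp m P (g n) ω :=
      Measurable.iInf fun n => measurable_condLExp' m P (g n)
    have h0 : ∫⁻ ω in {ω | κ ω ≤ k}, ⨅ n, condLExp m P (g n) ω ∂P = 0 := by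
      refine le_antisymm ?_ zero_le
      have h1 : Tendsto (fun n => ∫⁻ ω in {ω | κ ω ≤ k}, g n ω ∂P) atTop
          (𝓝 (∫⁻ ω in {ω | κ ω ≤ k}, 0 ∂P)) :=
        tendsto_lintegral_of_dominated_convergence' G (fun n => (hg n).restrict)
          (fun n => ae_restrict_of_ae (hgG n)) (hκG k).ne (ae_restrict_of_ae hglim)
      rw [lintegral_zero] at h1
      refine ge_of_tendsto' h1 fun n => ?_
      rw [← setLIntegral_condLExp hm P (g n) (hs k)]
      exact lintegral_mono fun ω => iInf_le _ n
    exact (lintegral_eq_zero_iff hmeas).1 h0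
  have hmonoc : ∀ a b, a ≤ b → condLExp m P (g b) ≤ᵐ[P] condLExp m P (g a) := fun a b hab =>
    condLExp_mono (Eventually.of_forall fun ω => hganti ω hab)
  have hfg : ∀ n, condLExp m P (f n) ≤ᵐ[P] condLExp m P (g n) := fun n =>
    condLExp_mono (Eventually.of_forall fun ω => le_iSup (fun i => f (n + i) ω) 0)
  filter_upwards [ae_all_iff.2 hzero, ae_all_iff.2 hfg,
    ae_all_iff.2 fun a => ae_all_iff.2 fun b => eventually_imp_distrib_left.2 (hmonoc a b)]
    with ω a1 a2 a3
  obtain ⟨k, hk⟩ := exists_nat_ge (κ ω)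
  have h1 := a1 k hk
  have h2 := tendsto_atTop_iInf (f := fun n => condLExp m P (g n) ω) fun a b hab => a3 a b hab
  rw [h1] at h2
  exact tendsto_of_tendsto_of_tendsto_of_le_of_le tendsto_const_nhds h2 (fun _ => zero_le) a2

/-- Conditional dominated convergence. -/
theorem tendsto_condE {f : ℕ → Ω → ℝ} (hf : ∀ n, AEStronglyMeasurable (f n) P) {G : Ω → ℝ}
    (hG : LocLp (ℱ t) 1 G P) (hfG : ∀ n, ∀ᵐ ω ∂P, |f n ω| ≤ |G ω|) {g : Ω → ℝ}
    (hlim : ∀ᵐ ω ∂P, Tendsto (fun n => f n ω) atTop (𝓝 (g ω))) :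
    ∀ᵐ ω ∂P, Tendsto (fun n => condE ℱ t P (f n) ω) atTop (𝓝 (condE ℱ t P g ω)) := by
  have hgm : AEStronglyMeasurable g P := aestronglyMeasurable_of_tendsto_ae atTop hf hlim
  have hgG : ∀ᵐ ω ∂P, |g ω| ≤ |G ω| := by
    filter_upwards [hlim, ae_all_iff.2 hfG] with ω h1 h2 using le_of_tendsto' h1.abs h2
  have hfL : ∀ n, LocLp (ℱ t) 1 (f n) P := fun n => hG.mono (hf n) (ℱ.le t) (hfG n)
  have hgL : LocLp (ℱ t) 1 g P := hG.mono hgm (ℱ.le t) hgG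
  have h2G : LocLp (ℱ t) 1 (fun ω => 2 * |G ω|) P := by
    refine LocLp.mul_left (g := fun _ => 2) (ℱ.le t) (hG.mono ?_ (ℱ.le t) ?_) measurable_const
    · exact (continuous_abs.comp_aestronglyMeasurable hG.aestronglyMeasurable)
    · exact Eventually.of_forall fun ω => by rw [abs_abs]
  have h1 := tendsto_condLExp_zero (ℱ.le t) (P := P)
    (f := fun n ω => ‖f n ω - g ω‖ₑ) (fun n => ((hf n).sub hgm).enorm)
    (G := fun ω => ‖2 * |G ω|‖ₑ) h2G.aestronglyMeasurable.enorm (h2G.condLExp_lt_top (ℱ.le t))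
    (fun n => by
      filter_upwards [hfG n, hgG] with ω a1 a2
      rw [enorm_le_iff_norm_le, Real.norm_eq_abs, Real.norm_eq_abs, abs_mul, abs_abs, abs_two]
      have := abs_sub (f n ω) (g ω)
      linarith)
    (by
      filter_upwards [hlim] with ω hω
      have h2 := (tendsto_iff_norm_sub_tendsto_zero.1 hω)
      have h3 := ENNReal.tendsto_ofReal h2
      simp only [ofReal_norm, ENNReal.ofReal_zero] at h3
      exact h3)
  filter_upwards [h1, ae_all_iff.2 fun n => condE_sub (hfL n) hgL,
    ae_all_iff.2 fun n => abs_condE_le ((hfL n).sub (ℱ.le t) hgL)] with ω a1 a2 a3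
  rw [tendsto_iff_norm_sub_tendsto_zero]
  have h4 := (ENNReal.tendsto_toReal ENNReal.zero_ne_top).comp a1
  refine squeeze_zero (fun _ => norm_nonneg _) (fun n => ?_) h4
  rw [Real.norm_eq_abs, ← a2 n]
  exact a3 n

end CondE

end

/-! ### The conditional spaces L^{t,p} and their pairing. -/

section

section

variable {Ω : Type*} {m mΩ : MeasurableSpace Ω} {P : Measure Ω}

/-- An essential bound C k is available on each {κ ≤ k}, and ⌈κ⌉ selects a valid k measurably. -/
theorem LocLp.exists_bound {f : Ω → ℝ} (hf : LocLp m ∞ f P) :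
    ∃ ξ : Ω → ℝ, Measurable[m] ξ ∧ ∀ᵐ ω ∂P, |f ω| ≤ ξ ω := by
  obtain ⟨κ, hκ, h⟩ := hf
  have h1 : ∀ k : ℕ, ∃ C : ℝ, ∀ᵐ ω ∂P, κ ω ≤ k → |f ω| ≤ C := fun k => by
    have h2 := (h k).2
    rw [eLpNorm_exponent_top] at h2
    refine ⟨(eLpNormEssSup ({ω | κ ω ≤ k}.indicator f) P).toReal, ?_⟩
    filter_upwards [ae_le_eLpNormEssSup (f := {ω | κ ω ≤ k}.indicator f) (μ := P)] with ω hω hk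
    rw [indicator_of_mem (show ω ∈ {ω | κ ω ≤ k} from hk)] at hω
    have := ENNReal.toReal_mono h2.ne hω
    simpa using this
  choose C hC using h1
  refine ⟨fun ω => C ⌈κ ω⌉₊, measurable_from_nat.comp (Nat.measurable_ceil.comp hκ), ?_⟩
  filter_upwards [ae_all_iff.2 hC] with ω hω
  exact hω _ (Nat.le_ceil _)

theorem condLExp_finsetSum [IsFiniteMeasure P] {ι : Type*} (s : Finset ι) (f : ι → Ω → ℝ≥0∞)
    (hf : ∀ i, AEMeasurable (f i) P) :
    ∀ᵐ ω ∂P, condLExp m P (fun ω => ∑ i ∈ s, f i ω) ω = ∑ i ∈ s, condLExp m P (f i) ω := by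
  classical
  induction s using Finset.induction_on with
  | empty =>
    filter_upwards with ω
    simp only [Finset.sum_empty]
    change condLExp m P 0 ω = 0
    rw [condLExp_zero]; rfl
  | insert a s ha ih =>
    simp_rw [Finset.sum_insert ha]
    filter_upwards [ih, condLExp_add_left (mΩ := m) (fun ω => ∑ i ∈ s, f i ω) (hf a)] with ω h1 h2
    rw [← h1]
    exact h2

/-- The conditional expectation of the sum is a finite combination with strictly positive weights,
so it is finite iff each term is. -/
theorem locLp_enorm_rpow_sum {T : ℕ} [IsFiniteMeasure P] (hm : m ≤ mΩ) {p : ℝ≥0∞} (hp0 : p ≠ 0)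
    (hp : p ≠ ∞) {S : Finset (Fin (T + 1))} {μ : Fin (T + 1) → ℝ} (hμ : ∀ s ∈ S, 0 < μ s)
    {X : Proc T P} :
    (∀ᵐ ω ∂P, condLExp m P (fun ω' => ∑ s ∈ S, ‖X s ω'‖ₑ ^ p.toReal * ENNReal.ofReal (μ s)) ω < ∞)
      ↔ ∀ s ∈ S, LocLp m p (X s) P := by
  have hmeas : ∀ s, AEMeasurable (fun ω => ‖X s ω‖ₑ ^ p.toReal) P := fun s =>
    (X s).aestronglyMeasurable.enorm.pow_const _
  have h1 : ∀ᵐ ω ∂P, condLExp m P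
      (fun ω' => ∑ s ∈ S, ‖X s ω'‖ₑ ^ p.toReal * ENNReal.ofReal (μ s)) ω
      = ∑ s ∈ S, ENNReal.ofReal (μ s) * condLExp m P (fun ω' => ‖X s ω'‖ₑ ^ p.toReal) ω := by
    filter_upwards [condLExp_finsetSum (m := m) S
      (fun s ω' => ‖X s ω'‖ₑ ^ p.toReal * ENNReal.ofReal (μ s)) fun s => (hmeas s).mul_const _,
      ae_all_iff.2 fun s => condLExp_mul_left hm (hmeas s)
        (measurable_const (a := ENNReal.ofReal (μ s)))] with ω h1 h2
    rw [h1]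
    refine Finset.sum_congr rfl fun s _ => ?_
    rw [← h2 s]
    simp only [mul_comm]
  rw [show (∀ s ∈ S, LocLp m p (X s) P) ↔ ∀ s ∈ S, ∀ᵐ ω ∂P,
    condLExp m P (fun ω => ‖X s ω‖ₑ ^ p.toReal) ω < ∞ from forall₂_congr fun s _ =>
    locLp_iff_condLExp hm hp0 hp (X s).aestronglyMeasurable]
  constructor
  · intro h s hs
    filter_upwards [h, h1] with ω a1 a2
    rw [a2, ENNReal.sum_lt_top] at a1
    have := a1 s hs
    by_contra hc
    rw [not_lt, top_le_iff] at hc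
    rw [hc, ENNReal.mul_top (ENNReal.ofReal_pos.2 (hμ s hs)).ne'] at this
    exact lt_irrefl _ this
  · intro h
    filter_upwards [h1, (Finset.eventually_all S).2 h] with ω a1 a2
    rw [a1, ENNReal.sum_lt_top]
    exact fun s hs => ENNReal.mul_lt_top ENNReal.ofReal_lt_top (a2 s hs)

end

variable {Ω : Type*} {mΩ : MeasurableSpace Ω} {P : Measure Ω} [IsProbabilityMeasure P] {T : ℕ}
  {ℱ : Filtration (Fin (T + 1)) mΩ} {t : Fin (T + 1)} {μ : Fin (T + 1) → ℝ}

/-- This removes the case distinction in the definition: for finite p the conditional norm is a root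
of a conditional expectation, and for p = ∞ local essential bounds glue to one 𝓕_t-measurable bound.
-/
theorem memLtp_iff (hμ : ∀ s, t ≤ s → 0 < μ s) {p : ℝ≥0∞} (hp0 : p ≠ 0) {X : Proc T P} :
    MemLtp ℱ t μ p X ↔ Adapted ℱ X ∧ (∀ s < t, X s = 0) ∧ ∀ s, LocLp (ℱ t) p (X s) P := by
  refine and_congr_right fun hA => and_congr_right fun hz => ?_
  have hzero : ∀ s < t, LocLp (ℱ t) p (X s) P := fun s hs => by
    rw [hz s hs]
    exact LocLp.of_memLp ((memLp_congr_ae AEEqFun.coeFn_zero).2 MemLp.zero)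
  by_cases hp : p = ∞
  · subst hp
    rw [if_pos rfl]
    constructor
    · rintro ⟨ξ, hξ⟩ s
      refine (LocLp.of_measurable (ℱ.le t) ξ.measurable_rep).mono (X s).aestronglyMeasurable
        (ℱ.le t) ?_
      filter_upwards [hξ s, ξ.coeFn_eq_rep] with ω a1 a2
      rw [← a2]
      exact a1.trans (le_abs_self _)
    · intro h
      choose ξ hξ hX using fun s => (h s).exists_bound
      have hm : Measurable[ℱ t] fun ω => ∑ s, |ξ s ω| :=
        Finset.measurable_fun_sum _ fun s _ => continuous_abs.measurable.comp (hξ s)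
      refine ⟨L0.of P _ hm, fun s => ?_⟩
      filter_upwards [hX s, L0.coeFn_of (P := P) _ hm] with ω a1 a2
      rw [a2]
      exact (a1.trans (le_abs_self _)).trans
        (Finset.single_le_sum (f := fun s => |ξ s ω|) (fun _ _ => abs_nonneg _) (Finset.mem_univ s))
  · rw [if_neg hp]
    have h1 : (∀ᵐ ω ∂P, condNorm ℱ t μ p X ω < ∞) ↔ ∀ᵐ ω ∂P, condLExp (ℱ t) P
        (fun ω' => ∑ s ∈ Finset.Ici t, ‖X s ω'‖ₑ ^ p.toReal * ENNReal.ofReal (μ s)) ω < ∞ := by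
      refine eventually_congr (Eventually.of_forall fun ω => ?_)
      rw [condNorm, ENNReal.rpow_lt_top_iff_of_pos
        (one_div_pos.2 (ENNReal.toReal_pos hp0 hp))]
    rw [h1, locLp_enorm_rpow_sum (ℱ.le t) hp0 hp fun s hs => hμ s (Finset.mem_Ici.1 hs)]
    refine ⟨fun h s => ?_, fun h s _ => h s⟩
    rcases lt_or_ge s t with hs | hs
    · exact hzero s hs
    · exact h s (Finset.mem_Ici.2 hs)

omit [IsProbabilityMeasure P] in
theorem pairing_comm (Z X : Proc T P) : pairing P ℱ t μ Z X = pairing P ℱ t μ X Z := by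
  simp only [pairing, mul_comm (Z _ _)]

omit [IsProbabilityMeasure P] in
theorem coeFn_pairing (Z X : Proc T P) : ∀ᵐ ω ∂P, (pairing P ℱ t μ Z X).1 ω
    = condE ℱ t P (fun ω => ∑ s ∈ Finset.Ici t, Z s ω * X s ω * μ s) ω :=
  AEEqFun.coeFn_mk _ _

omit [IsProbabilityMeasure P] in
theorem locLp_pairing {p q : ℝ≥0∞} [ENNReal.HolderConjugate p q] {Z X : Proc T P}
    (hZ : ∀ s, LocLp (ℱ t) q (Z s) P) (hX : ∀ s, LocLp (ℱ t) p (X s) P) :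
    LocLp (ℱ t) 1 (fun ω => ∑ s ∈ Finset.Ici t, Z s ω * X s ω * μ s) P := by
  refine LocLp.sum _ (ℱ.le t) fun s _ => ?_
  have h := ((hX s).mul (ℱ.le t) (hZ s)).mul_left (ℱ.le t) (g := fun _ => μ s) measurable_const
  refine h.congr (ℱ.le t) (Eventually.of_forall fun ω => ?_)
  ring

theorem pairing_congr_on {p q : ℝ≥0∞} [ENNReal.HolderConjugate p q] {Z Z' X X' : Proc T P}
    (hZ : ∀ s, LocLp (ℱ t) q (Z s) P) (hX : ∀ s, LocLp (ℱ t) p (X s) P)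
    (hZ' : ∀ s, LocLp (ℱ t) q (Z' s) P) (hX' : ∀ s, LocLp (ℱ t) p (X' s) P) {A : Set Ω}
    (hA : MeasurableSet[ℱ t] A) (h1 : ∀ s, ∀ᵐ ω ∂P, ω ∈ A → Z s ω = Z' s ω)
    (h2 : ∀ s, ∀ᵐ ω ∂P, ω ∈ A → X s ω = X' s ω) :
    ∀ᵐ ω ∂P, ω ∈ A → (pairing P ℱ t μ Z X).1 ω = (pairing P ℱ t μ Z' X').1 ω := by
  have h := condE_congr_on (P := P) (locLp_pairing (μ := μ) hZ hX).aestronglyMeasurable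
    (locLp_pairing (μ := μ) hZ' hX').aestronglyMeasurable hA (by
      filter_upwards [ae_all_iff.2 h1, ae_all_iff.2 h2] with ω a1 a2 hω
      exact Finset.sum_congr rfl fun s _ => by rw [a1 s hω, a2 s hω])
  filter_upwards [h, coeFn_pairing (ℱ := ℱ) (t := t) (μ := μ) Z X,
    coeFn_pairing (ℱ := ℱ) (t := t) (μ := μ) Z' X'] with ω a1 a2 a3 hω
  rw [a2, a3, a1 hω]

theorem pairing_comb_right {p q : ℝ≥0∞} [ENNReal.HolderConjugate p q] {Z X Y W : Proc T P}
    (hZ : ∀ s, LocLp (ℱ t) q (Z s) P) (hX : ∀ s, LocLp (ℱ t) p (X s) P)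
    (hY : ∀ s, LocLp (ℱ t) p (Y s) P) {a b : Ω → ℝ} (ha : Measurable[ℱ t] a)
    (hb : Measurable[ℱ t] b)
    (h : ∀ s, t ≤ s → ∀ᵐ ω ∂P, W s ω = a ω * X s ω + b ω * Y s ω) :
    ∀ᵐ ω ∂P, (pairing P ℱ t μ Z W).1 ω
      = a ω * (pairing P ℱ t μ Z X).1 ω + b ω * (pairing P ℱ t μ Z Y).1 ω := by
  have lX := locLp_pairing (μ := μ) hZ hX
  have lY := locLp_pairing (μ := μ) hZ hY
  have h1 := condE_congr (ℱ := ℱ) (t := t) (P := P)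
    (f := fun ω => ∑ s ∈ Finset.Ici t, Z s ω * W s ω * μ s)
    (g := fun ω => a ω * (∑ s ∈ Finset.Ici t, Z s ω * X s ω * μ s)
      + b ω * (∑ s ∈ Finset.Ici t, Z s ω * Y s ω * μ s)) (by
      filter_upwards [(Finset.eventually_all (Finset.Ici t)).2
        fun s hs => h s (Finset.mem_Ici.1 hs)] with ω hω
      rw [Finset.mul_sum, Finset.mul_sum, ← Finset.sum_add_distrib]
      refine Finset.sum_congr rfl fun s hs => ?_
      rw [hω s hs]; ring)
  filter_upwards [h1, condE_add (lX.mul_left (ℱ.le t) ha) (lY.mul_left (ℱ.le t) hb),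
    condE_mul_left lX ha, condE_mul_left lY hb, coeFn_pairing (ℱ := ℱ) (t := t) (μ := μ) Z W,
    coeFn_pairing (ℱ := ℱ) (t := t) (μ := μ) Z X, coeFn_pairing (ℱ := ℱ) (t := t) (μ := μ) Z Y]
    with ω a1 a2 a3 a4 a5 a6 a7
  rw [a5, a6, a7, a1, a2, a3, a4]

theorem pairing_comb_left {p q : ℝ≥0∞} [ENNReal.HolderConjugate p q] {Z Z' W X : Proc T P}
    (hZ : ∀ s, LocLp (ℱ t) q (Z s) P) (hZ' : ∀ s, LocLp (ℱ t) q (Z' s) P)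
    (hX : ∀ s, LocLp (ℱ t) p (X s) P) {a b : Ω → ℝ} (ha : Measurable[ℱ t] a)
    (hb : Measurable[ℱ t] b)
    (h : ∀ s, t ≤ s → ∀ᵐ ω ∂P, W s ω = a ω * Z s ω + b ω * Z' s ω) :
    ∀ᵐ ω ∂P, (pairing P ℱ t μ W X).1 ω
      = a ω * (pairing P ℱ t μ Z X).1 ω + b ω * (pairing P ℱ t μ Z' X).1 ω := by
  have : ENNReal.HolderConjugate q p := ENNReal.HolderConjugate.symm
  simp only [pairing_comm _ X]
  exact pairing_comb_right hX hZ hZ' ha hb h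

theorem tendsto_pairing_right {p q : ℝ≥0∞} [ENNReal.HolderConjugate p q] {Z X : Proc T P}
    {Y : ℕ → Proc T P} (hZ : ∀ s, LocLp (ℱ t) q (Z s) P) {G : Fin (T + 1) → Ω → ℝ}
    (hG : ∀ s, LocLp (ℱ t) p (G s) P) (hYG : ∀ n s, ∀ᵐ ω ∂P, |Y n s ω| ≤ |G s ω|)
    (hlim : ∀ s, ∀ᵐ ω ∂P, Tendsto (fun n => Y n s ω) atTop (𝓝 (X s ω))) :
    ∀ᵐ ω ∂P, Tendsto (fun n => (pairing P ℱ t μ Z (Y n)).1 ω) atTop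
      (𝓝 ((pairing P ℱ t μ Z X).1 ω)) := by
  have hGZ : LocLp (ℱ t) 1 (fun ω => ∑ s ∈ Finset.Ici t, |G s ω * Z s ω * μ s|) P := by
    refine LocLp.sum _ (ℱ.le t) fun s _ => ?_
    have h := ((hG s).mul (ℱ.le t) (hZ s)).mul_left (ℱ.le t) (g := fun _ => μ s) measurable_const
    refine h.mono ?_ (ℱ.le t) (Eventually.of_forall fun ω => ?_)
    · refine (continuous_abs.comp_aestronglyMeasurable h.aestronglyMeasurable).congr
        (Eventually.of_forall fun ω => ?_)
      simp only [mul_comm]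
    · rw [abs_abs]; exact (congrArg _ (by ring)).le
  have hm : ∀ W : Proc T P,
      AEStronglyMeasurable (fun ω => ∑ s ∈ Finset.Ici t, Z s ω * W s ω * μ s) P := fun W =>
    Finset.aestronglyMeasurable_fun_sum _ fun s _ =>
      (((Z s).aestronglyMeasurable.mul (W s).aestronglyMeasurable).mul_const _)
  have h := tendsto_condE (ℱ := ℱ) (t := t) (fun n => hm (Y n)) hGZ (fun n => by
      filter_upwards [ae_all_iff.2 (hYG n)] with ω hω
      rw [abs_of_nonneg (Finset.sum_nonneg fun s _ => abs_nonneg (G s ω * Z s ω * μ s))]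
      refine (Finset.abs_sum_le_sum_abs _ _).trans (Finset.sum_le_sum fun s _ => ?_)
      rw [abs_mul, abs_mul, abs_mul, abs_mul, mul_comm |Z s ω|]
      exact mul_le_mul_of_nonneg_right (mul_le_mul_of_nonneg_right (hω s) (abs_nonneg _))
        (abs_nonneg _))
    (g := fun ω => ∑ s ∈ Finset.Ici t, Z s ω * X s ω * μ s) (by
      filter_upwards [ae_all_iff.2 hlim] with ω hω
      exact tendsto_finsetSum _ fun s _ => ((hω s).const_mul _).mul_const _)
  filter_upwards [h, coeFn_pairing (ℱ := ℱ) (t := t) (μ := μ) Z X,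
    ae_all_iff.2 fun n => coeFn_pairing (ℱ := ℱ) (t := t) (μ := μ) Z (Y n)] with ω a1 a2 a3
  simp only [a2, a3]
  exact a1

theorem tendsto_pairing_left {p q : ℝ≥0∞} [ENNReal.HolderConjugate p q] {Z X : Proc T P}
    {Y : ℕ → Proc T P} (hX : ∀ s, LocLp (ℱ t) p (X s) P) {G : Fin (T + 1) → Ω → ℝ}
    (hG : ∀ s, LocLp (ℱ t) q (G s) P) (hYG : ∀ n s, ∀ᵐ ω ∂P, |Y n s ω| ≤ |G s ω|)
    (hlim : ∀ s, ∀ᵐ ω ∂P, Tendsto (fun n => Y n s ω) atTop (𝓝 (Z s ω))) :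
    ∀ᵐ ω ∂P, Tendsto (fun n => (pairing P ℱ t μ (Y n) X).1 ω) atTop
      (𝓝 ((pairing P ℱ t μ Z X).1 ω)) := by
  have : ENNReal.HolderConjugate q p := ENNReal.HolderConjugate.symm
  simp only [pairing_comm _ X]
  exact tendsto_pairing_right hX hG hYG hlim

/-- For `Z` in `L^q` and `X` in `L^p` the pairing is integrable, with the expected integral. -/
theorem integral_pairing {p q : ℝ≥0∞} [ENNReal.HolderConjugate p q] {Z X : Proc T P}
    (hZ : ∀ s, MemLp (Z s) q P) (hX : ∀ s, MemLp (X s) p P) :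
    Integrable (pairing P ℱ t μ Z X).1 P ∧ ∫ ω, (pairing P ℱ t μ Z X).1 ω ∂P
      = ∑ s ∈ Finset.Ici t, μ s * ∫ ω, Z s ω * X s ω ∂P := by
  have h0 : ∀ s, Integrable (fun ω => Z s ω * X s ω) P := fun s => by
    simpa only [mul_comm] using (show Integrable (fun ω => X s ω * Z s ω) P from
      (hX s).integrable_mul (hZ s))
  have h1 : Integrable (fun ω => ∑ s ∈ Finset.Ici t, Z s ω * X s ω * μ s) P :=
    integrable_finsetSum _ fun s _ => (h0 s).mul_const _
  have h2 : (pairing P ℱ t μ Z X).1 =ᵐ[P]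
      condExp (ℱ t) P (fun ω => ∑ s ∈ Finset.Ici t, Z s ω * X s ω * μ s) := by
    filter_upwards [coeFn_pairing (ℱ := ℱ) (t := t) (μ := μ) Z X,
      condE_eq_condExp (ℱ := ℱ) (t := t) h1] with ω a1 a2
    rw [a1, a2]
  refine ⟨integrable_condExp.congr h2.symm, ?_⟩
  rw [integral_congr_ae h2, integral_condExp (ℱ.le t), integral_finsetSum _
    fun s _ => (h0 s).mul_const _]
  refine Finset.sum_congr rfl fun s _ => ?_
  rw [integral_mul_const, mul_comm]

end

/-! ### Multiplicative decomposition of a nonnegative adapted process. -/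

section

variable {Ω : Type*} {m m' mΩ : MeasurableSpace Ω} {P : Measure Ω} [IsFiniteMeasure P]

theorem condLExp_condLExp (hm' : m ≤ m') (hm : m' ≤ mΩ) (f : Ω → ℝ≥0∞) :
    ∀ᵐ ω ∂P, condLExp m P (condLExp m' P f) ω = condLExp m P f ω := by
  refine ae_eq_condLExp (hm'.trans hm) P f (measurable_condLExp m P _) fun s hs => ?_
  rw [setLIntegral_condLExp (hm'.trans hm) P _ hs, setLIntegral_condLExp hm P _ (hm' s hs)]

/-- Integrate `f` over the `m`-measurable event on which its conditional expectation vanishes. -/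
theorem ae_eq_zero_of_condLExp_eq_zero (hm : m ≤ mΩ) {f : Ω → ℝ≥0∞} (hf : AEMeasurable f P) :
    ∀ᵐ ω ∂P, condLExp m P f ω = 0 → f ω = 0 := by
  have hs : MeasurableSet[m] {ω | condLExp m P f ω = 0} :=
    measurable_condLExp m P f (measurableSet_singleton 0)
  have h := setLIntegral_condLExp hm P f hs
  rw [setLIntegral_congr_fun (g := fun _ => 0) (hm _ hs) (fun ω hω => hω), lintegral_zero] at h
  have h2 := (lintegral_eq_zero_iff' hf.restrict).1 h.symm
  exact (ae_restrict_iff' (hm _ hs)).1 h2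

/-- Multiplicative decomposition: a nonnegative adapted process whose sum has conditional
expectation `1` is a martingale density times the decrements of a predictable decreasing process. -/
theorem exists_multiplicative_decomposition {𝒢 : ℕ → MeasurableSpace Ω} (hmono : Monotone 𝒢)
    (hle : ∀ n, 𝒢 n ≤ mΩ) {t T : ℕ} (htT : t ≤ T) {ζ : ℕ → Ω → ℝ≥0∞}
    (hζ : ∀ n, Measurable[𝒢 n] (ζ n))
    (h1 : ∀ᵐ ω ∂P, condLExp (𝒢 t) P (fun ω => ∑ k ∈ Finset.Icc t T, ζ k ω) ω = 1) :
    ∃ M D : ℕ → Ω → ℝ≥0∞, (∀ n, Measurable[𝒢 n] (M n)) ∧ (∀ n, Measurable[𝒢 n] (D (n + 1))) ∧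
      (∀ n ≤ t, D n = 1) ∧ M t = 1 ∧ (∀ ω, Antitone fun n => D n ω) ∧
      (∀ᵐ ω ∂P, D (T + 1) ω = 0) ∧
      (∀ n, t ≤ n → ∀ᵐ ω ∂P, condLExp (𝒢 n) P (M (n + 1)) ω = M n ω) ∧
      ∀ n, t ≤ n → n ≤ T → ∀ᵐ ω ∂P, M n ω * D (n + 1) ω + ζ n ω = M n ω * D n ω := by
  have hζ' : ∀ n, AEMeasurable (ζ n) P := fun n => ((hζ n).mono (hle n) le_rfl).aemeasurable
  have hS' : ∀ n, AEMeasurable (fun ω => ∑ k ∈ Finset.Icc n T, ζ k ω) P := fun n =>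
    Finset.aemeasurable_fun_sum _ fun k _ => hζ' k
  -- `U n` is the expected mass remaining from time `n` on, `W n` the part remaining strictly after
  -- `n`. Thus `U n = ζ n + W n`, and `W n` is the conditional expectation of `U (n + 1)`.
  set U : ℕ → Ω → ℝ≥0∞ := fun n => condLExp (𝒢 n) P fun ω => ∑ k ∈ Finset.Icc n T, ζ k ω with hU
  set W : ℕ → Ω → ℝ≥0∞ := fun n => condLExp (𝒢 n) P fun ω => ∑ k ∈ Finset.Icc (n + 1) T, ζ k ω
    with hW
  have mU : ∀ n, Measurable[𝒢 n] (U n) := fun n => measurable_condLExp _ _ _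
  have mW : ∀ n, Measurable[𝒢 n] (W n) := fun n => measurable_condLExp _ _ _
  have hWle : ∀ n, ∀ᵐ ω ∂P, W n ω ≤ U n ω := fun n =>
    condLExp_mono (Eventually.of_forall fun ω =>
      Finset.sum_le_sum_of_subset (Finset.Icc_subset_Icc_left n.le_succ))
  have hWU : ∀ n, ∀ᵐ ω ∂P, condLExp (𝒢 n) P (U (n + 1)) ω = W n ω := fun n =>
    condLExp_condLExp (hmono n.le_succ) (hle _) _
  have hUW : ∀ n, n ≤ T → ∀ᵐ ω ∂P, U n ω = ζ n ω + W n ω := by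
    intro n hn
    have e : (fun ω => ∑ k ∈ Finset.Icc n T, ζ k ω)
        = ζ n + fun ω => ∑ k ∈ Finset.Icc (n + 1) T, ζ k ω := by
      funext ω
      rw [Pi.add_apply, ← Finset.insert_Icc_add_one_left_eq_Icc hn, Finset.sum_insert (by simp)]
    have := condLExp_add_left (mΩ := 𝒢 n) (fun ω => ∑ k ∈ Finset.Icc (n + 1) T, ζ k ω) (hζ' n)
    filter_upwards [this] with ω hω
    simp only [hU, hW]
    rw [e, hω, Pi.add_apply, condLExp_eq_self (hle n) P (hζ n)]
  have hUfin : ∀ n, t ≤ n → ∀ᵐ ω ∂P, U n ω < ∞ := by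
    intro n hn
    refine condLExp_lt_top (ne_of_lt ?_)
    calc ∫⁻ ω, ∑ k ∈ Finset.Icc n T, ζ k ω ∂P ≤ ∫⁻ ω, ∑ k ∈ Finset.Icc t T, ζ k ω ∂P :=
          lintegral_mono fun ω => Finset.sum_le_sum_of_subset (Finset.Icc_subset_Icc_left hn)
      _ = ∫⁻ ω, 1 ∂P := by rw [← lintegral_condLExp (hle t) P, lintegral_congr_ae h1]
      _ < ∞ := by simp
  have hW0 : ∀ n, ∀ᵐ ω ∂P, W n ω = 0 → U (n + 1) ω = 0 := fun n => by
    filter_upwards [hWU n, ae_eq_zero_of_condLExp_eq_zero (P := P) (hle n)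
      ((mU (n + 1)).mono (hle _) le_rfl).aemeasurable] with ω a1 a2 a3
    exact a2 (a1.trans a3)
  -- From `t` on, `M` is multiplied by the martingale ratio U (k+1) / W k and `D` by the fraction W
  -- k / U k that is not spent, so that `M n * D n = U n` by telescoping. Where `W k = 0` the factor
  -- 1 keeps `M` a martingale, and `D` vanishes from `k + 1` on. The minimum with 1 makes `D`
  -- decreasing at every point, exceptional null sets included.
  let M : ℕ → Ω → ℝ≥0∞ := fun n => Nat.rec 1 (fun k f ω => if k < t then 1 else
    f ω * if W k ω = 0 then 1 else U (k + 1) ω / W k ω) n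
  let D : ℕ → Ω → ℝ≥0∞ := fun n => Nat.rec 1 (fun k f ω => if k < t then 1 else
    f ω * min (W k ω / U k ω) 1) n
  have hM : ∀ k, M (k + 1) = fun ω => if k < t then 1 else
    M k ω * if W k ω = 0 then 1 else U (k + 1) ω / W k ω := fun k => rfl
  have hD : ∀ k, D (k + 1) = fun ω => if k < t then 1 else
    D k ω * min (W k ω / U k ω) 1 := fun k => rfl
  have hMt : ∀ n ≤ t, M n = 1 := by
    intro n hn
    cases n with
    | zero => rfl
    | succ k => rw [hM]; funext ω; rw [if_pos (by omega)]; rfl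
  have hDt : ∀ n ≤ t, D n = 1 := by
    intro n hn
    cases n with
    | zero => rfl
    | succ k => rw [hD]; funext ω; rw [if_pos (by omega)]; rfl
  have mM : ∀ n, Measurable[𝒢 n] (M n) := by
    intro n
    induction n with
    | zero => exact measurable_const
    | succ k ih =>
      rw [hM]
      have mW' := (mW k).mono (hmono k.le_succ) le_rfl
      split_ifs
      · exact measurable_const
      · exact (ih.mono (hmono k.le_succ) le_rfl).mul (Measurable.ite
          (mW' (measurableSet_singleton 0)) measurable_const ((mU _).div mW'))
  have mD : ∀ n, Measurable[𝒢 n] (D (n + 1)) := by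
    intro n
    induction n with
    | zero =>
      rw [hD]
      split_ifs
      · exact measurable_const
      · exact measurable_const.mul (((mW 0).div (mU 0)).min measurable_const)
    | succ k ih =>
      rw [hD]
      split_ifs
      · exact measurable_const
      · exact (ih.mono (hmono k.le_succ) le_rfl).mul (((mW _).div (mU _)).min measurable_const)
  have hfac : ∀ n, t ≤ n → n ≤ T → ∀ᵐ ω ∂P, min (W n ω / U n ω) 1 * U n ω = W n ω := by
    intro n hn hnT
    filter_upwards [hUW n hnT, hUfin n hn] with ω a1 a2
    have hle : W n ω ≤ U n ω := a1 ▸ le_add_self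
    by_cases h0 : U n ω = 0
    · rw [h0] at hle ⊢
      rw [mul_zero]; exact (le_antisymm hle zero_le).symm
    · rw [min_eq_left (ENNReal.div_le_of_le_mul (by rwa [one_mul])), ENNReal.div_mul_cancel h0 a2.ne]
  have hMD : ∀ n, t ≤ n → n ≤ T → ∀ᵐ ω ∂P, M n ω * D n ω = U n ω := by
    intro n hn
    induction n, hn using Nat.le_induction with
    | base =>
      intro _
      filter_upwards [h1] with ω hω
      rw [hMt t le_rfl, hDt t le_rfl, Pi.one_apply, one_mul]
      exact hω.symm
    | succ k hk ih =>
      intro hkT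
      filter_upwards [ih (by omega), hfac k hk (by omega), hW0 k, hUW k (by omega), hUfin k hk]
        with ω a1 a2 a3 a4 a5
      simp only [hM, hD, if_neg (not_lt.2 hk)]
      split_ifs with h0
      · have h2 : min (W k ω / U k ω) 1 = 0 := by rw [h0, ENNReal.zero_div]; simp
        rw [h2, a3 h0, mul_zero, mul_zero]
      · have hWfin : W k ω ≠ ∞ := ((a4 ▸ le_add_self : W k ω ≤ U k ω).trans_lt a5).ne
        rw [mul_mul_mul_comm, a1, mul_comm, mul_assoc, a2, ENNReal.div_mul_cancel h0 hWfin]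
  refine ⟨M, D, mM, mD, hDt, hMt t le_rfl, ?_, ?_, ?_, ?_⟩
  · refine fun ω => antitone_nat_of_succ_le fun n => ?_
    rw [hD]
    simp only
    split_ifs with h
    · rw [hDt n h.le]; rfl
    · exact mul_le_of_le_one_right' (min_le_right _ _)
  · have hWT : W T = 0 := by
      simp only [hW]
      rw [Finset.Icc_eq_empty (by omega)]
      simp only [Finset.sum_empty]
      exact condLExp_zero P
    filter_upwards with ω
    rw [hD]
    simp only [if_neg (not_lt.2 htT), hWT]
    simp
  · intro n hn
    -- The first factor is measurable at time `n` and can be pulled out. The second is 1 or `U (n +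
    -- 1)` on complementary events of time `n`, so its conditional expectation is 1 or `W n`, and
    -- division by `W n` restores `M n`.
    have e : M (n + 1) = fun ω => (M n ω * if W n ω = 0 then 1 else (W n ω)⁻¹)
        * (if W n ω = 0 then 1 else U (n + 1) ω) := by
      rw [hM]
      funext ω
      rw [if_neg (not_lt.2 hn)]
      split_ifs
      · simp
      · rw [mul_assoc, mul_comm (W n ω)⁻¹, div_eq_mul_inv]
    have mg : Measurable[𝒢 n] fun ω => M n ω * if W n ω = 0 then 1 else (W n ω)⁻¹ :=
      (mM n).mul (Measurable.ite (mW n (measurableSet_singleton 0)) measurable_const (mW n).inv)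
    have hs : MeasurableSet[𝒢 n] {ω | W n ω = 0} := mW n (measurableSet_singleton 0)
    have mU' : AEMeasurable (U (n + 1)) P := ((mU (n + 1)).mono (hle _) le_rfl).aemeasurable
    have mV : AEMeasurable (fun ω => if W n ω = 0 then 1 else U (n + 1) ω) P :=
      (Measurable.ite (hle n _ hs) measurable_const ((mU (n + 1)).mono (hle _) le_rfl)).aemeasurable
    rw [e]
    filter_upwards [condLExp_mul_left (hle n) mV mg,
      condLExp_congr_on (hle n) mV (g := fun _ => 1) aemeasurable_const hs
        (Eventually.of_forall fun ω hω => if_pos hω),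
      condLExp_congr_on (hle n) mV mU' hs.compl (Eventually.of_forall fun ω hω => if_neg hω),
      hWU n, hUfin n hn, hWle n] with ω b1 b2 b3 b4 b5 b6
    rw [b1]
    by_cases h0 : W n ω = 0
    · rw [b2 h0, condLExp_const (hle n), if_pos h0, mul_one, mul_one]
    · rw [b3 h0, b4, if_neg h0, mul_assoc, ENNReal.inv_mul_cancel h0 (b6.trans_lt b5).ne, mul_one]
  · intro n hn hnT
    filter_upwards [hMD n hn hnT, hfac n hn hnT, hUW n hnT] with ω a1 a2 a3
    rw [hD]
    simp only [if_neg (not_lt.2 hn)]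
    rw [← mul_assoc, a1, mul_comm, a2, a3, add_comm]

end

/-! ### Change of measure and the discounted future as a pairing. -/

section

section

variable {Ω : Type*} {m mΩ : MeasurableSpace Ω} {P Q : Measure Ω} [IsFiniteMeasure P]
  [IsFiniteMeasure Q]

/-- Bayes' formula for a measure `Q ≪ P` that agrees with `P` on the conditioning `σ`-algebra. -/
theorem condLExp_eq_condLExp_rnDeriv_mul (hm : m ≤ mΩ) (hQP : Q ≪ P)
    (heq : ∀ A, MeasurableSet[m] A → Q A = P A) {f : Ω → ℝ≥0∞} (hf : AEMeasurable f P) :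
    ∀ᵐ ω ∂P, condLExp m Q f ω = condLExp m P (fun ω => Q.rnDeriv P ω * f ω) ω := by
  refine ae_eq_condLExp hm P _ (measurable_condLExp m Q f) fun s hs => ?_
  have htrim : P.trim hm = Q.trim hm := @Measure.ext _ m _ _ fun A hA => by
    rw [trim_measurableSet_eq hm hA, trim_measurableSet_eq hm hA, heq A hA]
  rw [← setLIntegral_trim hm (measurable_condLExp m Q f) hs, htrim,
    setLIntegral_trim hm (measurable_condLExp m Q f) hs, setLIntegral_condLExp hm Q f hs,
    setLIntegral_rnDeriv_mul hQP hf (hm s hs)]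

end

variable {Ω : Type*} {mΩ : MeasurableSpace Ω} {P : Measure Ω} [IsProbabilityMeasure P] {T : ℕ}
  {ℱ : Filtration (Fin (T + 1)) mΩ} {t : Fin (T + 1)} {μ : Fin (T + 1) → ℝ}

theorem coeFn_densityProcess {Q : Measure Ω} [IsFiniteMeasure Q] (hQP : Q ≪ P) (s : Fin (T + 1)) :
    ∀ᵐ ω ∂P, densityProcess P ℱ Q s ω = (condLExp (ℱ s) P (Q.rnDeriv P) ω).toReal := by
  have h1 := ae_eq_of_ae_eq_trim (toReal_rnDeriv_trim (ℱ.le s) hQP)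
  have h2 := toReal_condLExp (ℱ s) (Measure.measurable_rnDeriv Q P).aemeasurable
    (Measure.lintegral_rnDeriv_lt_top Q P).ne
  have h3 : ∀ᵐ ω ∂P, densityProcess P ℱ Q s ω
      = (@Measure.rnDeriv Ω (ℱ s) (Q.trim (ℱ.le s)) (P.trim (ℱ.le s)) ω).toReal :=
    AEEqFun.coeFn_mk _ _
  filter_upwards [h1, h2, h3] with ω a1 a2 a3
  rw [a3, a1, ← a2]

theorem condLExp_mul_condLExp {s : Fin (T + 1)} (hts : t ≤ s) {ρ g : Ω → ℝ≥0∞}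
    (hρ : AEMeasurable ρ P) (hg : Measurable[ℱ s] g) :
    ∀ᵐ ω ∂P, condLExp (ℱ t) P (fun ω => ρ ω * g ω) ω
      = condLExp (ℱ t) P (fun ω => condLExp (ℱ s) P ρ ω * g ω) ω := by
  have h1 : condLExp (ℱ s) P (fun ω => ρ ω * g ω) =ᵐ[P] fun ω => condLExp (ℱ s) P ρ ω * g ω := by
    filter_upwards [condLExp_mul_left (ℱ.le s) hρ hg] with ω hω
    rw [mul_comm (condLExp (ℱ s) P ρ ω), ← hω]
    simp only [mul_comm]
  filter_upwards [condLExp_condLExp (ℱ.mono hts) (ℱ.le s) (P := P) (fun ω => ρ ω * g ω),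
    condLExp_congr_ae (mΩ := ℱ t) h1] with ω a1 a2
  rw [← a1, a2]

theorem condE_sum {ι : Type*} (S : Finset ι) {f : ι → Ω → ℝ}
    (hf : ∀ i ∈ S, LocLp (ℱ t) 1 (f i) P) :
    ∀ᵐ ω ∂P, condE ℱ t P (fun ω => ∑ i ∈ S, f i ω) ω = ∑ i ∈ S, condE ℱ t P (f i) ω := by
  classical
  induction S using Finset.induction_on with
  | empty =>
    simp only [Finset.sum_empty]
    exact condE_of_measurable measurable_const
  | insert a S ha ih =>
    simp_rw [Finset.sum_insert ha]
    filter_upwards [ih fun i hi => hf i (Finset.mem_insert_of_mem hi),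
      condE_add (hf a (Finset.mem_insert_self _ _)) (LocLp.sum S (ℱ.le t)
        fun i hi => hf i (Finset.mem_insert_of_mem hi))] with ω h1 h2
    rw [h2, h1]

/-- Replacing a density by its conditional expectation. -/
theorem condE_density_mul {s : Fin (T + 1)} (hts : t ≤ s) {ρ : Ω → ℝ≥0∞} (hρ : AEMeasurable ρ P)
    (hfin : ∫⁻ ω, ρ ω ∂P ≠ ∞) {h : Ω → ℝ} (hh : AEStronglyMeasurable[ℱ s] h P)
    (hL : LocLp (ℱ t) 1 (fun ω => (condLExp (ℱ s) P ρ ω).toReal * h ω) P) :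
    LocLp (ℱ t) 1 (fun ω => (ρ ω).toReal * h ω) P ∧
    ∀ᵐ ω ∂P, condE ℱ t P (fun ω => (ρ ω).toReal * h ω) ω
      = condE ℱ t P (fun ω => (condLExp (ℱ s) P ρ ω).toReal * h ω) ω := by
  have hk : Measurable[ℱ s] (hh.mk h) := hh.stronglyMeasurable_mk.measurable
  -- The tower property is proved for every positively homogeneous `φ`. It is used for the absolute
  -- value, which gives local integrability, and for the positive and negative parts, which give the
  -- conditional expectation.
  have key : ∀ φ : ℝ → ℝ≥0∞, Measurable φ → (∀ a b, 0 ≤ a → φ (a * b) = ENNReal.ofReal a * φ b) →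
      ∀ᵐ ω ∂P, condLExp (ℱ t) P (fun ω => φ ((ρ ω).toReal * h ω)) ω
        = condLExp (ℱ t) P (fun ω => φ ((condLExp (ℱ s) P ρ ω).toReal * h ω)) ω := by
    intro φ hφ hmul
    have e1 : (fun ω => φ ((ρ ω).toReal * h ω)) =ᵐ[P] fun ω => ρ ω * φ (hh.mk h ω) := by
      filter_upwards [ae_lt_top' hρ hfin, hh.ae_eq_mk] with ω a1 a2
      rw [hmul _ _ ENNReal.toReal_nonneg, ENNReal.ofReal_toReal a1.ne, ← a2]
    have e2 : (fun ω => φ ((condLExp (ℱ s) P ρ ω).toReal * h ω)) =ᵐ[P]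
        fun ω => condLExp (ℱ s) P ρ ω * φ (hh.mk h ω) := by
      filter_upwards [condLExp_ne_top (mΩ := ℱ s) hfin, hh.ae_eq_mk] with ω a1 a2
      rw [hmul _ _ ENNReal.toReal_nonneg, ENNReal.ofReal_toReal a1, ← a2]
    filter_upwards [condLExp_congr_ae (mΩ := ℱ t) e1, condLExp_congr_ae (mΩ := ℱ t) e2,
      condLExp_mul_condLExp hts hρ (hφ.comp hk)] with ω a1 a2 a3
    rw [a1, a2]
    exact a3
  have hm' : AEStronglyMeasurable h P := hh.mono (ℱ.le s)
  have hmρ : AEStronglyMeasurable (fun ω => (ρ ω).toReal * h ω) P :=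
    hρ.ennreal_toReal.aestronglyMeasurable.mul hm'
  refine ⟨(locLp_iff_condLExp (ℱ.le t) one_ne_zero ENNReal.one_ne_top hmρ).2 ?_, ?_⟩
  · have := (locLp_iff_condLExp (ℱ.le t) one_ne_zero ENNReal.one_ne_top hL.aestronglyMeasurable).1 hL
    filter_upwards [this, key (fun x => ‖x‖ₑ ^ (1 : ℝ≥0∞).toReal) (by fun_prop) (fun a b ha => by
      simp only [ENNReal.toReal_one, ENNReal.rpow_one]
      rw [enorm_mul, Real.enorm_of_nonneg ha])] with ω a1 a2
    rw [a2]
    exact a1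
  · filter_upwards [key (fun x => ENNReal.ofReal x) (by fun_prop)
      (fun a b ha => ENNReal.ofReal_mul ha), key (fun x => ENNReal.ofReal (-x)) (by fun_prop)
      (fun a b ha => by rw [← mul_neg, ENNReal.ofReal_mul ha])] with ω a1 a2
    simp only [condE]
    rw [a1, a2]

/-- Abel summation. The terms with d (s+1) are reindexed through successor and predecessor; the
boundary term at the last time is absent since the next value there is 0. -/
theorem sum_Ici_sub_next (t : Fin (T + 1)) (d x : Fin (T + 1) → ℝ) :
    ∑ s ∈ Finset.Ici t, (d s - if s = Fin.last T then 0 else d (Order.succ s)) * x s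
      = d t * x t + ∑ k ∈ Finset.Ioi t, d k * (x k - x (Order.pred k)) := by
  simp only [sub_mul, mul_sub, Finset.sum_sub_distrib]
  rw [← Finset.Ioi_insert, Finset.sum_insert Finset.notMem_Ioi_self, add_sub_assoc]
  congr 2
  rw [Finset.Ioi_insert]
  simp only [ite_mul, zero_mul]
  rw [← Finset.sum_filter_add_sum_filter_not (Finset.Ici t) (fun s => s = Fin.last T)]
  rw [Finset.sum_eq_zero (s := (Finset.Ici t).filter _)
    (fun s hs => if_pos (Finset.mem_filter.1 hs).2), zero_add]
  have hmax : ∀ s : Fin (T + 1), s ≠ Fin.last T → ¬ IsMax s := fun s hs h =>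
    hs (Fin.last_le_iff.1 (h (Fin.le_last s)))
  have hmin : ∀ s : Fin (T + 1), t < s → ¬ IsMin s := fun s hs h => not_isMin_of_lt hs h
  refine Finset.sum_nbij' (fun s => Order.succ s) (fun k => Order.pred k) ?_ ?_ ?_ ?_ ?_
  · intro s hs
    obtain ⟨h1, h2⟩ := Finset.mem_filter.1 hs
    exact Finset.mem_Ioi.2 ((Finset.mem_Ici.1 h1).trans_lt (Order.lt_succ_of_not_isMax (hmax s h2)))
  · intro k hk
    have hk := Finset.mem_Ioi.1 hk
    refine Finset.mem_filter.2 ⟨Finset.mem_Ici.2 (Order.le_pred_of_lt hk), fun h => ?_⟩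
    have := Order.pred_lt_of_not_isMin (hmin k hk)
    rw [h] at this
    exact absurd (Fin.le_last k) (not_le.2 this)
  · intro s hs
    exact Order.pred_succ_of_not_isMax (hmax s (Finset.mem_filter.1 hs).2)
  · intro k hk
    exact Order.succ_pred_of_not_isMin (hmin k (Finset.mem_Ioi.1 hk))
  · intro s hs
    have h2 := (Finset.mem_filter.1 hs).2
    rw [if_neg h2, Order.pred_succ_of_not_isMax (hmax s h2)]

omit [IsProbabilityMeasure P] in
theorem coeFn_next (D : Proc T P) (s : Fin (T + 1)) : ∀ᵐ ω ∂P,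
    next D s ω = if s = Fin.last T then 0 else D (Order.succ s) ω := by
  by_cases h : s = Fin.last T
  · simp only [next, if_pos h]
    exact AEEqFun.coeFn_zero
  · simp only [next, if_neg h]
    simp

omit [IsProbabilityMeasure P] in
theorem coeFn_otimes (Q : Measure Ω) (D : Proc T P) {s : Fin (T + 1)} (hs : t ≤ s) : ∀ᵐ ω ∂P,
    otimes ℱ t μ Q D s ω = (μ s)⁻¹ * (densityProcess P ℱ Q s ω * (D s ω - next D s ω)) := by
  simp only [otimes, if_pos hs]
  filter_upwards [AEEqFun.coeFn_smul (μ s)⁻¹ (densityProcess P ℱ Q s * (D s - next D s)),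
    AEEqFun.coeFn_mul (densityProcess P ℱ Q s) (D s - next D s), AEEqFun.coeFn_sub (D s) (next D s)]
    with ω a1 a2 a3
  rw [a1, Pi.smul_apply, a2, Pi.mul_apply, a3, Pi.sub_apply, smul_eq_mul]

omit [IsProbabilityMeasure P] in
theorem coeFn_finsetSum {ι : Type*} (S : Finset ι) (f : ι → Ω →ₘ[P] ℝ) :
    ∀ᵐ ω ∂P, (∑ i ∈ S, f i : Ω →ₘ[P] ℝ) ω = ∑ i ∈ S, f i ω := by
  classical
  induction S using Finset.induction_on with
  | empty => simp only [Finset.sum_empty]; exact AEEqFun.coeFn_zero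
  | insert a S ha ih =>
    rw [Finset.sum_insert ha]
    filter_upwards [AEEqFun.coeFn_add (f a) (∑ i ∈ S, f i), ih] with ω h1 h2
    rw [h1, Pi.add_apply, h2, Finset.sum_insert ha]

omit [IsProbabilityMeasure P] in
theorem coeFn_discountedFuture (D X : Proc T P) : ∀ᵐ ω ∂P, discountedFuture t D X ω
    = X t ω + ∑ k ∈ Finset.Ioi t, D k ω * (X k ω - X (Order.pred k) ω) := by
  have h : ∀ k, ∀ᵐ ω ∂P, (D k * (X k - X (Order.pred k)) : Ω →ₘ[P] ℝ) ω
      = D k ω * (X k ω - X (Order.pred k) ω) := fun k => by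
    filter_upwards [AEEqFun.coeFn_mul (D k) (X k - X (Order.pred k)),
      AEEqFun.coeFn_sub (X k) (X (Order.pred k))] with ω a1 a2
    rw [a1, Pi.mul_apply, a2, Pi.sub_apply]
  filter_upwards [AEEqFun.coeFn_add (X t) (∑ k ∈ Finset.Ioi t, D k * (X k - X (Order.pred k))),
    coeFn_finsetSum (Finset.Ioi t) fun k => D k * (X k - X (Order.pred k)), ae_all_iff.2 h]
    with ω a1 a2 a3
  rw [discountedFuture, a1, Pi.add_apply, a2]
  simp only [a3]

variable {p q : ℝ≥0∞}

omit [IsProbabilityMeasure P] in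
theorem adapted_next {Q : Measure Ω} {D : Proc T P} (hD : MemD ℱ t Q D) (s : Fin (T + 1)) :
    AEStronglyMeasurable[ℱ s] (next D s) P := by
  by_cases h : s = Fin.last T
  · simp only [next, if_pos h]
    exact aestronglyMeasurable_zero.congr AEEqFun.coeFn_zero.symm
  · simp only [next, if_neg h]
    have hmax : ¬ IsMax s := fun h' => h (Fin.last_le_iff.1 (h' (Fin.le_last s)))
    have := hD.predictable (Order.succ s)
    rwa [Order.pred_succ_of_not_isMax hmax] at this

/-- Bayes' formula rewrites the left side under P with density ρ = dQ/dP. Abel summation, together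
with D_t = 1, gives ∑ (D_s - D_{s+1}) X_s. The s-th summand is 𝓕_s-measurable, so ρ may be replaced
by its conditional expectation Z_s, and Z_s (D_s - D_{s+1}) is the density of Q ⊗ D times μ_s. -/
theorem condE_discountedFuture [ENNReal.HolderConjugate p q] (hμ : ∀ s, t ≤ s → 0 < μ s)
    {Q : Measure Ω} {D : Proc T P} (h : Admissible ℱ t μ q Q D) {X : Proc T P}
    (hX : Adapted ℱ X) (hXp : ∀ s, t ≤ s → LocLp (ℱ t) p (X s) P) :
    ∀ᵐ ω ∂P, condE ℱ t Q (discountedFuture t D X) ω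
      = condE ℱ t P (fun ω => ∑ s ∈ Finset.Ici t, otimes ℱ t μ Q D s ω * X s ω * μ s) ω := by
  have := h.memM.prob
  set ρ := Q.rnDeriv P with hρ
  have mρ : Measurable ρ := Measure.measurable_rnDeriv Q P
  have fρ : ∫⁻ ω, ρ ω ∂P ≠ ∞ := (Measure.lintegral_rnDeriv_lt_top Q P).ne
  -- The normalization D_t = 1 is only known Q-almost surely. It transfers to P off {ρ = 0}, where
  -- the integrands carry the factor ρ and vanish.
  have aeQ : ∀ {r : Ω → Prop}, (∀ᵐ ω ∂Q, r ω) → ∀ᵐ ω ∂P, (ρ ω).toReal ≠ 0 → r ω := by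
    intro r hr
    rw [← Measure.withDensity_rnDeriv_eq Q P h.memM.ac, ae_withDensity_iff mρ] at hr
    filter_upwards [hr] with ω hω h0
    exact hω fun h1 => h0 (by rw [h1]; rfl)
  let k : Fin (T + 1) → Ω → ℝ := fun s ω => (D s ω - next D s ω) * X s ω
  have mk : ∀ s, AEStronglyMeasurable[ℱ s] (k s) P := fun s =>
    ((h.memD.adapted s).sub (adapted_next h.memD s)).mul (hX s)
  have hL : ∀ s, t ≤ s →
      LocLp (ℱ t) 1 (fun ω => (condLExp (ℱ s) P ρ ω).toReal * k s ω) P ∧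
      ∀ᵐ ω ∂P, (condLExp (ℱ s) P ρ ω).toReal * k s ω = otimes ℱ t μ Q D s ω * X s ω * μ s := by
    intro s hs
    have e : ∀ᵐ ω ∂P, (condLExp (ℱ s) P ρ ω).toReal * k s ω
        = otimes ℱ t μ Q D s ω * X s ω * μ s := by
      filter_upwards [coeFn_otimes (ℱ := ℱ) (μ := μ) Q D hs,
        coeFn_densityProcess (ℱ := ℱ) h.memM.ac s] with ω a1 a2
      rw [a1, a2]
      have := (hμ s hs).ne'
      simp only [k]
      rw [hρ]
      field_simp
    refine ⟨?_, e⟩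
    have h1 := ((hXp s hs).mul (ℱ.le t) (LocLp.of_memLp (m := ℱ t) (h.memLp s))).mul_left
      (ℱ.le t) (g := fun _ => μ s) measurable_const
    refine h1.congr (ℱ.le t) ?_
    filter_upwards [e] with ω hω
    rw [hω]; ring
  have hden := fun s (hs : t ≤ s) => condE_density_mul hs mρ.aemeasurable fρ (mk s) (hL s hs).1
  have e1 : ∀ᵐ ω ∂P, condE ℱ t Q (discountedFuture t D X) ω
      = condE ℱ t P (fun ω => (ρ ω).toReal * discountedFuture t D X ω) ω := by
    have mDF : AEMeasurable (discountedFuture t D X) P :=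
      (discountedFuture t D X).aestronglyMeasurable.aemeasurable
    have e2 : ∀ σ : ℝ, (fun ω => ρ ω * ENNReal.ofReal (σ * discountedFuture t D X ω)) =ᵐ[P]
        fun ω => ENNReal.ofReal (σ * ((ρ ω).toReal * discountedFuture t D X ω)) := by
      intro σ
      filter_upwards [Measure.rnDeriv_ne_top Q P] with ω hω
      rw [mul_left_comm, ENNReal.ofReal_mul ENNReal.toReal_nonneg, ENNReal.ofReal_toReal hω]
    have e3 : ∀ σ : ℝ, ∀ᵐ ω ∂P,
        condLExp (ℱ t) Q (fun ω => ENNReal.ofReal (σ * discountedFuture t D X ω)) ω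
        = condLExp (ℱ t) P
          (fun ω => ENNReal.ofReal (σ * ((ρ ω).toReal * discountedFuture t D X ω))) ω := by
      intro σ
      filter_upwards [condLExp_eq_condLExp_rnDeriv_mul (ℱ.le t) h.memM.ac h.memM.eq_on
        ((mDF.const_mul σ).ennreal_ofReal), condLExp_congr_ae (mΩ := ℱ t) (e2 σ)] with ω a1 a2
      rw [a1, ← hρ, a2]
    filter_upwards [e3 1, e3 (-1)] with ω a1 a2
    simp only [one_mul, neg_one_mul] at a1 a2
    simp only [condE]
    rw [a1, a2]
  have e4 : ∀ᵐ ω ∂P, (ρ ω).toReal * discountedFuture t D X ω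
      = ∑ s ∈ Finset.Ici t, (ρ ω).toReal * k s ω := by
    filter_upwards [coeFn_discountedFuture (t := t) D X, aeQ (h.memD.one t le_rfl),
      ae_all_iff.2 fun s => coeFn_next D s] with ω a1 a2 a3
    rw [← Finset.mul_sum]
    by_cases h0 : (ρ ω).toReal = 0
    · rw [h0, zero_mul, zero_mul]
    · congr 1
      simp only [k, a3]
      rw [sum_Ici_sub_next t (fun s => D s ω) (fun s => X s ω), a1, a2 h0, one_mul]
  filter_upwards [e1, condE_congr (ℱ := ℱ) (t := t) e4,
    condE_sum (ℱ := ℱ) (t := t) (Finset.Ici t) (f := fun s ω => (ρ ω).toReal * k s ω)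
      fun s hs => (hden s (Finset.mem_Ici.1 hs)).1,
    condE_sum (ℱ := ℱ) (t := t) (Finset.Ici t)
      (f := fun s ω => (condLExp (ℱ s) P ρ ω).toReal * k s ω)
      fun s hs => (hL s (Finset.mem_Ici.1 hs)).1,
    (Finset.eventually_all (Finset.Ici t)).2 fun s hs => (hden s (Finset.mem_Ici.1 hs)).2,
    condE_congr (ℱ := ℱ) (t := t) (P := P) (f := fun ω => ∑ s ∈ Finset.Ici t,
      (condLExp (ℱ s) P ρ ω).toReal * k s ω)
      (g := fun ω => ∑ s ∈ Finset.Ici t, otimes ℱ t μ Q D s ω * X s ω * μ s) (by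
        filter_upwards [(Finset.eventually_all (Finset.Ici t)).2
          fun s hs => (hL s (Finset.mem_Ici.1 hs)).2] with ω hω
        exact Finset.sum_congr rfl fun s hs => hω s hs)] with ω b1 b2 b3 b4 b5 b6
  rw [b1, b2, b3, ← b6, b4]
  exact Finset.sum_congr rfl fun s hs => b5 s hs

end

/-! ### The densities Q ⊗ D are the normalized nonnegative processes. -/

section

variable {Ω : Type*} {mΩ : MeasurableSpace Ω} {P : Measure Ω} {T : ℕ}
  {ℱ : Filtration (Fin (T + 1)) mΩ} {t : Fin (T + 1)} {μ : Fin (T + 1) → ℝ} {p q : ℝ≥0∞}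

/-- The normalized elements of the positive cone of the dual. -/
structure IsDual (ℱ : Filtration (Fin (T + 1)) mΩ) (t : Fin (T + 1)) (μ : Fin (T + 1) → ℝ)
    (q : ℝ≥0∞) (Z : Proc T P) : Prop where
  adapted : Adapted ℱ Z
  zero : ∀ s < t, Z s = 0
  nonneg : ∀ s, ∀ᵐ ω ∂P, 0 ≤ Z s ω
  memLp : ∀ s, MemLp (Z s) q P
  norm : ∀ᵐ ω ∂P, condE ℱ t P (fun ω => ∑ s ∈ Finset.Ici t, Z s ω * μ s) ω = 1

variable [IsProbabilityMeasure P]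

/-- The integral of Z_s over a Q-null event of 𝓕_s is 0. This disposes of the P-nonnull events on
which properties of D that hold only Q-almost surely may fail. -/
theorem ae_densityProcess_eq_zero {Q : Measure Ω} [IsFiniteMeasure Q] (hQP : Q ≪ P)
    {s : Fin (T + 1)} {N : Set Ω} (hN : ∃ N', MeasurableSet[ℱ s] N' ∧ N =ᵐ[P] N') (hQN : Q N = 0) :
    ∀ᵐ ω ∂P, ω ∈ N → densityProcess P ℱ Q s ω = 0 := by
  obtain ⟨N', hN', hNN⟩ := hN
  have hQ' : Q N' = 0 := by rw [← measure_congr (hQP.ae_eq hNN), hQN]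
  have h1 : ∫⁻ ω in N', condLExp (ℱ s) P (Q.rnDeriv P) ω ∂P = 0 := by
    rw [setLIntegral_condLExp (ℱ.le s) P _ hN', Measure.setLIntegral_rnDeriv hQP, hQ']
  rw [lintegral_eq_zero_iff (measurable_condLExp' _ _ _)] at h1
  have h2 := (ae_restrict_iff' (ℱ.le s _ hN')).1 h1
  filter_upwards [h2, hNN, coeFn_densityProcess (ℱ := ℱ) hQP s] with ω a1 a2 a3 hω
  rw [a3, a1 ((iff_of_eq (show (ω ∈ N) = (ω ∈ N') from a2)).1 hω)]
  rfl

/-- Nonnegativity: D decreases Q-almost surely, and Z_s vanishes where it does not. Normalization: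
for the constant process 1 all increments are 0, so its discounted future is 1, and
`condE_discountedFuture` evaluates the total mass. -/
theorem isDual_otimes [ENNReal.HolderConjugate p q] (hμ : ∀ s, t ≤ s → 0 < μ s)
    {Q : Measure Ω} {D : Proc T P} (h : Admissible ℱ t μ q Q D) :
    IsDual ℱ t μ q (otimes ℱ t μ Q D) := by
  have := h.memM.prob
  have mZ : ∀ s, AEStronglyMeasurable[ℱ s] (densityProcess P ℱ Q s) P := fun s => by
    have := ((@Measure.measurable_rnDeriv Ω (ℱ s) (Q.trim (ℱ.le s))
      (P.trim (ℱ.le s))).ennreal_toReal).stronglyMeasurable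
    exact this.aestronglyMeasurable.congr (AEEqFun.coeFn_mk _ _).symm
  have hdec : ∀ s, ∀ᵐ ω ∂Q, 0 ≤ D s ω - next D s ω := by
    intro s
    by_cases hs : s = Fin.last T
    · filter_upwards [h.memM.ac.ae_le (coeFn_next D s), h.memM.ac.ae_le
        (AEEqFun.coeFn_le.2 (h.memD.nonneg s)), h.memM.ac.ae_le (AEEqFun.coeFn_zero (μ := P) (β := ℝ))]
        with ω a1 a2 a3
      rw [a1, if_pos hs, sub_zero]
      rw [a3] at a2
      exact a2
    · filter_upwards [h.memM.ac.ae_le (coeFn_next D s),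
        h.memD.decreasing s (Order.succ s) (Order.le_succ s)] with ω a1 a2
      rw [a1, if_neg hs]
      linarith
  refine ⟨fun s => ?_, fun s hs => by simp [otimes, not_le.2 hs], fun s => ?_, h.memLp, ?_⟩
  · by_cases hs : t ≤ s
    · refine ((mZ s).mul ((h.memD.adapted s).sub (adapted_next h.memD s))).const_mul (μ s)⁻¹
        |>.congr ?_
      filter_upwards [coeFn_otimes (ℱ := ℱ) (μ := μ) Q D hs] with ω a1
      rw [a1]; rfl
    · simp only [otimes, if_neg hs]
      exact aestronglyMeasurable_zero.congr AEEqFun.coeFn_zero.symm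
  · by_cases hs : t ≤ s
    · have mD : AEStronglyMeasurable[ℱ s] (fun ω => D s ω - next D s ω) P :=
        (h.memD.adapted s).sub (adapted_next h.memD s)
      have h1 := ae_densityProcess_eq_zero (ℱ := ℱ) h.memM.ac (s := s)
        (N := {ω | ¬ 0 ≤ D s ω - next D s ω})
        ⟨{ω | ¬ 0 ≤ mD.mk _ ω}, (measurableSet_le measurable_const
          mD.stronglyMeasurable_mk.measurable).compl, by
          filter_upwards [mD.ae_eq_mk] with ω hω
          change (¬ 0 ≤ D s ω - next D s ω) = ¬ 0 ≤ mD.mk _ ω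
          rw [hω]⟩ (hdec s)
      filter_upwards [coeFn_otimes (ℱ := ℱ) (μ := μ) Q D hs, h1,
        coeFn_densityProcess (ℱ := ℱ) h.memM.ac s] with ω a1 a2 a3
      rw [a1]
      by_cases h0 : 0 ≤ D s ω - next D s ω
      · rw [a3]
        exact mul_nonneg (inv_nonneg.2 (hμ s hs).le) (mul_nonneg ENNReal.toReal_nonneg h0)
      · rw [a2 h0]; simp
    · simp only [otimes, if_neg hs]
      filter_upwards [AEEqFun.coeFn_zero (μ := P) (β := ℝ)] with ω hω
      rw [hω]; rfl
  · have h1 := condE_discountedFuture (p := p) hμ h (X := fun _ => (1 : Ω →ₘ[P] ℝ))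
      (fun s => aestronglyMeasurable_one.congr AEEqFun.coeFn_one.symm)
      (fun s _ => LocLp.of_memLp ((memLp_congr_ae AEEqFun.coeFn_one).2 (memLp_const 1)))
    have h2 : ∀ᵐ ω ∂P, condE ℱ t Q (discountedFuture t D fun _ => (1 : Ω →ₘ[P] ℝ)) ω = 1 := by
      have e : ∀ᵐ ω ∂P, discountedFuture t D (fun _ => (1 : Ω →ₘ[P] ℝ)) ω = 1 := by
        filter_upwards [coeFn_discountedFuture (t := t) D fun _ => (1 : Ω →ₘ[P] ℝ),
          AEEqFun.coeFn_one (μ := P) (β := ℝ)] with ω a1 a2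
        rw [a1, a2]
        simp
      have h3 : ∀ᵐ ω ∂Q, condE ℱ t Q (discountedFuture t D fun _ => (1 : Ω →ₘ[P] ℝ)) ω = 1 := by
        filter_upwards [condE_congr (ℱ := ℱ) (t := t) (h.memM.ac.ae_le e),
          condE_of_measurable (ℱ := ℱ) (t := t) (P := Q) (measurable_const (a := (1 : ℝ)))]
          with ω a1 a2
        rw [a1, a2]
      -- The exceptional event belongs to 𝓕_t, where Q and P agree, so it is also P-null.
      have hs : MeasurableSet[ℱ t] {ω | ¬ condE ℱ t Q
          (discountedFuture t D fun _ => (1 : Ω →ₘ[P] ℝ)) ω = 1} :=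
        ((measurable_condE ℱ t Q _) (measurableSet_singleton 1)).compl
      rw [ae_iff, ← h.memM.eq_on _ hs]
      exact h3
    filter_upwards [h1, h2, condE_congr (ℱ := ℱ) (t := t) (P := P)
      (f := fun ω => ∑ s ∈ Finset.Ici t, otimes ℱ t μ Q D s ω * (1 : Ω →ₘ[P] ℝ) ω * μ s)
      (g := fun ω => ∑ s ∈ Finset.Ici t, otimes ℱ t μ Q D s ω * μ s) (by
        filter_upwards [AEEqFun.coeFn_one (μ := P) (β := ℝ)] with ω hω
        rw [hω]; simp)] with ω a1 a2 a3
    rw [← a3, ← a1, a2]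

/-- The multiplicative decomposition is applied to ζ_s = Z_s μ_s. Its martingale part at time T is
the density of Q with respect to P, equal in conditional mean to 1 at time t, so Q agrees with P on
𝓕_t; its predictable part is D. -/
theorem exists_admissible_of_isDual (hμ : ∀ s, t ≤ s → 0 < μ s) {Z : Proc T P}
    (hZ : IsDual ℱ t μ q Z) : ∃ (Q : Measure Ω) (D : Proc T P),
      Admissible ℱ t μ q Q D ∧ Z = otimes ℱ t μ Q D := by
  -- Times are extended to ℕ by freezing at T, as the decomposition refers to the index T + 1.
  let e : ℕ → Fin (T + 1) := fun n => ⟨min n T, by omega⟩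
  have he : ∀ s : Fin (T + 1), e s.1 = s := fun s => Fin.ext (by simp [e]; omega)
  have hemono : Monotone e := fun a b h => by
    rw [Fin.le_def]; simp only [e]; omega
  let 𝒢 : ℕ → MeasurableSpace Ω := fun n => ℱ (e n)
  have h𝒢 : ∀ s : Fin (T + 1), 𝒢 s.1 = ℱ s := fun s => by simp only [𝒢, he]
  let ζ : ℕ → Ω → ℝ≥0∞ := fun n ω =>
    ENNReal.ofReal ((hZ.adapted (e n)).mk _ ω * μ (e n))
  have hζm : ∀ n, Measurable[𝒢 n] (ζ n) := fun n =>
    ((hZ.adapted (e n)).stronglyMeasurable_mk.measurable.mul_const _).ennreal_ofReal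
  have hζ : ∀ s, ∀ᵐ ω ∂P, ζ s.1 ω = ENNReal.ofReal (Z s ω * μ s) := fun s => by
    filter_upwards [(hZ.adapted s).ae_eq_mk] with ω hω
    simp only [ζ]
    rw [he, ← hω]
  have hsum : ∀ᵐ ω ∂P, ∑ k ∈ Finset.Icc t.1 T, ζ k ω
      = ENNReal.ofReal (∑ s ∈ Finset.Ici t, Z s ω * μ s) := by
    filter_upwards [ae_all_iff.2 hζ, ae_all_iff.2 hZ.nonneg] with ω a1 a2
    rw [ENNReal.ofReal_sum_of_nonneg fun s hs => mul_nonneg (a2 s) (hμ s (Finset.mem_Ici.1 hs)).le]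
    refine (Finset.sum_nbij' (fun s : Fin (T + 1) => s.1) e ?_ ?_ ?_ ?_ ?_).symm
    · intro s hs
      have := Finset.mem_Ici.1 hs
      exact Finset.mem_Icc.2 ⟨this, Nat.lt_succ_iff.1 s.2⟩
    · intro k hk
      obtain ⟨h1, h2⟩ := Finset.mem_Icc.1 hk
      refine Finset.mem_Ici.2 ?_
      rw [Fin.le_def]; simp only [e]; omega
    · intro s _; exact he s
    · intro k hk
      obtain ⟨h1, h2⟩ := Finset.mem_Icc.1 hk
      simp only [e]; omega
    · intro s _; exact (a1 s).symm
  have hnn : ∀ᵐ ω ∂P, 0 ≤ ∑ s ∈ Finset.Ici t, Z s ω * μ s := by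
    filter_upwards [ae_all_iff.2 hZ.nonneg] with ω a2
    exact Finset.sum_nonneg fun s hs => mul_nonneg (a2 s) (hμ s (Finset.mem_Ici.1 hs)).le
  have h1 : ∀ᵐ ω ∂P, condLExp (𝒢 t.1) P (fun ω => ∑ k ∈ Finset.Icc t.1 T, ζ k ω) ω = 1 := by
    rw [h𝒢]
    have hz : (fun ω => ENNReal.ofReal (-∑ s ∈ Finset.Ici t, Z s ω * μ s)) =ᵐ[P] 0 := by
      filter_upwards [hnn] with ω hω
      exact ENNReal.ofReal_of_nonpos (by linarith)
    filter_upwards [condLExp_congr_ae (mΩ := ℱ t) hsum, hZ.norm,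
      condLExp_congr_ae (mΩ := ℱ t) hz] with ω a1 a2 a3
    rw [a1]
    simp only [condE] at a2
    rw [a3, condLExp_zero, Pi.zero_apply, ENNReal.toReal_zero, sub_zero] at a2
    rwa [ENNReal.toReal_eq_one_iff] at a2
  obtain ⟨M, D, mM, mD, hDt, hMt, hDanti, hDT, hmart, hMD⟩ := exists_multiplicative_decomposition
    (P := P) (𝒢 := 𝒢) (fun a b h => ℱ.mono (hemono h)) (fun n => ℱ.le _)
    (Nat.lt_succ_iff.1 t.2) hζm h1
  have hmartT : ∀ s : Fin (T + 1), t ≤ s → ∀ᵐ ω ∂P, condLExp (ℱ s) P (M T) ω = M s.1 ω := by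
    have : ∀ n, ∀ s : Fin (T + 1), t ≤ s → s.1 + n = T →
        ∀ᵐ ω ∂P, condLExp (ℱ s) P (M T) ω = M s.1 ω := by
      intro n
      induction n with
      | zero =>
        intro s _ hn
        have hs : s.1 = T := by omega
        have h2 := mM s.1
        rw [h𝒢, hs] at h2
        rw [condLExp_eq_self (ℱ.le s) P h2, hs]
        exact Eventually.of_forall fun _ => rfl
      | succ n ih =>
        intro s hts hn
        have hlt : s.1 + 1 < T + 1 := by omega
        have hle : s ≤ ⟨s.1 + 1, hlt⟩ := by rw [Fin.le_def]; simp
        have h2 := ih ⟨s.1 + 1, hlt⟩ (hts.trans hle) (by simp only; omega)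
        have h3 := hmart s.1 hts
        rw [h𝒢] at h3
        filter_upwards [condLExp_condLExp (ℱ.mono hle) (ℱ.le _) (P := P) (M T),
          condLExp_congr_ae (mΩ := ℱ s) h2, h3] with ω a1 a2 a3
        rw [← a1, a2, a3]
    exact fun s hs => this (T - s.1) s hs (by omega)
  have mMT : Measurable[ℱ (Fin.last T)] (M T) := by
    have := mM (Fin.last T).1
    rw [h𝒢] at this
    exact this
  have mMT' : Measurable (M T) := mMT.mono (ℱ.le _) le_rfl
  have hQset : ∀ A, MeasurableSet[ℱ t] A → P.withDensity (M T) A = P A := by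
    intro A hA
    rw [withDensity_apply _ (ℱ.le t _ hA), ← setLIntegral_condLExp (ℱ.le t) P _ hA,
      lintegral_congr_ae (ae_restrict_of_ae (hmartT t le_rfl)), hMt]
    simp
  have hQprob : IsProbabilityMeasure (P.withDensity (M T)) :=
    ⟨by rw [hQset _ MeasurableSet.univ, measure_univ]⟩
  have hrn := Measure.rnDeriv_withDensity P mMT'
  have mD' : ∀ n, Measurable[𝒢 n] (D n) := by
    intro n
    cases n with
    | zero => rw [hDt 0 (Nat.zero_le _)]; exact measurable_const
    | succ k => exact (mD k).mono (ℱ.mono (hemono k.le_succ)) le_rfl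
  have mDs : ∀ s : Fin (T + 1), Measurable[ℱ s] (D s.1) := fun s => by
    have := mD' s.1
    rwa [h𝒢] at this
  have hD1 : ∀ n ω, D n ω ≤ 1 := fun n ω => by
    have := hDanti ω (Nat.zero_le n)
    simp only [hDt 0 (Nat.zero_le _)] at this
    exact this
  have hDfin : ∀ n ω, D n ω ≠ ∞ := fun n ω => ((hD1 n ω).trans_lt ENNReal.one_lt_top).ne
  let D' : Proc T P := fun s => AEEqFun.mk (fun ω => (D s.1 ω).toReal)
    (((mDs s).mono (ℱ.le s) le_rfl).ennreal_toReal.aestronglyMeasurable)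
  have cD' : ∀ s, ∀ᵐ ω ∂P, D' s ω = (D s.1 ω).toReal := fun s => AEEqFun.coeFn_mk _ _
  have hac := withDensity_absolutelyContinuous P (M T)
  have hnext : ∀ s, ∀ᵐ ω ∂P, next D' s ω = (D (s.1 + 1) ω).toReal := by
    intro s
    by_cases hs : s = Fin.last T
    · filter_upwards [coeFn_next D' s, hDT] with ω a1 a2
      rw [a1, if_pos hs, hs, Fin.val_last, a2]; rfl
    · have hlt : s.1 + 1 < T + 1 := by
        have : s.1 ≠ T := fun h => hs (Fin.ext h)
        omega
      have hsucc : (Order.succ s).1 = s.1 + 1 := by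
        have : Order.succ s = ⟨s.1 + 1, hlt⟩ := by
          refine Order.succ_eq_of_covBy ⟨by rw [Fin.lt_def]; simp, fun c h1 h2 => ?_⟩
          rw [Fin.lt_def] at h1 h2
          simp only at h2; omega
        rw [this]
      filter_upwards [coeFn_next D' s, cD' (Order.succ s)] with ω a1 a2
      rw [a1, if_neg hs, a2, hsucc]
  have hotimes : Z = otimes ℱ t μ (P.withDensity (M T)) D' := by
    funext s
    by_cases hs : t ≤ s
    · refine AEEqFun.ext ?_
      filter_upwards [coeFn_otimes (ℱ := ℱ) (μ := μ) (P.withDensity (M T)) D' hs,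
        coeFn_densityProcess (ℱ := ℱ) hac s, condLExp_congr_ae (mΩ := ℱ s) hrn, hmartT s hs,
        cD' s, hnext s, hMD s.1 hs (Nat.lt_succ_iff.1 s.2), hζ s, hZ.nonneg s,
        condLExp_ne_top (mΩ := ℱ s) (P := P) (f := M T) (by
          have := hQset _ MeasurableSet.univ
          rw [withDensity_apply _ MeasurableSet.univ, Measure.restrict_univ, measure_univ] at this
          rw [this]; simp)] with ω a1 a2 a3 a4 a5 a6 a7 a8 a9 a10
      rw [a4] at a10
      rw [a1, a2, a3, a4, a5, a6]
      rw [a8] at a7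
      have h2 := congrArg ENNReal.toReal a7
      rw [ENNReal.toReal_add (ENNReal.mul_ne_top a10 (hDfin _ _)) ENNReal.ofReal_ne_top,
        ENNReal.toReal_mul, ENNReal.toReal_mul, ENNReal.toReal_ofReal
        (mul_nonneg a9 (hμ s hs).le)] at h2
      rw [mul_sub, ← h2]
      have := (hμ s hs).ne'
      field_simp
      ring
    · simp only [otimes, if_neg hs]
      exact hZ.zero s (not_le.1 hs)
  refine ⟨P.withDensity (M T), D', ⟨⟨hQprob, hac, ?_, hQset⟩, ⟨fun s => ?_, fun s => ?_,
    fun s hs => ?_, fun s => ?_, fun s s' hs => ?_⟩, fun s => ?_⟩, hotimes⟩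
  · exact mMT.stronglyMeasurable.aestronglyMeasurable.congr hrn.symm
  · exact (mDs s).ennreal_toReal.stronglyMeasurable.aestronglyMeasurable.congr
      (AEEqFun.coeFn_mk _ _).symm
  · rw [← AEEqFun.coeFn_le]
    filter_upwards [cD' s, AEEqFun.coeFn_zero (μ := P) (β := ℝ)] with ω a1 a2
    rw [a1, a2]; exact ENNReal.toReal_nonneg
  · filter_upwards [hac.ae_le (cD' s)] with ω a1
    rw [a1, hDt s.1 hs]; simp
  · have h2 : Measurable[ℱ (Order.pred s)] (D s.1) := by
      by_cases h0 : s.1 = 0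
      · rw [h0, hDt 0 (Nat.zero_le _)]; exact measurable_const
      · have h3 := mD (s.1 - 1)
        rw [Nat.sub_add_cancel (by omega)] at h3
        have h4 : Order.pred s = e (s.1 - 1) := by
          refine Order.pred_eq_of_covBy ⟨by rw [Fin.lt_def]; simp only [e]; omega,
            fun c h1 h2 => ?_⟩
          rw [Fin.lt_def] at h1 h2
          simp only [e] at h1; omega
        rw [h4]; exact h3
    exact h2.ennreal_toReal.stronglyMeasurable.aestronglyMeasurable.congr
      (AEEqFun.coeFn_mk _ _).symm
  · filter_upwards [hac.ae_le (cD' s), hac.ae_le (cD' s')] with ω a1 a2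
    rw [a1, a2]
    exact ENNReal.toReal_mono (hDfin _ _) (hDanti ω hs)
  · rw [← hotimes]; exact hZ.memLp s

end

/-! ### Convergence of concatenations in L⁰-module topologies. -/

section

variable {Ω : Type*} {mΩ : MeasurableSpace Ω} {P : Measure Ω} {T : ℕ}
  {ℱ : Filtration (Fin (T + 1)) mΩ} {t : Fin (T + 1)}

/-- The filter of sets that eventually contain the concatenations along `𝓕_t`-measurable indices;
`G N w` means that `w` is the concatenation along `N`. -/
def glueFilter {E : Type*} (m : MeasurableSpace Ω) (G : (Ω → ℕ) → E → Prop) : Filter E where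
  sets := {U | ∃ J : Ω → ℕ, Measurable[m] J ∧
    ∀ N : Ω → ℕ, Measurable[m] N → J ≤ N → ∀ w, G N w → w ∈ U}
  univ_sets := ⟨0, measurable_const, fun _ _ _ _ _ => mem_univ _⟩
  sets_of_superset := by
    rintro U V ⟨J, hJ, h⟩ hUV
    exact ⟨J, hJ, fun N hN hJN w hw => hUV (h N hN hJN w hw)⟩
  inter_sets := by
    rintro U V ⟨J, hJ, h⟩ ⟨J', hJ', h'⟩
    exact ⟨J ⊔ J', hJ.sup hJ', fun N hN hJN w hw => ⟨h N hN (le_sup_left.trans hJN) w hw,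
      h' N hN (le_sup_right.trans hJN) w hw⟩⟩

/-- Neighbourhoods have random radii, and an almost surely convergent sequence enters such a ball
only from a random index on. Convergence is therefore tested on concatenations along large
measurable indices instead of on single members of the sequence. -/
theorem mem_of_isClosed_of_glue {E : Type*} [TopologicalSpace E] {m : MeasurableSpace Ω}
    {G : (Ω → ℕ) → E → Prop} {C : Set E} (hC : IsClosed C) {x : E}
    (hlim : glueFilter m G ≤ 𝓝 x)
    (h : ∀ N : Ω → ℕ, Measurable[m] N → ∃ w, G N w ∧ w ∈ C) : x ∈ C := by
  by_contra hx
  obtain ⟨J, hJ, hJC⟩ := hlim (hC.isOpen_compl.mem_nhds hx)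
  obtain ⟨w, hw, hwC⟩ := h J hJ
  exact hJC J hJ le_rfl w hw hwC

/-- A measurable index from which on an almost surely convergent sequence is small. -/
theorem exists_measurable_index {m : MeasurableSpace Ω} {δ : ℕ → Ω → ℝ≥0∞}
    (hδ : ∀ n, Measurable[m] (δ n)) (hlim : ∀ᵐ ω ∂P, Tendsto (fun n => δ n ω) atTop (𝓝 0))
    {ε : Ω → ℝ≥0∞} (hε : Measurable[m] ε) (hpos : ∀ᵐ ω ∂P, 0 < ε ω) :
    ∃ J : Ω → ℕ, Measurable[m] J ∧ ∀ᵐ ω ∂P, ∀ n, J ω ≤ n → δ n ω ≤ ε ω := by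
  classical
  let A : ℕ → Set Ω := fun n => ⋂ k, {ω | δ (n + k) ω ≤ ε ω}
  have hA : ∀ n, MeasurableSet[m] (A n) := fun n =>
    MeasurableSet.iInter fun k => measurableSet_le (hδ _) hε
  -- The second alternative makes the search for the first good index terminate on the exceptional
  -- set.
  let p : Ω → ℕ → Prop := fun ω n => ω ∈ A n ∨ ω ∉ ⋃ k, A k
  have hp : ∀ ω, ∃ n, p ω n := by
    intro ω
    by_cases h : ω ∈ ⋃ k, A k
    · obtain ⟨n, hn⟩ := mem_iUnion.1 h
      exact ⟨n, Or.inl hn⟩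
    · exact ⟨0, Or.inr h⟩
  refine ⟨fun ω => Nat.find (hp ω), @measurable_find Ω m p _ hp fun k =>
    (hA k).union (MeasurableSet.iUnion hA).compl, ?_⟩
  filter_upwards [hlim, hpos] with ω h1 h2 n hn
  rw [ENNReal.tendsto_atTop_zero] at h1
  obtain ⟨K, hK⟩ := h1 _ h2
  have h3 : ω ∈ ⋃ k, A k := mem_iUnion.2 ⟨K, mem_iInter.2 fun k => hK _ (by omega)⟩
  rcases Nat.find_spec (hp ω) with h | h
  · have := mem_iInter.1 h (n - Nat.find (hp ω))
    rwa [Nat.add_sub_cancel' hn] at this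
  · exact absurd h3 h

/-- Convergence of concatenations in a topology given by an `L⁰`-valued distance. -/
theorem tendsto_glueFilter_ball {E E' : Type*} {G : (Ω → ℕ) → E → Prop} {d : E' → E' → Ω → ℝ≥0∞}
    {f : E → E'} {x' : E'} {δ : ℕ → Ω → ℝ≥0∞} (hδ : ∀ n, Measurable[ℱ t] (δ n))
    (hlim : ∀ᵐ ω ∂P, Tendsto (fun n => δ n ω) atTop (𝓝 0))
    (hd : ∀ N : Ω → ℕ, Measurable[ℱ t] N → ∀ w, G N w → ∀ᵐ ω ∂P, d x' (f w) ω ≤ δ (N ω) ω) :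
    Tendsto f (glueFilter (ℱ t) G) (@nhds E' (ballTopology P ℱ t d) x') := by
  let _ := ballTopology P ℱ t d
  intro V hV
  obtain ⟨U, hUV, hU, hxU⟩ := mem_nhds_iff.1 hV
  obtain ⟨ε, hε, hball⟩ := hU x' hxU
  obtain ⟨J, hJ, hJε⟩ := exists_measurable_index (P := P) hδ hlim
    (ε := fun ω => ENNReal.ofReal (ε.rep ω)) ε.measurable_rep.ennreal_ofReal (by
      filter_upwards [hε, ε.coeFn_eq_rep] with ω a1 a2
      rw [← a2]; exact ENNReal.ofReal_pos.2 a1)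
  refine ⟨J, hJ, fun N hN hJN w hw => hUV (hball _ ?_)⟩
  filter_upwards [hd N hN w hw, hJε, ε.coeFn_eq_rep] with ω a1 a2 a3
  rw [a3]
  exact a1.trans (a2 _ (hJN ω))

theorem tendsto_glueFilter_l0 {E : Type*} {G : (Ω → ℕ) → E → Prop} {f : E → L0 P ℱ t}
    {a : ℕ → L0 P ℱ t} {b : L0 P ℱ t}
    (hlim : ∀ᵐ ω ∂P, Tendsto (fun n => (a n).1 ω) atTop (𝓝 (b.1 ω)))
    (hf : ∀ N : Ω → ℕ, Measurable[ℱ t] N → ∀ w, G N w → ∀ᵐ ω ∂P, (f w).1 ω = (a (N ω)).1 ω) :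
    Tendsto f (glueFilter (ℱ t) G) (@nhds _ (l0Topology P ℱ t) b) := by
  refine tendsto_glueFilter_ball (δ := fun n ω => ‖b.rep ω - (a n).rep ω‖ₑ)
    (fun n => continuous_enorm.measurable.comp (b.measurable_rep.sub (a n).measurable_rep)) ?_ ?_
  · filter_upwards [hlim, b.coeFn_eq_rep, ae_all_iff.2 fun n => (a n).coeFn_eq_rep] with ω h1 h2 h3
    rw [h2] at h1
    simp only [h3] at h1
    have h4 := (tendsto_const_nhds (x := b.rep ω)).sub h1
    rw [sub_self] at h4
    have h5 := (continuous_enorm.tendsto (0 : ℝ)).comp h4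
    rw [enorm_zero] at h5
    exact h5
  · intro N hN w hw
    filter_upwards [hf N hN w hw, b.coeFn_eq_rep, ae_all_iff.2 fun n => (a n).coeFn_eq_rep]
      with ω h1 h2 h3
    rw [h1, h2, h3]

/-- If the inequality fails at `x`, a perturbation of both sides by less than a third of the random
gap on {g x < f x} cannot restore it. -/
theorem isClosed_le_on {E : Type*} [TopologicalSpace E] {f g : E → L0 P ℱ t}
    (hf : @Continuous _ _ _ (l0Topology P ℱ t) f) (hg : @Continuous _ _ _ (l0Topology P ℱ t) g)
    {A : Set Ω} :
    IsClosed {x | ∀ᵐ ω ∂P, ω ∈ A → (f x).1 ω ≤ (g x).1 ω} := by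
  classical
  let _ := l0Topology P ℱ t
  rw [← isOpen_compl_iff, isOpen_iff_mem_nhds]
  intro x hx
  let e : Ω → ℝ := fun ω => if (g x).rep ω < (f x).rep ω then ((f x).rep ω - (g x).rep ω) / 3 else 1
  have he : Measurable[ℱ t] e := Measurable.ite
    (measurableSet_lt (g x).measurable_rep (f x).measurable_rep)
    (((f x).measurable_rep.sub (g x).measurable_rep).div_const 3) measurable_const
  have hepos : ∀ ω, 0 < e ω := fun ω => by
    simp only [e]
    split_ifs with h
    · linarith
    · exact one_pos
  -- Strict balls of random radius are open: around each member, half of the remaining margin is an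
  -- admissible radius.
  have key : ∀ b : L0 P ℱ t, {n : L0 P ℱ t | ∀ᵐ ω ∂P, |b.1 ω - n.1 ω| < e ω} ∈ 𝓝 b := by
    intro b
    refine IsOpen.mem_nhds ?_ (by
      change ∀ᵐ ω ∂P, |b.1 ω - b.1 ω| < e ω
      exact Eventually.of_forall fun ω => by rw [sub_self, abs_zero]; exact hepos ω)
    intro n hn
    have hr : Measurable[ℱ t] fun ω => (e ω - |b.rep ω - n.rep ω|) / 2 :=
      (he.sub (continuous_abs.measurable.comp (b.measurable_rep.sub n.measurable_rep))).div_const 2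
    have hn' : ∀ᵐ ω ∂P, |b.1 ω - n.1 ω| < e ω := hn
    refine ⟨L0.of P _ hr, ?_, fun y hy => ?_⟩
    · filter_upwards [L0.coeFn_of (P := P) _ hr, hn', b.coeFn_eq_rep, n.coeFn_eq_rep]
        with ω a1 a2 a3 a4
      rw [a1, ← a3, ← a4]; linarith
    · change ∀ᵐ ω ∂P, |b.1 ω - y.1 ω| < e ω
      filter_upwards [L0.coeFn_of (P := P) _ hr, hn', b.coeFn_eq_rep, n.coeFn_eq_rep, hy]
        with ω a1 a2 a3 a4 a5
      rw [a1, ← a3, ← a4, ← ofReal_norm, ENNReal.ofReal_le_ofReal_iff (by linarith),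
        Real.norm_eq_abs] at a5
      have := abs_sub_le (b.1 ω) (n.1 ω) (y.1 ω)
      linarith
  filter_upwards [hf.continuousAt.preimage_mem_nhds (key (f x)),
    hg.continuousAt.preimage_mem_nhds (key (g x))] with y h1 h2 hy
  refine hx ?_
  have h1' : ∀ᵐ ω ∂P, |(f x).1 ω - (f y).1 ω| < e ω := h1
  have h2' : ∀ᵐ ω ∂P, |(g x).1 ω - (g y).1 ω| < e ω := h2
  have hy' : ∀ᵐ ω ∂P, ω ∈ A → (f y).1 ω ≤ (g y).1 ω := hy
  change ∀ᵐ ω ∂P, ω ∈ A → (f x).1 ω ≤ (g x).1 ω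
  filter_upwards [h1', h2', hy', (f x).coeFn_eq_rep, (g x).coeFn_eq_rep] with ω a1 a2 a3 a4 a5 hω
  by_contra hcon
  rw [not_le] at hcon
  have : e ω = ((f x).1 ω - (g x).1 ω) / 3 := by
    simp only [e]
    rw [if_pos (by rwa [← a4, ← a5]), a4, a5]
  rw [this] at a1 a2
  have b1 := (abs_lt.1 a1).2
  have b2 := (abs_lt.1 a2).1
  have b3 := a3 hω
  linarith

end

/-! ### Upper semicontinuity along dominated sequences. -/

section

variable {Ω : Type*} {mΩ : MeasurableSpace Ω} {P : Measure Ω} [IsProbabilityMeasure P] {T : ℕ}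
  {ℱ : Filtration (Fin (T + 1)) mΩ} {t : Fin (T + 1)} {μ : Fin (T + 1) → ℝ} {p q : ℝ≥0∞}

omit [IsProbabilityMeasure P] in
theorem aestronglyMeasurable_comb {m : MeasurableSpace Ω} {f g h : Ω → ℝ}
    (hf : AEStronglyMeasurable[m] f P) (hg : AEStronglyMeasurable[m] g P) {a b : Ω → ℝ}
    (ha : Measurable[m] a) (hb : Measurable[m] b)
    (hW : ∀ᵐ ω ∂P, h ω = a ω * f ω + b ω * g ω) : AEStronglyMeasurable[m] h P :=
  ((ha.stronglyMeasurable.aestronglyMeasurable.mul hf).add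
    (hb.stronglyMeasurable.aestronglyMeasurable.mul hg)).congr (hW.mono fun _ h => h.symm)

/-- The process `a X + b Y`. -/
def combProc (a b : Ω → ℝ) (ha : Measurable a) (hb : Measurable b) (X Y : Proc T P) : Proc T P :=
  fun s => AEEqFun.mk (fun ω => a ω * X s ω + b ω * Y s ω)
    ((ha.aestronglyMeasurable.mul (X s).aestronglyMeasurable).add
      (hb.aestronglyMeasurable.mul (Y s).aestronglyMeasurable))

omit [IsProbabilityMeasure P] in
theorem exists_comb {a b : Ω → ℝ} (ha : Measurable[ℱ t] a) (hb : Measurable[ℱ t] b)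
    {X Y : Proc T P} (hX : Adapted ℱ X) (hY : Adapted ℱ Y) (hX0 : ∀ s < t, X s = 0)
    (hY0 : ∀ s < t, Y s = 0) : ∃ W : Proc T P, Adapted ℱ W ∧ (∀ s < t, W s = 0) ∧
      ∀ s, ∀ᵐ ω ∂P, W s ω = a ω * X s ω + b ω * Y s ω := by
  let W := combProc a b (ha.mono (ℱ.le t) le_rfl) (hb.mono (ℱ.le t) le_rfl) X Y
  have hW : ∀ s, ∀ᵐ ω ∂P, W s ω = a ω * X s ω + b ω * Y s ω := fun s => AEEqFun.coeFn_mk _ _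
  have hW0 : ∀ s < t, W s = 0 := fun s hs => by
    ext1
    filter_upwards [hW s, AEEqFun.coeFn_zero (μ := P) (β := ℝ)] with ω h1 h2
    rw [h1, hX0 s hs, hY0 s hs, h2]; simp
  refine ⟨W, fun s => ?_, hW0, hW⟩
  rcases lt_or_ge s t with hs | hs
  · rw [hW0 s hs]; exact aestronglyMeasurable_zero.congr AEEqFun.coeFn_zero.symm
  · exact aestronglyMeasurable_comb (hX s) (hY s) (ha.mono (ℱ.mono hs) le_rfl)
      (hb.mono (ℱ.mono hs) le_rfl) (hW s)

theorem Ltp.locLp (hμ : ∀ s, t ≤ s → 0 < μ s) (hp : p ≠ 0) (X : Ltp P ℱ t μ p) (s : Fin (T + 1)) :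
    LocLp (ℱ t) p (X.1 s) P := ((memLtp_iff hμ hp).1 X.2).2.2 s

theorem Ltp.exists_comb (hμ : ∀ s, t ≤ s → 0 < μ s) (hp : p ≠ 0) {a b : Ω → ℝ}
    (ha : Measurable[ℱ t] a) (hb : Measurable[ℱ t] b) (X Y : Ltp P ℱ t μ p) :
    ∃ W : Ltp P ℱ t μ p, ∀ s, ∀ᵐ ω ∂P, W.1 s ω = a ω * X.1 s ω + b ω * Y.1 s ω := by
  obtain ⟨W, h1, h2, h3⟩ := PathAI.exists_comb ha hb X.2.1 Y.2.1 X.2.2.1 Y.2.2.1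
  refine ⟨⟨W, (memLtp_iff hμ hp).2 ⟨h1, h2, fun s => ?_⟩⟩, h3⟩
  exact (((X.locLp hμ hp s).mul_left (ℱ.le t) ha).add (ℱ.le t)
    ((Y.locLp hμ hp s).mul_left (ℱ.le t) hb)).congr (ℱ.le t) (h3 s)

theorem Ltp.exists_glue (hμ : ∀ s, t ≤ s → 0 < μ s) (hp : p ≠ 0) {N : Ω → ℕ}
    (hN : Measurable[ℱ t] N) (Y : ℕ → Ltp P ℱ t μ p) :
    ∃ W : Ltp P ℱ t μ p, ∀ s, ∀ᵐ ω ∂P, W.1 s ω = (Y (N ω)).1 s ω := by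
  obtain ⟨h1, h2⟩ := adapted_glue hN (fun n => (Y n).2.1) (fun n => (Y n).2.2.1)
  have h3 := coeFn_glue (hN.mono (ℱ.le t) le_rfl) fun n => (Y n).1
  exact ⟨⟨_, (memLtp_iff hμ hp).2 ⟨h1, h2, fun s =>
    (LocLp.glue (ℱ.le t) (fun n => (Y n).locLp hμ hp s) hN).congr (ℱ.le t) (h3 s)⟩⟩, h3⟩

theorem pairing_glue [ENNReal.HolderConjugate p q] {N : Ω → ℕ} (hN : Measurable[ℱ t] N)
    {Z W : Proc T P} {Y : ℕ → Proc T P} (hZ : ∀ s, LocLp (ℱ t) q (Z s) P)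
    (hW : ∀ s, LocLp (ℱ t) p (W s) P) (hY : ∀ n s, LocLp (ℱ t) p (Y n s) P)
    (h : ∀ s, ∀ᵐ ω ∂P, W s ω = Y (N ω) s ω) :
    ∀ᵐ ω ∂P, (pairing P ℱ t μ Z W).1 ω = (pairing P ℱ t μ Z (Y (N ω))).1 ω := by
  have h1 : ∀ n, ∀ᵐ ω ∂P, ω ∈ {ω | N ω = n} →
      (pairing P ℱ t μ Z W).1 ω = (pairing P ℱ t μ Z (Y n)).1 ω := fun n =>
    pairing_congr_on hZ hW hZ (hY n) (hN (measurableSet_singleton n))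
      (fun s => Eventually.of_forall fun _ _ => rfl) fun s => by
        filter_upwards [h s] with ω hω hn
        rw [hω, show N ω = n from hn]
  filter_upwards [ae_all_iff.2 h1] with ω hω using hω _ rfl

/-- Dominated concatenations converge in the weak topology of `L^{t,p}`. -/
theorem Ltp.glueFilter_le_nhds_weak [ENNReal.HolderConjugate p q] (hμ : ∀ s, t ≤ s → 0 < μ s)
    {Y : ℕ → Ltp P ℱ t μ p} {X : Ltp P ℱ t μ p} {G : Fin (T + 1) → Ω → ℝ}
    (hG : ∀ s, LocLp (ℱ t) p (G s) P) (hYG : ∀ n s, ∀ᵐ ω ∂P, |(Y n).1 s ω| ≤ |G s ω|)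
    (hlim : ∀ s, ∀ᵐ ω ∂P, Tendsto (fun n => (Y n).1 s ω) atTop (𝓝 (X.1 s ω))) :
    glueFilter (ℱ t) (fun N (w : Ltp P ℱ t μ p) => ∀ s, ∀ᵐ ω ∂P, w.1 s ω = (Y (N ω)).1 s ω)
      ≤ @nhds _ (⨅ Z : Ltp P ℱ t μ q, TopologicalSpace.induced
        (fun X => pairing P ℱ t μ Z.1 X.1) (l0Topology P ℱ t)) X := by
  have hp : p ≠ 0 := ENNReal.HolderConjugate.ne_zero p q
  have hq : q ≠ 0 := ENNReal.HolderConjugate.ne_zero q p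
  rw [nhds_iInf]
  refine le_iInf fun Z => ?_
  rw [@nhds_induced _ _ (l0Topology P ℱ t), ← tendsto_iff_comap]
  refine tendsto_glueFilter_l0 (a := fun n => pairing P ℱ t μ Z.1 (Y n).1)
    (tendsto_pairing_right (Z.locLp hμ hq) hG hYG hlim) ?_
  intro N hN w hw
  have h := pairing_glue (μ := μ) (p := p) (q := q) (Y := fun n => (Y n).1) hN (Z.locLp hμ hq)
    (w.locLp hμ hp) (fun n => (Y n).locLp hμ hp) hw
  exact h

/-- Dominated concatenations converge in the topology of the conditional `p`-norm. -/
theorem Ltp.glueFilter_le_nhds_norm (hμ : ∀ s, t ≤ s → 0 < μ s) (hp : p ≠ 0) (htop : p ≠ ∞)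
    {Y : ℕ → Ltp P ℱ t μ p} {X : Ltp P ℱ t μ p} {G : Fin (T + 1) → Ω → ℝ}
    (hG : ∀ s, LocLp (ℱ t) p (G s) P) (hYG : ∀ n s, ∀ᵐ ω ∂P, |(Y n).1 s ω| ≤ |G s ω|)
    (hlim : ∀ s, ∀ᵐ ω ∂P, Tendsto (fun n => (Y n).1 s ω) atTop (𝓝 (X.1 s ω))) :
    glueFilter (ℱ t) (fun N (w : Ltp P ℱ t μ p) => ∀ s, ∀ᵐ ω ∂P, w.1 s ω = (Y (N ω)).1 s ω)
      ≤ @nhds _ (ballTopology P ℱ t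
        (fun X Y ω => condNorm ℱ t μ p (fun s => X.1 s - Y.1 s) ω)) X := by
  have hXG : ∀ s, ∀ᵐ ω ∂P, |X.1 s ω| ≤ |G s ω| := fun s => by
    filter_upwards [hlim s, ae_all_iff.2 fun n => hYG n s] with ω h1 h2
      using le_of_tendsto' h1.abs h2
  have hpr : 0 < p.toReal := ENNReal.toReal_pos hp htop
  refine tendsto_glueFilter_ball (f := id) (δ := fun n => condNorm ℱ t μ p
    fun s => X.1 s - (Y n).1 s) (fun n => (measurable_condLExp _ _ _).pow_const _) ?_ ?_
  · let f : ℕ → Ω → ℝ≥0∞ := fun n ω => ∑ s ∈ Finset.Ici t,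
      ‖(X.1 s - (Y n).1 s : Ω →ₘ[P] ℝ) ω‖ₑ ^ p.toReal * ENNReal.ofReal (μ s)
    -- The limit obeys the same bound `|G|`, so `2 * |G|` dominates the differences.
    let Gp : Proc T P := fun s => AEEqFun.mk (fun ω => 2 * G s ω)
      ((hG s).aestronglyMeasurable.const_mul 2)
    have hGp : ∀ s, ∀ᵐ ω ∂P, Gp s ω = 2 * G s ω := fun s => AEEqFun.coeFn_mk _ _
    have h1 := tendsto_condLExp_zero (P := P) (ℱ.le t) (f := f)
      (fun n => Finset.aemeasurable_fun_sum _ fun s _ =>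
        ((X.1 s - (Y n).1 s).aestronglyMeasurable.enorm.pow_const _).mul_const _)
      (G := fun ω => ∑ s ∈ Finset.Ici t, ‖Gp s ω‖ₑ ^ p.toReal * ENNReal.ofReal (μ s))
      (Finset.aemeasurable_fun_sum _ fun s _ =>
        ((Gp s).aestronglyMeasurable.enorm.pow_const _).mul_const _)
      ((locLp_enorm_rpow_sum (ℱ.le t) hp htop fun s hs => hμ s (Finset.mem_Ici.1 hs)).2
        fun s _ => ((hG s).mul_left (ℱ.le t) (g := fun _ => 2) measurable_const).congr
          (ℱ.le t) (hGp s)) (fun n => by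
        filter_upwards [ae_all_iff.2 hGp, ae_all_iff.2 (hYG n), ae_all_iff.2 hXG,
          ae_all_iff.2 fun s => AEEqFun.coeFn_sub (X.1 s) ((Y n).1 s)] with ω a1 a2 a3 a4
        refine Finset.sum_le_sum fun s _ => ?_
        gcongr
        rw [a1, a4, enorm_le_iff_norm_le, Real.norm_eq_abs, Real.norm_eq_abs, abs_mul, abs_two,
          Pi.sub_apply]
        have := abs_sub (X.1 s ω) ((Y n).1 s ω)
        linarith [a2 s, a3 s]) (by
        filter_upwards [ae_all_iff.2 hlim, ae_all_iff.2 fun n => ae_all_iff.2 fun s =>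
          AEEqFun.coeFn_sub (X.1 s) ((Y n).1 s)] with ω a1 a2
        have : Tendsto (fun n => f n ω) atTop (𝓝 (∑ s ∈ Finset.Ici t, 0)) := by
          refine tendsto_finsetSum _ fun s _ => ?_
          have h2 := (tendsto_const_nhds (x := X.1 s ω)).sub (a1 s)
          rw [sub_self] at h2
          have h3 := (continuous_enorm.tendsto (0 : ℝ)).comp h2
          rw [enorm_zero] at h3
          have h4 := (ENNReal.continuous_rpow_const (y := p.toReal)).tendsto 0 |>.comp h3
          rw [ENNReal.zero_rpow_of_pos hpr] at h4
          have h5 := ENNReal.Tendsto.mul_const (b := ENNReal.ofReal (μ s)) h4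
            (Or.inr ENNReal.ofReal_ne_top)
          rw [zero_mul] at h5
          refine h5.congr fun n => ?_
          simp only [Function.comp_apply, a2, Pi.sub_apply]
        simpa using this)
    filter_upwards [h1] with ω hω
    have h4 := (ENNReal.continuous_rpow_const (y := 1 / p.toReal)).tendsto 0 |>.comp hω
    rw [ENNReal.zero_rpow_of_pos (one_div_pos.2 hpr)] at h4
    exact h4
  · intro N hN w hw
    have h2 : ∀ n, ∀ᵐ ω ∂P, ω ∈ {ω | N ω = n} →
        condNorm ℱ t μ p (fun s => X.1 s - w.1 s) ω
          = condNorm ℱ t μ p (fun s => X.1 s - (Y n).1 s) ω := by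
      intro n
      have h3 := condLExp_congr_on (P := P) (ℱ.le t)
        (f := fun ω' => ∑ s ∈ Finset.Ici t, ‖(X.1 s - w.1 s : Ω →ₘ[P] ℝ) ω'‖ₑ ^ p.toReal
          * ENNReal.ofReal (μ s))
        (g := fun ω' => ∑ s ∈ Finset.Ici t, ‖(X.1 s - (Y n).1 s : Ω →ₘ[P] ℝ) ω'‖ₑ ^ p.toReal
          * ENNReal.ofReal (μ s))
        (Finset.aemeasurable_fun_sum _ fun s _ =>
          ((X.1 s - w.1 s).aestronglyMeasurable.enorm.pow_const _).mul_const _)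
        (Finset.aemeasurable_fun_sum _ fun s _ =>
          ((X.1 s - (Y n).1 s).aestronglyMeasurable.enorm.pow_const _).mul_const _)
        (hN (measurableSet_singleton n)) (by
          filter_upwards [ae_all_iff.2 hw, ae_all_iff.2 fun s =>
            AEEqFun.coeFn_sub (X.1 s) ((Y n).1 s), ae_all_iff.2 fun s =>
            AEEqFun.coeFn_sub (X.1 s) (w.1 s)] with ω a1 a2 a3 hn
          refine Finset.sum_congr rfl fun s _ => ?_
          rw [a2, a3, Pi.sub_apply, Pi.sub_apply, a1 s, show N ω = n from hn])
      filter_upwards [h3] with ω hω hn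
      simp only [condNorm]
      rw [hω hn]
    filter_upwards [ae_all_iff.2 h2] with ω hω
    exact (hω _ rfl).le

/-- A function on `L^{t,p}` with closed upper level sets that is local is upper semicontinuous
along dominated almost surely convergent sequences, on each `𝓕_t`-measurable set. -/
theorem IsUSCAssessmentIndex.le_of_tendsto [ENNReal.HolderConjugate p q]
    (hμ : ∀ s, t ≤ s → 0 < μ s) {F : Ltp P ℱ t μ p → L0bar P ℱ t} (hF : IsUSCAssessmentIndex F)
    {B : Set Ω} (hB : MeasurableSet[ℱ t] B) {c : EReal} {Y : ℕ → Ltp P ℱ t μ p}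
    {X : Ltp P ℱ t μ p} {G : Fin (T + 1) → Ω → ℝ} (hG : ∀ s, LocLp (ℱ t) p (G s) P)
    (hYG : ∀ n s, ∀ᵐ ω ∂P, |(Y n).1 s ω| ≤ |G s ω|)
    (hlim : ∀ s, ∀ᵐ ω ∂P, Tendsto (fun n => (Y n).1 s ω) atTop (𝓝 (X.1 s ω)))
    (hc : ∀ n, ∀ᵐ ω ∂P, ω ∈ B → c ≤ (F (Y n)).1 ω) : ∀ᵐ ω ∂P, ω ∈ B → c ≤ (F X).1 ω := by
  classical
  have hp : p ≠ 0 := ENNReal.HolderConjugate.ne_zero p q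
  -- Level `c` on `B` and ⊥ elsewhere: a single closed upper level set encodes the inequality on `B`
  -- alone.
  have hk : Measurable[ℱ t] fun ω => if ω ∈ B then c else ⊥ :=
    Measurable.ite hB measurable_const measurable_const
  let k : L0bar P ℱ t := L0bar.of P _ hk
  have hkF : ∀ W : Ltp P ℱ t μ p, k ≤ F W ↔ ∀ᵐ ω ∂P, ω ∈ B → c ≤ (F W).1 ω := by
    intro W
    rw [L0bar.le_iff]
    refine eventually_congr ?_
    filter_upwards [L0bar.coeFn_of (P := P) _ hk] with ω h1
    rw [h1]
    by_cases hω : ω ∈ B <;> simp [hω]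
  let Gl : (Ω → ℕ) → Ltp P ℱ t μ p → Prop := fun N w => ∀ s, ∀ᵐ ω ∂P, w.1 s ω = (Y (N ω)).1 s ω
  rw [← hkF]
  let _ := ltpTopology P ℱ t μ p
  refine mem_of_isClosed_of_glue (m := ℱ t) (G := Gl) (hF.usc k) (x := X) ?_ fun N hN => ?_
  · by_cases htop : p = ∞
    · have hq : q = 1 := (ENNReal.HolderConjugate.eq_top_iff_eq_one p q).1 htop
      subst hq
      rw [show ltpTopology P ℱ t μ p = _ from if_pos htop]
      exact Ltp.glueFilter_le_nhds_weak hμ hG hYG hlim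
    · rw [show ltpTopology P ℱ t μ p = _ from if_neg htop]
      exact Ltp.glueFilter_le_nhds_norm hμ hp htop hG hYG hlim
  · obtain ⟨w, hw⟩ := Ltp.exists_glue hμ hp hN Y
    refine ⟨w, hw, ?_⟩
    change k ≤ F w
    rw [hkF]
    have h1 : ∀ n, ∀ᵐ ω ∂P, ω ∈ {ω | N ω = n} → (F w).1 ω = (F (Y n)).1 ω := fun n => by
      filter_upwards [hF.isLocal {ω | N ω = n} (hN (measurableSet_singleton n)) (Y n) w w
        (fun s => by
          filter_upwards [hw s] with ω hω
          exact ⟨fun hn => by rw [hω, show N ω = n from hn], fun _ => rfl⟩)] with ω hω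
      exact hω.1
    filter_upwards [ae_all_iff.2 h1, ae_all_iff.2 hc] with ω a1 a2 hω
    rw [a1 _ rfl]
    exact a2 _ hω

end

/-! ### Stability of the dual set and lower semicontinuity of R⁻. -/

section

section

variable {Ω : Type*} {m mΩ : MeasurableSpace Ω} {P : Measure Ω}

/-- The limsup of `m`-measurable representatives, taken in `EReal`, is `m`-measurable without any
completeness of `m`, and it agrees almost surely with `g`. -/
theorem aestronglyMeasurable_of_tendsto_ae_of_le {f : ℕ → Ω → ℝ} {g : Ω → ℝ}
    (hf : ∀ n, AEStronglyMeasurable[m] (f n) P)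
    (h : ∀ᵐ ω ∂P, Tendsto (fun n => f n ω) atTop (𝓝 (g ω))) : AEStronglyMeasurable[m] g P := by
  have hm : Measurable[m] fun ω => (limsup (fun n => (((hf n).mk _ ω : ℝ) : EReal)) atTop).toReal :=
    (Measurable.limsup fun n =>
      (hf n).stronglyMeasurable_mk.measurable.coe_real_ereal).ereal_toReal
  refine ⟨_, hm.stronglyMeasurable, ?_⟩
  filter_upwards [h, ae_all_iff.2 fun n => (hf n).ae_eq_mk] with ω h1 h2
  have h3 := (continuous_coe_real_ereal.tendsto (g ω)).comp h1
  have h4 : Tendsto (fun n => (((hf n).mk _ ω : ℝ) : EReal)) atTop (𝓝 (g ω : EReal)) := by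
    refine h3.congr fun n => ?_
    simp only [Function.comp_apply, h2]
  rw [h4.limsup_eq, EReal.toReal_coe]

end

variable {Ω : Type*} {mΩ : MeasurableSpace Ω} {P : Measure Ω} [IsProbabilityMeasure P] {T : ℕ}
  {ℱ : Filtration (Fin (T + 1)) mΩ} {t : Fin (T + 1)} {μ : Fin (T + 1) → ℝ} {p q : ℝ≥0∞}

omit [IsProbabilityMeasure P] in
theorem IsDual.locLp {Z : Proc T P} (hZ : IsDual ℱ t μ q Z) (s : Fin (T + 1)) :
    LocLp (ℱ t) q (Z s) P := LocLp.of_memLp (hZ.memLp s)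

theorem MD.isDual (p : ℝ≥0∞) [ENNReal.HolderConjugate p q] (hμ : ∀ s, t ≤ s → 0 < μ s)
    (Z : MD P ℱ t μ q) : IsDual ℱ t μ q Z.1 := by
  obtain ⟨Z, Q, D, h, rfl⟩ := Z
  exact isDual_otimes (p := p) hμ h

/-- The element of the dual set given by a normalized nonnegative process. -/
def IsDual.toMD (hμ : ∀ s, t ≤ s → 0 < μ s) {Z : Proc T P} (hZ : IsDual ℱ t μ q Z) :
    MD P ℱ t μ q := ⟨Z, exists_admissible_of_isDual hμ hZ⟩

theorem Ltp.exists_const (hμ : ∀ s, t ≤ s → 0 < μ s) (hp : p ≠ 0) {r : Ω → ℝ}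
    (hr : Measurable[ℱ t] r) :
    ∃ W : Ltp P ℱ t μ p, ∀ s, t ≤ s → ∀ᵐ ω ∂P, W.1 s ω = r ω := by
  let r' : Ω →ₘ[P] ℝ := AEEqFun.mk r (hr.mono (ℱ.le t) le_rfl).aestronglyMeasurable
  have hr' : ∀ᵐ ω ∂P, r' ω = r ω := AEEqFun.coeFn_mk _ _
  refine ⟨⟨fun s => if t ≤ s then r' else 0, (memLtp_iff hμ hp).2 ⟨fun s => ?_, fun s hs => ?_,
    fun s => ?_⟩⟩, fun s hs => ?_⟩
  · by_cases hs : t ≤ s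
    · simp only [if_pos hs]
      exact (hr.mono (ℱ.mono hs) le_rfl).stronglyMeasurable.aestronglyMeasurable.congr
        (AEEqFun.coeFn_mk _ _).symm
    · simp only [if_neg hs]
      exact aestronglyMeasurable_zero.congr AEEqFun.coeFn_zero.symm
  · simp [not_le.2 hs]
  · by_cases hs : t ≤ s
    · simp only [if_pos hs]
      exact (LocLp.of_measurable (ℱ.le t) hr).congr (ℱ.le t) hr'
    · simp only [if_neg hs]
      exact LocLp.of_memLp ((memLp_congr_ae AEEqFun.coeFn_zero).2 MemLp.zero)
  · simp only [if_pos hs]; exact hr'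

omit [IsProbabilityMeasure P] in
theorem pairing_one {Z E : Proc T P} (hE : ∀ s, t ≤ s → ∀ᵐ ω ∂P, E s ω = 1) :
    ∀ᵐ ω ∂P, (pairing P ℱ t μ Z E).1 ω
      = condE ℱ t P (fun ω => ∑ s ∈ Finset.Ici t, Z s ω * μ s) ω := by
  filter_upwards [coeFn_pairing (ℱ := ℱ) (t := t) (μ := μ) Z E, condE_congr (ℱ := ℱ) (t := t)
    (P := P) (f := fun ω => ∑ s ∈ Finset.Ici t, Z s ω * E s ω * μ s)
    (g := fun ω => ∑ s ∈ Finset.Ici t, Z s ω * μ s) (by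
      filter_upwards [(Finset.eventually_all (Finset.Ici t)).2
        fun s hs => hE s (Finset.mem_Ici.1 hs)] with ω hω
      exact Finset.sum_congr rfl fun s hs => by rw [hω s hs, mul_one])] with ω a1 a2
  rw [a1, a2]

/-- Since Z is normalized, an 𝓕_t-measurable amount held constant over {t, …, T} pairs to itself. -/
theorem IsDual.pairing_add_const [ENNReal.HolderConjugate p q] (hμ : ∀ s, t ≤ s → 0 < μ s)
    {Z : Proc T P} (hZ : IsDual ℱ t μ q Z) {X W : Ltp P ℱ t μ p} {a b : Ω → ℝ}
    (ha : Measurable[ℱ t] a) (hb : Measurable[ℱ t] b)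
    (h : ∀ s, t ≤ s → ∀ᵐ ω ∂P, W.1 s ω = a ω * X.1 s ω + b ω) :
    ∀ᵐ ω ∂P, (pairing P ℱ t μ Z W.1).1 ω = a ω * (pairing P ℱ t μ Z X.1).1 ω + b ω := by
  have hp : p ≠ 0 := ENNReal.HolderConjugate.ne_zero p q
  obtain ⟨E, hE⟩ := Ltp.exists_const (P := P) hμ hp (r := fun _ => 1)
    (measurable_const : Measurable[ℱ t] _)
  have h1 := pairing_comb_right (μ := μ) (W := W.1) hZ.locLp (X.locLp hμ hp) (E.locLp hμ hp) ha hb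
    (fun s hs => by
      filter_upwards [h s hs, hE s hs] with ω a1 a2
      rw [a1, a2, mul_one])
  filter_upwards [h1, pairing_one (μ := μ) (Z := Z) hE, hZ.norm] with ω a1 a2 a3
  rw [a1, a2, a3, mul_one]

theorem isDual_of_pairing_one (hμ : ∀ s, t ≤ s → 0 < μ s) {Z : Proc T P} (h1 : Adapted ℱ Z)
    (h2 : ∀ s < t, Z s = 0) (h3 : ∀ s, ∀ᵐ ω ∂P, 0 ≤ Z s ω) (h4 : ∀ s, MemLp (Z s) q P)
    (hp : p ≠ 0)
    (h5 : ∀ E : Ltp P ℱ t μ p, (∀ s, t ≤ s → ∀ᵐ ω ∂P, E.1 s ω = 1) →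
      ∀ᵐ ω ∂P, (pairing P ℱ t μ Z E.1).1 ω = 1) : IsDual ℱ t μ q Z := by
  refine ⟨h1, h2, h3, h4, ?_⟩
  obtain ⟨E, hE⟩ := Ltp.exists_const (P := P) (p := p) hμ hp (r := fun _ => 1)
    (measurable_const : Measurable[ℱ t] _)
  filter_upwards [h5 E hE, pairing_one (ℱ := ℱ) (μ := μ) (Z := Z) hE] with ω a1 a2
  rw [← a2, a1]

theorem memLp_comb {Ω : Type*} {m mΩ : MeasurableSpace Ω} {P : Measure Ω} {f g h : Ω → ℝ} (hm : m ≤ mΩ) (hf : MemLp f q P)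
    (hg : MemLp g q P) {l : Ω → ℝ} (hl : Measurable[m] l)
    (hl01 : ∀ᵐ ω ∂P, 0 ≤ l ω ∧ l ω ≤ 1) (hW : ∀ᵐ ω ∂P, h ω = l ω * f ω + (1 - l ω) * g ω) :
    MemLp h q P := by
  have hl' : AEStronglyMeasurable l P :=
    (show @Measurable Ω ℝ mΩ _ l from hl.mono hm le_rfl).aestronglyMeasurable
  have i1 : MemLp (fun ω => l ω * f ω) q P := hf.mono (hl'.mul hf.1) (by
    filter_upwards [hl01] with ω hω
    rw [norm_mul, Real.norm_of_nonneg hω.1]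
    exact mul_le_of_le_one_left (norm_nonneg _) hω.2)
  have i2 : MemLp (fun ω => (1 - l ω) * g ω) q P :=
    hg.mono (((aestronglyMeasurable_const (b := (1 : ℝ))).sub hl').mul hg.1) (by
      filter_upwards [hl01] with ω hω
      rw [norm_mul, Real.norm_of_nonneg (by linarith [hω.2])]
      exact mul_le_of_le_one_left (norm_nonneg _) (by linarith [hω.1]))
  exact (memLp_congr_ae hW).2 (i1.add i2)

theorem IsDual.of_comb (p : ℝ≥0∞) [ENNReal.HolderConjugate p q] (hμ : ∀ s, t ≤ s → 0 < μ s)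
    {Z Z' W : Proc T P} (hZ : IsDual ℱ t μ q Z) (hZ' : IsDual ℱ t μ q Z') {l : Ω → ℝ}
    (hl : Measurable[ℱ t] l) (hl01 : ∀ᵐ ω ∂P, 0 ≤ l ω ∧ l ω ≤ 1)
    (hW : ∀ s, ∀ᵐ ω ∂P, W s ω = l ω * Z s ω + (1 - l ω) * Z' s ω) : IsDual ℱ t μ q W := by
  have hp : p ≠ 0 := ENNReal.HolderConjugate.ne_zero p q
  have hl' : Measurable[ℱ t] fun ω => 1 - l ω := measurable_const.sub hl
  have hW0 : ∀ s < t, W s = 0 := fun s hs => by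
    ext1
    filter_upwards [hW s, AEEqFun.coeFn_zero (μ := P) (β := ℝ)] with ω h1 h2
    rw [h1, hZ.zero s hs, hZ'.zero s hs, h2]; simp
  refine isDual_of_pairing_one (p := p) hμ (fun s => ?_) hW0 (fun s => ?_) (fun s => ?_) hp ?_
  · rcases lt_or_ge s t with hs | hs
    · rw [hW0 s hs]; exact aestronglyMeasurable_zero.congr AEEqFun.coeFn_zero.symm
    · exact aestronglyMeasurable_comb (hZ.adapted s) (hZ'.adapted s) (hl.mono (ℱ.mono hs) le_rfl)
        (hl'.mono (ℱ.mono hs) le_rfl) (hW s)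
  · filter_upwards [hW s, hZ.nonneg s, hZ'.nonneg s, hl01] with ω h1 h2 h3 h4
    rw [h1]
    exact add_nonneg (mul_nonneg h4.1 h2) (mul_nonneg (by linarith [h4.2]) h3)
  · exact memLp_comb (ℱ.le t) (hZ.memLp s) (hZ'.memLp s) hl hl01 (hW s)
  · intro E hE
    filter_upwards [pairing_comb_left (μ := μ) (W := W) hZ.locLp hZ'.locLp (E.locLp hμ hp) hl hl'
      (fun s _ => hW s), pairing_one (ℱ := ℱ) (μ := μ) (Z := Z) hE,
      pairing_one (ℱ := ℱ) (μ := μ) (Z := Z') hE, hZ.norm, hZ'.norm] with ω a1 a2 a3 a4 a5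
    rw [a1, a2, a3, a4, a5]; ring

theorem IsDual.of_tendsto (p : ℝ≥0∞) [ENNReal.HolderConjugate p q] (hμ : ∀ s, t ≤ s → 0 < μ s)
    {Z : ℕ → Proc T P} {W : Proc T P} (hZ : ∀ n, IsDual ℱ t μ q (Z n)) {h : Ω → ℝ}
    (hh : MemLp h q P) (hZh : ∀ n s, ∀ᵐ ω ∂P, |Z n s ω| ≤ |h ω|)
    (hlim : ∀ s, ∀ᵐ ω ∂P, Tendsto (fun n => Z n s ω) atTop (𝓝 (W s ω))) :
    IsDual ℱ t μ q W := by
  have hp : p ≠ 0 := ENNReal.HolderConjugate.ne_zero p q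
  refine isDual_of_pairing_one (p := p) hμ (fun s => ?_) (fun s hs => ?_) (fun s => ?_)
    (fun s => ?_) hp ?_
  · exact aestronglyMeasurable_of_tendsto_ae_of_le (fun n => (hZ n).adapted s) (hlim s)
  · ext1
    filter_upwards [hlim s, AEEqFun.coeFn_zero (μ := P) (β := ℝ)] with ω h1 h2
    simp only [(hZ _).zero s hs, h2] at h1 ⊢
    exact tendsto_nhds_unique h1 tendsto_const_nhds
  · filter_upwards [hlim s, ae_all_iff.2 fun n => (hZ n).nonneg s] with ω h1 h2
    exact ge_of_tendsto' h1 h2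
  · refine hh.mono (W s).aestronglyMeasurable ?_
    filter_upwards [hlim s, ae_all_iff.2 fun n => hZh n s] with ω h1 h2
    exact le_of_tendsto' h1.norm h2
  · intro E hE
    filter_upwards [tendsto_pairing_left (μ := μ) (Y := Z) (Z := W) (G := fun _ => h)
      (E.locLp hμ hp) (fun _ => LocLp.of_memLp (m := ℱ t) hh) hZh hlim,
      ae_all_iff.2 fun n => pairing_one (ℱ := ℱ) (μ := μ) (Z := Z n) hE,
      ae_all_iff.2 fun n => (hZ n).norm] with ω a1 a2 a3
    simp only [a2, a3] at a1
    exact tendsto_nhds_unique a1 tendsto_const_nhds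

/-- The common bound `h` keeps the concatenation in L^q itself, which the dual set requires; without
it only local integrability would survive. -/
theorem IsDual.exists_glue {Z : ℕ → Proc T P} (hZ : ∀ n, IsDual ℱ t μ q (Z n)) {h : Ω → ℝ}
    (hh : MemLp h q P) (hZh : ∀ n s, ∀ᵐ ω ∂P, |Z n s ω| ≤ |h ω|) {N : Ω → ℕ}
    (hN : Measurable[ℱ t] N) :
    ∃ W : Proc T P, IsDual ℱ t μ q W ∧ ∀ s, ∀ᵐ ω ∂P, W s ω = Z (N ω) s ω := by
  obtain ⟨h1, h2⟩ := adapted_glue hN (fun n => (hZ n).adapted) (fun n => (hZ n).zero)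
  have h3 := coeFn_glue (hN.mono (ℱ.le t) le_rfl) Z
  have h4 : ∀ s, MemLp (glue (hN.mono (ℱ.le t) le_rfl) Z s) q P := fun s => by
    refine hh.mono (AEEqFun.aestronglyMeasurable _) ?_
    filter_upwards [h3 s, ae_all_iff.2 fun n => hZh n s] with ω a1 a2
    rw [a1]; exact a2 _
  refine ⟨_, ⟨h1, h2, fun s => ?_, h4, ?_⟩, h3⟩
  · filter_upwards [h3 s, ae_all_iff.2 fun n => (hZ n).nonneg s] with ω a1 a2
    rw [a1]; exact a2 _
  · have hm : ∀ W : Proc T P, AEStronglyMeasurable (fun ω => ∑ s ∈ Finset.Ici t, W s ω * μ s) P :=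
      fun W => Finset.aestronglyMeasurable_fun_sum _ fun s _ =>
        (W s).aestronglyMeasurable.mul_const _
    have h5 : ∀ n, ∀ᵐ ω ∂P, ω ∈ {ω | N ω = n} →
        condE ℱ t P (fun ω => ∑ s ∈ Finset.Ici t,
          glue (hN.mono (ℱ.le t) le_rfl) Z s ω * μ s) ω
        = condE ℱ t P (fun ω => ∑ s ∈ Finset.Ici t, Z n s ω * μ s) ω := fun n =>
      condE_congr_on (hm _) (hm _) (hN (measurableSet_singleton n)) (by
        filter_upwards [ae_all_iff.2 h3] with ω hω hn
        exact Finset.sum_congr rfl fun s _ => by rw [hω, show N ω = n from hn])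
    filter_upwards [ae_all_iff.2 h5, ae_all_iff.2 fun n => (hZ n).norm] with ω a1 a2
    rw [a1 _ rfl, a2]

/-- The sum of an element of `L⁰(𝓕_t)` and a constant. -/
def L0.addConst (v : L0 P ℱ t) (a : ℝ) : L0 P ℱ t :=
  L0.of P (fun ω => v.rep ω + a) (v.measurable_rep.add_const a)

omit [IsProbabilityMeasure P] in
theorem L0.coeFn_addConst (v : L0 P ℱ t) (a : ℝ) : ∀ᵐ ω ∂P, (v.addConst a).1 ω = v.1 ω + a := by
  filter_upwards [L0.coeFn_of (P := P) _ (v.measurable_rep.add_const a), v.coeFn_eq_rep]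
    with ω h1 h2
  rw [L0.addConst, h1, h2]

omit [IsProbabilityMeasure P] in
-- At a real-valued `v` the essential supremum over all arguments strictly below `v` can be tested
-- along v - 1/(k+1): any such argument lies below one of these, with k depending on ω, and locality
-- allows the choice event by event.
theorem leftVersion_le_iff {R S : L0bar P ℱ t → L0bar P ℱ t}
    (hloc : ∀ A, MeasurableSet[ℱ t] A → ∀ n n' : L0bar P ℱ t, (∀ᵐ ω ∂P, ω ∈ A → n.1 ω = n'.1 ω) →
      ∀ᵐ ω ∂P, ω ∈ A → (R n).1 ω = (R n').1 ω) (hmono : Monotone R) (hS : IsLeftVersion R S)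
    (v : L0 P ℱ t) (c : L0bar P ℱ t) :
    S v.toBar ≤ c ↔ ∀ k : ℕ, R (v.addConst (-(1 / ((k : ℝ) + 1)))).toBar ≤ c := by
  constructor
  · intro h k
    refine le_trans ((hS v.toBar).1 ⟨(v.addConst (-(1 / ((k : ℝ) + 1)))).toBar, ?_, ?_⟩) h
    · filter_upwards [L0.coeFn_toBar v, L0.coeFn_toBar (v.addConst (-(1 / ((k : ℝ) + 1)))),
        v.coeFn_addConst (-(1 / ((k : ℝ) + 1)))] with ω a1 a2 a3 _
      rw [a1, a2, a3, EReal.coe_lt_coe_iff]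
      have : (0 : ℝ) < 1 / ((k : ℝ) + 1) := by positivity
      linarith
    · filter_upwards [L0.coeFn_toBar v] with ω a1
      exact ⟨fun _ => rfl, fun h => absurd h (by rw [a1]; exact EReal.coe_ne_bot _)⟩
  · intro h
    refine (hS v.toBar).2 ?_
    rintro j ⟨n, hn, hj⟩
    rw [L0bar.le_iff]
    have hA : ∀ k : ℕ, MeasurableSet[ℱ t] {ω | n.rep ω ≤ ((v.rep ω + -(1 / ((k : ℝ) + 1)) : ℝ) : EReal)} :=
      fun k => measurableSet_le n.measurable_rep
        (v.measurable_rep.add_const _).coe_real_ereal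
    have h1 : ∀ k : ℕ, ∀ᵐ ω ∂P, ω ∈ {ω | n.rep ω ≤ ((v.rep ω + -(1 / ((k : ℝ) + 1)) : ℝ) : EReal)} →
        (R n).1 ω ≤ c.1 ω := by
      intro k
      let vk := (v.addConst (-(1 / ((k : ℝ) + 1)))).toBar
      have hvk : ∀ᵐ ω ∂P, vk.1 ω = ((v.rep ω + -(1 / ((k : ℝ) + 1)) : ℝ) : EReal) := by
        filter_upwards [L0.coeFn_toBar (v.addConst (-(1 / ((k : ℝ) + 1)))),
          v.coeFn_addConst (-(1 / ((k : ℝ) + 1))), v.coeFn_eq_rep] with ω a1 a2 a3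
        rw [a1, a2, a3]
      -- The minimum agrees with `n` where `n` is below the k-th test argument and never exceeds the
      -- latter, so locality and monotonicity both apply.
      let n' : L0bar P ℱ t := L0bar.of P (fun ω => min (n.rep ω) (vk.rep ω))
        (n.measurable_rep.min vk.measurable_rep)
      have hn' : ∀ᵐ ω ∂P, n'.1 ω = min (n.rep ω) (vk.rep ω) := L0bar.coeFn_of _ _
      have hle : n' ≤ vk := by
        rw [L0bar.le_iff]
        filter_upwards [hn', vk.coeFn_eq_rep] with ω a1 a2
        rw [a1, a2]; exact min_le_right _ _
      filter_upwards [hloc _ (hA k) n n' (by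
        filter_upwards [hn', n.coeFn_eq_rep, vk.coeFn_eq_rep, hvk] with ω a1 a2 a3 a4 hω
        rw [a1, a2, ← a3, a4, min_eq_left hω]), L0bar.le_iff.1 (hmono hle), L0bar.le_iff.1 (h k)]
        with ω a1 a2 a3 hω
      rw [a1 hω]; exact a2.trans a3
    filter_upwards [ae_all_iff.2 h1, hj, hn, L0.coeFn_toBar v, n.coeFn_eq_rep, v.coeFn_eq_rep]
      with ω a1 a2 a3 a4 a5 a6
    have hb : v.toBar.1 ω ≠ ⊥ := by rw [a4]; exact EReal.coe_ne_bot _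
    rw [a2.1 hb]
    have h3 := a3 hb
    rw [a4, a5, a6] at h3
    obtain ⟨r, hr1, hr2⟩ := EReal.lt_iff_exists_real_btwn.1 h3
    obtain ⟨k, hk⟩ := exists_nat_one_div_lt (sub_pos.2 (EReal.coe_lt_coe_iff.1 hr2))
    refine a1 k ?_
    refine hr1.le.trans ?_
    rw [EReal.coe_le_coe_iff]
    linarith

section RiskFunction

variable {R : MD P ℱ t μ q → L0bar P ℱ t → L0bar P ℱ t}

omit [IsProbabilityMeasure P] in
theorem IsMinimalRiskFunction.congr_on (hR : IsMinimalRiskFunction p R) {A : Set Ω}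
    (hA : MeasurableSet[ℱ t] A) {Z Z' : MD P ℱ t μ q} {n n' : L0bar P ℱ t}
    (hZ : ∀ k, ∀ᵐ ω ∂P, ω ∈ A → Z.1 k ω = Z'.1 k ω) (hn : ∀ᵐ ω ∂P, ω ∈ A → n.1 ω = n'.1 ω) :
    ∀ᵐ ω ∂P, ω ∈ A → (R Z n).1 ω = (R Z' n').1 ω := by
  filter_upwards [hR.isLocal A hA Z' Z Z n' n n
    (fun k => (hZ k).mono fun ω h => ⟨h, fun _ => rfl⟩) (hn.mono fun ω h => ⟨h, fun _ => rfl⟩)]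
    with ω h using h.1

/-- The left-continuous version of a minimal risk function is lower semicontinuous along dominated
almost surely convergent sequences, on each `𝓕_t`-measurable set. -/
theorem IsMinimalRiskFunction.le_of_tendsto [ENNReal.HolderConjugate p q]
    (hμ : ∀ s, t ≤ s → 0 < μ s) (hR : IsMinimalRiskFunction p R) {B : Set Ω}
    (hB : MeasurableSet[ℱ t] B) {c : EReal} {Z : ℕ → MD P ℱ t μ q} {v : ℕ → L0 P ℱ t}
    {Z' : MD P ℱ t μ q} {v' : L0 P ℱ t} {h : Ω → ℝ} (hh : MemLp h q P)
    (hZh : ∀ n s, ∀ᵐ ω ∂P, |(Z n).1 s ω| ≤ |h ω|)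
    (hlim : ∀ s, ∀ᵐ ω ∂P, Tendsto (fun n => (Z n).1 s ω) atTop (𝓝 (Z'.1 s ω)))
    (hlimv : ∀ᵐ ω ∂P, Tendsto (fun n => (v n).1 ω) atTop (𝓝 (v'.1 ω)))
    (hc : ∀ n (k : ℕ), ∀ᵐ ω ∂P, ω ∈ B →
      (R (Z n) ((v n).addConst (-(1 / ((k : ℝ) + 1)))).toBar).1 ω ≤ c) (k : ℕ) :
    ∀ᵐ ω ∂P, ω ∈ B → (R Z' (v'.addConst (-(1 / ((k : ℝ) + 1)))).toBar).1 ω ≤ c := by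
  classical
  have hp : p ≠ 0 := ENNReal.HolderConjugate.ne_zero p q
  obtain ⟨Rm, hRm, hclosed⟩ := hR.lsc
  -- The level ⊤ off `B` imposes nothing there, so closedness of one lower level set gives the
  -- statement on `B`.
  have hk : Measurable[ℱ t] fun ω => if ω ∈ B then c else ⊤ :=
    Measurable.ite hB measurable_const measurable_const
  let K : L0bar P ℱ t := L0bar.of P _ hk
  have hkF : ∀ f : L0bar P ℱ t, f ≤ K ↔ ∀ᵐ ω ∂P, ω ∈ B → f.1 ω ≤ c := by
    intro f
    rw [L0bar.le_iff]
    refine eventually_congr ?_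
    filter_upwards [L0bar.coeFn_of (P := P) _ hk] with ω h1
    rw [h1]
    by_cases hω : ω ∈ B <;> simp [hω]
  have hiff : ∀ (Z : MD P ℱ t μ q) (v : L0 P ℱ t), Rm Z v.toBar ≤ K ↔ ∀ k : ℕ, ∀ᵐ ω ∂P, ω ∈ B →
      (R Z (v.addConst (-(1 / ((k : ℝ) + 1)))).toBar).1 ω ≤ c := by
    intro Z v
    rw [leftVersion_le_iff (fun A hA n n' hn => hR.congr_on hA
      (fun _ => Eventually.of_forall fun _ _ => rfl) hn) (hR.increasing Z) (hRm Z) v K]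
    exact forall_congr' fun k => hkF _
  refine (hiff Z' v').1 ?_ k
  let Gl : (Ω → ℕ) → MD P ℱ t μ q × L0 P ℱ t → Prop := fun N w =>
    (∀ s, ∀ᵐ ω ∂P, w.1.1 s ω = (Z (N ω)).1 s ω) ∧ ∀ᵐ ω ∂P, w.2.1 ω = (v (N ω)).1 ω
  let _ := mdTopology P ℱ t μ p q
  let _ := l0Topology P ℱ t
  refine mem_of_isClosed_of_glue (m := ℱ t) (G := Gl) (hclosed K) (x := (Z', v')) ?_ fun N hN => ?_
  · rw [nhds_prod_eq]
    refine Tendsto.prodMk (f := glueFilter (ℱ t) Gl) (m₁ := fun w => w.1) (m₂ := fun w => w.2) ?_ ?_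
    · rw [mdTopology, nhds_iInf, tendsto_iInf]
      intro X
      rw [@nhds_induced _ _ (l0Topology P ℱ t), tendsto_comap_iff]
      refine tendsto_glueFilter_l0 (a := fun n => pairing P ℱ t μ (Z n).1 X.1)
        (tendsto_pairing_left (p := p) (q := q) (X.locLp hμ hp)
          (fun _ => LocLp.of_memLp (m := ℱ t) hh) hZh hlim) ?_
      intro N hN w hw
      have : ENNReal.HolderConjugate q p := ENNReal.HolderConjugate.symm
      have h2 := pairing_glue (μ := μ) (p := q) (q := p) (Y := fun n => (Z n).1) hN
        (X.locLp hμ hp) (MD.isDual p hμ w.1).locLp (fun n => (MD.isDual p hμ (Z n)).locLp) hw.1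
      filter_upwards [h2] with ω hω
      rw [Function.comp_apply, pairing_comm, hω, pairing_comm]
    · exact tendsto_glueFilter_l0 (a := v) hlimv fun N hN w hw => hw.2
  · obtain ⟨W, hW, hWN⟩ := IsDual.exists_glue (fun n => MD.isDual p hμ (Z n)) hh hZh hN
    have hvm : Measurable[ℱ t] fun ω => (v (N ω)).rep ω := by
      have h1 : @Measurable (ℕ × Ω) ℝ (@Prod.instMeasurableSpace _ _ _ (ℱ t)) _
          (fun z : ℕ × Ω => (v z.1).rep z.2) :=
        @measurable_from_prod_countable_right ℕ Ω ℝ _ (ℱ t) _ _ _ _ fun n => (v n).measurable_rep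
      exact h1.comp (hN.prodMk measurable_id)
    have hv : ∀ᵐ ω ∂P, (L0.of P _ hvm).1 ω = (v (N ω)).1 ω := by
      filter_upwards [L0.coeFn_of (P := P) _ hvm, ae_all_iff.2 fun n => (v n).coeFn_eq_rep]
        with ω h1 h2
      rw [h1, h2]
    refine ⟨(hW.toMD hμ, L0.of P _ hvm), ⟨hWN, hv⟩, ?_⟩
    change Rm _ (L0.of P _ hvm).toBar ≤ K
    rw [hiff]
    intro k
    have h1 : ∀ n, ∀ᵐ ω ∂P, ω ∈ {ω | N ω = n} →
        (R (hW.toMD hμ) ((L0.of P _ hvm).addConst (-(1 / ((k : ℝ) + 1)))).toBar).1 ω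
          = (R (Z n) ((v n).addConst (-(1 / ((k : ℝ) + 1)))).toBar).1 ω := fun n =>
      hR.congr_on (hN (measurableSet_singleton n)) (fun s => by
        filter_upwards [hWN s] with ω hω hn
        exact hω.trans (by rw [show N ω = n from hn])) (by
        filter_upwards [hv, L0.coeFn_toBar ((L0.of P _ hvm).addConst (-(1 / ((k : ℝ) + 1)))),
          L0.coeFn_toBar ((v n).addConst (-(1 / ((k : ℝ) + 1)))),
          (v n).coeFn_addConst (-(1 / ((k : ℝ) + 1))),
          (L0.of P _ hvm).coeFn_addConst (-(1 / ((k : ℝ) + 1)))] with ω a1 a2 a3 a4 a5 hn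
        rw [a2, a3, a4, a5, a1, show N ω = n from hn])
    filter_upwards [ae_all_iff.2 h1, ae_all_iff.2 fun n => hc n k] with ω a1 a2 hω
    rw [a1 _ rfl]
    exact a2 _ hω

end RiskFunction

end

/-! ### Conditional separation on an event. -/

section

variable {Ω : Type*} {mΩ : MeasurableSpace Ω} {P : Measure Ω} [IsProbabilityMeasure P] {T : ℕ}
  {ℱ : Filtration (Fin (T + 1)) mΩ} {t : Fin (T + 1)} {μ : Fin (T + 1) → ℝ} {p q : ℝ≥0∞}

theorem measurable_indicator_one {m : MeasurableSpace Ω} {A : Set Ω} (hA : MeasurableSet[m] A) :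
    Measurable[m] (A.indicator (1 : Ω → ℝ)) :=
  Measurable.indicator (m := m) (@measurable_const ℝ Ω _ m 1) hA

theorem integral_mul_condExp {m : MeasurableSpace Ω} (hm : m ≤ mΩ) {f g : Ω → ℝ}
    (hf : AEStronglyMeasurable[m] f P) (hg : Integrable g P) (hfg : Integrable (fun ω => g ω * f ω) P) :
    ∫ ω, (condExp m P g) ω * f ω ∂P = ∫ ω, g ω * f ω ∂P := by
  rw [← integral_condExp hm (f := fun ω => g ω * f ω)]
  exact integral_congr_ae (condExp_mul_of_aestronglyMeasurable_right hf hfg hg).symm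

/-- A process with prescribed scalar component is separated from a decomposable convex set by a
continuous linear functional, uniformly on an `𝓕_t`-measurable set. -/
theorem exists_local_separation [ENNReal.HolderConjugate p q] (hμ : ∀ s, t ≤ s → 0 < μ s)
    {K : Set (Proc T P × L0 P ℱ t)} (hKa : ∀ k ∈ K, Adapted ℱ k.1)
    (hK0 : ∀ k ∈ K, ∀ s < t, k.1 s = 0) (hKp : ∀ k ∈ K, ∀ s, MemLp (k.1 s) q P)
    (hKv : ∀ k ∈ K, MemLp k.2.1 q P)
    (hcomb : ∀ l : Ω → ℝ, Measurable[ℱ t] l → (∀ ω, 0 ≤ l ω ∧ l ω ≤ 1) → ∀ k₁ ∈ K, ∀ k₂ ∈ K,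
      ∀ w : Proc T P × L0 P ℱ t,
      (∀ s, ∀ᵐ ω ∂P, w.1 s ω = l ω * k₁.1 s ω + (1 - l ω) * k₂.1 s ω) →
      (∀ᵐ ω ∂P, w.2.1 ω = l ω * k₁.2.1 ω + (1 - l ω) * k₂.2.1 ω) → w ∈ K)
    (hcl : ∀ (k : ℕ → Proc T P × L0 P ℱ t) (h : Ω → ℝ), MemLp h q P → (∀ n, k n ∈ K) →
      (∀ n s, ∀ᵐ ω ∂P, |(k n).1 s ω| ≤ |h ω|) → ∀ w : Proc T P × L0 P ℱ t,
      (∀ s, ∀ᵐ ω ∂P, Tendsto (fun n => (k n).1 s ω) atTop (𝓝 (w.1 s ω))) →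
      (∀ᵐ ω ∂P, Tendsto (fun n => (k n).2.1 ω) atTop (𝓝 (w.2.1 ω))) → MemLp w.2.1 q P → w ∈ K)
    {x : Proc T P × L0 P ℱ t} (hxa : Adapted ℱ x.1) (hx0 : ∀ s < t, x.1 s = 0)
    (hxp : ∀ s, MemLp (x.1 s) q P) (hxv : MemLp x.2.1 q P) (hx : x ∉ K) (hne : K.Nonempty)
    {B : Set Ω} (hB : MeasurableSet[ℱ t] B)
    (hcatB : ∀ k ∈ K, ∀ w : Proc T P × L0 P ℱ t,
      (∀ s, ∀ᵐ ω ∂P, (ω ∈ B → w.1 s ω = k.1 s ω) ∧ (ω ∉ B → w.1 s ω = x.1 s ω)) →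
      (∀ᵐ ω ∂P, (ω ∈ B → w.2.1 ω = k.2.1 ω) ∧ (ω ∉ B → w.2.1 ω = x.2.1 ω)) → w ∈ K) :
    ∃ (X : Proc T P) (ξ : Ω → ℝ) (B' : Set Ω) (η : ℝ), Adapted ℱ X ∧ (∀ s < t, X s = 0) ∧
      (∀ s, MemLp (X s) p P) ∧ Measurable[ℱ t] ξ ∧ MeasurableSet[ℱ t] B' ∧ B' ⊆ B ∧ P B' ≠ 0 ∧
      0 < η ∧ ∀ k ∈ K, ∀ᵐ ω ∂P, ω ∈ B' → (pairing P ℱ t μ x.1 X).1 ω + ξ ω * x.2.1 ω + η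
        ≤ (pairing P ℱ t μ k.1 X).1 ω + ξ ω * k.2.1 ω := by
  classical
  have hpq' : ENNReal.HolderConjugate q p := ENNReal.HolderConjugate.symm
  have hp1 : 1 ≤ p := ENNReal.HolderConjugate.one_le p q
  -- The scalar component occupies the index `none`, so process and scalar form one finite family.
  let fam : Proc T P × L0 P ℱ t → Option (Fin (T + 1)) → Ω →ₘ[P] ℝ := fun k o => o.elim k.2.1 k.1
  obtain ⟨g, hg, δ, hδ, hsep⟩ := exists_separating_family (P := P) (p := q) (q := p)
    (K := fam '' K) (by
      rintro _ ⟨k, hk, rfl⟩ (_ | s)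
      · exact hKv k hk
      · exact hKp k hk s) (by
      rintro _ ⟨k₁, hk₁, rfl⟩ _ ⟨k₂, hk₂, rfl⟩ a b ha hb hab
      have hv : AEStronglyMeasurable[ℱ t] (a • k₁.2.1 + b • k₂.2.1 : Ω →ₘ[P] ℝ) P := by
        refine ((k₁.2.2.const_smul a).add (k₂.2.2.const_smul b)).congr ?_
        filter_upwards [AEEqFun.coeFn_add (a • k₁.2.1) (b • k₂.2.1), AEEqFun.coeFn_smul a k₁.2.1,
          AEEqFun.coeFn_smul b k₂.2.1] with ω a1 a2 a3
        rw [a1, Pi.add_apply, Pi.add_apply, a2, a3]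
      have hb' : b = 1 - a := by linarith
      have hco : ∀ f g : Ω →ₘ[P] ℝ, ∀ᵐ ω ∂P, (a • f + b • g : Ω →ₘ[P] ℝ) ω
          = a * f ω + (1 - a) * g ω := fun f g => by
        filter_upwards [AEEqFun.coeFn_add (a • f) (b • g), AEEqFun.coeFn_smul a f,
          AEEqFun.coeFn_smul b g] with ω a1 a2 a3
        rw [a1, Pi.add_apply, a2, a3, Pi.smul_apply, Pi.smul_apply, smul_eq_mul, smul_eq_mul, hb']
      refine ⟨(fun s => a • k₁.1 s + b • k₂.1 s, ⟨_, hv⟩), hcomb (fun _ => a) measurable_const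
        (fun _ => ⟨ha, by linarith⟩) k₁ hk₁ k₂ hk₂ _ (fun s => hco _ _) (hco _ _), ?_⟩
      funext o
      rcases o with _ | s <;> rfl) (by
      intro y h hh hy hyh z hz
      choose k hk hky using hy
      have hv : AEStronglyMeasurable[ℱ t] (z none) P := by
        refine aestronglyMeasurable_of_tendsto_ae_of_le (f := fun n => y n none) (fun n => ?_)
          (hz none)
        rw [← hky n]; exact (k n).2.2
      have hhv : MemLp (z none) q P := by
        refine hh.mono (z none).aestronglyMeasurable ?_
        filter_upwards [hz none, ae_all_iff.2 fun n => hyh n none] with ω a1 a2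
        exact le_of_tendsto' a1.norm fun n => (a2 n).trans (le_abs_self _)
      refine ⟨(fun s => z (some s), ⟨z none, hv⟩), hcl k h hh hk (fun n s => ?_) _ (fun s => ?_) ?_
        hhv, ?_⟩
      · filter_upwards [hyh n (some s)] with ω a1
        rw [← hky n] at a1
        exact a1.trans (le_abs_self _)
      · filter_upwards [hz (some s)] with ω a1
        simp only [← hky] at a1
        exact a1
      · filter_upwards [hz none] with ω a1
        simp only [← hky] at a1
        exact a1
      · funext o
        rcases o with _ | s <;> rfl)
    (x := fam x) (by
      rintro (_ | s)
      · exact hxv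
      · exact hxp s) (by
      rintro ⟨k, hk, hkx⟩
      refine hx ?_
      have : k = x := Prod.ext (funext fun s => congrFun hkx (some s))
        (Subtype.ext (congrFun hkx none))
      rwa [← this])
  have hgint : ∀ o, Integrable (g o) P := fun o => (hg o).integrable hp1
  -- Projecting the separating densities onto 𝓕_s does not change their integrals against adapted
  -- processes; dividing by μ_s turns the sum of integrals into the expectation of a pairing.
  let X : Proc T P := fun s => if hs : t ≤ s then AEEqFun.mk
    (fun ω => (μ s)⁻¹ * (condExp (ℱ s) P (g (some s))) ω)
    ((stronglyMeasurable_condExp.mono (ℱ.le s)).aestronglyMeasurable.const_mul _) else 0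
  have hX : ∀ s, t ≤ s → ∀ᵐ ω ∂P, X s ω = (μ s)⁻¹ * (condExp (ℱ s) P (g (some s))) ω := fun s hs => by
    simp only [X, dif_pos hs]
    exact AEEqFun.coeFn_mk _ _
  have hX0 : ∀ s < t, X s = 0 := fun s hs => dif_neg (not_le.2 hs)
  have hXa : Adapted ℱ X := fun s => by
    by_cases hs : t ≤ s
    · exact (stronglyMeasurable_condExp.aestronglyMeasurable.const_mul _).congr
        ((hX s hs).mono fun _ h => h.symm)
    · rw [hX0 s (not_le.1 hs)]
      exact aestronglyMeasurable_zero.congr AEEqFun.coeFn_zero.symm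
  have hXp : ∀ s, MemLp (X s) p P := fun s => by
    by_cases hs : t ≤ s
    · exact (memLp_congr_ae (hX s hs)).2 (((hg (some s)).condExp hp1).const_mul _)
    · rw [hX0 s (not_le.1 hs)]
      exact (memLp_congr_ae AEEqFun.coeFn_zero).2 MemLp.zero
  let ξ : Ω → ℝ := condExp (ℱ t) P (g none)
  have hξ : Measurable[ℱ t] ξ := stronglyMeasurable_condExp.measurable
  have hξp : MemLp ξ p P := (hg none).condExp hp1
  have hint : ∀ k : Proc T P × L0 P ℱ t, Adapted ℱ k.1 → (∀ s < t, k.1 s = 0) →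
      (∀ s, MemLp (k.1 s) q P) → MemLp k.2.1 q P →
      Integrable (fun ω => (pairing P ℱ t μ k.1 X).1 ω + ξ ω * k.2.1 ω) P ∧
      ∫ ω, ((pairing P ℱ t μ k.1 X).1 ω + ξ ω * k.2.1 ω) ∂P = ∑ o, ∫ ω, g o ω * fam k o ω ∂P := by
    intro k ka k0 kp kv
    obtain ⟨i1, e1⟩ := integral_pairing (ℱ := ℱ) (t := t) (μ := μ) (p := p) (q := q) kp hXp
    have i2 : Integrable (fun ω => ξ ω * k.2.1 ω) P := hξp.integrable_mul kv
    refine ⟨i1.add i2, ?_⟩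
    rw [integral_add i1 i2, e1, Fintype.sum_option, add_comm]
    congr 1
    · exact integral_mul_condExp (ℱ.le t) k.2.2 (hgint _) ((hg none).integrable_mul kv)
    · rw [← Finset.sum_subset (Finset.subset_univ (Finset.Ici t))]
      · refine Finset.sum_congr rfl fun s hs => ?_
        have hs := Finset.mem_Ici.1 hs
        rw [← integral_const_mul]
        change _ = ∫ ω, g (some s) ω * k.1 s ω ∂P
        rw [← integral_mul_condExp (ℱ.le s) (ka s) (hgint _) ((hg (some s)).integrable_mul (kp s))]
        refine integral_congr_ae ?_
        filter_upwards [hX s hs] with ω hω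
        rw [hω]
        have := (hμ s hs).ne'
        field_simp
      · intro s _ hs
        have hs : s < t := not_le.1 fun h => hs (Finset.mem_Ici.2 h)
        change ∫ ω, g (some s) ω * k.1 s ω ∂P = 0
        rw [k0 s hs]
        refine integral_eq_zero_of_ae ?_
        filter_upwards [AEEqFun.coeFn_zero (μ := P) (β := ℝ)] with ω hω
        rw [hω]; simp
  obtain ⟨ix, ex⟩ := hint x hxa hx0 hxp hxv
  -- The conditional gap between `k` and `x`; `ψ` is the same variable formed from 𝓕_t-measurable
  -- representatives. Its expectation is at least `δ` on `K`.
  let φ : Proc T P × L0 P ℱ t → Ω → ℝ := fun k ω =>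
    (pairing P ℱ t μ k.1 X).1 ω + ξ ω * k.2.1 ω - ((pairing P ℱ t μ x.1 X).1 ω + ξ ω * x.2.1 ω)
  let ψ : Proc T P × L0 P ℱ t → Ω → ℝ := fun k ω =>
    (pairing P ℱ t μ k.1 X).rep ω + ξ ω * k.2.rep ω
      - ((pairing P ℱ t μ x.1 X).rep ω + ξ ω * x.2.rep ω)
  have hψm : ∀ k, Measurable[ℱ t] (ψ k) := fun k =>
    ((L0.measurable_rep _).add (hξ.mul (L0.measurable_rep _))).sub
      ((L0.measurable_rep _).add (hξ.mul (L0.measurable_rep _)))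
  have hψφ : ∀ k, ∀ᵐ ω ∂P, ψ k ω = φ k ω := fun k => by
    filter_upwards [(pairing P ℱ t μ k.1 X).coeFn_eq_rep, k.2.coeFn_eq_rep,
      (pairing P ℱ t μ x.1 X).coeFn_eq_rep, x.2.coeFn_eq_rep] with ω a1 a2 a3 a4
    simp only [φ, ψ]
    rw [a1, a2, a3, a4]
  have hφcomb : ∀ l : Ω → ℝ, Measurable[ℱ t] l → ∀ k₁ k₂ w : Proc T P × L0 P ℱ t,
      (∀ s, MemLp (k₁.1 s) q P) → (∀ s, MemLp (k₂.1 s) q P) →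
      (∀ s, ∀ᵐ ω ∂P, w.1 s ω = l ω * k₁.1 s ω + (1 - l ω) * k₂.1 s ω) →
      (∀ᵐ ω ∂P, w.2.1 ω = l ω * k₁.2.1 ω + (1 - l ω) * k₂.2.1 ω) →
      ∀ᵐ ω ∂P, φ w ω = l ω * φ k₁ ω + (1 - l ω) * φ k₂ ω := by
    intro l hl k₁ k₂ w h1 h2 h3 h4
    filter_upwards [pairing_comb_left (μ := μ) (p := p) (q := q) (W := w.1) (X := X)
      (fun s => LocLp.of_memLp (h1 s)) (fun s => LocLp.of_memLp (h2 s))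
      (fun s => LocLp.of_memLp (hXp s)) hl (show Measurable[ℱ t] fun ω => 1 - l ω from measurable_const.sub hl)
      (fun s _ => h3 s), h4]
      with ω a1 a2
    simp only [φ]
    rw [a1, a2]; ring
  have hexists : ∀ A, MeasurableSet[ℱ t] A → ∀ k₁ k₂ : Proc T P × L0 P ℱ t, Adapted ℱ k₁.1 →
      Adapted ℱ k₂.1 → (∀ s < t, k₁.1 s = 0) → (∀ s < t, k₂.1 s = 0) →
      ∃ w : Proc T P × L0 P ℱ t,
      (∀ s, ∀ᵐ ω ∂P, w.1 s ω = A.indicator 1 ω * k₁.1 s ω + (1 - A.indicator 1 ω) * k₂.1 s ω) ∧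
      ∀ᵐ ω ∂P, w.2.1 ω = A.indicator 1 ω * k₁.2.1 ω + (1 - A.indicator 1 ω) * k₂.2.1 ω := by
    intro A hA k₁ k₂ a1 a2 z1 z2
    have hl : Measurable[ℱ t] (A.indicator (1 : Ω → ℝ)) := measurable_indicator_one hA
    obtain ⟨W, -, -, hW⟩ := exists_comb hl
      (show Measurable[ℱ t] fun ω => 1 - A.indicator (1 : Ω → ℝ) ω from measurable_const.sub hl) a1 a2 z1 z2
    have hm : Measurable[ℱ t] fun ω => A.indicator (1 : Ω → ℝ) ω * k₁.2.rep ω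
        + (1 - A.indicator (1 : Ω → ℝ) ω) * k₂.2.rep ω :=
      (hl.mul (L0.measurable_rep _)).add ((measurable_const.sub hl).mul (L0.measurable_rep _))
    refine ⟨(W, L0.of P _ hm), hW, ?_⟩
    filter_upwards [L0.coeFn_of (P := P) _ hm, k₁.2.coeFn_eq_rep, k₂.2.coeFn_eq_rep] with ω b1 b2 b3
    rw [b1, b2, b3]
  -- `K` is stable under 𝓕_t-convex combinations, in particular under pasting, so the family of gaps
  -- is too, and the bound in expectation localizes to an event.
  obtain ⟨B₀, hB₀, hPB₀, η, hη, hBη⟩ := exists_set_forall_le_of_forall_le_integral (P := P)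
    (ℱ.le t) (𝒢 := {f | Measurable[ℱ t] f ∧ ∃ k ∈ K, ∀ᵐ ω ∂P, f ω = φ k ω})
    (by obtain ⟨k, hk⟩ := hne; exact ⟨ψ k, hψm k, k, hk, hψφ k⟩)
    (fun f hf => hf.1)
    (by
      rintro f ⟨-, k, hk, hfk⟩
      obtain ⟨ik, -⟩ := hint k (hKa k hk) (hK0 k hk) (hKp k hk) (hKv k hk)
      exact (ik.sub ix).congr (hfk.mono fun _ h => h.symm))
    (by
      rintro A hA f ⟨hfm, k₁, hk₁, hf⟩ h ⟨hhm, k₂, hk₂, hh⟩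
      obtain ⟨w, hw1, hw2⟩ := hexists A hA k₁ k₂ (hKa _ hk₁) (hKa _ hk₂) (hK0 _ hk₁) (hK0 _ hk₂)
      have hl : Measurable[ℱ t] (A.indicator (1 : Ω → ℝ)) := measurable_indicator_one hA
      have hwK := hcomb _ hl (fun ω => by
        by_cases hω : ω ∈ A <;> simp [hω]) k₁ hk₁ k₂ hk₂ w hw1 hw2
      have hφ := hφcomb _ hl k₁ k₂ w (hKp _ hk₁) (hKp _ hk₂) hw1 hw2
      refine ⟨ψ w, ⟨hψm w, w, hwK, hψφ w⟩, ?_, ?_⟩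
      · filter_upwards [hφ, hψφ w, hf] with ω a1 a2 a3 hω
        rw [a2, a1, a3, indicator_of_mem hω]; simp
      · filter_upwards [hφ, hψφ w, hh] with ω a1 a2 a3 hω
        rw [a2, a1, a3, indicator_of_notMem hω]; simp)
    hδ (by
      rintro f ⟨-, k, hk, hfk⟩
      obtain ⟨ik, ek⟩ := hint k (hKa k hk) (hK0 k hk) (hKp k hk) (hKv k hk)
      rw [integral_congr_ae (show f =ᵐ[P] φ k from hfk)]
      simp only [φ]
      rw [integral_sub ik ix, ek, ex]
      linarith [hsep _ ⟨k, hk, rfl⟩])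
  have hBη' : ∀ k ∈ K, ∀ᵐ ω ∂P, ω ∈ B₀ → η ≤ φ k ω := fun k hk => by
    filter_upwards [hBη (ψ k) ⟨hψm k, k, hk, hψφ k⟩, hψφ k] with ω a1 a2 hω
    rw [← a2]; exact a1 hω
  -- A member of `K` pasted with `x` off `B` still belongs to `K` and has zero gap off `B`, so a gap
  -- of at least η is possible only inside `B`.
  have hnull : ∀ᵐ ω ∂P, ω ∈ B₀ → ω ∈ B := by
    obtain ⟨k, hk⟩ := hne
    obtain ⟨w, hw1, hw2⟩ := hexists B hB k x (hKa _ hk) hxa (hK0 _ hk) hx0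
    have hl : Measurable[ℱ t] (B.indicator (1 : Ω → ℝ)) := measurable_indicator_one hB
    have hwK := hcatB k hk w (fun s => by
        filter_upwards [hw1 s] with ω h1
        exact ⟨fun hω => by rw [h1, indicator_of_mem hω]; simp,
          fun hω => by rw [h1, indicator_of_notMem hω]; simp⟩) (by
        filter_upwards [hw2] with ω h1
        exact ⟨fun hω => by rw [h1, indicator_of_mem hω]; simp,
          fun hω => by rw [h1, indicator_of_notMem hω]; simp⟩)
    filter_upwards [hBη' w hwK, hφcomb _ hl k x w (hKp _ hk) hxp hw1 hw2] with ω a1 a2 hω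
    by_contra hωB
    have h3 := a1 hω
    rw [a2, indicator_of_notMem hωB] at h3
    have h4 : φ x ω = 0 := sub_self _
    rw [h4] at h3
    simp at h3
    linarith
  refine ⟨X, ξ, B₀ ∩ B, η, hXa, hX0, hXp, hξ, hB₀.inter hB, inter_subset_right, ?_, hη, ?_⟩
  · intro h0
    refine hPB₀ ?_
    rw [measure_eq_zero_iff_ae_notMem] at h0 ⊢
    filter_upwards [h0, hnull] with ω a1 a2 hω using a1 ⟨hω, a2 hω⟩
  · intro k hk
    filter_upwards [hBη' k hk] with ω a1 hω
    have := a1 hω.1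
    simp only [φ] at this
    linarith

end

/-! ### Right-continuous versions of local increasing maps. -/

section

variable {Ω : Type*} {mΩ : MeasurableSpace Ω} {P : Measure Ω} {T : ℕ}
  {ℱ : Filtration (Fin (T + 1)) mΩ} {t : Fin (T + 1)} {μ : Fin (T + 1) → ℝ} {p q : ℝ≥0∞}

/-- A sequence decreasing to `s` from strictly above, for `s < ⊤`. -/
def above (k : ℕ) (s : EReal) : EReal :=
  if s = ⊤ then ⊤ else if s = ⊥ then ((-(k : ℝ) : ℝ) : EReal)
    else ((s.toReal + 1 / ((k : ℝ) + 1) : ℝ) : EReal)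

theorem measurable_above (k : ℕ) : Measurable (above k) :=
  Measurable.ite (measurableSet_singleton _) measurable_const <|
    Measurable.ite (measurableSet_singleton _) measurable_const <|
      measurable_coe_real_ereal.comp (measurable_ereal_toReal.add_const _)

theorem above_top (k : ℕ) : above k ⊤ = ⊤ := if_pos rfl

theorem above_bot (k : ℕ) : above k ⊥ = ((-(k : ℝ) : ℝ) : EReal) := by simp [above]

theorem above_coe (k : ℕ) (r : ℝ) : above k r = ((r + 1 / ((k : ℝ) + 1) : ℝ) : EReal) := by
  simp [above]

theorem lt_above (k : ℕ) {s : EReal} (hs : s ≠ ⊤) : s < above k s := by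
  induction s with
  | bot => rw [above_bot]; exact EReal.bot_lt_coe _
  | top => exact absurd rfl hs
  | coe r =>
    rw [above_coe, EReal.coe_lt_coe_iff]
    exact lt_add_of_pos_right r (by positivity)

theorem le_above (k : ℕ) (s : EReal) : s ≤ above k s := by
  by_cases hs : s = ⊤
  · rw [hs, above_top]
  · exact (lt_above k hs).le

theorem above_ne_top (k : ℕ) {s : EReal} (hs : s ≠ ⊤) : above k s ≠ ⊤ := by
  induction s with
  | bot => rw [above_bot]; exact EReal.coe_ne_top _
  | top => exact absurd rfl hs
  | coe r => rw [above_coe]; exact EReal.coe_ne_top _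

theorem antitone_above (s : EReal) : Antitone fun k => above k s := by
  intro j k hjk
  have hjk' : (j : ℝ) ≤ k := by exact_mod_cast hjk
  induction s with
  | bot =>
    simp only [above_bot, EReal.coe_le_coe_iff]
    linarith
  | top => simp only [above_top, le_refl]
  | coe r =>
    simp only [above_coe, EReal.coe_le_coe_iff]
    gcongr

theorem exists_above_le {s n : EReal} (h : s < n) : ∃ k, above k s ≤ n := by
  induction s with
  | bot =>
    obtain ⟨x, -, hx⟩ := EReal.lt_iff_exists_real_btwn.1 h
    obtain ⟨k, hk⟩ := exists_nat_gt (-x)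
    refine ⟨k, ?_⟩
    rw [above_bot]
    refine le_trans ?_ hx.le
    rw [EReal.coe_le_coe_iff]
    linarith
  | top => exact absurd h not_top_lt
  | coe r =>
    obtain ⟨x, hrx, hx⟩ := EReal.lt_iff_exists_real_btwn.1 h
    obtain ⟨k, hk⟩ := exists_nat_one_div_lt (sub_pos.2 (EReal.coe_lt_coe_iff.1 hrx))
    refine ⟨k, ?_⟩
    rw [above_coe]
    refine le_trans ?_ hx.le
    rw [EReal.coe_le_coe_iff]
    linarith

/-- At real `s`, two steps of length 1/(2k+2) make one of length 1/(k+1); at ⊥ the first step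
already leads far below -k. This lets an upper approximation be inserted twice. -/
theorem above_above_le (k : ℕ) (s : EReal) : above (2 * k + 1) (above (2 * k + 1) s) ≤ above k s := by
  have h1 : 1 / ((2 * k + 1 : ℕ) + 1 : ℝ) = 1 / ((k : ℝ) + 1) / 2 := by
    push_cast
    field_simp
    ring
  induction s with
  | bot =>
    rw [above_bot, above_bot, above_coe, EReal.coe_le_coe_iff, h1]
    have h2 : 1 / ((k : ℝ) + 1) ≤ 1 := by
      rw [div_le_one (by positivity)]
      linarith [Nat.cast_nonneg (α := ℝ) k]
    have := Nat.cast_nonneg (α := ℝ) k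
    push_cast
    linarith
  | top => rw [above_top, above_top]; exact le_top
  | coe r =>
    rw [above_coe, above_coe, above_coe, EReal.coe_le_coe_iff, h1]
    linarith

/-- The random variable `above k s`. -/
def L0bar.above (k : ℕ) (s : L0bar P ℱ t) : L0bar P ℱ t :=
  L0bar.of P (fun ω => PathAI.above k (s.rep ω)) ((measurable_above k).comp s.measurable_rep)

theorem L0bar.coeFn_above (k : ℕ) (s : L0bar P ℱ t) :
    ∀ᵐ ω ∂P, (s.above k).1 ω = PathAI.above k (s.1 ω) := by
  filter_upwards [L0bar.coeFn_of (P := P) _ ((measurable_above k).comp s.measurable_rep),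
    s.coeFn_eq_rep] with ω a1 a2
  rw [a2]; exact a1

theorem L0bar.exists_ite {A : Set Ω} (hA : MeasurableSet[ℱ t] A) (f g : L0bar P ℱ t) :
    ∃ h : L0bar P ℱ t, ∀ᵐ ω ∂P, (ω ∈ A → h.1 ω = f.1 ω) ∧ (ω ∉ A → h.1 ω = g.1 ω) := by
  classical
  have hm : Measurable[ℱ t] fun ω => if ω ∈ A then f.rep ω else g.rep ω :=
    Measurable.ite hA f.measurable_rep g.measurable_rep
  refine ⟨L0bar.of P _ hm, ?_⟩
  filter_upwards [L0bar.coeFn_of (P := P) _ hm, f.coeFn_eq_rep, g.coeFn_eq_rep] with ω a1 a2 a3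
  rw [a1, a2, a3]
  exact ⟨fun h => if_pos h, fun h => if_neg h⟩

/-- Locality of a map `L̄⁰ → L̄⁰`. -/
def IsLocalMap (H : L0bar P ℱ t → L0bar P ℱ t) : Prop :=
  ∀ A, MeasurableSet[ℱ t] A → ∀ n n' : L0bar P ℱ t, (∀ᵐ ω ∂P, ω ∈ A → n.1 ω = n'.1 ω) →
    ∀ᵐ ω ∂P, ω ∈ A → (H n).1 ω = (H n').1 ω

/-- Compare `n` with the variable that equals `n'` on `A` and `n` elsewhere. -/
theorem IsLocalMap.le_on {H : L0bar P ℱ t → L0bar P ℱ t} (hloc : IsLocalMap H)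
    (hmono : Monotone H) {A : Set Ω} (hA : MeasurableSet[ℱ t] A) {n n' : L0bar P ℱ t}
    (h : ∀ᵐ ω ∂P, ω ∈ A → n.1 ω ≤ n'.1 ω) : ∀ᵐ ω ∂P, ω ∈ A → (H n).1 ω ≤ (H n').1 ω := by
  obtain ⟨k, hk⟩ := L0bar.exists_ite hA n' n
  have h1 : H n ≤ H k := hmono (L0bar.le_iff.2 (by
    filter_upwards [h, hk] with ω a1 a2
    by_cases hω : ω ∈ A
    · rw [a2.1 hω]; exact a1 hω
    · rw [a2.2 hω]))
  filter_upwards [L0bar.le_iff.1 h1, hloc A hA k n' (hk.mono fun ω a => a.1)] with ω a1 a2 hω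
  rw [← a2 hω]; exact a1

/-- The approximations `above k` of `s` are cofinal from above: where `s < n`, some index with
`above k s ≤ n` exists, and locality permits it to depend on ω. Hence the essential infimum is a
countable pointwise infimum. -/
theorem isRightVersion_iff {H G : L0bar P ℱ t → L0bar P ℱ t} (hloc : IsLocalMap H)
    (hmono : Monotone H) : IsRightVersion H G ↔ ∀ s, ∀ᵐ ω ∂P,
      (s.1 ω = ⊤ → (G s).1 ω = ⊤) ∧ (s.1 ω ≠ ⊤ → (G s).1 ω = ⨅ k, (H (s.above k)).1 ω) := by
  classical
  refine forall_congr' fun s => ?_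
  have hT : MeasurableSet[ℱ t] {ω | s.rep ω = ⊤} := s.measurable_rep (measurableSet_singleton _)
  have hm : Measurable[ℱ t] fun ω => if s.rep ω = ⊤ then (⊤ : EReal)
      else ⨅ k, (H (s.above k)).rep ω :=
    Measurable.ite hT measurable_const (Measurable.iInf fun k => L0bar.measurable_rep _)
  have hv : ∀ᵐ ω ∂P, (s.1 ω = ⊤ → (L0bar.of P _ hm).1 ω = ⊤) ∧
      (s.1 ω ≠ ⊤ → (L0bar.of P _ hm).1 ω = ⨅ k, (H (s.above k)).1 ω) := by
    filter_upwards [L0bar.coeFn_of (P := P) _ hm, s.coeFn_eq_rep,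
      ae_all_iff.2 fun k => (H (s.above k)).coeFn_eq_rep] with ω a1 a2 a3
    rw [a1, a2]
    refine ⟨fun h => if_pos h, fun h => ?_⟩
    rw [if_neg h]
    exact iInf_congr fun k => (a3 k).symm
  have hglb : IsGLB {k | ∃ n : L0bar P ℱ t, (∀ᵐ ω ∂P, s.1 ω ≠ ⊤ → s.1 ω < n.1 ω) ∧
      ∀ᵐ ω ∂P, (s.1 ω ≠ ⊤ → k.1 ω = (H n).1 ω) ∧ (s.1 ω = ⊤ → k.1 ω = ⊤)} (L0bar.of P _ hm) := by
    constructor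
    · rintro k ⟨n, hn, hk⟩
      rw [L0bar.le_iff]
      have h1 : ∀ j, ∀ᵐ ω ∂P, ω ∈ {ω | (s.above j).rep ω ≤ n.rep ω} →
          (H (s.above j)).1 ω ≤ (H n).1 ω := fun j =>
        hloc.le_on hmono (measurableSet_le (L0bar.measurable_rep _) (L0bar.measurable_rep _)) (by
          filter_upwards [(s.above j).coeFn_eq_rep, n.coeFn_eq_rep] with ω a1 a2 a3
          rw [a1, a2]; exact a3)
      filter_upwards [hv, hn, hk, ae_all_iff.2 h1, ae_all_iff.2 fun j => L0bar.coeFn_above j s,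
        ae_all_iff.2 fun j => (s.above j).coeFn_eq_rep, n.coeFn_eq_rep] with ω a1 a2 a3 a4 a5 a6 a7
      by_cases hs : s.1 ω = ⊤
      · rw [a3.2 hs]; exact le_top
      · rw [a1.2 hs, a3.1 hs]
        obtain ⟨j, hj⟩ := exists_above_le (a2 hs)
        refine (iInf_le _ j).trans (a4 j ?_)
        rw [← a6, ← a7, a5]
        exact hj
    · intro b hb
      rw [L0bar.le_iff]
      have h1 : ∀ j, ∀ᵐ ω ∂P, s.1 ω ≠ ⊤ → b.1 ω ≤ (H (s.above j)).1 ω := fun j => by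
        obtain ⟨k, hk⟩ := L0bar.exists_ite hT (L0bar.of P (fun _ => ⊤) measurable_const)
          (H (s.above j))
        have hkS := hb ⟨s.above j, by
          filter_upwards [L0bar.coeFn_above j s] with ω a1 h
          rw [a1]; exact lt_above j h, show ∀ᵐ ω ∂P, (s.1 ω ≠ ⊤ → k.1 ω = _) ∧ _ by
          filter_upwards [hk, s.coeFn_eq_rep, L0bar.coeFn_of (P := P) (fun _ => (⊤ : EReal))
            (measurable_const : Measurable[ℱ t] _)] with ω a1 a2 a3
          rw [a2]
          exact ⟨fun h => a1.2 h, fun h => (a1.1 h).trans a3⟩⟩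
        filter_upwards [hk, s.coeFn_eq_rep, L0bar.le_iff.1 hkS] with ω a1 a2 a3 h
        rw [← a1.2 (by rw [a2] at h; exact h)]
        exact a3
      filter_upwards [hv, ae_all_iff.2 h1] with ω a1 a2
      by_cases hs : s.1 ω = ⊤
      · rw [a1.1 hs]; exact le_top
      · rw [a1.2 hs]
        exact le_iInf fun j => a2 j hs
  constructor
  · intro h
    rw [h.unique hglb]
    exact hv
  · intro h
    have : G s = L0bar.of P _ hm := L0bar.ext_ae (by
      filter_upwards [h, hv] with ω a1 a2
      by_cases hs : s.1 ω = ⊤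
      · rw [a1.1 hs, a2.1 hs]
      · rw [a1.2 hs, a2.2 hs])
    rw [this]
    exact hglb

/-- The right-continuous version of `H`. -/
def rightVersion [IsProbabilityMeasure P] (H : L0bar P ℱ t → L0bar P ℱ t) (s : L0bar P ℱ t) : L0bar P ℱ t :=
  (L0bar.exists_isGLB {k | ∃ n : L0bar P ℱ t, (∀ᵐ ω ∂P, s.1 ω ≠ ⊤ → s.1 ω < n.1 ω) ∧
    ∀ᵐ ω ∂P, (s.1 ω ≠ ⊤ → k.1 ω = (H n).1 ω) ∧ (s.1 ω = ⊤ → k.1 ω = ⊤)}).choose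

theorem isRightVersion_rightVersion [IsProbabilityMeasure P] (H : L0bar P ℱ t → L0bar P ℱ t) :
    IsRightVersion H (rightVersion H) := fun _ => (L0bar.exists_isGLB _).choose_spec

theorem IsRightVersion.le_on {H G : L0bar P ℱ t → L0bar P ℱ t} (hloc : IsLocalMap H)
    (hmono : Monotone H) (hG : IsRightVersion H G) {A : Set Ω} (hA : MeasurableSet[ℱ t] A)
    {s n : L0bar P ℱ t} (h : ∀ᵐ ω ∂P, ω ∈ A → s.1 ω < n.1 ω) :
    ∀ᵐ ω ∂P, ω ∈ A → (G s).1 ω ≤ (H n).1 ω := by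
  have h1 : ∀ j, ∀ᵐ ω ∂P, ω ∈ A ∩ {ω | (s.above j).rep ω ≤ n.rep ω} →
      (H (s.above j)).1 ω ≤ (H n).1 ω := fun j =>
    hloc.le_on hmono (hA.inter
      (measurableSet_le (L0bar.measurable_rep _) (L0bar.measurable_rep _))) (by
      filter_upwards [(s.above j).coeFn_eq_rep, n.coeFn_eq_rep] with ω a1 a2 a3
      rw [a1, a2]; exact a3.2)
  filter_upwards [(isRightVersion_iff hloc hmono).1 hG s, ae_all_iff.2 h1,
    ae_all_iff.2 fun j => L0bar.coeFn_above j s, h,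
    ae_all_iff.2 fun j => (s.above j).coeFn_eq_rep, n.coeFn_eq_rep] with ω a1 a4 a5 a2 a6 a7 hω
  rw [a1.2 (ne_top_of_lt (a2 hω))]
  obtain ⟨j, hj⟩ := exists_above_le (a2 hω)
  refine (iInf_le _ j).trans (a4 j ⟨hω, ?_⟩)
  change (s.above j).rep ω ≤ n.rep ω
  rw [← a6, ← a7, a5]
  exact hj

theorem le_rightVersion {H G : L0bar P ℱ t → L0bar P ℱ t} (hloc : IsLocalMap H)
    (hmono : Monotone H) (hG : IsRightVersion H G) (s : L0bar P ℱ t) : H s ≤ G s := by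
  rw [L0bar.le_iff]
  have h1 : ∀ j, H s ≤ H (s.above j) := fun j => hmono (L0bar.le_iff.2 (by
    filter_upwards [L0bar.coeFn_above j s] with ω a1
    rw [a1]; exact le_above j _))
  filter_upwards [(isRightVersion_iff hloc hmono).1 hG s,
    ae_all_iff.2 fun j => L0bar.le_iff.1 (h1 j)] with ω a1 a2
  by_cases hs : s.1 ω = ⊤
  · rw [a1.1 hs]; exact le_top
  · rw [a1.2 hs]; exact le_iInf a2

theorem isLocalMap_rightVersion {H G : L0bar P ℱ t → L0bar P ℱ t} (hloc : IsLocalMap H)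
    (hmono : Monotone H) (hG : IsRightVersion H G) : IsLocalMap G := by
  intro A hA n n' h
  have h1 : ∀ j, ∀ᵐ ω ∂P, ω ∈ A → (H (n.above j)).1 ω = (H (n'.above j)).1 ω := fun j =>
    hloc A hA _ _ (by
      filter_upwards [h, L0bar.coeFn_above j n, L0bar.coeFn_above j n'] with ω a1 a2 a3 hω
      rw [a2, a3, a1 hω])
  filter_upwards [(isRightVersion_iff hloc hmono).1 hG n,
    (isRightVersion_iff hloc hmono).1 hG n', h, ae_all_iff.2 h1] with ω a1 a2 a3 a4 hω
  by_cases hs : n.1 ω = ⊤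
  · rw [a1.1 hs, a2.1 (by rw [← a3 hω]; exact hs)]
  · rw [a1.2 hs, a2.2 (by rw [← a3 hω]; exact hs)]
    exact iInf_congr fun j => a4 j hω

theorem monotone_rightVersion {H G : L0bar P ℱ t → L0bar P ℱ t} (hloc : IsLocalMap H)
    (hmono : Monotone H) (hG : IsRightVersion H G) : Monotone G := by
  intro n n' h
  rw [L0bar.le_iff] at h ⊢
  have h1 : ∀ j, ∀ᵐ ω ∂P, ω ∈ {ω | n'.rep ω ≠ ⊤} → (G n).1 ω ≤ (H (n'.above j)).1 ω := fun j =>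
    hG.le_on hloc hmono (n'.measurable_rep (measurableSet_singleton _)).compl (by
      filter_upwards [h, L0bar.coeFn_above j n', n'.coeFn_eq_rep] with ω a1 a2 a3 hω
      rw [a2]
      refine a1.trans_lt (lt_above j ?_)
      rw [a3]; exact hω)
  filter_upwards [(isRightVersion_iff hloc hmono).1 hG n', ae_all_iff.2 h1,
    n'.coeFn_eq_rep] with ω a1 a2 a3
  by_cases hs : n'.1 ω = ⊤
  · rw [a1.1 hs]; exact le_top
  · rw [a1.2 hs]
    exact le_iInf fun j => a2 j (by rw [a3] at hs; exact hs)

/-- Applying the approximation twice shows that `G` at the (2k+1)-st approximation of `s` is at most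
`H` at the k-th, so the infimum of `G` from above is no larger than that of `H`, which is `G s`. -/
theorem isRightVersion_self {H G : L0bar P ℱ t → L0bar P ℱ t} (hloc : IsLocalMap H)
    (hmono : Monotone H) (hG : IsRightVersion H G) : IsRightVersion G G := by
  have hGl := isLocalMap_rightVersion hloc hmono hG
  have hGm := monotone_rightVersion hloc hmono hG
  rw [isRightVersion_iff hGl hGm]
  intro s
  have hT : MeasurableSet[ℱ t] {ω | s.rep ω ≠ ⊤} :=
    (s.measurable_rep (measurableSet_singleton _)).compl
  have h1 : ∀ k, G s ≤ G (s.above k) := fun k => hGm (L0bar.le_iff.2 (by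
    filter_upwards [L0bar.coeFn_above k s] with ω a1
    rw [a1]; exact le_above k _))
  have h2 : ∀ k, ∀ᵐ ω ∂P, (s.1 ω ≠ ⊤) →
      (G (s.above (2 * k + 1))).1 ω ≤ (H (s.above k)).1 ω := fun k => by
    have h3 : (s.above (2 * k + 1)).above (2 * k + 1) ≤ s.above k := L0bar.le_iff.2 (by
      filter_upwards [L0bar.coeFn_above (2 * k + 1) (s.above (2 * k + 1)), L0bar.coeFn_above k s,
        L0bar.coeFn_above (2 * k + 1) s] with ω a1 a2 a3
      rw [a1, a2, a3]
      exact above_above_le k _)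
    filter_upwards [(isRightVersion_iff hloc hmono).1 hG (s.above (2 * k + 1)),
      L0bar.le_iff.1 (hmono h3), L0bar.coeFn_above (2 * k + 1) s] with ω a1 a2 a3 hs
    rw [a1.2 (by rw [a3]; exact above_ne_top _ hs)]
    exact (iInf_le _ (2 * k + 1)).trans a2
  filter_upwards [(isRightVersion_iff hloc hmono).1 hG s, ae_all_iff.2 h2,
    ae_all_iff.2 fun k => L0bar.le_iff.1 (h1 k)] with ω a1 a2 a3
  refine ⟨a1.1, fun hs => le_antisymm (le_iInf a3) ?_⟩
  rw [a1.2 hs]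
  exact le_iInf fun k => (iInf_le _ _).trans (a2 k hs)

end

/-! ### The maximal risk of F and its minimal risk function. -/

section

variable {Ω : Type*} {mΩ : MeasurableSpace Ω} {P : Measure Ω} [IsProbabilityMeasure P] {T : ℕ}
  {ℱ : Filtration (Fin (T + 1)) mΩ} {t : Fin (T + 1)} {μ : Fin (T + 1) → ℝ} {p q : ℝ≥0∞}

/-- The essential supremum of `F X` on `{⟨Z, X⟩ ≤ n}`. -/
def maxRisk (F : Ltp P ℱ t μ p → L0bar P ℱ t) (Z : MD P ℱ t μ q) (n : L0bar P ℱ t) :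
    L0bar P ℱ t :=
  (L0bar.exists_isLUB {k | ∃ X : Ltp P ℱ t μ p, ∀ᵐ ω ∂P,
    (((pairing P ℱ t μ Z.1 X.1).1 ω : EReal) ≤ n.1 ω → k.1 ω = (F X).1 ω) ∧
    (¬ ((pairing P ℱ t μ Z.1 X.1).1 ω : EReal) ≤ n.1 ω → k.1 ω = ⊥)}).choose

theorem isLUB_maxRisk (F : Ltp P ℱ t μ p → L0bar P ℱ t) (Z : MD P ℱ t μ q) (n : L0bar P ℱ t) :
    IsLUB {k | ∃ X : Ltp P ℱ t μ p, ∀ᵐ ω ∂P,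
      (((pairing P ℱ t μ Z.1 X.1).1 ω : EReal) ≤ n.1 ω → k.1 ω = (F X).1 ω) ∧
      (¬ ((pairing P ℱ t μ Z.1 X.1).1 ω : EReal) ≤ n.1 ω → k.1 ω = ⊥)} (maxRisk F Z n) :=
  (L0bar.exists_isLUB _).choose_spec

omit [IsProbabilityMeasure P] in
theorem measurableSet_pairing_le (Z X : Proc T P) (n : L0bar P ℱ t) :
    MeasurableSet[ℱ t] {ω | ((pairing P ℱ t μ Z X).rep ω : EReal) ≤ n.rep ω} :=
  measurableSet_le (measurable_coe_real_ereal.comp (L0.measurable_rep _)) n.measurable_rep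

theorem le_maxRisk (F : Ltp P ℱ t μ p → L0bar P ℱ t) (Z : MD P ℱ t μ q) (n : L0bar P ℱ t)
    (X : Ltp P ℱ t μ p) : ∀ᵐ ω ∂P, ((pairing P ℱ t μ Z.1 X.1).1 ω : EReal) ≤ n.1 ω →
      (F X).1 ω ≤ (maxRisk F Z n).1 ω := by
  obtain ⟨k, hk⟩ := L0bar.exists_ite (measurableSet_pairing_le (μ := μ) Z.1 X.1 n) (F X)
    (L0bar.of P (fun _ => ⊥) measurable_const)
  have hk' : ∀ᵐ ω ∂P,
    (((pairing P ℱ t μ Z.1 X.1).1 ω : EReal) ≤ n.1 ω → k.1 ω = (F X).1 ω) ∧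
    (¬ ((pairing P ℱ t μ Z.1 X.1).1 ω : EReal) ≤ n.1 ω → k.1 ω = ⊥) := by
    filter_upwards [hk, (pairing P ℱ t μ Z.1 X.1).coeFn_eq_rep, n.coeFn_eq_rep,
      L0bar.coeFn_of (P := P) (fun _ => (⊥ : EReal)) (measurable_const : Measurable[ℱ t] _)]
      with ω a1 a2 a3 a4
    rw [a2, a3]
    exact ⟨a1.1, fun h => (a1.2 h).trans a4⟩
  filter_upwards [L0bar.le_iff.1 ((isLUB_maxRisk F Z n).1 ⟨X, hk'⟩), hk']
    with ω a1 a2 h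
  rw [← a2.1 h]
  exact a1

theorem maxRisk_le_on (F : Ltp P ℱ t μ p → L0bar P ℱ t) (Z : MD P ℱ t μ q) (n : L0bar P ℱ t)
    {A : Set Ω} (hA : MeasurableSet[ℱ t] A) (c : L0bar P ℱ t)
    (h : ∀ X : Ltp P ℱ t μ p, ∀ᵐ ω ∂P, ω ∈ A →
      ((pairing P ℱ t μ Z.1 X.1).1 ω : EReal) ≤ n.1 ω → (F X).1 ω ≤ c.1 ω) :
    ∀ᵐ ω ∂P, ω ∈ A → (maxRisk F Z n).1 ω ≤ c.1 ω := by
  refine L0bar.isLUB_le_on (isLUB_maxRisk F Z n) hA c ?_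
  rintro k ⟨X, hk⟩
  filter_upwards [h X, hk] with ω a1 a2 hω
  by_cases hn : ((pairing P ℱ t μ Z.1 X.1).1 ω : EReal) ≤ n.1 ω
  · rw [a2.1 hn]; exact a1 hω hn
  · rw [a2.2 hn]; exact bot_le

theorem monotone_maxRisk (F : Ltp P ℱ t μ p → L0bar P ℱ t) (Z : MD P ℱ t μ q) :
    Monotone (maxRisk F Z) := by
  intro n n' h
  rw [L0bar.le_iff] at h ⊢
  have := maxRisk_le_on F Z n MeasurableSet.univ (maxRisk F Z n') fun X => by
    filter_upwards [le_maxRisk F Z n' X, h] with ω a1 a2 _ h3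
    exact a1 (h3.trans a2)
  filter_upwards [this] with ω hω using hω (mem_univ _)

variable [ENNReal.HolderConjugate p q]

theorem maxRisk_le_maxRisk_on (hμ : ∀ s, t ≤ s → 0 < μ s) (F : Ltp P ℱ t μ p → L0bar P ℱ t)
    {Z Z' : MD P ℱ t μ q} {n n' : L0bar P ℱ t} {A : Set Ω} (hA : MeasurableSet[ℱ t] A)
    (hZ : ∀ k, ∀ᵐ ω ∂P, ω ∈ A → Z.1 k ω = Z'.1 k ω) (hn : ∀ᵐ ω ∂P, ω ∈ A → n.1 ω = n'.1 ω) :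
    ∀ᵐ ω ∂P, ω ∈ A → (maxRisk F Z n).1 ω ≤ (maxRisk F Z' n').1 ω := by
  refine maxRisk_le_on F Z n hA _ fun X => ?_
  have hX := X.locLp hμ (ENNReal.HolderConjugate.ne_zero p q)
  filter_upwards [le_maxRisk F Z' n' X, hn, pairing_congr_on (μ := μ) (p := p) (q := q)
    (MD.isDual p hμ Z).locLp hX (MD.isDual p hμ Z').locLp hX hA hZ
    (fun _ => Eventually.of_forall fun _ _ => rfl)] with ω a1 a2 a3 hω h
  refine a1 ?_
  rw [← a3 hω, ← a2 hω]
  exact h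

theorem maxRisk_congr_on (hμ : ∀ s, t ≤ s → 0 < μ s) (F : Ltp P ℱ t μ p → L0bar P ℱ t)
    {Z Z' : MD P ℱ t μ q} {n n' : L0bar P ℱ t} {A : Set Ω} (hA : MeasurableSet[ℱ t] A)
    (hZ : ∀ k, ∀ᵐ ω ∂P, ω ∈ A → Z.1 k ω = Z'.1 k ω) (hn : ∀ᵐ ω ∂P, ω ∈ A → n.1 ω = n'.1 ω) :
    ∀ᵐ ω ∂P, ω ∈ A → (maxRisk F Z n).1 ω = (maxRisk F Z' n').1 ω := by
  filter_upwards [maxRisk_le_maxRisk_on hμ F hA hZ hn, maxRisk_le_maxRisk_on hμ F hA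
    (fun k => (hZ k).mono fun ω h hω => (h hω).symm) (hn.mono fun ω h hω => (h hω).symm)]
    with ω a1 a2 hω using le_antisymm (a1 hω) (a2 hω)

theorem isLocalMap_maxRisk (hμ : ∀ s, t ≤ s → 0 < μ s) (F : Ltp P ℱ t μ p → L0bar P ℱ t)
    (Z : MD P ℱ t μ q) : IsLocalMap (maxRisk F Z) := fun _ hA _ _ h =>
  maxRisk_congr_on hμ F hA (fun _ => Eventually.of_forall fun _ _ => rfl) h

/-- The candidate for the minimal risk function of `F`. -/
def riskOf (F : Ltp P ℱ t μ p → L0bar P ℱ t) (Z : MD P ℱ t μ q) : L0bar P ℱ t → L0bar P ℱ t :=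
  rightVersion (maxRisk F Z)

/-- The weights 0 and 1 are treated apart, because 0 times ⊥ is 0. For interior weights a value ⊥
makes the left side ⊥, whereas the right side is real. -/
theorem comb_lt_above {l : ℝ} (h0 : 0 ≤ l) (h1 : l ≤ 1) {a b : EReal} (ha : a ≠ ⊤) (hb : b ≠ ⊤)
    (j : ℕ) : (l : EReal) * a + ((1 - l : ℝ) : EReal) * b
      < (l : EReal) * above j a + ((1 - l : ℝ) : EReal) * above j b := by
  obtain ⟨a', ha'⟩ : ∃ a' : ℝ, above j a = a' := by
    induction a with
    | bot => exact ⟨_, above_bot j⟩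
    | top => exact absurd rfl ha
    | coe r => exact ⟨_, above_coe j r⟩
  obtain ⟨b', hb'⟩ : ∃ b' : ℝ, above j b = b' := by
    induction b with
    | bot => exact ⟨_, above_bot j⟩
    | top => exact absurd rfl hb
    | coe r => exact ⟨_, above_coe j r⟩
  have hal := lt_above j ha
  have hbl := lt_above j hb
  rw [ha'] at hal ⊢
  rw [hb'] at hbl ⊢
  rcases h0.eq_or_lt with h | h
  · subst h
    simpa using hbl
  rcases h1.eq_or_lt with h' | h'
  · subst h'
    simpa using hal
  rw [← EReal.coe_mul, ← EReal.coe_mul, ← EReal.coe_add]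
  induction a with
  | bot =>
    rw [EReal.coe_mul_bot_of_pos h, EReal.bot_add]
    exact EReal.bot_lt_coe _
  | top => exact absurd rfl ha
  | coe r =>
    induction b with
    | bot =>
      rw [EReal.coe_mul_bot_of_pos (sub_pos.2 h'), EReal.add_bot]
      exact EReal.bot_lt_coe _
    | top => exact absurd rfl hb
    | coe r' =>
      rw [← EReal.coe_mul, ← EReal.coe_mul, ← EReal.coe_add]
      rw [EReal.coe_lt_coe_iff] at hal hbl ⊢
      have := mul_lt_mul_of_pos_left hal h
      have := mul_lt_mul_of_pos_left hbl (sub_pos.2 h')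
      linarith

theorem le_or_le_of_comb_le {l : ℝ} (h0 : 0 ≤ l) (h1 : l ≤ 1) {x y : ℝ} {a b : EReal}
    (ha : a ≠ ⊤) (hb : b ≠ ⊤) (ha' : a ≠ ⊥) (hb' : b ≠ ⊥)
    (h : ((l * x + (1 - l) * y : ℝ) : EReal) ≤ (l : EReal) * a + ((1 - l : ℝ) : EReal) * b) :
    (x : EReal) ≤ a ∨ (y : EReal) ≤ b := by
  lift a to ℝ using ⟨ha, ha'⟩
  lift b to ℝ using ⟨hb, hb'⟩
  rw [← EReal.coe_mul, ← EReal.coe_mul, ← EReal.coe_add, EReal.coe_le_coe_iff] at h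
  rw [EReal.coe_le_coe_iff, EReal.coe_le_coe_iff]
  by_contra! hc
  rcases h0.eq_or_lt with h2 | h2
  · subst h2
    linarith [hc.2]
  · have := mul_lt_mul_of_pos_left hc.1 h2
    have := mul_le_mul_of_nonneg_left hc.2.le (sub_nonneg.2 h1)
    linarith

theorem above_ne_bot (k : ℕ) {s : EReal} : above k s ≠ ⊥ := by
  induction s with
  | bot => rw [above_bot]; exact EReal.coe_ne_bot _
  | top => rw [above_top]; exact top_ne_bot
  | coe r => rw [above_coe]; exact EReal.coe_ne_bot _

/-- If ⟨Z, X⟩ is at most the combination of n₁ and n₂, then ⟨Z₁, X⟩ ≤ n₁ or ⟨Z₂, X⟩ ≤ n₂, so F X is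
bounded by one of the two maximal risks. This is applied at the real values `above j` of the
arguments. In the limit j → ∞ the infimum passes through the maximum because both sequences
decrease. Where an argument is ⊤ the right side is ⊤. -/
theorem riskOf_quasiconvex (hμ : ∀ s, t ≤ s → 0 < μ s) (F : Ltp P ℱ t μ p → L0bar P ℱ t)
    {l : L0 P ℱ t} (hl : ∀ᵐ ω ∂P, 0 ≤ l.1 ω ∧ l.1 ω ≤ 1) {Z₁ Z₂ Z : MD P ℱ t μ q}
    {s₁ s₂ s : L0bar P ℱ t}
    (hZ : ∀ k, ∀ᵐ ω ∂P, Z.1 k ω = l.1 ω * Z₁.1 k ω + (1 - l.1 ω) * Z₂.1 k ω)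
    (hs : ∀ᵐ ω ∂P, s.1 ω = (l.1 ω : EReal) * s₁.1 ω + ((1 - l.1 ω : ℝ) : EReal) * s₂.1 ω) :
    ∀ᵐ ω ∂P, (riskOf F Z s).1 ω ≤ max ((riskOf F Z₁ s₁).1 ω) ((riskOf F Z₂ s₂).1 ω) := by
  have hp := ENNReal.HolderConjugate.ne_zero p q
  have hiff := fun Z : MD P ℱ t μ q => (isRightVersion_iff (isLocalMap_maxRisk hμ F Z)
    (monotone_maxRisk F Z)).1 (isRightVersion_rightVersion (maxRisk F Z))
  let A : Set Ω := {ω | s₁.rep ω ≠ ⊤} ∩ {ω | s₂.rep ω ≠ ⊤}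
  have hA : MeasurableSet[ℱ t] A :=
    ((s₁.measurable_rep (measurableSet_singleton _)).compl).inter
      (s₂.measurable_rep (measurableSet_singleton _)).compl
  have hAiff : ∀ᵐ ω ∂P, ω ∈ A ↔ s₁.1 ω ≠ ⊤ ∧ s₂.1 ω ≠ ⊤ := by
    filter_upwards [s₁.coeFn_eq_rep, s₂.coeFn_eq_rep] with ω a1 a2
    rw [a1, a2]; rfl
  have key : ∀ j, ∀ᵐ ω ∂P, ω ∈ A → (riskOf F Z s).1 ω
      ≤ max ((maxRisk F Z₁ (s₁.above j)).1 ω) ((maxRisk F Z₂ (s₂.above j)).1 ω) := by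
    intro j
    have hm : Measurable[ℱ t] fun ω => (l.rep ω : EReal) * (s₁.above j).rep ω
        + ((1 - l.rep ω : ℝ) : EReal) * (s₂.above j).rep ω :=
      ((measurable_coe_real_ereal.comp l.measurable_rep).mul (L0bar.measurable_rep _)).add
        ((measurable_coe_real_ereal.comp (measurable_const.sub l.measurable_rep)).mul
          (L0bar.measurable_rep _))
    have hn : ∀ᵐ ω ∂P, (L0bar.of P _ hm).1 ω = (l.1 ω : EReal) * above j (s₁.1 ω)
        + ((1 - l.1 ω : ℝ) : EReal) * above j (s₂.1 ω) := by
      filter_upwards [L0bar.coeFn_of (P := P) _ hm, l.coeFn_eq_rep, (s₁.above j).coeFn_eq_rep,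
        (s₂.above j).coeFn_eq_rep, L0bar.coeFn_above j s₁, L0bar.coeFn_above j s₂]
        with ω a1 a2 a3 a4 a5 a6
      rw [a1, a2, ← a3, ← a4, a5, a6]
    have hc : Measurable[ℱ t] fun ω => max ((maxRisk F Z₁ (s₁.above j)).rep ω)
        ((maxRisk F Z₂ (s₂.above j)).rep ω) :=
      (L0bar.measurable_rep _).max (L0bar.measurable_rep _)
    have hc' : ∀ᵐ ω ∂P, (L0bar.of P _ hc).1 ω = max ((maxRisk F Z₁ (s₁.above j)).1 ω)
        ((maxRisk F Z₂ (s₂.above j)).1 ω) := by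
      filter_upwards [L0bar.coeFn_of (P := P) _ hc, (maxRisk F Z₁ (s₁.above j)).coeFn_eq_rep,
        (maxRisk F Z₂ (s₂.above j)).coeFn_eq_rep] with ω a1 a2 a3
      rw [a1, a2, a3]
    have h1 := (isRightVersion_rightVersion (maxRisk F Z)).le_on (isLocalMap_maxRisk hμ F Z)
      (monotone_maxRisk F Z) hA (s := s) (n := L0bar.of P _ hm) (by
        filter_upwards [hn, hs, hl, hAiff] with ω a1 a2 a3 a4 hω
        rw [a1, a2]
        exact comb_lt_above a3.1 a3.2 (a4.1 hω).1 (a4.1 hω).2 j)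
    have h2 := maxRisk_le_on F Z (L0bar.of P _ hm) hA (L0bar.of P _ hc) fun X => by
      filter_upwards [le_maxRisk F Z₁ (s₁.above j) X, le_maxRisk F Z₂ (s₂.above j) X, hn, hl,
        hAiff, hc', L0bar.coeFn_above j s₁, L0bar.coeFn_above j s₂, l.coeFn_eq_rep,
        pairing_comb_left (μ := μ) (p := p) (q := q) (W := Z.1) (MD.isDual p hμ Z₁).locLp
          (MD.isDual p hμ Z₂).locLp (X.locLp hμ hp) l.measurable_rep
          (show Measurable[ℱ t] fun ω => 1 - l.rep ω from measurable_const.sub l.measurable_rep)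
          (fun k _ => by
            filter_upwards [hZ k, l.coeFn_eq_rep] with ω b1 b2
            rw [b1, b2])] with ω a1 a2 a3 a4 a5 a6 a7 a8 a9 a10 hω h
      rw [a3, a10, ← a9] at h
      rw [a6]
      rcases le_or_le_of_comb_le a4.1 a4.2 (above_ne_top j (a5.1 hω).1)
        (above_ne_top j (a5.1 hω).2) (above_ne_bot j) (above_ne_bot j) h with h3 | h3
      · exact le_max_of_le_left (a1 (by rw [a7]; exact h3))
      · exact le_max_of_le_right (a2 (by rw [a8]; exact h3))
    filter_upwards [h1, h2, hc'] with ω a1 a2 a3 hω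
    rw [← a3]
    exact (a1 hω).trans (a2 hω)
  have hanti : ∀ (Z : MD P ℱ t μ q) (s : L0bar P ℱ t), ∀ᵐ ω ∂P,
      Antitone fun j => (maxRisk F Z (s.above j)).1 ω := by
    intro Z s
    have : ∀ i j : ℕ, i ≤ j → maxRisk F Z (s.above j) ≤ maxRisk F Z (s.above i) := fun i j hij =>
      monotone_maxRisk F Z (L0bar.le_iff.2 (by
        filter_upwards [L0bar.coeFn_above i s, L0bar.coeFn_above j s] with ω a1 a2
        rw [a1, a2]
        exact antitone_above _ hij))
    have h2 : ∀ i j : ℕ, ∀ᵐ ω ∂P, i ≤ j →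
        (maxRisk F Z (s.above j)).1 ω ≤ (maxRisk F Z (s.above i)).1 ω := fun i j => by
      by_cases hij : i ≤ j
      · exact (L0bar.le_iff.1 (this i j hij)).mono fun _ h _ => h
      · exact Eventually.of_forall fun _ h => absurd h hij
    filter_upwards [ae_all_iff.2 fun i => ae_all_iff.2 (h2 i)] with ω a1 i j hij using a1 i j hij
  filter_upwards [ae_all_iff.2 key, hAiff, hiff Z₁ s₁, hiff Z₂ s₂, hanti Z₁ s₁, hanti Z₂ s₂]
    with ω a1 a2 a3 a4 a5 a6
  by_cases h1 : s₁.1 ω = ⊤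
  · exact le_max_of_le_left ((le_of_le_of_eq le_top (a3.1 h1).symm))
  by_cases h2 : s₂.1 ω = ⊤
  · exact le_max_of_le_right ((le_of_le_of_eq le_top (a4.1 h2).symm))
  have h3 := le_iInf fun j => a1 j (a2.2 ⟨h1, h2⟩)
  have h4 := iInf_sup_of_antitone a5 a6
  change _ ≤ max ((rightVersion _ _).1 ω) ((rightVersion _ _).1 ω)
  rw [a3.2 h1, a4.2 h2]
  exact h3.trans h4.le

/-- This writes the lower level sets of the left version as intersections of conditions affine in
(Z, v), one for each X, from which closedness is visible. If v exceeded ⟨Z, X⟩ where F X > c, then X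
would be admissible for the constraint v - 1/(k+1) with k large and force a value above c. -/
theorem riskOf_leftVersion_le_iff (hμ : ∀ s, t ≤ s → 0 < μ s) (F : Ltp P ℱ t μ p → L0bar P ℱ t)
    {Z : MD P ℱ t μ q} {S : L0bar P ℱ t → L0bar P ℱ t} (hS : IsLeftVersion (riskOf F Z) S)
    (v : L0 P ℱ t) (c : L0bar P ℱ t) : S v.toBar ≤ c ↔ ∀ X : Ltp P ℱ t μ p,
      ∀ᵐ ω ∂P, ω ∈ {ω | c.1 ω < (F X).1 ω} → v.1 ω ≤ (pairing P ℱ t μ Z.1 X.1).1 ω := by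
  have hloc := isLocalMap_maxRisk hμ F Z
  have hmono := monotone_maxRisk F Z
  have hR := isRightVersion_rightVersion (maxRisk F Z)
  have hcoe : ∀ a : ℝ, ∀ᵐ ω ∂P, (v.addConst a).toBar.1 ω = ((v.1 ω + a : ℝ) : EReal) := fun a => by
    filter_upwards [L0.coeFn_toBar (v.addConst a), v.coeFn_addConst a] with ω a1 a2
    rw [a1, a2]
  rw [leftVersion_le_iff (isLocalMap_rightVersion hloc hmono hR)
    (monotone_rightVersion hloc hmono hR) hS]
  constructor
  · intro h X
    filter_upwards [ae_all_iff.2 fun k : ℕ => le_maxRisk F Z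
        (v.addConst (-(1 / ((k : ℝ) + 1)))).toBar X,
      ae_all_iff.2 fun k : ℕ => hcoe (-(1 / ((k : ℝ) + 1))),
      ae_all_iff.2 fun k => L0bar.le_iff.1 (h k), ae_all_iff.2 fun k : ℕ => L0bar.le_iff.1
        (le_rightVersion hloc hmono hR (v.addConst (-(1 / ((k : ℝ) + 1)))).toBar)]
      with ω a1 a2 a3 a4 hω
    by_contra! hlt
    obtain ⟨k, hk⟩ := exists_nat_one_div_lt (sub_pos.2 hlt)
    refine absurd hω (not_lt.2 (((a1 k) ?_).trans ((a4 k).trans (a3 k))))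
    rw [a2 k, EReal.coe_le_coe_iff]
    linarith
  · intro h k
    -- The right version at v - 1/(k+1) is bounded by the maximal risk at the strictly larger
    -- argument v - 1/(k+2), which is still below v.
    have h1 := hR.le_on hloc hmono MeasurableSet.univ
      (s := (v.addConst (-(1 / ((k : ℝ) + 1)))).toBar)
      (n := (v.addConst (-(1 / (((k + 1 : ℕ) : ℝ) + 1)))).toBar) (by
        filter_upwards [hcoe (-(1 / ((k : ℝ) + 1))), hcoe (-(1 / (((k + 1 : ℕ) : ℝ) + 1)))]
          with ω a1 a2 _
        rw [a1, a2, EReal.coe_lt_coe_iff]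
        have : 1 / (((k + 1 : ℕ) : ℝ) + 1) < 1 / ((k : ℝ) + 1) := by
          push_cast
          exact one_div_lt_one_div_of_lt (by positivity) (by linarith)
        linarith)
    have h2 := maxRisk_le_on F Z (v.addConst (-(1 / (((k + 1 : ℕ) : ℝ) + 1)))).toBar
      MeasurableSet.univ c fun X => by
        filter_upwards [h X, hcoe (-(1 / (((k + 1 : ℕ) : ℝ) + 1)))] with ω a1 a2 _ h3
        rw [a2, EReal.coe_le_coe_iff] at h3
        by_contra hc
        have := a1 (not_le.1 hc)
        have : 0 < 1 / (((k + 1 : ℕ) : ℝ) + 1) := by positivity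
        linarith
    rw [L0bar.le_iff]
    filter_upwards [h1, h2] with ω a1 a2
    exact (a1 (mem_univ _)).trans (a2 (mem_univ _))

/-- The asymptotic maximum is ess sup F: every X is admissible at the level ⟨Z, X⟩, whatever Z is.
Closedness reduces to the half-space description of R⁻ and the continuity of both sides of each
inequality. -/
theorem isMinimalRiskFunction_riskOf (hμ : ∀ s, t ≤ s → 0 < μ s)
    (F : Ltp P ℱ t μ p → L0bar P ℱ t) :
    IsMinimalRiskFunction p (riskOf F : MD P ℱ t μ q → _) := by
  have hloc := fun Z : MD P ℱ t μ q => isLocalMap_maxRisk hμ F Z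
  have hmono := fun Z : MD P ℱ t μ q => monotone_maxRisk F Z
  have hR := fun Z : MD P ℱ t μ q => isRightVersion_rightVersion (maxRisk F Z)
  have hcongr : ∀ {Z Z' : MD P ℱ t μ q} {n n' : L0bar P ℱ t} {A : Set Ω},
      MeasurableSet[ℱ t] A → (∀ k, ∀ᵐ ω ∂P, ω ∈ A → Z.1 k ω = Z'.1 k ω) →
      (∀ᵐ ω ∂P, ω ∈ A → n.1 ω = n'.1 ω) →
      ∀ᵐ ω ∂P, ω ∈ A → (riskOf F Z n).1 ω = (riskOf F Z' n').1 ω := by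
    intro Z Z' n n' A hA hZ hn
    have h1 : ∀ j, ∀ᵐ ω ∂P, ω ∈ A →
        (maxRisk F Z (n.above j)).1 ω = (maxRisk F Z' (n'.above j)).1 ω := fun j =>
      maxRisk_congr_on hμ F hA hZ (by
        filter_upwards [hn, L0bar.coeFn_above j n, L0bar.coeFn_above j n'] with ω a1 a2 a3 hω
        rw [a2, a3, a1 hω])
    filter_upwards [(isRightVersion_iff (hloc Z) (hmono Z)).1 (hR Z) n,
      (isRightVersion_iff (hloc Z') (hmono Z')).1 (hR Z') n', hn, ae_all_iff.2 h1]
      with ω a1 a2 a3 a4 hω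
    by_cases hs : n.1 ω = ⊤
    · exact (a1.1 hs).trans (a2.1 (by rw [← a3 hω]; exact hs)).symm
    · exact (a1.2 hs).trans ((iInf_congr fun j => a4 j hω).trans
        (a2.2 (by rw [← a3 hω]; exact hs)).symm)
  refine ⟨?_, fun Z => monotone_rightVersion (hloc Z) (hmono Z) (hR Z),
    fun Z => isRightVersion_self (hloc Z) (hmono Z) (hR Z),
    fun l hl Z₁ Z₂ Z s₁ s₂ s hZ hs => riskOf_quasiconvex hμ F hl hZ hs, ?_, ?_⟩
  · intro A hA Z₁ Z₂ Z s₁ s₂ s hZ hs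
    filter_upwards [hcongr (Z := Z) (Z' := Z₁) hA (fun k => (hZ k).mono fun _ h => h.1)
        (hs.mono fun _ h => h.1),
      hcongr (Z := Z) (Z' := Z₂) hA.compl (fun k => (hZ k).mono fun _ h => h.2)
        (hs.mono fun _ h => h.2)] with ω a1 a2 using ⟨a1, a2⟩
  · obtain ⟨u, hu⟩ := L0bar.exists_isLUB (range F)
    refine ⟨u, fun Z => ⟨?_, fun b hb => hu.2 ?_⟩⟩
    · rintro _ ⟨s, rfl⟩
      have h1 := (hR Z).le_on (hloc Z) (hmono Z) MeasurableSet.univ (s := s.toBar)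
        (n := s.toBar.above 0) (by
          filter_upwards [L0bar.coeFn_above 0 s.toBar, L0.coeFn_toBar s] with ω a1 a2 _
          rw [a1]
          exact lt_above 0 (by rw [a2]; exact EReal.coe_ne_top _))
      have h2 := maxRisk_le_on F Z (s.toBar.above 0) MeasurableSet.univ u fun X => by
        filter_upwards [L0bar.le_iff.1 (hu.1 ⟨X, rfl⟩)] with ω a1 _ _ using a1
      rw [L0bar.le_iff]
      filter_upwards [h1, h2] with ω a1 a2
      exact (a1 (mem_univ _)).trans (a2 (mem_univ _))
    · rintro _ ⟨X, rfl⟩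
      have h1 := (le_rightVersion (hloc Z) (hmono Z) (hR Z)
        (pairing P ℱ t μ Z.1 X.1).toBar).trans (hb ⟨_, rfl⟩)
      rw [L0bar.le_iff] at h1 ⊢
      filter_upwards [h1, le_maxRisk F Z (pairing P ℱ t μ Z.1 X.1).toBar X,
        L0.coeFn_toBar (pairing P ℱ t μ Z.1 X.1)] with ω a1 a2 a3
      exact (a2 a3.symm.le).trans a1
  · refine ⟨fun Z s => (L0bar.exists_isLUB {k | ∃ n : L0bar P ℱ t,
      (∀ᵐ ω ∂P, s.1 ω ≠ ⊥ → n.1 ω < s.1 ω) ∧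
      ∀ᵐ ω ∂P, (s.1 ω ≠ ⊥ → k.1 ω = (riskOf F Z n).1 ω) ∧ (s.1 ω = ⊥ → k.1 ω = ⊥)}).choose,
      fun Z s => (L0bar.exists_isLUB _).choose_spec, fun m => ?_⟩
    have hset := fun z : MD P ℱ t μ q × L0 P ℱ t =>
      riskOf_leftVersion_le_iff hμ F (Z := z.1) (fun s => (L0bar.exists_isLUB _).choose_spec) z.2 m
    simp only [hset, ofPred_forall]
    let _ := mdTopology P ℱ t μ p q
    let _ := l0Topology P ℱ t
    refine isClosed_iInter fun X => isClosed_le_on continuous_snd ?_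
    have h1 : Continuous fun Z : MD P ℱ t μ q => pairing P ℱ t μ Z.1 X.1 :=
      continuous_iff_le_induced.2 (iInf_le _ X)
    exact h1.comp continuous_fst

end

/-! ### Restriction, pasting and supports. -/

section

variable {Ω : Type*} {mΩ : MeasurableSpace Ω} {P : Measure Ω} {T : ℕ}
  {ℱ : Filtration (Fin (T + 1)) mΩ} {t : Fin (T + 1)} {μ : Fin (T + 1) → ℝ} {p q : ℝ≥0∞}

theorem exists_measure_inter_ne_zero {Ω : Type*} {mΩ : MeasurableSpace Ω} {P : Measure Ω}
    {A : Set Ω} (hA : P A ≠ 0) {S : ℕ → Set Ω}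
    (h : ∀ᵐ ω ∂P, ω ∈ A → ∃ k, ω ∈ S k) : ∃ k, P (A ∩ S k) ≠ 0 := by
  by_contra! hc
  refine hA ?_
  rw [measure_eq_zero_iff_ae_notMem]
  have h1 : ∀ᵐ ω ∂P, ∀ k, ω ∉ A ∩ S k :=
    ae_all_iff.2 fun k => measure_eq_zero_iff_ae_notMem.1 (hc k)
  filter_upwards [h, h1] with ω a1 a2 hω
  obtain ⟨k, hk⟩ := a1 hω
  exact a2 k ⟨hω, hk⟩

theorem Ltp.exists_memLp_on [IsProbabilityMeasure P] (hμ : ∀ s, t ≤ s → 0 < μ s) (hp : p ≠ 0) (Y : Ltp P ℱ t μ p) :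
    ∃ κ : Ω → ℝ, Measurable[ℱ t] κ ∧ ∀ s (k : ℕ) (A : Set Ω), MeasurableSet[ℱ t] A →
      A ⊆ {ω | κ ω ≤ k} → MemLp (A.indicator (Y.1 s)) p P := by
  choose κ hκ h using fun s => Y.locLp hμ hp s
  refine ⟨fun ω => ∑ s, |κ s ω|, Finset.measurable_sum _ fun s _ =>
    continuous_abs.measurable.comp (hκ s), fun s k A hA hAk =>
    MemLp.mono_indicator (h s k) (ℱ.le t _ hA) fun ω hω => ?_⟩
  refine le_trans ((le_abs_self (κ s ω)).trans ?_) (show ∑ s, |κ s ω| ≤ k from hAk hω)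
  exact Finset.single_le_sum (f := fun s => |κ s ω|) (fun _ _ => abs_nonneg _) (Finset.mem_univ s)

theorem exists_iteProc {A : Set Ω} (hA : MeasurableSet[ℱ t] A) {X Y : Proc T P}
    (hX : Adapted ℱ X) (hY : Adapted ℱ Y) (hX0 : ∀ s < t, X s = 0) (hY0 : ∀ s < t, Y s = 0) :
    ∃ W : Proc T P, Adapted ℱ W ∧ (∀ s < t, W s = 0) ∧
      ∀ s, ∀ᵐ ω ∂P, (ω ∈ A → W s ω = X s ω) ∧ (ω ∉ A → W s ω = Y s ω) := by
  obtain ⟨W, h1, h2, h3⟩ := exists_comb (measurable_indicator_one hA)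
    (show Measurable[ℱ t] fun ω => 1 - A.indicator (1 : Ω → ℝ) ω from
      measurable_const.sub (measurable_indicator_one hA)) hX hY hX0 hY0
  refine ⟨W, h1, h2, fun s => ?_⟩
  filter_upwards [h3 s] with ω a1
  exact ⟨fun hω => by rw [a1, indicator_of_mem hω]; simp,
    fun hω => by rw [a1, indicator_of_notMem hω]; simp⟩

theorem memLp_ite {m : MeasurableSpace Ω} (hm : m ≤ mΩ) {A : Set Ω} (hA : MeasurableSet[m] A)
    {f g h : Ω → ℝ} (hf : MemLp (A.indicator f) p P) (hg : MemLp g p P)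
    (hW : ∀ᵐ ω ∂P, (ω ∈ A → h ω = f ω) ∧ (ω ∉ A → h ω = g ω)) : MemLp h p P := by
  refine (memLp_congr_ae (f := h) (g := A.indicator f + Aᶜ.indicator g) ?_).2
    (hf.add (hg.indicator (hm _ hA).compl))
  filter_upwards [hW] with ω a1
  by_cases hω : ω ∈ A
  · rw [Pi.add_apply, indicator_of_mem hω, indicator_of_notMem (Set.notMem_compl_iff.2 hω), a1.1 hω, add_zero]
  · rw [Pi.add_apply, indicator_of_notMem hω, indicator_of_mem (by exact hω), a1.2 hω, zero_add]

variable [IsProbabilityMeasure P]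

theorem memLtp_of_memLp (hμ : ∀ s, t ≤ s → 0 < μ s) (hp : p ≠ 0) {X : Proc T P}
    (h1 : Adapted ℱ X) (h2 : ∀ s < t, X s = 0) (h3 : ∀ s, MemLp (X s) p P) :
    MemLtp ℱ t μ p X :=
  (memLtp_iff hμ hp).2 ⟨h1, h2, fun s => LocLp.of_memLp (h3 s)⟩

theorem Ltp.exists_ite (hμ : ∀ s, t ≤ s → 0 < μ s) (hp : p ≠ 0) {A : Set Ω}
    (hA : MeasurableSet[ℱ t] A) (X Y : Ltp P ℱ t μ p) :
    ∃ W : Ltp P ℱ t μ p, ∀ s, ∀ᵐ ω ∂P, (ω ∈ A → W.1 s ω = X.1 s ω) ∧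
      (ω ∉ A → W.1 s ω = Y.1 s ω) := by
  obtain ⟨W, h⟩ := Ltp.exists_comb hμ hp (measurable_indicator_one hA)
    (show Measurable[ℱ t] fun ω => 1 - A.indicator (1 : Ω → ℝ) ω from
      measurable_const.sub (measurable_indicator_one hA)) X Y
  refine ⟨W, fun s => ?_⟩
  filter_upwards [h s] with ω a1
  exact ⟨fun hω => by rw [a1, indicator_of_mem hω]; simp,
    fun hω => by rw [a1, indicator_of_notMem hω]; simp⟩

theorem Ltp.zero_mem (hμ : ∀ s, t ≤ s → 0 < μ s) (hp : p ≠ 0) :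
    MemLtp ℱ t μ p (fun _ => 0 : Proc T P) :=
  memLtp_of_memLp hμ hp (fun _ => aestronglyMeasurable_zero.congr AEEqFun.coeFn_zero.symm)
    (fun _ _ => rfl) fun _ => (memLp_congr_ae AEEqFun.coeFn_zero).2 MemLp.zero

/-- The restriction of an element of `L^{t,p}` to a set on which it is `p`-integrable. -/
theorem Ltp.exists_restrict (hμ : ∀ s, t ≤ s → 0 < μ s) (hp : p ≠ 0) {B : Set Ω}
    (hB : MeasurableSet[ℱ t] B) (hPB : P B ≠ 0) (Y : Ltp P ℱ t μ p) :
    ∃ (B' : Set Ω) (W : Ltp P ℱ t μ p), MeasurableSet[ℱ t] B' ∧ B' ⊆ B ∧ P B' ≠ 0 ∧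
      (∀ s, MemLp (W.1 s) p P) ∧ ∀ s, ∀ᵐ ω ∂P, ω ∈ B' → W.1 s ω = Y.1 s ω := by
  obtain ⟨κ, hκ, h⟩ := Y.exists_memLp_on hμ hp
  obtain ⟨k, hk⟩ := exists_measure_inter_ne_zero hPB (S := fun k : ℕ => {ω | κ ω ≤ k})
    (Eventually.of_forall fun ω _ => exists_nat_ge (κ ω))
  have hA : MeasurableSet[ℱ t] (B ∩ {ω | κ ω ≤ k}) :=
    hB.inter (measurableSet_le hκ measurable_const)
  obtain ⟨W, hW⟩ := Ltp.exists_ite hμ hp hA Y ⟨_, Ltp.zero_mem hμ hp⟩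
  exact ⟨_, W, hA, inter_subset_left, hk, fun s => memLp_ite (ℱ.le t) hA
    (h s k _ hA inter_subset_right) ((memLp_congr_ae AEEqFun.coeFn_zero).2 MemLp.zero) (hW s),
    fun s => (hW s).mono fun _ h => h.1⟩

omit [IsProbabilityMeasure P] in
theorem IsUSCAssessmentIndex.congr_on {F : Ltp P ℱ t μ p → L0bar P ℱ t}
    (hF : IsUSCAssessmentIndex F) {A : Set Ω} (hA : MeasurableSet[ℱ t] A) {X Y : Ltp P ℱ t μ p}
    (h : ∀ s, ∀ᵐ ω ∂P, ω ∈ A → X.1 s ω = Y.1 s ω) :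
    ∀ᵐ ω ∂P, ω ∈ A → (F X).1 ω = (F Y).1 ω := by
  filter_upwards [hF.isLocal A hA Y X X fun s => (h s).mono fun ω h => ⟨h, fun _ => rfl⟩] with ω a
  exact a.1

/-- Two processes with nonnegative product and nonpositive pairing have disjoint supports. -/
theorem mul_eq_zero_of_pairing_nonpos [ENNReal.HolderConjugate p q] (hμ : ∀ s, t ≤ s → 0 < μ s)
    {Z X : Proc T P} (hZ : ∀ s, MemLp (Z s) q P) (hX : ∀ s, MemLp (X s) p P)
    (h0 : ∀ s, t ≤ s → ∀ᵐ ω ∂P, 0 ≤ Z s ω * X s ω)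
    (h : ∀ᵐ ω ∂P, (pairing P ℱ t μ Z X).1 ω ≤ 0) :
    ∀ s, t ≤ s → ∀ᵐ ω ∂P, Z s ω * X s ω = 0 := by
  have hpq' : ENNReal.HolderConjugate q p := ENNReal.HolderConjugate.symm
  obtain ⟨i, e⟩ := integral_pairing (ℱ := ℱ) (t := t) (μ := μ) (p := p) (q := q) hZ hX
  have h1 : ∫ ω, (pairing P ℱ t μ Z X).1 ω ∂P ≤ 0 := integral_nonpos_of_ae h
  rw [e] at h1
  have h2 : ∀ s ∈ Finset.Ici t, 0 ≤ μ s * ∫ ω, Z s ω * X s ω ∂P := fun s hs =>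
    mul_nonneg (hμ s (Finset.mem_Ici.1 hs)).le (integral_nonneg_of_ae (h0 s (Finset.mem_Ici.1 hs)))
  have h3 := (Finset.sum_eq_zero_iff_of_nonneg h2).1 (le_antisymm h1 (Finset.sum_nonneg h2))
  intro s hs
  have h4 := (mul_eq_zero.1 (h3 s (Finset.mem_Ici.2 hs))).resolve_left (hμ s hs).ne'
  exact (integral_eq_zero_iff_of_nonneg_ae (h0 s hs) ((hZ s).integrable_mul (hX s))).1 h4

/-- The constant process with value 1/∑ μ_s. It serves as a default off the event of interest. -/
theorem exists_isDual (q : ℝ≥0∞) (hμ : ∀ s, t ≤ s → 0 < μ s) :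
    ∃ Z : Proc T P, IsDual ℱ t μ q Z := by
  have hpos : 0 < ∑ s ∈ Finset.Ici t, μ s :=
    Finset.sum_pos (fun s hs => hμ s (Finset.mem_Ici.1 hs)) ⟨t, Finset.mem_Ici.2 le_rfl⟩
  set r := (∑ s ∈ Finset.Ici t, μ s)⁻¹ with hr
  obtain ⟨Z, hZ⟩ : ∃ Z : Proc T P, Z = fun s => if t ≤ s then AEEqFun.const Ω r else 0 := ⟨_, rfl⟩
  have h1 : ∀ s, t ≤ s → ∀ᵐ ω ∂P, Z s ω = r := fun s hs => by
    rw [hZ]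
    simp only [if_pos hs]
    exact AEEqFun.coeFn_const _ _
  have h0 : ∀ s, ¬ t ≤ s → ∀ᵐ ω ∂P, Z s ω = 0 := fun s hs => by
    rw [hZ]
    simp only [if_neg hs]
    exact AEEqFun.coeFn_zero
  refine ⟨Z, fun s => ?_, fun s hs => by rw [hZ]; exact if_neg (not_le.2 hs), fun s => ?_,
    fun s => ?_, ?_⟩
  · by_cases hs : t ≤ s
    · exact aestronglyMeasurable_const.congr ((h1 s hs).mono fun _ h => h.symm)
    · exact aestronglyMeasurable_const.congr ((h0 s hs).mono fun _ h => h.symm)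
  · by_cases hs : t ≤ s
    · filter_upwards [h1 s hs] with ω a
      rw [a]; exact (inv_pos.2 hpos).le
    · filter_upwards [h0 s hs] with ω a
      rw [a]
  · by_cases hs : t ≤ s
    · exact (memLp_congr_ae (h1 s hs)).2 (memLp_const r)
    · exact (memLp_congr_ae (h0 s hs)).2 (memLp_const 0)
  · have h2 : ∀ᵐ ω ∂P, ∑ s ∈ Finset.Ici t, Z s ω * μ s = 1 := by
      filter_upwards [ae_all_iff.2 fun s : Fin (T + 1) =>
        (show ∀ᵐ ω ∂P, t ≤ s → Z s ω = r from by
          by_cases hs : t ≤ s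
          · exact (h1 s hs).mono fun _ h _ => h
          · exact Eventually.of_forall fun _ h => absurd h hs)] with ω a
      rw [Finset.sum_congr rfl fun s hs => by rw [a s (Finset.mem_Ici.1 hs)], ← Finset.mul_sum, hr,
        inv_mul_cancel₀ hpos.ne']
    filter_upwards [condE_congr (ℱ := ℱ) (t := t) h2, condE_of_measurable (ℱ := ℱ) (t := t) (P := P)
      (g := fun _ => (1 : ℝ)) measurable_const] with ω a1 a2
    rw [a1, a2]

end

/-! ### Positivity and normalization of separating processes. -/

section

variable {Ω : Type*} {mΩ : MeasurableSpace Ω} {P : Measure Ω} [IsProbabilityMeasure P] {T : ℕ}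
  {ℱ : Filtration (Fin (T + 1)) mΩ} {t : Fin (T + 1)} {μ : Fin (T + 1) → ℝ} {p q : ℝ≥0∞}
  [ENNReal.HolderConjugate p q]

/-- A `q`-integrable process separating an upper level set is nonnegative. -/
theorem nonneg_of_separates_level_set (hμ : ∀ s, t ≤ s → 0 < μ s)
    {F : Ltp P ℱ t μ p → L0bar P ℱ t} (hF : IsUSCAssessmentIndex F) {B B' : Set Ω}
    (hB' : MeasurableSet[ℱ t] B') {c : EReal} {z : Proc T P} (hza : Adapted ℱ z)
    (hzq : ∀ s, MemLp (z s) q P) {a : L0 P ℱ t}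
    {Y : Ltp P ℱ t μ p} (hYp : ∀ s, MemLp (Y.1 s) p P) (hY : ∀ᵐ ω ∂P, ω ∈ B → c ≤ (F Y).1 ω)
    (hsep : ∀ Y : Ltp P ℱ t μ p, (∀ s, MemLp (Y.1 s) p P) →
      (∀ᵐ ω ∂P, ω ∈ B → c ≤ (F Y).1 ω) →
      ∀ᵐ ω ∂P, ω ∈ B' → a.1 ω ≤ (pairing P ℱ t μ Y.1 z).1 ω) :
    ∀ s, t ≤ s → ∀ᵐ ω ∂P, ω ∈ B' → 0 ≤ z s ω := by
  classical
  have hp : p ≠ 0 := ENNReal.HolderConjugate.ne_zero p q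
  have hpq' : ENNReal.HolderConjugate q p := ENNReal.HolderConjugate.symm
  choose g hg hgz using fun s => hza s
  have hSm : ∀ s, t ≤ s → MeasurableSet[ℱ s] ({ω | g s ω < 0} ∩ B') := fun s hs =>
    (measurableSet_lt (hg s).measurable measurable_const).inter (ℱ.mono hs _ hB')
  -- The test process lives exactly where `z` is negative on `B'`; it is nonnegative, so adding it
  -- increases `F`.
  let e : Fin (T + 1) → Ω → ℝ := fun s => ({ω | g s ω < 0} ∩ B').indicator (1 : Ω → ℝ)
  have hem : ∀ s, t ≤ s → Measurable[ℱ s] (e s) := fun s hs => measurable_indicator_one (hSm s hs)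
  let E : Proc T P := fun s => if hs : t ≤ s then
    AEEqFun.mk (e s) ((hem s hs).mono (ℱ.le s) le_rfl).aestronglyMeasurable else 0
  have hE : ∀ s, t ≤ s → ∀ᵐ ω ∂P, E s ω = e s ω := fun s hs => by
    simp only [E, dif_pos hs]
    exact AEEqFun.coeFn_mk _ _
  have hE0 : ∀ s < t, E s = 0 := fun s hs => dif_neg (not_le.2 hs)
  have hEa : Adapted ℱ E := fun s => by
    by_cases hs : t ≤ s
    · exact (hem s hs).stronglyMeasurable.aestronglyMeasurable.congr
        ((hE s hs).mono fun _ h => h.symm)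
    · rw [hE0 s (not_le.1 hs)]
      exact aestronglyMeasurable_zero.congr AEEqFun.coeFn_zero.symm
  have he01 : ∀ s ω, 0 ≤ e s ω ∧ e s ω ≤ 1 := fun s ω => by
    by_cases hω : ω ∈ {ω | g s ω < 0} ∩ B'
    · simp [e, indicator_of_mem hω]
    · simp [e, indicator_of_notMem hω]
  have hEp : ∀ s, MemLp (E s) p P := fun s => by
    by_cases hs : t ≤ s
    · refine (memLp_congr_ae (hE s hs)).2 (MemLp.of_bound
        ((hem s hs).mono (ℱ.le s) le_rfl).aestronglyMeasurable 1 (Eventually.of_forall fun ω => ?_))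
      rw [Real.norm_eq_abs, abs_of_nonneg (he01 s ω).1]
      exact (he01 s ω).2
    · rw [hE0 s (not_le.1 hs)]
      exact (memLp_congr_ae AEEqFun.coeFn_zero).2 MemLp.zero
  have hEL := memLtp_of_memLp hμ hp hEa hE0 hEp
  have hEnonneg : ∀ s, ∀ᵐ ω ∂P, 0 ≤ E s ω := fun s => by
    by_cases hs : t ≤ s
    · filter_upwards [hE s hs] with ω h
      rw [h]; exact (he01 s ω).1
    · rw [hE0 s (not_le.1 hs)]
      filter_upwards [AEEqFun.coeFn_zero (μ := P) (β := ℝ)] with ω h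
      rw [h]; rfl
  -- By monotonicity Y + rE stays in the level set for every r. The separation bounds ⟨Y, z⟩ + r⟨E,
  -- z⟩ from below uniformly in r, which forces ⟨E, z⟩ ≥ 0 on `B'`.
  have hr : ∀ r : ℕ, ∀ᵐ ω ∂P, ω ∈ B' → a.1 ω ≤ (pairing P ℱ t μ Y.1 z).1 ω
      + r * (pairing P ℱ t μ E z).1 ω := by
    intro r
    obtain ⟨W, hW⟩ := Ltp.exists_comb hμ hp (a := fun _ => (1 : ℝ)) (b := fun _ => (r : ℝ))
      measurable_const measurable_const Y ⟨E, hEL⟩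
    have hWp : ∀ s, MemLp (W.1 s) p P := fun s => by
      refine (memLp_congr_ae ?_).2 ((hYp s).add ((hEp s).const_mul (r : ℝ)))
      filter_upwards [hW s] with ω h
      rw [h, Pi.add_apply, one_mul]
    have hYW : F Y ≤ F W := hF.mono Y W fun s => by
      rw [← AEEqFun.coeFn_le]
      filter_upwards [hW s, hEnonneg s] with ω h1 h2
      rw [h1, one_mul]
      exact le_add_of_nonneg_right (mul_nonneg r.cast_nonneg h2)
    filter_upwards [hsep W hWp (by
        filter_upwards [hY, L0bar.le_iff.1 hYW] with ω h1 h2 hω using (h1 hω).trans h2),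
      pairing_comb_left (μ := μ) (p := q) (q := p) (W := W.1) (X := z)
      (fun s => LocLp.of_memLp (hYp s)) (fun s => LocLp.of_memLp (hEp s))
      (fun s => LocLp.of_memLp (hzq s)) (a := fun _ => (1 : ℝ)) (b := fun _ => (r : ℝ))
      measurable_const measurable_const (fun s _ => hW s)] with ω h1 h2 hω
    rw [h2, one_mul] at h1
    exact h1 hω
  have hge : ∀ᵐ ω ∂P, ω ∈ B' → 0 ≤ (pairing P ℱ t μ E z).1 ω := by
    filter_upwards [ae_all_iff.2 hr] with ω h hω
    by_contra! hlt
    obtain ⟨r, hr⟩ := exists_nat_gt (((pairing P ℱ t μ Y.1 z).1 ω - a.1 ω)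
      / -(pairing P ℱ t μ E z).1 ω)
    rw [div_lt_iff₀ (neg_pos.2 hlt)] at hr
    have := h r hω
    linarith
  have hge0 : ∀ᵐ ω ∂P, 0 ≤ (pairing P ℱ t μ E z).1 ω := by
    filter_upwards [hge, pairing_congr_on (μ := μ) (p := q) (q := p) (Z := E) (Z' := fun _ => 0)
      (X := z) (X' := z) (A := B'ᶜ)
      (fun s => LocLp.of_memLp (hEp s)) (fun s => LocLp.of_memLp (hzq s))
      (fun s => LocLp.of_memLp ((memLp_congr_ae AEEqFun.coeFn_zero).2 MemLp.zero))
      (fun s => LocLp.of_memLp (hzq s)) hB'.compl (fun s => by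
        by_cases hs : t ≤ s
        · filter_upwards [hE s hs, AEEqFun.coeFn_zero (μ := P) (β := ℝ)] with ω h1 h2 hω
          rw [h1, h2]
          exact indicator_of_notMem (fun h => hω h.2) _
        · rw [hE0 s (not_le.1 hs)]
          exact Eventually.of_forall fun _ _ => rfl)
      (fun s => Eventually.of_forall fun _ _ => rfl),
      pairing_comb_left (ℱ := ℱ) (t := t) (μ := μ) (p := q) (q := p) (W := fun _ => 0) (X := z)
        (Z := E) (Z' := E) (fun s => LocLp.of_memLp (hEp s)) (fun s => LocLp.of_memLp (hEp s))
        (fun s => LocLp.of_memLp (hzq s)) (a := fun _ => (0 : ℝ)) (b := fun _ => (0 : ℝ))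
        measurable_const measurable_const (fun s _ => by
          filter_upwards [AEEqFun.coeFn_zero (μ := P) (β := ℝ)] with ω h2
          rw [h2]; simp)] with ω h1 h2 h3
    by_cases hω : ω ∈ B'
    · exact h1 hω
    · rw [h2 hω, h3]; simp
  -- The product of -z and E is nonnegative by the choice of E, while its pairing is nonpositive;
  -- hence it vanishes, and z < 0 is impossible on `B'`.
  have hzero := mul_eq_zero_of_pairing_nonpos (ℱ := ℱ) (p := p) (q := q) hμ (Z := fun s => -z s)
    (X := E) (fun s => (memLp_congr_ae (AEEqFun.coeFn_neg _)).2 (hzq s).neg) hEp (fun s hs => by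
      filter_upwards [hE s hs, hgz s, AEEqFun.coeFn_neg (z s)] with ω h1 h2 h3
      rw [h1, h3, Pi.neg_apply, h2]
      by_cases hω : ω ∈ {ω | g s ω < 0} ∩ B'
      · simp only [e, indicator_of_mem hω, Pi.one_apply, mul_one]
        have : g s ω < 0 := hω.1
        linarith
      · simp [e, indicator_of_notMem hω]) (by
      filter_upwards [hge0, pairing_comb_right (ℱ := ℱ) (t := t) (μ := μ) (p := q) (q := p) (Z := E)
        (X := z) (Y := z) (W := fun s => -z s) (fun s => LocLp.of_memLp (hEp s))
        (fun s => LocLp.of_memLp (hzq s)) (fun s => LocLp.of_memLp (hzq s))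
        (a := fun _ => (-1 : ℝ)) (b := fun _ => (0 : ℝ)) measurable_const measurable_const
        (fun s _ => by
          filter_upwards [AEEqFun.coeFn_neg (z s)] with ω h2
          rw [h2]; simp)] with ω h1 h2
      rw [pairing_comm, h2]
      linarith)
  intro s hs
  filter_upwards [hzero s hs, hE s hs, hgz s, AEEqFun.coeFn_neg (z s)] with ω h1 h2 h3 h4 hω
  by_contra! hlt
  rw [h3] at hlt
  rw [h2, h4, Pi.neg_apply, h3] at h1
  simp only [e, indicator_of_mem (show ω ∈ {ω | g s ω < 0} ∩ B' from ⟨hlt, hω⟩), Pi.one_apply,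
    mul_one] at h1
  linarith

/-- Normalization of a nonnegative `q`-integrable process on a set where it does not vanish. -/
theorem exists_isDual_smul (hμ : ∀ s, t ≤ s → 0 < μ s) {z : Proc T P} (hza : Adapted ℱ z)
    (hz0 : ∀ s < t, z s = 0) (hzq : ∀ s, MemLp (z s) q P) {B : Set Ω} (hB : MeasurableSet[ℱ t] B)
    (hPB : P B ≠ 0) (hz : ∀ s, t ≤ s → ∀ᵐ ω ∂P, ω ∈ B → 0 ≤ z s ω)
    {Y : Proc T P} (hY : ∀ s, LocLp (ℱ t) p (Y s) P)
    (hne : ∀ᵐ ω ∂P, ω ∈ B → (pairing P ℱ t μ z Y).1 ω ≠ 0) :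
    ∃ (Z : Proc T P) (B' : Set Ω) (N : Ω → ℝ), IsDual ℱ t μ q Z ∧ MeasurableSet[ℱ t] B' ∧ B' ⊆ B ∧
      P B' ≠ 0 ∧ Measurable[ℱ t] N ∧ (∀ ω ∈ B', 0 < N ω) ∧
      ∀ s, ∀ᵐ ω ∂P, ω ∈ B' → Z s ω = N ω * z s ω := by
  classical
  have hp : p ≠ 0 := ENNReal.HolderConjugate.ne_zero p q
  have hpq' : ENNReal.HolderConjugate q p := ENNReal.HolderConjugate.symm
  obtain ⟨E, hE⟩ := Ltp.exists_const (P := P) (ℱ := ℱ) hμ hp (r := fun _ => (1 : ℝ))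
    measurable_const
  let M : Ω → ℝ := (pairing P ℱ t μ z E.1).rep
  have hM : Measurable[ℱ t] M := L0.measurable_rep _
  have hMz : ∀ᵐ ω ∂P, (pairing P ℱ t μ z E.1).1 ω = M ω := L0.coeFn_eq_rep _
  have hEp : ∀ s, LocLp (ℱ t) p (E.1 s) P := E.locLp hμ hp
  have hzL : ∀ s, LocLp (ℱ t) q (z s) P := fun s => LocLp.of_memLp (hzq s)
  -- Where the total mass `M` is nonpositive, the nonnegative process `z` vanishes, so its pairing
  -- with `Y` would be 0.
  have hpos : ∀ᵐ ω ∂P, ω ∈ B → 0 < M ω := by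
    have hS : MeasurableSet[ℱ t] ({ω | M ω ≤ 0} ∩ B) :=
      (measurableSet_le hM measurable_const).inter hB
    have hem := measurable_indicator_one hS
    have heL := Ltp.exists_const (P := P) (ℱ := ℱ) hμ hp hem
    obtain ⟨E', hE'⟩ := heL
    have hEp' : ∀ s, MemLp (E'.1 s) p P := fun s => by
      by_cases hs : t ≤ s
      · refine (memLp_congr_ae (hE' s hs)).2 (MemLp.of_bound
          (hem.mono (ℱ.le t) le_rfl).aestronglyMeasurable 1 (Eventually.of_forall fun ω => ?_))
        by_cases hω : ω ∈ {ω | M ω ≤ 0} ∩ B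
        · simp [indicator_of_mem hω]
        · simp [indicator_of_notMem hω]
      · rw [E'.2.2.1 s (not_le.1 hs)]
        exact (memLp_congr_ae AEEqFun.coeFn_zero).2 MemLp.zero
    have hzero := mul_eq_zero_of_pairing_nonpos (ℱ := ℱ) (p := p) (q := q) hμ hzq hEp'
      (fun s hs => by
        filter_upwards [hE' s hs, hz s hs] with ω h1 h2
        rw [h1]
        by_cases hω : ω ∈ {ω | M ω ≤ 0} ∩ B
        · rw [indicator_of_mem hω]; simpa using h2 hω.2
        · rw [indicator_of_notMem hω]; simp) (by
        filter_upwards [hMz, pairing_comb_right (μ := μ) (p := p) (q := q) (Z := z) (W := E'.1)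
          (X := E.1) (Y := E.1) hzL hEp hEp hem (b := fun _ => (0 : ℝ)) measurable_const
          (fun s hs => by
            filter_upwards [hE s hs, hE' s hs] with ω h1 h2
            rw [h1, h2]; simp)] with ω h1 h2
        rw [h2, h1]
        by_cases hω : ω ∈ {ω | M ω ≤ 0} ∩ B
        · rw [indicator_of_mem hω]; simpa using hω.1
        · rw [indicator_of_notMem hω]; simp)
    filter_upwards [hne, pairing_congr_on (μ := μ) (p := p) (q := q) (Z := z) (Z' := fun _ => 0)
      (X := Y) (X' := Y) hzL hY
      (fun s => LocLp.of_memLp ((memLp_congr_ae AEEqFun.coeFn_zero).2 MemLp.zero)) hY hS (fun s => by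
        by_cases hs : t ≤ s
        · filter_upwards [hzero s hs, hE' s hs, AEEqFun.coeFn_zero (μ := P) (β := ℝ)]
            with ω h1 h2 h3 hω
          rw [h2, indicator_of_mem hω] at h1
          rw [h3]
          simpa using h1
        · rw [hz0 s (not_le.1 hs)]
          exact Eventually.of_forall fun _ _ => rfl)
      (fun s => Eventually.of_forall fun _ _ => rfl),
      pairing_comb_left (ℱ := ℱ) (t := t) (μ := μ) (p := p) (q := q) (W := fun _ => 0) (X := Y)
        (Z := z) (Z' := z) hzL hzL hY (a := fun _ => (0 : ℝ)) (b := fun _ => (0 : ℝ))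
        measurable_const measurable_const (fun s _ => by
          filter_upwards [AEEqFun.coeFn_zero (μ := P) (β := ℝ)] with ω h2
          rw [h2]; simp)] with ω h1 h2 h3 hω
    by_contra hle
    refine h1 hω ?_
    rw [h2 ⟨not_lt.1 hle, hω⟩, h3]
    simp
  obtain ⟨k, hk⟩ := exists_measure_inter_ne_zero hPB
    (S := fun k : ℕ => {ω | 1 / ((k : ℝ) + 1) ≤ M ω}) (by
      filter_upwards [hpos] with ω h hω
      obtain ⟨k, hk⟩ := exists_nat_one_div_lt (h hω)
      exact ⟨k, hk.le⟩)
  -- On this event 1/M ≤ k + 1, so dividing by the mass preserves L^q.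
  set B' := B ∩ {ω | 1 / ((k : ℝ) + 1) ≤ M ω} with hB'def
  have hB' : MeasurableSet[ℱ t] B' := hB.inter (measurableSet_le measurable_const hM)
  have hk0 : (0 : ℝ) < 1 / ((k : ℝ) + 1) := by positivity
  obtain ⟨Z₀, hZ₀⟩ := exists_isDual (P := P) (ℱ := ℱ) q hμ
  have ha : Measurable[ℱ t] fun ω => B'.indicator (1 : Ω → ℝ) ω * (M ω)⁻¹ :=
    (measurable_indicator_one hB').mul hM.inv
  have hb : Measurable[ℱ t] fun ω => 1 - B'.indicator (1 : Ω → ℝ) ω :=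
    measurable_const.sub (measurable_indicator_one hB')
  -- Off `B'` the default `Z₀` is used, since the normalization must hold on all of Ω.
  obtain ⟨Z, hZa, hZ0, hZ⟩ := exists_comb ha hb hza hZ₀.adapted hz0 hZ₀.zero
  have hZB : ∀ s, ∀ᵐ ω ∂P, (ω ∈ B' → Z s ω = (M ω)⁻¹ * z s ω) ∧ (ω ∉ B' → Z s ω = Z₀ s ω) :=
    fun s => by
      filter_upwards [hZ s] with ω h
      exact ⟨fun hω => by rw [h, indicator_of_mem hω]; simp,
        fun hω => by rw [h, indicator_of_notMem hω]; simp⟩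
  have hZdual : IsDual ℱ t μ q Z := by
    refine isDual_of_pairing_one hμ hZa hZ0 (fun s => ?_) (fun s => ?_) hp fun E₁ hE₁ => ?_
    · by_cases hs : t ≤ s
      · filter_upwards [hZB s, hZ₀.nonneg s, hz s hs] with ω h1 h2 h3
        by_cases hω : ω ∈ B'
        · rw [h1.1 hω]
          exact mul_nonneg (inv_nonneg.2 (hk0.le.trans hω.2)) (h3 hω.1)
        · rw [h1.2 hω]; exact h2
      · rw [hZ0 s (not_le.1 hs)]
        filter_upwards [AEEqFun.coeFn_zero (μ := P) (β := ℝ)] with ω h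
        rw [h]; rfl
    · refine memLp_ite (ℱ.le t) hB' (f := fun ω => (M ω)⁻¹ * z s ω) ?_ (hZ₀.memLp s) (hZB s)
      refine MemLp.of_le_mul (c := (k : ℝ) + 1) (hzq s) ?_ (Eventually.of_forall fun ω => ?_)
      · exact (((hM.mono (ℱ.le t) le_rfl).inv).aestronglyMeasurable.mul
          (z s).aestronglyMeasurable).indicator (ℱ.le t _ hB')
      · by_cases hω : ω ∈ B'
        · rw [indicator_of_mem hω, norm_mul]
          refine mul_le_mul_of_nonneg_right ?_ (norm_nonneg _)
          have h1 : 1 / ((k : ℝ) + 1) ≤ M ω := hω.2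
          rw [Real.norm_eq_abs, abs_of_nonneg (inv_nonneg.2 (hk0.le.trans h1))]
          rw [← one_div, one_div_le (hk0.trans_le h1) (by positivity)]
          exact h1
        · rw [indicator_of_notMem hω, norm_zero]
          positivity
    · filter_upwards [pairing_comb_left (μ := μ) (p := p) (q := q) (W := Z) (X := E₁.1)
        hzL hZ₀.locLp (E₁.locLp hμ hp) ha hb (fun s _ => hZ s),
        pairing_congr_on (μ := μ) (p := p) (q := q) (Z := z) (X := E₁.1) (Z' := z) (X' := E.1)
          hzL (E₁.locLp hμ hp) hzL hEp MeasurableSet.univ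
          (fun s => Eventually.of_forall fun _ _ => rfl) (fun s => by
            by_cases hs : t ≤ s
            · filter_upwards [hE s hs, hE₁ s hs] with ω h1 h2 _
              rw [h1, h2]
            · rw [E.2.2.1 s (not_le.1 hs), E₁.2.2.1 s (not_le.1 hs)]
              exact Eventually.of_forall fun _ _ => rfl), hMz,
        pairing_one (P := P) (ℱ := ℱ) (μ := μ) (Z := Z₀) hE₁, hZ₀.norm] with ω h1 h2 h3 h4 h5
      rw [h1, h2 (mem_univ _), h3, h4, h5]
      by_cases hω : ω ∈ B'
      · rw [indicator_of_mem hω]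
        have : M ω ≠ 0 := (hk0.trans_le hω.2).ne'
        simp [this]
      · rw [indicator_of_notMem hω]; simp
  exact ⟨Z, B', fun ω => (M ω)⁻¹, hZdual, hB', inter_subset_left, hk, hM.inv,
    fun ω hω => inv_pos.2 (hk0.trans_le hω.2), fun s => (hZB s).mono fun _ h => h.1⟩

end

/-! ### The representation of F by its minimal risk function. -/

section

variable {Ω : Type*} {mΩ : MeasurableSpace Ω} {P : Measure Ω} [IsProbabilityMeasure P] {T : ℕ}
  {ℱ : Filtration (Fin (T + 1)) mΩ} {t : Fin (T + 1)} {μ : Fin (T + 1) → ℝ} {p q : ℝ≥0∞}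

omit [IsProbabilityMeasure P] in
/-- If `f ≤ g` fails, then `f > c > g` on a nonnull set for some real constant `c`. -/
theorem L0bar.exists_between_of_not_le {f g : L0bar P ℱ t} (h : ¬ f ≤ g) :
    ∃ (c : ℝ) (B : Set Ω), MeasurableSet[ℱ t] B ∧ P B ≠ 0 ∧
      ∀ᵐ ω ∂P, ω ∈ B → g.1 ω < c ∧ (c : EReal) < f.1 ω := by
  have h1 : P {ω | g.rep ω < f.rep ω} ≠ 0 := by
    intro h0
    refine h (L0bar.le_iff.2 ?_)
    rw [measure_eq_zero_iff_ae_notMem] at h0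
    filter_upwards [h0, f.coeFn_eq_rep, g.coeFn_eq_rep] with ω a1 a2 a3
    rw [a2, a3]
    exact not_lt.1 a1
  -- A rational lies strictly between the two values at each point of the event; countability fixes
  -- one rational on a nonnull part.
  obtain ⟨k, hk⟩ := exists_measure_inter_ne_zero h1
    (S := fun k : ℕ => {ω | g.rep ω < (((Encodable.decode (α := ℚ) k).getD 0 : ℝ) : EReal)} ∩
      {ω | (((Encodable.decode (α := ℚ) k).getD 0 : ℝ) : EReal) < f.rep ω})
    (Eventually.of_forall fun ω hω => by
      obtain ⟨r, hr1, hr2⟩ := EReal.lt_iff_exists_rat_btwn.1 hω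
      refine ⟨Encodable.encode r, ?_⟩
      simp only [Encodable.encodek, Option.getD_some]
      exact ⟨hr1, hr2⟩)
  refine ⟨(((Encodable.decode (α := ℚ) k).getD 0 : ℚ) : ℝ), _, ?_, fun h0 => hk (measure_mono_null inter_subset_right h0), ?_⟩
  · exact (measurableSet_lt g.measurable_rep measurable_const).inter
      (measurableSet_lt measurable_const f.measurable_rep)
  · filter_upwards [f.coeFn_eq_rep, g.coeFn_eq_rep] with ω a2 a3 hω
    rw [a2, a3]
    exact hω

/-- The upper level set of p-integrable processes is convex by quasiconcavity, stable under pasting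
by locality, and closed under dominated limits by upper semicontinuity. Local separation applies
with p and q interchanged and a scalar component identically 0. -/
theorem IsUSCAssessmentIndex.exists_separation [ENNReal.HolderConjugate p q]
    (hμ : ∀ s, t ≤ s → 0 < μ s) {F : Ltp P ℱ t μ p → L0bar P ℱ t} (hF : IsUSCAssessmentIndex F)
    {B : Set Ω} (hB : MeasurableSet[ℱ t] B) (hPB : P B ≠ 0) {c : EReal} {X Y : Ltp P ℱ t μ p}
    (hXp : ∀ s, MemLp (X.1 s) p P) (hYp : ∀ s, MemLp (Y.1 s) p P)
    (hX : ∀ᵐ ω ∂P, ω ∈ B → (F X).1 ω < c) (hY : ∀ᵐ ω ∂P, ω ∈ B → c ≤ (F Y).1 ω) :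
    ∃ (z : Proc T P) (B' : Set Ω) (η : ℝ), Adapted ℱ z ∧ (∀ s < t, z s = 0) ∧
      (∀ s, MemLp (z s) q P) ∧ MeasurableSet[ℱ t] B' ∧ B' ⊆ B ∧ P B' ≠ 0 ∧ 0 < η ∧
      ∀ Y : Ltp P ℱ t μ p, (∀ s, MemLp (Y.1 s) p P) → (∀ᵐ ω ∂P, ω ∈ B → c ≤ (F Y).1 ω) →
        ∀ᵐ ω ∂P, ω ∈ B' → (pairing P ℱ t μ z X.1).1 ω + η ≤ (pairing P ℱ t μ z Y.1).1 ω := by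
  have hp : p ≠ 0 := ENNReal.HolderConjugate.ne_zero p q
  have hpq' : ENNReal.HolderConjugate q p := ENNReal.HolderConjugate.symm
  let o : L0 P ℱ t := L0.of P (fun _ => 0) measurable_const
  have ho : ∀ᵐ ω ∂P, o.1 ω = 0 := L0.coeFn_of _ _
  have hop : MemLp o.1 p P := (memLp_congr_ae ho).2 (memLp_const 0)
  let K : Set (Proc T P × L0 P ℱ t) := {k | ∃ Y : Ltp P ℱ t μ p, k.1 = Y.1 ∧
    (∀ s, MemLp (Y.1 s) p P) ∧ (∀ᵐ ω ∂P, k.2.1 ω = 0) ∧ ∀ᵐ ω ∂P, ω ∈ B → c ≤ (F Y).1 ω}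
  have hzero : ∀ (w Y Y' : Proc T P) (l : Ω → ℝ), (∀ s < t, Y s = 0) → (∀ s < t, Y' s = 0) →
      (∀ s, ∀ᵐ ω ∂P, w s ω = l ω * Y s ω + (1 - l ω) * Y' s ω) → ∀ s < t, w s = 0 := by
    intro w Y Y' l h1 h2 h s hs
    refine AEEqFun.ext ?_
    filter_upwards [h s, AEEqFun.coeFn_zero (μ := P) (β := ℝ)] with ω a1 a2
    rw [a1, h1 s hs, h2 s hs, a2]; simp
  have hcombK : ∀ l : Ω → ℝ, Measurable[ℱ t] l → (∀ ω, 0 ≤ l ω ∧ l ω ≤ 1) →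
      ∀ Y Y' : Ltp P ℱ t μ p, (∀ s, MemLp (Y.1 s) p P) → (∀ s, MemLp (Y'.1 s) p P) →
      ∀ w : Proc T P, (∀ s, ∀ᵐ ω ∂P, w s ω = l ω * Y.1 s ω + (1 - l ω) * Y'.1 s ω) →
      ∃ W : Ltp P ℱ t μ p, w = W.1 ∧ ∀ s, MemLp (W.1 s) p P := by
    intro l hl hl01 Y Y' hY hY' w hw
    have h1 : ∀ s, MemLp (w s) p P := fun s =>
      memLp_comb (ℱ.le t) (hY s) (hY' s) hl (Eventually.of_forall hl01) (hw s)
    refine ⟨⟨w, memLtp_of_memLp hμ hp (fun s => ?_) (hzero w _ _ l Y.2.2.1 Y'.2.2.1 hw) h1⟩, rfl,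
      h1⟩
    by_cases hs : t ≤ s
    · exact aestronglyMeasurable_comb (Y.2.1 s) (Y'.2.1 s) (hl.mono (ℱ.mono hs) le_rfl)
        (show Measurable[ℱ s] fun ω => 1 - l ω from
          measurable_const.sub (hl.mono (ℱ.mono hs) le_rfl)) (hw s)
    · rw [hzero w _ _ l Y.2.2.1 Y'.2.2.1 hw s (not_le.1 hs)]
      exact aestronglyMeasurable_zero.congr AEEqFun.coeFn_zero.symm
  obtain ⟨z, ξ, B', η, h1, h2, h3, -, h5, h6, h7, h8, h9⟩ :=
    exists_local_separation (p := q) (q := p) (μ := μ) hμ (K := K) (x := (X.1, o)) (B := B)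
    (by rintro _ ⟨Y, hY, -⟩; rw [hY]; exact Y.2.1)
    (by rintro _ ⟨Y, hY, -⟩; rw [hY]; exact Y.2.2.1)
    (by rintro _ ⟨Y, hY, hYp, -⟩; rw [hY]; exact hYp)
    (by rintro _ ⟨Y, -, -, h, -⟩; exact (memLp_congr_ae h).2 (memLp_const 0))
    (by
      rintro l hl hl01 _ ⟨Y, e, hYp, hv, hc⟩ _ ⟨Y', e', hYp', hv', hc'⟩ w hw1 hw2
      rw [e, e'] at hw1
      obtain ⟨W, hW, hWp⟩ := hcombK l hl hl01 Y Y' hYp hYp' w.1 hw1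
      refine ⟨W, hW, hWp, ?_, ?_⟩
      · filter_upwards [hw2, hv, hv'] with ω a1 a2 a3
        rw [a1, a2, a3]; simp
      · filter_upwards [hc, hc', hF.quasiconcave (L0.of P l hl) (by
          filter_upwards [L0.coeFn_of (P := P) l hl] with ω a
          rw [a]; exact hl01 ω) Y Y' W (fun s => by
          filter_upwards [L0.coeFn_of (P := P) l hl, hw1 s] with ω a a'
          rw [a, ← hW, a'])] with ω a1 a2 a3 hω
        exact (le_min (a1 hω) (a2 hω)).trans a3)
    (by
      intro k h hh hk hkh w hw1 hw2 _
      choose Y e hYp hv hc using hk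
      have hwp : ∀ s, MemLp (w.1 s) p P := fun s => by
        refine hh.mono (w.1 s).aestronglyMeasurable ?_
        filter_upwards [hw1 s, ae_all_iff.2 fun n => hkh n s] with ω a1 a2
        exact le_of_tendsto' a1.norm a2
      have hw0 : ∀ s < t, w.1 s = 0 := fun s hs => by
        refine AEEqFun.ext ?_
        filter_upwards [hw1 s, AEEqFun.coeFn_zero (μ := P) (β := ℝ)] with ω a1 a2
        have : (fun n => (k n).1 s ω) = fun _ => 0 := by
          funext n
          rw [e n, (Y n).2.2.1 s hs, a2]; rfl
        rw [this] at a1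
        rw [a2]
        exact tendsto_nhds_unique a1 tendsto_const_nhds
      let W : Ltp P ℱ t μ p := ⟨w.1, memLtp_of_memLp hμ hp (fun s =>
        aestronglyMeasurable_of_tendsto_ae_of_le (f := fun n => (k n).1 s)
          (fun n => by rw [e n]; exact (Y n).2.1 s) (hw1 s)) hw0 hwp⟩
      refine ⟨W, rfl, hwp, ?_, ?_⟩
      · filter_upwards [hw2, ae_all_iff.2 hv] with ω a1 a2
        simp only [a2] at a1
        exact tendsto_nhds_unique a1 tendsto_const_nhds
      · refine hF.le_of_tendsto (q := q) hμ hB (G := fun _ => h) (Y := Y) (X := W)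
          (fun _ => LocLp.of_memLp hh) (fun n s => ?_) (fun s => ?_) hc
        · filter_upwards [hkh n s] with ω a
          rw [← e n]; exact a
        · filter_upwards [hw1 s] with ω a
          simp only [← e]
          exact a)
    X.2.1 X.2.2.1 hXp hop (by
      rintro ⟨Y, e, -, -, hc⟩
      have : X = Y := Subtype.ext e
      rw [← this] at hc
      refine hPB ?_
      rw [measure_eq_zero_iff_ae_notMem]
      filter_upwards [hX, hc] with ω a1 a2 hω
      exact absurd (a2 hω) (not_le.2 (a1 hω)))
    ⟨(Y.1, o), Y, rfl, hYp, ho, hY⟩ hB (by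
      rintro _ ⟨Y, e, hYp, hv, hc⟩ w hw1 hw2
      rw [e] at hw1
      obtain ⟨W, hW, hWp⟩ := hcombK _ (measurable_indicator_one hB) (fun ω => by
        by_cases hω : ω ∈ B
        · simp [indicator_of_mem hω]
        · simp [indicator_of_notMem hω]) Y X hYp hXp w.1 (fun s => by
        filter_upwards [hw1 s] with ω a1
        by_cases hω : ω ∈ B
        · rw [a1.1 hω, indicator_of_mem hω]; simp
        · rw [a1.2 hω, indicator_of_notMem hω]; simp)
      refine ⟨W, hW, hWp, ?_, ?_⟩
      · filter_upwards [hw2, hv, ho] with ω a1 a2 a3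
        by_cases hω : ω ∈ B
        · rw [a1.1 hω, a2]
        · rw [a1.2 hω, a3]
      · filter_upwards [hc, hF.congr_on hB (X := W) (Y := Y) (fun s => by
          filter_upwards [hw1 s] with ω a1 hω
          rw [← hW, a1.1 hω])] with ω a1 a2 hω
        rw [a2 hω]; exact a1 hω)
  refine ⟨z, B', η, h1, h2, h3, h5, h6, h7, h8, fun Y hYp hY => ?_⟩
  filter_upwards [h9 (Y.1, o) ⟨Y, rfl, hYp, ho, hY⟩, ho] with ω a1 a2 hω
  have := a1 hω
  rw [a2] at this
  rw [pairing_comm z, pairing_comm z]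
  linarith

/-- If a lower bound b exceeded F X, a constant c would lie strictly between them on an event.
Separating X from {F ≥ c} there and normalizing gives a Z for which every Y with ⟨Z, Y⟩ slightly
above ⟨Z, X⟩ at most satisfies F Y ≤ c; this bounds the risk at ⟨Z, X⟩, and hence b, by c. -/
theorem isGLB_riskOf [ENNReal.HolderConjugate p q] (hμ : ∀ s, t ≤ s → 0 < μ s)
    {F : Ltp P ℱ t μ p → L0bar P ℱ t} (hF : IsUSCAssessmentIndex F) (X : Ltp P ℱ t μ p) :
    IsGLB (range fun Z : MD P ℱ t μ q => riskOf F Z (pairing P ℱ t μ Z.1 X.1).toBar) (F X) := by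
  have hp : p ≠ 0 := ENNReal.HolderConjugate.ne_zero p q
  have hloc := fun Z : MD P ℱ t μ q => isLocalMap_maxRisk hμ F Z
  have hmono := fun Z : MD P ℱ t μ q => monotone_maxRisk F Z
  have hR := fun Z : MD P ℱ t μ q => isRightVersion_rightVersion (maxRisk F Z)
  constructor
  · rintro _ ⟨Z, rfl⟩
    rw [L0bar.le_iff]
    filter_upwards [le_maxRisk F Z (pairing P ℱ t μ Z.1 X.1).toBar X,
      L0.coeFn_toBar (pairing P ℱ t μ Z.1 X.1), L0bar.le_iff.1 (le_rightVersion (hloc Z) (hmono Z)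
        (hR Z) (pairing P ℱ t μ Z.1 X.1).toBar)] with ω a1 a2 a3
    exact (a1 a2.symm.le).trans a3
  intro b hb
  by_contra hbX
  obtain ⟨c, B, hB, hPB, hc⟩ := L0bar.exists_between_of_not_le hbX
  -- The common contradiction: on A, b ≤ R(Z, ⟨Z, X⟩) ≤ M(Z, n) ≤ c < b, for a level n strictly
  -- above ⟨Z, X⟩.
  have hfalse : ∀ (Z : MD P ℱ t μ q) (n : L0bar P ℱ t) (A : Set Ω), MeasurableSet[ℱ t] A →
      A ⊆ B → P A ≠ 0 →
      (∀ᵐ ω ∂P, ω ∈ A → ((pairing P ℱ t μ Z.1 X.1).1 ω : EReal) < n.1 ω) →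
      (∀ Y : Ltp P ℱ t μ p, ∀ᵐ ω ∂P, ω ∈ A → ((pairing P ℱ t μ Z.1 Y.1).1 ω : EReal) ≤ n.1 ω →
        (F Y).1 ω ≤ c) → False := by
    intro Z n A hA hAB hPA hn hY
    refine hPA ?_
    rw [measure_eq_zero_iff_ae_notMem]
    have hcm := L0bar.coeFn_of (P := P) (fun _ => (c : EReal)) (measurable_const : Measurable[ℱ t] _)
    filter_upwards [hc, L0bar.le_iff.1 (hb ⟨Z, rfl⟩), (hR Z).le_on (hloc Z) (hmono Z) hA
        (s := (pairing P ℱ t μ Z.1 X.1).toBar) (n := n) (by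
          filter_upwards [hn, L0.coeFn_toBar (pairing P ℱ t μ Z.1 X.1)] with ω a1 a2 hω
          rw [a2]; exact a1 hω),
      maxRisk_le_on F Z n hA (L0bar.of P (fun _ => (c : EReal)) measurable_const) (fun Y => by
        filter_upwards [hY Y, hcm] with ω a1 a2 hω h
        rw [a2]; exact a1 hω h), hcm] with ω a1 a2 a3 a4 a5 hω
    rw [a5] at a4
    exact absurd ((a1 (hAB hω)).2) (not_lt.2 (a2.trans ((a3 hω).trans (a4 hω))))
  -- If no payoff reaches level c on a nonnull part of B, there is nothing to separate from; then F
  -- ≤ c on B, and any Z with n = ⊤ will do.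
  by_cases hcase : ∃ (Y : Ltp P ℱ t μ p) (A : Set Ω), MeasurableSet[ℱ t] A ∧ A ⊆ B ∧ P A ≠ 0 ∧
      ∀ᵐ ω ∂P, ω ∈ A → (c : EReal) ≤ (F Y).1 ω
  swap
  · obtain ⟨Z, hZ⟩ := exists_isDual (P := P) (ℱ := ℱ) q hμ
    refine hfalse (hZ.toMD hμ) (L0bar.of P (fun _ => ⊤) measurable_const) B hB subset_rfl hPB ?_
      fun Y => ?_
    · filter_upwards [L0bar.coeFn_of (P := P) (fun _ => (⊤ : EReal))
        (measurable_const : Measurable[ℱ t] _)] with ω a _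
      rw [a]; exact EReal.coe_lt_top _
    · have h0 : P ({ω | (c : EReal) < (F Y).rep ω} ∩ B) = 0 := by
        by_contra h0
        refine hcase ⟨Y, _, (measurableSet_lt measurable_const (F Y).measurable_rep).inter hB,
          inter_subset_right, h0, ?_⟩
        filter_upwards [(F Y).coeFn_eq_rep] with ω a hω
        rw [a]; exact le_of_lt hω.1
      rw [measure_eq_zero_iff_ae_notMem] at h0
      filter_upwards [h0, (F Y).coeFn_eq_rep] with ω a1 a2 hω _
      rw [a2]
      by_contra hlt
      exact a1 ⟨not_le.1 hlt, hω⟩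
  obtain ⟨Y₀, A₀, hA₀, hAB, hPA₀, hY₀⟩ := hcase
  -- Separation takes place in L^p, so both processes are restricted to an event on which they are
  -- p-integrable.
  obtain ⟨A₁, X₁, hA₁, hA₁₀, hPA₁, hX₁p, hX₁⟩ := X.exists_restrict hμ hp hA₀ hPA₀
  obtain ⟨A₂, Y₁, hA₂, hA₂₁, hPA₂, hY₁p, hY₁⟩ := Y₀.exists_restrict hμ hp hA₁ hPA₁
  have hX₁' : ∀ s, ∀ᵐ ω ∂P, ω ∈ A₂ → X₁.1 s ω = X.1 s ω := fun s =>
    (hX₁ s).mono fun ω h hω => h (hA₂₁ hω)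
  have hFY₁ : ∀ᵐ ω ∂P, ω ∈ A₂ → (c : EReal) ≤ (F Y₁).1 ω := by
    filter_upwards [hY₀, hF.congr_on hA₂ hY₁] with ω a1 a2 hω
    rw [a2 hω]; exact a1 (hA₁₀ (hA₂₁ hω))
  have hFX₁ : ∀ᵐ ω ∂P, ω ∈ A₂ → (F X₁).1 ω < c := by
    filter_upwards [hc, hF.congr_on hA₂ hX₁'] with ω a1 a2 hω
    rw [a2 hω]; exact (a1 (hAB (hA₁₀ (hA₂₁ hω)))).1
  obtain ⟨z, B', η, hza, hz0, hzq, hB', hB'A, hPB', hη, hsep⟩ :=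
    hF.exists_separation (q := q) hμ hA₂ hPA₂ hX₁p hY₁p hFX₁ hFY₁
  have hzL : ∀ s, LocLp (ℱ t) q (z s) P := fun s => LocLp.of_memLp (hzq s)
  have hznn := nonneg_of_separates_level_set hμ hF hB' hza hzq (B := A₂)
    (a := (pairing P ℱ t μ z X₁.1).addConst η) hY₁p hFY₁ (fun Y hYp hY => by
      filter_upwards [hsep Y hYp hY, (pairing P ℱ t μ z X₁.1).coeFn_addConst η] with ω a1 a2 hω
      rw [a2, pairing_comm Y.1]
      exact a1 hω)
  -- The difference Y₁ - X₁ has pairing at least η with z on B', so z can be normalized there.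
  obtain ⟨U, hU⟩ := Ltp.exists_comb hμ hp (a := fun _ => (1 : ℝ)) (b := fun _ => (-1 : ℝ))
    measurable_const measurable_const Y₁ X₁
  obtain ⟨Z, B₃, N, hZ, hB₃, hB₃B', hPB₃, hN, hNpos, hZN⟩ :=
    exists_isDual_smul (p := p) (q := q) hμ hza hz0 hzq hB' hPB' hznn (U.locLp hμ hp) (by
      filter_upwards [hsep Y₁ hY₁p hFY₁, pairing_comb_right (μ := μ) (p := p) (q := q) (Z := z)
        (W := U.1) hzL (Y₁.locLp hμ hp) (X₁.locLp hμ hp) (a := fun _ => (1 : ℝ))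
        (b := fun _ => (-1 : ℝ)) measurable_const measurable_const (fun s _ => hU s)]
        with ω a1 a2 hω
      rw [a2]
      have := a1 hω
      intro h
      linarith)
  have hZz : ∀ W : Ltp P ℱ t μ p, ∀ᵐ ω ∂P, ω ∈ B₃ →
      (pairing P ℱ t μ Z W.1).1 ω = N ω * (pairing P ℱ t μ z W.1).1 ω := fun W => by
    obtain ⟨V, hVa, hV0, hV⟩ := exists_comb hN (b := fun _ => (0 : ℝ)) measurable_const hza hza hz0
      hz0
    have hVL : ∀ s, LocLp (ℱ t) q (V s) P := fun s => by
      refine LocLp.congr ((LocLp.of_memLp (m := ℱ t) (hzq s)).mul_left (ℱ.le t) hN) (ℱ.le t) ?_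
      filter_upwards [hV s] with ω a
      rw [a]; simp
    filter_upwards [pairing_congr_on (μ := μ) (p := p) (q := q) (Z := Z) (Z' := V) (X := W.1)
      (X' := W.1) hZ.locLp (W.locLp hμ hp) hVL (W.locLp hμ hp) hB₃ (fun s => by
        filter_upwards [hZN s, hV s] with ω a1 a2 hω
        rw [a1 hω, a2]; simp) (fun s => Eventually.of_forall fun _ _ => rfl),
      pairing_comb_left (μ := μ) (p := p) (q := q) (W := V) (X := W.1) hzL hzL (W.locLp hμ hp) hN
        (b := fun _ => (0 : ℝ)) measurable_const (fun s _ => hV s)] with ω a1 a2 hω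
    rw [a1 hω, a2]; simp
  -- The level is half a gap above ⟨Z, X⟩; since Z = N z on B₃, the gap there is N η.
  have hnm : Measurable[ℱ t] fun ω =>
      (((pairing P ℱ t μ Z X.1).rep ω + N ω * (η / 2) : ℝ) : EReal) :=
    measurable_coe_real_ereal.comp ((L0.measurable_rep _).add (hN.mul_const _))
  have hn : ∀ᵐ ω ∂P, (L0bar.of P _ hnm).1 ω
      = (((pairing P ℱ t μ Z X.1).1 ω + N ω * (η / 2) : ℝ) : EReal) := by
    filter_upwards [L0bar.coeFn_of (P := P) _ hnm, (pairing P ℱ t μ Z X.1).coeFn_eq_rep]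
      with ω a1 a2
    rw [a1, a2]
  refine hfalse (hZ.toMD hμ) (L0bar.of P _ hnm) B₃ hB₃
    (hB₃B'.trans (hB'A.trans (hA₂₁.trans (hA₁₀.trans hAB)))) hPB₃ ?_ fun Y => ?_
  · filter_upwards [hn] with ω a1 hω
    rw [a1, EReal.coe_lt_coe_iff]
    have := mul_pos (hNpos ω hω) (half_pos hη)
    exact lt_add_of_pos_right _ this
  · obtain ⟨κ, hκ, hκp⟩ := Y.exists_memLp_on hμ hp
    have hk : ∀ k : ℕ, ∀ᵐ ω ∂P, κ ω ≤ k → ω ∈ B₃ →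
        ((pairing P ℱ t μ Z Y.1).1 ω : EReal) ≤ (L0bar.of P _ hnm).1 ω → (F Y).1 ω ≤ c := by
      intro k
      have hA : MeasurableSet[ℱ t] ({ω | κ ω ≤ k} ∩ {ω | (c : EReal) < (F Y).rep ω}) :=
        (measurableSet_le hκ measurable_const).inter
          (measurableSet_lt measurable_const (F Y).measurable_rep)
      -- Where F Y > c and Y is p-integrable, keep Y; elsewhere use Y₁, which already reaches level
      -- c on A₂. The pasted process lies in the separated set, so ⟨Z, Y⟩ exceeds the chosen level
      -- where F Y > c.
      obtain ⟨W, hW⟩ := Ltp.exists_ite hμ hp hA Y Y₁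
      filter_upwards [hsep W (fun s => memLp_ite (ℱ.le t) hA
          (hκp s k _ hA inter_subset_left) (hY₁p s) (hW s)) (by
          filter_upwards [hFY₁, hF.isLocal _ hA Y Y₁ W hW, (F Y).coeFn_eq_rep] with ω a1 a2 a3 hω
          by_cases h : ω ∈ {ω | κ ω ≤ k} ∩ {ω | (c : EReal) < (F Y).rep ω}
          · rw [a2.1 h, a3]; exact le_of_lt h.2
          · rw [a2.2 h]; exact a1 hω),
        pairing_congr_on (μ := μ) (p := p) (q := q) (Z := z) (Z' := z) (X := W.1) (X' := Y.1)
          hzL (W.locLp hμ hp) hzL (Y.locLp hμ hp) hA (fun s => Eventually.of_forall fun _ _ => rfl)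
          (fun s => (hW s).mono fun _ h => h.1),
        pairing_congr_on (μ := μ) (p := p) (q := q) (Z := z) (Z' := z) (X := X₁.1) (X' := X.1)
          hzL (X₁.locLp hμ hp) hzL (X.locLp hμ hp) hA₂ (fun s => Eventually.of_forall fun _ _ => rfl)
          hX₁', hZz X, hZz Y, hn, (F Y).coeFn_eq_rep] with ω a1 a2 a3 a4 a5 a6 a7 hκω hω hle
      by_contra hlt
      rw [a7] at hlt
      have hω' : ω ∈ B' := hB₃B' hω
      rw [a6, EReal.coe_le_coe_iff, a4 hω, a5 hω] at hle
      have h1 := a1 hω'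
      rw [a2 ⟨hκω, not_le.1 hlt⟩, a3 (hB'A hω')] at h1
      have h2 := mul_le_mul_of_nonneg_left h1 (hNpos ω hω).le
      have h3 := mul_pos (hNpos ω hω) hη
      rw [mul_add] at h2
      linarith
    filter_upwards [ae_all_iff.2 hk] with ω a hω hle
    obtain ⟨k, hk⟩ := exists_nat_ge (κ ω)
    exact a k hk hω hle

end

/-! ### Separation from the lower level sets of R⁻. -/

section

variable {Ω : Type*} {mΩ : MeasurableSpace Ω} {P : Measure Ω} {T : ℕ}
  {ℱ : Filtration (Fin (T + 1)) mΩ} {t : Fin (T + 1)} {μ : Fin (T + 1) → ℝ} {p q : ℝ≥0∞}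

theorem L0.exists_ite {A : Set Ω} (hA : MeasurableSet[ℱ t] A) (f g : L0 P ℱ t) :
    ∃ h : L0 P ℱ t, ∀ᵐ ω ∂P, (ω ∈ A → h.1 ω = f.1 ω) ∧ (ω ∉ A → h.1 ω = g.1 ω) := by
  classical
  have hm : Measurable[ℱ t] fun ω => if ω ∈ A then f.rep ω else g.rep ω :=
    Measurable.ite hA f.measurable_rep g.measurable_rep
  refine ⟨L0.of P _ hm, ?_⟩
  filter_upwards [L0.coeFn_of (P := P) _ hm, f.coeFn_eq_rep, g.coeFn_eq_rep] with ω a1 a2 a3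
  rw [a1, a2, a3]
  exact ⟨fun h => if_pos h, fun h => if_neg h⟩

theorem L0.coeFn_addConst_toBar (v : L0 P ℱ t) (a : ℝ) :
    ∀ᵐ ω ∂P, (v.addConst a).toBar.1 ω = ((v.1 ω + a : ℝ) : EReal) := by
  filter_upwards [L0.coeFn_toBar (v.addConst a), v.coeFn_addConst a] with ω a1 a2
  rw [a1, a2]

theorem L0.toBar_congr_on {v v' : L0 P ℱ t} {A : Set Ω}
    (h : ∀ᵐ ω ∂P, ω ∈ A → v.1 ω = v'.1 ω) (a : ℝ) :
    ∀ᵐ ω ∂P, ω ∈ A → (v.addConst a).toBar.1 ω = (v'.addConst a).toBar.1 ω := by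
  filter_upwards [h, v.coeFn_addConst_toBar a, v'.coeFn_addConst_toBar a] with ω a1 a2 a3 hω
  rw [a2, a3, a1 hω]

/-- The restriction of `v` to a set on which it is bounded. -/
theorem L0.exists_restrict [IsFiniteMeasure P] {A : Set Ω} (hA : MeasurableSet[ℱ t] A)
    (v : L0 P ℱ t) {k : ℕ} (hAk : A ⊆ {ω | |v.rep ω| ≤ k}) (w : L0 P ℱ t) (hw : MemLp w.1 q P) :
    ∃ v' : L0 P ℱ t, MemLp v'.1 q P ∧
      ∀ᵐ ω ∂P, (ω ∈ A → v'.1 ω = v.1 ω) ∧ (ω ∉ A → v'.1 ω = w.1 ω) := by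
  obtain ⟨v', hv'⟩ := L0.exists_ite hA v w
  refine ⟨v', memLp_ite (ℱ.le t) hA ?_ hw hv', hv'⟩
  refine MemLp.of_bound (v.1.aestronglyMeasurable.indicator (ℱ.le t _ hA)) k ?_
  filter_upwards [v.coeFn_eq_rep] with ω a
  by_cases hω : ω ∈ A
  · rw [indicator_of_mem hω, a]; exact hAk hω
  · rw [indicator_of_notMem hω, norm_zero]; exact k.cast_nonneg

variable [IsProbabilityMeasure P] [ENNReal.HolderConjugate p q]

theorem MD.exists_ite (p : ℝ≥0∞) [ENNReal.HolderConjugate p q] (hμ : ∀ s, t ≤ s → 0 < μ s)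
    {A : Set Ω} (hA : MeasurableSet[ℱ t] A) (Z Z' : MD P ℱ t μ q) :
    ∃ W : MD P ℱ t μ q, ∀ s, ∀ᵐ ω ∂P, (ω ∈ A → W.1 s ω = Z.1 s ω) ∧
      (ω ∉ A → W.1 s ω = Z'.1 s ω) := by
  have hZ := MD.isDual p hμ Z
  have hZ' := MD.isDual p hμ Z'
  obtain ⟨W, -, -, h⟩ := exists_iteProc hA hZ.adapted hZ'.adapted hZ.zero hZ'.zero
  refine ⟨(IsDual.of_comb p hμ hZ hZ' (measurable_indicator_one hA) (Eventually.of_forall fun ω => ?_)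
    fun s => ?_ : IsDual ℱ t μ q W).toMD hμ, h⟩
  · by_cases hω : ω ∈ A
    · simp [indicator_of_mem hω]
    · simp [indicator_of_notMem hω]
  · filter_upwards [h s] with ω a
    by_cases hω : ω ∈ A
    · rw [a.1 hω, indicator_of_mem hω]; simp
    · rw [a.2 hω, indicator_of_notMem hω]; simp

/-- Local separation of a point from the lower level set of the left-continuous version of a minimal
risk function. -/
theorem IsMinimalRiskFunction.exists_separation (hμ : ∀ s, t ≤ s → 0 < μ s)
    {R : MD P ℱ t μ q → L0bar P ℱ t → L0bar P ℱ t} (hR : IsMinimalRiskFunction p R) {B : Set Ω}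
    (hB : MeasurableSet[ℱ t] B) (hPB : P B ≠ 0) {c : EReal} {Z₀ : MD P ℱ t μ q} {v₀ : L0 P ℱ t}
    {j : ℕ} (h₀ : ∀ᵐ ω ∂P, ω ∈ B → c < (R Z₀ (v₀.addConst (-(1 / ((j : ℝ) + 1)))).toBar).1 ω)
    {Z₁ : MD P ℱ t μ q} {v₁ : L0 P ℱ t}
    (h₁ : ∀ k : ℕ, ∀ᵐ ω ∂P, ω ∈ B → (R Z₁ (v₁.addConst (-(1 / ((k : ℝ) + 1)))).toBar).1 ω ≤ c) :
    ∃ (X : Ltp P ℱ t μ p) (ξ : Ω → ℝ) (B' : Set Ω) (η : ℝ), Measurable[ℱ t] ξ ∧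
      MeasurableSet[ℱ t] B' ∧ B' ⊆ B ∧ P B' ≠ 0 ∧ 0 < η ∧
      ∀ (Z : MD P ℱ t μ q) (v : L0 P ℱ t) (A : Set Ω), MeasurableSet[ℱ t] A → A ⊆ B' →
        (∀ k : ℕ, ∀ᵐ ω ∂P, ω ∈ A → (R Z (v.addConst (-(1 / ((k : ℝ) + 1)))).toBar).1 ω ≤ c) →
        ∀ᵐ ω ∂P, ω ∈ A → (pairing P ℱ t μ Z₀.1 X.1).1 ω + ξ ω * v₀.1 ω + η
          ≤ (pairing P ℱ t μ Z.1 X.1).1 ω + ξ ω * v.1 ω := by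
  have hp : p ≠ 0 := ENNReal.HolderConjugate.ne_zero p q
  let o : L0 P ℱ t := L0.of P (fun _ => 0) measurable_const
  have hop : MemLp o.1 q P := (memLp_congr_ae (L0.coeFn_of _ _)).2 (memLp_const 0)
  -- Both scalar components are made q-integrable by passing to an event on which they are bounded
  -- and setting them to 0 elsewhere.
  obtain ⟨N, hN⟩ := exists_measure_inter_ne_zero hPB
    (S := fun N : ℕ => {ω | |v₀.rep ω| ≤ N} ∩ {ω | |v₁.rep ω| ≤ N})
    (Eventually.of_forall fun ω _ => by
      obtain ⟨N, h⟩ := exists_nat_ge (max |v₀.rep ω| |v₁.rep ω|)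
      exact ⟨N, (le_max_left _ _).trans h, (le_max_right _ _).trans h⟩)
  set B₁ := B ∩ ({ω | |v₀.rep ω| ≤ N} ∩ {ω | |v₁.rep ω| ≤ N}) with hB₁def
  have habs : ∀ (v : L0 P ℱ t) (N : ℕ), MeasurableSet[ℱ t] {ω | |v.rep ω| ≤ N} := fun v N =>
    measurableSet_le (continuous_abs.measurable.comp v.measurable_rep) measurable_const
  have hB₁ : MeasurableSet[ℱ t] B₁ := hB.inter ((habs v₀ N).inter (habs v₁ N))
  obtain ⟨w₀, hw₀p, hw₀⟩ := L0.exists_restrict (q := q) hB₁ v₀ (fun ω hω => hω.2.1) o hop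
  obtain ⟨w₁, hw₁p, hw₁⟩ := L0.exists_restrict (q := q) hB₁ v₁ (fun ω hω => hω.2.2) o hop
  have hcongr : ∀ {Z Z' : MD P ℱ t μ q} {v v' : L0 P ℱ t} {A : Set Ω}, MeasurableSet[ℱ t] A →
      (∀ s, ∀ᵐ ω ∂P, ω ∈ A → Z.1 s ω = Z'.1 s ω) → (∀ᵐ ω ∂P, ω ∈ A → v.1 ω = v'.1 ω) →
      ∀ a : ℝ, ∀ᵐ ω ∂P, ω ∈ A →
        (R Z (v.addConst a).toBar).1 ω = (R Z' (v'.addConst a).toBar).1 ω :=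
    fun hA hZ hv a => hR.congr_on hA hZ (L0.toBar_congr_on hv a)
  have hrfl : ∀ (Z : MD P ℱ t μ q) (A : Set Ω), ∀ s, ∀ᵐ ω ∂P, ω ∈ A → Z.1 s ω = Z.1 s ω :=
    fun _ _ _ => Eventually.of_forall fun _ _ => rfl
  have h₀' : ∀ᵐ ω ∂P, ω ∈ B₁ → c < (R Z₀ (w₀.addConst (-(1 / ((j : ℝ) + 1)))).toBar).1 ω := by
    filter_upwards [h₀, hcongr hB₁ (hrfl Z₀ B₁) (hw₀.mono fun _ h => h.1) (-(1 / ((j : ℝ) + 1)))]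
      with ω a1 a2 hω
    rw [a2 hω]; exact a1 hω.1
  have h₁' : ∀ k : ℕ, ∀ᵐ ω ∂P, ω ∈ B₁ →
      (R Z₁ (w₁.addConst (-(1 / ((k : ℝ) + 1)))).toBar).1 ω ≤ c := fun k => by
    filter_upwards [h₁ k, hcongr hB₁ (hrfl Z₁ B₁) (hw₁.mono fun _ h => h.1) (-(1 / ((k : ℝ) + 1)))]
      with ω a1 a2 hω
    rw [a2 hω]; exact a1 hω.1
  let K : Set (Proc T P × L0 P ℱ t) := {k | ∃ Z : MD P ℱ t μ q, k.1 = Z.1 ∧ MemLp k.2.1 q P ∧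
    ∀ i : ℕ, ∀ᵐ ω ∂P, ω ∈ B₁ → (R Z (k.2.addConst (-(1 / ((i : ℝ) + 1)))).toBar).1 ω ≤ c}
  have hd := fun Z : MD P ℱ t μ q => MD.isDual p hμ Z
  obtain ⟨X, ξ, B', η, hXa, hX0, hXp, hξ, hB', hB'B, hPB', hη, hsep⟩ :=
    exists_local_separation (p := p) (q := q) (μ := μ) hμ (K := K) (x := (Z₀.1, w₀)) (B := B₁)
    (by rintro _ ⟨Z, e, -⟩; rw [e]; exact (hd Z).adapted)
    (by rintro _ ⟨Z, e, -⟩; rw [e]; exact (hd Z).zero)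
    (by rintro _ ⟨Z, e, -⟩; rw [e]; exact (hd Z).memLp)
    (by rintro _ ⟨Z, -, h, -⟩; exact h)
    (by
      rintro l hl hl01 k ⟨Z, e, hv, hc⟩ k' ⟨Z', e', hv', hc'⟩ w hw1 hw2
      rw [e, e'] at hw1
      have hW := IsDual.of_comb p hμ (hd Z) (hd Z') hl (Eventually.of_forall hl01) hw1
      refine ⟨hW.toMD hμ, rfl, memLp_comb (ℱ.le t) hv hv' hl (Eventually.of_forall hl01) hw2,
        fun i => ?_⟩
      have hlc := L0.coeFn_of (P := P) l hl
      filter_upwards [hc i, hc' i, hR.quasiconvex (L0.of P l hl)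
        (by filter_upwards [hlc] with ω a; rw [a]; exact hl01 ω) Z Z' (hW.toMD hμ)
        (k.2.addConst (-(1 / ((i : ℝ) + 1)))).toBar (k'.2.addConst (-(1 / ((i : ℝ) + 1)))).toBar
        (w.2.addConst (-(1 / ((i : ℝ) + 1)))).toBar
        (fun s => by filter_upwards [hlc, hw1 s] with ω a a'; rw [a]; exact a')
        (by
          filter_upwards [hlc, hw2, k.2.coeFn_addConst_toBar (-(1 / ((i : ℝ) + 1))),
            k'.2.coeFn_addConst_toBar (-(1 / ((i : ℝ) + 1))),
            w.2.coeFn_addConst_toBar (-(1 / ((i : ℝ) + 1)))] with ω a1 a2 a3 a4 a5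
          rw [a3, a4, a5, a1, a2, ← EReal.coe_mul, ← EReal.coe_mul, ← EReal.coe_add,
            EReal.coe_eq_coe_iff]
          ring)] with ω a1 a2 a3 hω
      exact a3.trans (max_le (a1 hω) (a2 hω)))
    (by
      intro k h hh hk hkh w hw1 hw2 hwp
      choose Z e hv hc using hk
      have hZh : ∀ n s, ∀ᵐ ω ∂P, |(Z n).1 s ω| ≤ |h ω| := fun n s => by
        rw [← e n]; exact hkh n s
      have hlim : ∀ s, ∀ᵐ ω ∂P, Tendsto (fun n => (Z n).1 s ω) atTop (𝓝 (w.1 s ω)) := fun s => by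
        filter_upwards [hw1 s] with ω a
        simp only [← e]
        exact a
      have hW := IsDual.of_tendsto p hμ (fun n => hd (Z n)) hh hZh hlim
      exact ⟨hW.toMD hμ, rfl, hwp, fun i => hR.le_of_tendsto hμ hB₁ (Z := Z) (Z' := hW.toMD hμ) hh
        hZh hlim hw2 hc i⟩)
    (hd Z₀).adapted (hd Z₀).zero (hd Z₀).memLp hw₀p (by
      rintro ⟨Z, e, -, hc⟩
      have : Z₀ = Z := Subtype.ext e
      rw [← this] at hc
      refine hN ?_
      rw [measure_eq_zero_iff_ae_notMem]
      filter_upwards [h₀', hc j] with ω a1 a2 hω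
      exact absurd (a2 hω) (not_le.2 (a1 hω)))
    ⟨(Z₁.1, w₁), Z₁, rfl, hw₁p, h₁'⟩ hB₁ (by
      rintro k ⟨Z, e, hv, hc⟩ w hw1 hw2
      rw [e] at hw1
      obtain ⟨W, hW⟩ := MD.exists_ite p hμ hB₁ Z Z₀
      have hwW : w.1 = W.1 := by
        funext s
        refine AEEqFun.ext ?_
        filter_upwards [hw1 s, hW s] with ω a1 a2
        by_cases hω : ω ∈ B₁
        · rw [a1.1 hω, a2.1 hω]
        · rw [a1.2 hω, a2.2 hω]
      refine ⟨W, hwW, memLp_ite (ℱ.le t) hB₁ (hv.indicator (ℱ.le t _ hB₁)) hw₀p hw2, fun i => ?_⟩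
      filter_upwards [hc i, hcongr hB₁ (fun s => (hW s).mono fun _ h => h.1)
        (hw2.mono fun _ h => h.1) (-(1 / ((i : ℝ) + 1)))] with ω a1 a2 hω
      rw [a2 hω]; exact a1 hω)
  refine ⟨⟨X, memLtp_of_memLp hμ hp hXa hX0 hXp⟩, ξ, B', η, hξ, hB', hB'B.trans inter_subset_left,
    hPB', hη, fun Z v A hA hAB' hc => ?_⟩
  have hXL : ∀ s, LocLp (ℱ t) p (X s) P := fun s => LocLp.of_memLp (hXp s)
  -- An arbitrary admissible pair, possibly unbounded in v, is pasted with (Z₁, w₁) off the event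
  -- {|v| ≤ M} ∩ A to obtain an element of `K`; then M grows.
  have key : ∀ M : ℕ, ∀ᵐ ω ∂P, ω ∈ A ∩ {ω | |v.rep ω| ≤ M} →
      (pairing P ℱ t μ Z₀.1 X).1 ω + ξ ω * v₀.1 ω + η
        ≤ (pairing P ℱ t μ Z.1 X).1 ω + ξ ω * v.1 ω := by
    intro M
    have hAM : MeasurableSet[ℱ t] (A ∩ {ω | |v.rep ω| ≤ M}) := hA.inter (habs v M)
    obtain ⟨w, hwp, hw⟩ := L0.exists_restrict (q := q) hAM v (fun ω hω => hω.2) w₁ hw₁p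
    obtain ⟨W, hW⟩ := MD.exists_ite p hμ hAM Z Z₁
    have hK : ((W.1, w) : Proc T P × L0 P ℱ t) ∈ K := by
      refine ⟨W, rfl, hwp, fun i => ?_⟩
      filter_upwards [hc i, h₁' i, hcongr hAM (fun s => (hW s).mono fun _ h => h.1)
          (hw.mono fun _ h => h.1) (-(1 / ((i : ℝ) + 1))),
        hcongr hAM.compl (fun s => (hW s).mono fun _ h => h.2)
          (hw.mono fun _ h => h.2) (-(1 / ((i : ℝ) + 1)))] with ω a1 a2 a3 a4 hω
      by_cases hωA : ω ∈ A ∩ {ω | |v.rep ω| ≤ M}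
      · rw [a3 hωA]; exact a1 hωA.1
      · rw [a4 hωA]; exact a2 hω
    filter_upwards [hsep _ hK, hw₀, hw, pairing_congr_on (μ := μ) (p := p) (q := q) (Z := W.1)
      (Z' := Z.1) (X := X) (X' := X) (hd W).locLp hXL (hd Z).locLp hXL hAM
      (fun s => (hW s).mono fun _ h => h.1) (fun s => Eventually.of_forall fun _ _ => rfl)]
      with ω a1 a2 a3 a4 hω
    have := a1 (hAB' hω.1)
    rwa [a2.1 (hB'B (hAB' hω.1)), a3.1 hω, a4 hω] at this
  filter_upwards [ae_all_iff.2 key] with ω a hω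
  obtain ⟨M, hM⟩ := exists_nat_ge (|v.rep ω|)
  exact a M ⟨hω, hM⟩

end

/-! ### Slopes, affine majorants and levels of a representing risk function. -/

section

variable {Ω : Type*} {mΩ : MeasurableSpace Ω} {P : Measure Ω} [IsProbabilityMeasure P] {T : ℕ}
  {ℱ : Filtration (Fin (T + 1)) mΩ} {t : Fin (T + 1)} {μ : Fin (T + 1) → ℝ} {p q : ℝ≥0∞}

theorem nonpos_of_forall_nat_le {a b ξ v : ℝ} (h : ∀ r : ℕ, a ≤ b + ξ * (v + -(r : ℝ))) :
    ξ ≤ 0 := by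
  by_contra! hξ
  obtain ⟨r, hr⟩ := exists_nat_gt ((b + ξ * v - a) / ξ)
  rw [div_lt_iff₀ hξ] at hr
  have := h r
  linarith

variable {R : MD P ℱ t μ q → L0bar P ℱ t → L0bar P ℱ t}

omit [IsProbabilityMeasure P] in
theorem IsMinimalRiskFunction.isLocalMap (hR : IsMinimalRiskFunction p R) (Z : MD P ℱ t μ q) :
    IsLocalMap (R Z) := fun _ hA _ _ h =>
  hR.congr_on hA (fun _ => Eventually.of_forall fun _ _ => rfl) h

omit [IsProbabilityMeasure P] in
theorem IsMinimalRiskFunction.le_of_le_on (hR : IsMinimalRiskFunction p R) {Z : MD P ℱ t μ q}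
    {A : Set Ω} (hA : MeasurableSet[ℱ t] A) {c : EReal} {v w : L0bar P ℱ t}
    (hvw : ∀ᵐ ω ∂P, ω ∈ A → v.1 ω ≤ w.1 ω) (hw : ∀ᵐ ω ∂P, ω ∈ A → (R Z w).1 ω ≤ c) :
    ∀ᵐ ω ∂P, ω ∈ A → (R Z v).1 ω ≤ c := by
  filter_upwards [hw, (hR.isLocalMap Z).le_on (hR.increasing Z) hA hvw] with ω a1 a2 hω
  exact (a2 hω).trans (a1 hω)

omit [IsProbabilityMeasure P] in
/-- The slope of a separating functional in the scalar direction is nonpositive. -/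
theorem IsMinimalRiskFunction.slope_nonpos (hR : IsMinimalRiskFunction p R) {B : Set Ω}
    (hB : MeasurableSet[ℱ t] B) {c : EReal} {Z₁ : MD P ℱ t μ q} {v₁ : L0 P ℱ t}
    (h₁ : ∀ k : ℕ, ∀ᵐ ω ∂P, ω ∈ B → (R Z₁ (v₁.addConst (-(1 / ((k : ℝ) + 1)))).toBar).1 ω ≤ c)
    {X : Ltp P ℱ t μ p} {ξ a : Ω → ℝ}
    (h : ∀ (Z : MD P ℱ t μ q) (v : L0 P ℱ t) (A : Set Ω), MeasurableSet[ℱ t] A → A ⊆ B →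
        (∀ k : ℕ, ∀ᵐ ω ∂P, ω ∈ A → (R Z (v.addConst (-(1 / ((k : ℝ) + 1)))).toBar).1 ω ≤ c) →
        ∀ᵐ ω ∂P, ω ∈ A → a ω ≤ (pairing P ℱ t μ Z.1 X.1).1 ω + ξ ω * v.1 ω) :
    ∀ᵐ ω ∂P, ω ∈ B → ξ ω ≤ 0 := by
  -- Lowering v₁ by r keeps the pair in the lower level set because R is increasing; a positive
  -- slope would violate the separating inequality for large r.
  have h2 : ∀ r : ℕ, ∀ᵐ ω ∂P, ω ∈ B →
      a ω ≤ (pairing P ℱ t μ Z₁.1 X.1).1 ω + ξ ω * (v₁.1 ω + -(r : ℝ)) := fun r => by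
    filter_upwards [h Z₁ (v₁.addConst (-(r : ℝ))) B hB subset_rfl (fun k =>
      hR.le_of_le_on hB (by
        filter_upwards [(v₁.addConst (-(r : ℝ))).coeFn_addConst_toBar (-(1 / ((k : ℝ) + 1))),
          v₁.coeFn_addConst (-(r : ℝ)), v₁.coeFn_addConst_toBar (-(1 / ((k : ℝ) + 1)))]
          with ω a1 a2 a3 _
        rw [a1, a2, a3, EReal.coe_le_coe_iff]
        have := r.cast_nonneg (α := ℝ)
        linarith) (h₁ k)), v₁.coeFn_addConst (-(r : ℝ))] with ω a1 a2 hω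
    rw [← a2]; exact a1 hω
  filter_upwards [ae_all_iff.2 h2] with ω a hω
  exact nonpos_of_forall_nat_le fun r => a r hω

variable {F : Ltp P ℱ t μ p → L0bar P ℱ t}

/-- Where ⟨Z, X⟩ ≤ n one has F X ≤ R(Z, ⟨Z, X⟩) ≤ R(Z, n), by the representation and monotonicity.
-/
theorem maxRisk_le_of_representation (hR : IsMinimalRiskFunction p R)
    (hrep : ∀ X : Ltp P ℱ t μ p,
      IsGLB (range fun Z : MD P ℱ t μ q => R Z (pairing P ℱ t μ Z.1 X.1).toBar) (F X))
    (Z : MD P ℱ t μ q) (n : L0bar P ℱ t) : maxRisk F Z n ≤ R Z n := by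
  rw [L0bar.le_iff]
  have := maxRisk_le_on F Z n MeasurableSet.univ (R Z n) fun X => by
    have hA : MeasurableSet[ℱ t] {ω | ((pairing P ℱ t μ Z.1 X.1).rep ω : EReal) ≤ n.rep ω} :=
      measurableSet_pairing_le _ _ _
    filter_upwards [L0bar.le_iff.1 ((hrep X).1 ⟨Z, rfl⟩), (hR.isLocalMap Z).le_on (hR.increasing Z)
      hA (n := (pairing P ℱ t μ Z.1 X.1).toBar) (n' := n) (by
        filter_upwards [(pairing P ℱ t μ Z.1 X.1).coeFn_toBar,
          (pairing P ℱ t μ Z.1 X.1).coeFn_eq_rep, n.coeFn_eq_rep] with ω a1 a2 a3 hω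
        rw [a1, a2, a3]; exact hω), (pairing P ℱ t μ Z.1 X.1).coeFn_eq_rep, n.coeFn_eq_rep]
      with ω a1 a2 a3 a4 _ h
    rw [a3, a4] at h
    exact a1.trans (a2 h)
  filter_upwards [this] with ω a using a (mem_univ _)

/-- If `⟨Z₀, Y⟩ ≤ n` and the maximal risk at `(Z₀, n)` is below `c`, then `c` is locally an upper bound of
some risk appearing in the representation of `F Y`. -/
theorem exists_mem_lowerLevel
    (hrep : ∀ X : Ltp P ℱ t μ p,
      IsGLB (range fun Z : MD P ℱ t μ q => R Z (pairing P ℱ t μ Z.1 X.1).toBar) (F X))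
    {Z₀ : MD P ℱ t μ q} {n : L0 P ℱ t} {B : Set Ω} (hB : MeasurableSet[ℱ t] B) (hPB : P B ≠ 0)
    {c : ℝ} {Y : Ltp P ℱ t μ p}
    (hY : ∀ᵐ ω ∂P, ω ∈ B → (pairing P ℱ t μ Z₀.1 Y.1).1 ω ≤ n.1 ω)
    (hn : ∀ᵐ ω ∂P, ω ∈ B → (maxRisk F Z₀ n.toBar).1 ω < c) :
    ∃ (Z : MD P ℱ t μ q) (A : Set Ω), MeasurableSet[ℱ t] A ∧ A ⊆ B ∧ P A ≠ 0 ∧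
      ∀ᵐ ω ∂P, ω ∈ A → (R Z (pairing P ℱ t μ Z.1 Y.1).toBar).1 ω ≤ c := by
  by_contra hcon
  have hcc := L0bar.coeFn_of (P := P) (fun _ => (c : EReal)) (measurable_const : Measurable[ℱ t] _)
  have h1 := L0bar.le_isGLB_on (hrep Y) hB (L0bar.of P (fun _ => (c : EReal)) measurable_const) (by
    rintro _ ⟨Z, rfl⟩
    have h0 : P ({ω | (R Z (pairing P ℱ t μ Z.1 Y.1).toBar).rep ω ≤ c} ∩ B) = 0 := by
      by_contra h0
      refine hcon ⟨Z, _, (measurableSet_le (L0bar.measurable_rep _) measurable_const).inter hB,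
        inter_subset_right, h0, ?_⟩
      filter_upwards [(R Z (pairing P ℱ t μ Z.1 Y.1).toBar).coeFn_eq_rep] with ω a hω
      rw [a]; exact hω.1
    rw [measure_eq_zero_iff_ae_notMem] at h0
    filter_upwards [h0, (R Z (pairing P ℱ t μ Z.1 Y.1).toBar).coeFn_eq_rep, hcc] with ω a1 a2 a3 hω
    rw [a3, a2]
    by_contra hlt
    exact a1 ⟨(not_le.1 hlt).le, hω⟩)
  refine hPB ?_
  rw [measure_eq_zero_iff_ae_notMem]
  filter_upwards [h1, hcc, hn, hY, le_maxRisk F Z₀ n.toBar Y, n.coeFn_toBar]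
    with ω a1 a2 a3 a4 a5 a6 hω
  rw [a2] at a1
  rw [a6, EReal.coe_le_coe_iff] at a5
  exact absurd (a3 hω) (not_lt.2 ((a1 hω).trans (a5 (a4 hω))))

variable [ENNReal.HolderConjugate p q]

/-- An affine majorant of the lower level set of a minimal risk function. -/
theorem IsMinimalRiskFunction.exists_majorant (hμ : ∀ s, t ≤ s → 0 < μ s)
    (hR : IsMinimalRiskFunction p R) {B : Set Ω} (hB : MeasurableSet[ℱ t] B) (hPB : P B ≠ 0)
    {c : EReal} {Z₁ : MD P ℱ t μ q} {v₁ n : L0 P ℱ t}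
    (hn : ∀ᵐ ω ∂P, ω ∈ B → c < (R Z₁ n.toBar).1 ω)
    (h₁ : ∀ k : ℕ, ∀ᵐ ω ∂P, ω ∈ B → (R Z₁ (v₁.addConst (-(1 / ((k : ℝ) + 1)))).toBar).1 ω ≤ c) :
    ∃ (Y : Ltp P ℱ t μ p) (B' : Set Ω), MeasurableSet[ℱ t] B' ∧ B' ⊆ B ∧ P B' ≠ 0 ∧
      ∀ (Z : MD P ℱ t μ q) (v : L0 P ℱ t) (A : Set Ω), MeasurableSet[ℱ t] A → A ⊆ B' →
        (∀ k : ℕ, ∀ᵐ ω ∂P, ω ∈ A → (R Z (v.addConst (-(1 / ((k : ℝ) + 1)))).toBar).1 ω ≤ c) →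
        ∀ᵐ ω ∂P, ω ∈ A → v.1 ω ≤ (pairing P ℱ t μ Z.1 Y.1).1 ω := by
  have hp : p ≠ 0 := ENNReal.HolderConjugate.ne_zero p q
  -- The point to be separated has scalar component n + 1, so that the argument n is its test value
  -- of index 0, namely (n + 1) - 1/(0 + 1).
  have e : ((n.addConst 1).addConst (-(1 / (((0 : ℕ) : ℝ) + 1)))).toBar = n.toBar :=
    L0bar.ext_ae (by
      filter_upwards [(n.addConst 1).coeFn_addConst_toBar (-(1 / (((0 : ℕ) : ℝ) + 1))),
        n.coeFn_addConst 1, n.coeFn_toBar] with ω a1 a2 a3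
      rw [a1, a2, a3]
      norm_num)
  obtain ⟨X, ξ, B', η, hξ, hB', hB'B, hPB', hη, hsep⟩ := hR.exists_separation hμ hB hPB
    (v₀ := n.addConst 1) (j := 0) (by rw [e]; exact hn) h₁
  have h₁' : ∀ k : ℕ, ∀ᵐ ω ∂P, ω ∈ B' →
      (R Z₁ (v₁.addConst (-(1 / ((k : ℝ) + 1)))).toBar).1 ω ≤ c := fun k =>
    (h₁ k).mono fun ω a hω => a (hB'B hω)
  -- The point (Z₁, n + 1) and the level set element (Z₁, v₁) share the same Z₁, so with ξ = 0 the
  -- strict separation by η would be absurd.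
  have hneg : ∀ᵐ ω ∂P, ω ∈ B' → ξ ω < 0 := by
    filter_upwards [hR.slope_nonpos hB' h₁' hsep, hsep Z₁ v₁ B' hB' subset_rfl h₁'] with ω a1 a2 hω
    refine lt_of_le_of_ne (a1 hω) fun h0 => ?_
    have := a2 hω
    rw [h0] at this
    linarith
  -- Solving the separating inequality for v gives an affine bound in Z. Its constant term is
  -- absorbed into the process Y, because elements of the dual set reproduce 𝓕_t-measurable
  -- constants.
  let a : Ω → ℝ := fun ω => (pairing P ℱ t μ Z₁.1 X.1).rep ω + ξ ω * (n.addConst 1).rep ω + η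
  have ha : Measurable[ℱ t] a :=
    ((L0.measurable_rep _).add (hξ.mul (L0.measurable_rep _))).add_const _
  have hb1 : Measurable[ℱ t] fun ω => (-ξ ω)⁻¹ := hξ.neg.inv
  have hb2 : Measurable[ℱ t] fun ω => -((-ξ ω)⁻¹ * a ω) := (hb1.mul ha).neg
  obtain ⟨C, hC⟩ := Ltp.exists_const (P := P) hμ hp hb2
  obtain ⟨Y, hY⟩ := Ltp.exists_comb hμ hp hb1 (b := fun _ => (1 : ℝ)) measurable_const X C
  refine ⟨Y, B', hB', hB'B, hPB', fun Z v A hA hAB hc => ?_⟩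
  filter_upwards [hneg, hsep Z v A hA hAB hc, (pairing P ℱ t μ Z₁.1 X.1).coeFn_eq_rep,
    (n.addConst 1).coeFn_eq_rep, (MD.isDual p hμ Z).pairing_add_const hμ (X := X) (W := Y) hb1 hb2
      (fun s hs => by
        filter_upwards [hY s, hC s hs] with ω a1 a2
        rw [a1, a2, one_mul])] with ω a1 a2 a3 a4 a5 hω
  rw [a5]
  have h1 := a2 hω
  rw [a3, a4] at h1
  have h2 : 0 < -ξ ω := neg_pos.2 (a1 (hAB hω))
  have h3 : v.1 ω = (-ξ ω)⁻¹ * (-ξ ω * v.1 ω) := by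
    rw [← mul_assoc, inv_mul_cancel₀ h2.ne', one_mul]
  rw [h3, ← sub_eq_add_neg, ← mul_sub]
  refine mul_le_mul_of_nonneg_left ?_ (inv_nonneg.2 h2.le)
  simp only [a]
  linarith

end

/-! ### Uniqueness of the minimal risk function. -/

section

variable {Ω : Type*} {mΩ : MeasurableSpace Ω} {P : Measure Ω} [IsProbabilityMeasure P] {T : ℕ}
  {ℱ : Filtration (Fin (T + 1)) mΩ} {t : Fin (T + 1)} {μ : Fin (T + 1) → ℝ} {p q : ℝ≥0∞}
  [ENNReal.HolderConjugate p q] {R : MD P ℱ t μ q → L0bar P ℱ t → L0bar P ℱ t}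
  {F : Ltp P ℱ t μ p → L0bar P ℱ t}

/-- A minimal risk function representing `F` lies below the maximal risk of `F` at strictly larger
arguments. -/
theorem le_maxRisk_of_lt (hμ : ∀ s, t ≤ s → 0 < μ s) (hR : IsMinimalRiskFunction p R)
    (hrep : ∀ X : Ltp P ℱ t μ p,
      IsGLB (range fun Z : MD P ℱ t μ q => R Z (pairing P ℱ t μ Z.1 X.1).toBar) (F X))
    (Z₀ : MD P ℱ t μ q) {s : L0bar P ℱ t} {n : L0 P ℱ t} (hs : ∀ᵐ ω ∂P, s.1 ω < n.1 ω) :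
    R Z₀ s ≤ maxRisk F Z₀ n.toBar := by
  have hp : p ≠ 0 := ENNReal.HolderConjugate.ne_zero p q
  by_contra hnot
  obtain ⟨c, B, hB, hPB, hc⟩ := L0bar.exists_between_of_not_le hnot
  have hcc := L0bar.coeFn_of (P := P) (fun _ => (c : EReal)) (measurable_const : Measurable[ℱ t] _)
  -- The margin between s and n is made uniform, so that R(Z₀, n - 1/(j+1)) > c on B₀ and (Z₀, n)
  -- lies outside the lower level set of R⁻ there.
  obtain ⟨j, hj⟩ := exists_measure_inter_ne_zero hPB
    (S := fun j : ℕ => {ω | s.rep ω ≤ ((n.rep ω + -(1 / ((j : ℝ) + 1)) : ℝ) : EReal)}) (by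
      filter_upwards [hs, s.coeFn_eq_rep, n.coeFn_eq_rep] with ω a1 a2 a3 _
      rw [a2, a3] at a1
      obtain ⟨x, hx1, hx2⟩ := EReal.lt_iff_exists_real_btwn.1 a1
      obtain ⟨j, hj⟩ := exists_nat_one_div_lt (sub_pos.2 (EReal.coe_lt_coe_iff.1 hx2))
      exact ⟨j, hx1.le.trans (EReal.coe_le_coe_iff.2 (by linarith))⟩)
  set B₀ := B ∩ {ω | s.rep ω ≤ ((n.rep ω + -(1 / ((j : ℝ) + 1)) : ℝ) : EReal)} with hB₀def
  have hB₀ : MeasurableSet[ℱ t] B₀ := hB.inter (measurableSet_le s.measurable_rep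
    (measurable_coe_real_ereal.comp (n.measurable_rep.add_const _)))
  have hmax : ∀ᵐ ω ∂P, ω ∈ B₀ → (maxRisk F Z₀ n.toBar).1 ω < c :=
    hc.mono fun ω h hω => (h hω.1).1
  have hRj : ∀ᵐ ω ∂P, ω ∈ B₀ →
      (c : EReal) < (R Z₀ (n.addConst (-(1 / ((j : ℝ) + 1)))).toBar).1 ω := by
    filter_upwards [hc, (hR.isLocalMap Z₀).le_on (hR.increasing Z₀) hB₀ (n := s)
      (n' := (n.addConst (-(1 / ((j : ℝ) + 1)))).toBar) (by
        filter_upwards [n.coeFn_addConst_toBar (-(1 / ((j : ℝ) + 1))), s.coeFn_eq_rep,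
          n.coeFn_eq_rep] with ω a1 a2 a3 hω
        rw [a1, a2, a3]; exact hω.2)] with ω a1 a2 hω
    exact (a1 hω.1).2.trans_le (a2 hω)
  have hRn : ∀ᵐ ω ∂P, ω ∈ B₀ → (c : EReal) < (R Z₀ n.toBar).1 ω := by
    filter_upwards [hc, L0bar.le_iff.1 (hR.increasing Z₀ (L0bar.le_iff.2 (by
      filter_upwards [hs, n.coeFn_toBar] with ω a1 a2
      rw [a2]; exact a1.le) : s ≤ n.toBar))] with ω a1 a2 hω
    exact (a1 hω.1).2.trans_le a2
  -- The payoff held constant at n has ⟨Z₀, C⟩ = n, which provides a first element (Z₁, v₁) of the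
  -- lower level set.
  obtain ⟨C, hC⟩ := Ltp.exists_const (P := P) hμ hp n.measurable_rep
  obtain ⟨Z₁, B₁, hB₁, hB₁₀, hPB₁, hZ₁⟩ := exists_mem_lowerLevel hrep hB₀ hj (Y := C)
    (n := n) (Z₀ := Z₀) (by
      filter_upwards [(MD.isDual p hμ Z₀).pairing_add_const hμ (X := C) (W := C)
        (a := fun _ => (0 : ℝ)) measurable_const n.measurable_rep (fun s hs => by
          filter_upwards [hC s hs] with ω a
          rw [a]; simp), n.coeFn_eq_rep] with ω a1 a2 _
      rw [a1, a2]; simp) hmax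
  set v₁ := pairing P ℱ t μ Z₁.1 C.1 with hv₁def
  have hlow : ∀ {Z : MD P ℱ t μ q} {v : L0 P ℱ t} {A : Set Ω}, MeasurableSet[ℱ t] A →
      (∀ᵐ ω ∂P, ω ∈ A → (R Z v.toBar).1 ω ≤ c) → ∀ k : ℕ, ∀ᵐ ω ∂P, ω ∈ A →
      (R Z (v.addConst (-(1 / ((k : ℝ) + 1)))).toBar).1 ω ≤ c := by
    intro Z v A hA h k
    refine hR.le_of_le_on hA ?_ h
    filter_upwards [v.coeFn_addConst_toBar (-(1 / ((k : ℝ) + 1))), v.coeFn_toBar] with ω a1 a2 _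
    rw [a1, a2, EReal.coe_le_coe_iff]
    have : (0 : ℝ) < 1 / ((k : ℝ) + 1) := by positivity
    linarith
  -- The asymptotic maximum enters here: R(Z₀, n) > c, and ess sup R(Z₁, ·) is the same as for Z₀,
  -- so R(Z₁, ·) also exceeds c somewhere. This is what yields a nonvertical majorant Y₂.
  obtain ⟨n₂, B₂, hB₂, hB₂₁, hPB₂, hn₂⟩ : ∃ (n₂ : L0 P ℱ t) (B₂ : Set Ω), MeasurableSet[ℱ t] B₂ ∧
      B₂ ⊆ B₁ ∧ P B₂ ≠ 0 ∧ ∀ᵐ ω ∂P, ω ∈ B₂ → (c : EReal) < (R Z₁ n₂.toBar).1 ω := by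
    by_contra hcon
    obtain ⟨u, hu⟩ := hR.asymptoticMax
    have h1 := L0bar.isLUB_le_on (hu Z₁) hB₁ (L0bar.of P (fun _ => (c : EReal)) measurable_const) (by
      rintro _ ⟨n₂, rfl⟩
      have h0 : P ({ω | (c : EReal) < (R Z₁ n₂.toBar).rep ω} ∩ B₁) = 0 := by
        by_contra h0
        refine hcon ⟨n₂, _, (measurableSet_lt measurable_const (L0bar.measurable_rep _)).inter hB₁,
          inter_subset_right, h0, ?_⟩
        filter_upwards [(R Z₁ n₂.toBar).coeFn_eq_rep] with ω a hω
        rw [a]; exact hω.1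
      rw [measure_eq_zero_iff_ae_notMem] at h0
      filter_upwards [h0, (R Z₁ n₂.toBar).coeFn_eq_rep, hcc] with ω a1 a2 a3 hω
      rw [a3, a2]
      by_contra hlt
      exact a1 ⟨not_le.1 hlt, hω⟩)
    refine hPB₁ ?_
    rw [measure_eq_zero_iff_ae_notMem]
    filter_upwards [h1, hcc, hRn, L0bar.le_iff.1 ((hu Z₀).1 ⟨n, rfl⟩)] with ω a1 a2 a3 a4 hω
    have := a1 hω
    rw [a2] at this
    exact absurd (a3 (hB₁₀ hω)) (not_lt.2 (a4.trans this))
  obtain ⟨Y₂, B₃, hB₃, hB₃₂, hPB₃, hY₂⟩ := hR.exists_majorant hμ hB₂ hPB₂ hn₂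
    (hlow hB₂ (hZ₁.mono fun ω h hω => h (hB₂₁ hω)))
  have hB₃₁ := hB₃₂.trans hB₂₁
  -- Only ξ ≤ 0 is known for this functional; the case ξ = 0 is the reason for bringing in Y₂.
  obtain ⟨X, ξ, B₄, η, hξ, hB₄, hB₄₃, hPB₄, hη, hsep⟩ := hR.exists_separation hμ hB₃ hPB₃
    (hRj.mono fun ω h hω => h (hB₁₀ (hB₃₁ hω))) (hlow hB₃ (hZ₁.mono fun ω h hω => h (hB₃₁ hω)))
  have hξ0 := hR.slope_nonpos hB₄
    (hlow hB₄ (hZ₁.mono fun ω h hω => h (hB₃₁ (hB₄₃ hω)))) hsep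
  let x₀ := (pairing P ℱ t μ Z₀.1 X.1).rep
  let y₀ := (pairing P ℱ t μ Z₀.1 Y₂.1).rep
  have hx₀ : Measurable[ℱ t] x₀ := L0.measurable_rep _
  have hy₀ : Measurable[ℱ t] y₀ := L0.measurable_rep _
  let d : Ω → ℝ := fun ω => 1 + |y₀ ω| + |n.rep ω|
  have hd : Measurable[ℱ t] d := (measurable_const.add (continuous_abs.measurable.comp hy₀)).add
    (continuous_abs.measurable.comp n.measurable_rep)
  -- Adding δ times the inequality v ≤ ⟨Z, Y₂⟩ makes the slope ξ - δ strictly negative. The size of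
  -- δ ensures that this costs at most η/2 of the gap at the point (Z₀, n).
  let δ : Ω → ℝ := fun ω => η / 2 * (d ω)⁻¹
  have hδ : Measurable[ℱ t] δ := hd.inv.const_mul _
  have hdpos : ∀ ω, 0 < d ω := fun ω => by positivity
  have hδpos : ∀ ω, 0 < δ ω := fun ω => mul_pos (half_pos hη) (inv_pos.2 (hdpos ω))
  have hδle : ∀ ω, -(η / 2) ≤ δ ω * (n.rep ω - y₀ ω) := fun ω => by
    have h1 : δ ω * d ω = η / 2 := by
      simp only [δ]
      rw [mul_assoc, inv_mul_cancel₀ (hdpos ω).ne', mul_one]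
    have h2 : -d ω ≤ n.rep ω - y₀ ω := by
      simp only [d]
      linarith [neg_abs_le (n.rep ω), le_abs_self (y₀ ω)]
    have := mul_le_mul_of_nonneg_left h2 (hδpos ω).le
    linarith
  let ρ : Ω → ℝ := fun ω => (δ ω - ξ ω)⁻¹
  have hρ : Measurable[ℱ t] ρ := (hδ.sub hξ).inv
  -- This constant normalizes ⟨Z₀, Y'⟩ = n - ρ η/4, just below n where ρ > 0, while the combined gap
  -- of at least η/2 still leaves η/4.
  let b : Ω → ℝ := fun ω => n.rep ω - ρ ω * (x₀ ω + δ ω * y₀ ω + η / 4)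
  have hb : Measurable[ℱ t] b :=
    n.measurable_rep.sub (hρ.mul ((hx₀.add (hδ.mul hy₀)).add_const _))
  obtain ⟨X', hX'⟩ := Ltp.exists_comb hμ hp (a := fun _ => (1 : ℝ)) measurable_const hδ X Y₂
  obtain ⟨D, hD⟩ := Ltp.exists_const (P := P) hμ hp hb
  obtain ⟨Y', hY'⟩ := Ltp.exists_comb hμ hp hρ (b := fun _ => (1 : ℝ)) measurable_const X' D
  have hpair : ∀ Z : MD P ℱ t μ q, ∀ᵐ ω ∂P, (pairing P ℱ t μ Z.1 Y'.1).1 ω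
      = ρ ω * ((pairing P ℱ t μ Z.1 X.1).1 ω + δ ω * (pairing P ℱ t μ Z.1 Y₂.1).1 ω) + b ω :=
    fun Z => by
      filter_upwards [(MD.isDual p hμ Z).pairing_add_const hμ (X := X') (W := Y') hρ hb
          (fun s hs => by
            filter_upwards [hY' s, hD s hs] with ω a1 a2
            rw [a1, a2, one_mul]),
        pairing_comb_right (μ := μ) (p := p) (q := q) (W := X'.1) (MD.isDual p hμ Z).locLp
          (X.locLp hμ hp) (Y₂.locLp hμ hp) (a := fun _ => (1 : ℝ)) measurable_const hδ
          (fun s _ => hX' s)] with ω a1 a2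
      rw [a1, a2, one_mul]
  have hρpos : ∀ᵐ ω ∂P, ω ∈ B₄ → 0 < δ ω - ξ ω := by
    filter_upwards [hξ0] with ω a hω
    linarith [a hω, hδpos ω]
  -- Since ⟨Z₀, Y'⟩ ≤ n and M(Z₀, n) < c, the representation of F Y' supplies some Z with R(Z, ⟨Z,
  -- Y'⟩) ≤ c. For v = ⟨Z, Y'⟩ the two separating inequalities then give (δ - ξ) v ≥ (δ - ξ) v +
  -- η/4.
  obtain ⟨Z, A, hA, hAB, hPA, hZ⟩ := exists_mem_lowerLevel hrep hB₄ hPB₄ (Y := Y')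
    (n := n) (Z₀ := Z₀) (c := c) (by
      filter_upwards [hpair Z₀, (pairing P ℱ t μ Z₀.1 X.1).coeFn_eq_rep, n.coeFn_eq_rep,
        (pairing P ℱ t μ Z₀.1 Y₂.1).coeFn_eq_rep, hρpos] with ω a1 a2 a3 a4 a5 hω
      rw [a1, a2, a3, a4]
      have h1 : 0 < ρ ω * (η / 4) := mul_pos (inv_pos.2 (a5 hω)) (by linarith)
      change ρ ω * (x₀ ω + δ ω * y₀ ω) + (n.rep ω - ρ ω * (x₀ ω + δ ω * y₀ ω + η / 4)) ≤ _
      rw [mul_add (ρ ω) _ (η / 4)]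
      linarith) (hmax.mono fun ω h hω => h (hB₁₀ (hB₃₁ (hB₄₃ hω))))
  refine hPA ?_
  rw [measure_eq_zero_iff_ae_notMem]
  filter_upwards [hsep Z _ A hA hAB (hlow hA hZ), hY₂ Z _ A hA (hAB.trans hB₄₃) (hlow hA hZ),
    hpair Z, (pairing P ℱ t μ Z₀.1 X.1).coeFn_eq_rep, n.coeFn_eq_rep, hρpos]
    with ω a1 a2 a3 a4 a5 a6 hω
  have h1 := a1 hω
  have h2 := mul_le_mul_of_nonneg_left (a2 hω) (hδpos ω).le
  have h3 := hδle ω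
  have h4 := a6 (hAB hω)
  rw [a4, a5] at h1
  set v := (pairing P ℱ t μ Z.1 Y'.1).1 ω
  have h5 : (δ ω - ξ ω) * v = (pairing P ℱ t μ Z.1 X.1).1 ω
      + δ ω * (pairing P ℱ t μ Z.1 Y₂.1).1 ω + (δ ω - ξ ω) * n.rep ω
      - (x₀ ω + δ ω * y₀ ω + η / 4) := by
    rw [a3]
    simp only [b, ρ]
    have := h4.ne'
    field_simp
    ring
  change x₀ ω + _ + _ ≤ _ at h1
  linarith

/-- R lies above the maximal risk, and below it at strictly larger arguments. Approximating s from
above and using right-continuity of R makes both bounds meet at the right-continuous version of the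
maximal risk. -/
theorem eq_riskOf (hμ : ∀ s, t ≤ s → 0 < μ s) (hR : IsMinimalRiskFunction p R)
    (hrep : ∀ X : Ltp P ℱ t μ p,
      IsGLB (range fun Z : MD P ℱ t μ q => R Z (pairing P ℱ t μ Z.1 X.1).toBar) (F X)) :
    R = riskOf F := by
  funext Z s
  have hloc := isLocalMap_maxRisk hμ F Z
  have hA : MeasurableSet[ℱ t] {ω | s.rep ω ≠ ⊤} :=
    (s.measurable_rep (measurableSet_singleton _)).compl
  -- The strict comparison needs real arguments above s on all of Ω, so s is replaced by 0 where it
  -- is ⊤; locality undoes this on {s ≠ ⊤}.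
  obtain ⟨s', hs'⟩ := L0bar.exists_ite hA s (L0bar.of P (fun _ => 0) measurable_const)
  have hs'top : ∀ᵐ ω ∂P, s'.1 ω ≠ ⊤ := by
    filter_upwards [hs', s.coeFn_eq_rep, L0bar.coeFn_of (P := P) (fun _ => (0 : EReal))
      (measurable_const : Measurable[ℱ t] _)] with ω a1 a2 a3
    by_cases h : s.rep ω ≠ ⊤
    · rw [a1.1 h, a2]; exact h
    · rw [a1.2 h, a3]; exact EReal.zero_ne_top
  have key : ∀ k, ∀ᵐ ω ∂P, ω ∈ {ω | s.rep ω ≠ ⊤} →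
      (R Z s).1 ω ≤ (maxRisk F Z (s.above k)).1 ω := by
    intro k
    have hnm : Measurable[ℱ t] fun ω => ((s'.above k).rep ω).toReal :=
      measurable_ereal_toReal.comp (L0bar.measurable_rep _)
    have hn : ∀ᵐ ω ∂P, (((L0.of P _ hnm).1 ω : ℝ) : EReal) = above k (s'.1 ω) := by
      filter_upwards [L0.coeFn_of (P := P) _ hnm, (s'.above k).coeFn_eq_rep,
        L0bar.coeFn_above k s', hs'top] with ω a1 a2 a3 a4
      rw [a1, ← a2, a3]
      exact EReal.coe_toReal (above_ne_top k a4) (above_ne_bot k)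
    have h1 := le_maxRisk_of_lt hμ hR hrep Z (s := s') (n := L0.of P _ hnm) (by
      filter_upwards [hn, hs'top] with ω a1 a2
      rw [a1]; exact lt_above k a2)
    filter_upwards [L0bar.le_iff.1 h1, hR.isLocalMap Z _ hA s s'
        (hs'.mono fun ω h hω => (h.1 hω).symm),
      hloc _ hA (s.above k) (L0.of P _ hnm).toBar (by
        filter_upwards [hs', hn, L0bar.coeFn_above k s, (L0.of P _ hnm).coeFn_toBar]
          with ω a1 a2 a3 a4 hω
        rw [a3, a4, a2, a1.1 hω])] with ω a1 a2 a3 hω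
    rw [a2 hω, a3 hω]
    exact a1
  refine L0bar.ext_ae ?_
  filter_upwards [(isRightVersion_iff (hR.isLocalMap Z) (hR.increasing Z)).1
      (hR.rightContinuous Z) s,
    (isRightVersion_iff hloc (monotone_maxRisk F Z)).1 (isRightVersion_rightVersion _) s,
    ae_all_iff.2 key, ae_all_iff.2 fun k => L0bar.le_iff.1
      (maxRisk_le_of_representation hR hrep Z (s.above k)), s.coeFn_eq_rep] with ω a1 a2 a3 a4 a5
  by_cases h : s.1 ω = ⊤
  · exact (a1.1 h).trans (a2.1 h).symm
  · refine Eq.trans (le_antisymm ?_ ?_) (a2.2 h).symm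
    · exact le_iInf fun k => a3 k (by rw [a5] at h; exact h)
    · rw [a1.2 h]
      exact iInf_mono a4

end

/-! ### Splitting a path into past and future. -/

section

variable {Ω : Type*} {mΩ : MeasurableSpace Ω} {P : Measure Ω} [IsProbabilityMeasure P] {T : ℕ}
  {ℱ : Filtration (Fin (T + 1)) mΩ} {t : Fin (T + 1)} {μ : Fin (T + 1) → ℝ} {p q : ℝ≥0∞}

omit [IsProbabilityMeasure P] in
theorem concat_pastOf (X : XSpace P ℱ t μ p) : concat (pastOf X) ⟨after t X.1, X.2.2⟩ = X := by
  refine Subtype.ext (funext fun s => ?_)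
  change before t X.1 s + after t X.1 s = X.1 s
  by_cases h : t ≤ s
  · simp [before, after, h, not_lt.2 h]
  · simp [before, after, h, not_le.1 h]

omit [IsProbabilityMeasure P] in
theorem pastOf_concat (x : Past P ℱ t) (Y : Ltp P ℱ t μ p) : pastOf (concat x Y) = x := by
  refine Subtype.ext (funext fun s => ?_)
  change (if s < t then x.1 s + Y.1 s else 0) = x.1 s
  by_cases h : s < t
  · rw [if_pos h, Y.2.2.1 s h, add_zero]
  · rw [if_neg h, x.2.2 s (not_lt.1 h)]

omit [IsProbabilityMeasure P] in
theorem after_concat (x : Past P ℱ t) (Y : Ltp P ℱ t μ p) : after t (concat x Y).1 = Y.1 := by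
  funext s
  change (if t ≤ s then x.1 s + Y.1 s else 0) = Y.1 s
  by_cases h : t ≤ s
  · rw [if_pos h, x.2.2 s h, zero_add]
  · rw [if_neg h, Y.2.2.1 s (not_le.1 h)]

theorem condEL0_discountedFuture [ENNReal.HolderConjugate p q] (hμ : ∀ s, t ≤ s → 0 < μ s)
    {Q : Measure Ω} {D : Proc T P} (h : Admissible ℱ t μ q Q D) (X : XSpace P ℱ t μ p) :
    condEL0 P ℱ t Q (discountedFuture t D X.1)
      = pairing P ℱ t μ (otimes ℱ t μ Q D) (after t X.1) := by
  have hX := ((memLtp_iff hμ (ENNReal.HolderConjugate.ne_zero p q)).1 X.2.2).2.2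
  refine L0.ext_ae ?_
  have h1 := condE_discountedFuture (p := p) (q := q) hμ h X.2.1 (fun s hs => by
    have := hX s
    rwa [after, if_pos hs] at this)
  have h2 : (fun ω => ∑ s ∈ Finset.Ici t, otimes ℱ t μ Q D s ω * after t X.1 s ω * μ s)
      = fun ω => ∑ s ∈ Finset.Ici t, otimes ℱ t μ Q D s ω * X.1 s ω * μ s := by
    funext ω
    refine Finset.sum_congr rfl fun s hs => ?_
    rw [after, if_pos (Finset.mem_Ici.1 hs)]
  have h3 := coeFn_pairing (P := P) (ℱ := ℱ) (t := t) (μ := μ) (otimes ℱ t μ Q D) (after t X.1)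
  rw [h2] at h3
  filter_upwards [h1, h3, AEEqFun.coeFn_mk (condE ℱ t Q (discountedFuture t D X.1))
    ((measurable_condE ℱ t Q (discountedFuture t D X.1)).mono (ℱ.le t)
      le_rfl).aestronglyMeasurable (μ := P)] with ω a1 a2 a3
  exact a3.trans (a1.trans a2.symm)

theorem setOf_risk_eq_range [ENNReal.HolderConjugate p q] (hμ : ∀ s, t ≤ s → 0 < μ s)
    (R : MD P ℱ t μ q → L0bar P ℱ t → L0bar P ℱ t) (X : XSpace P ℱ t μ p) :
    {r | ∃ (Q : Measure Ω) (D : Proc T P) (h : Admissible ℱ t μ q Q D),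
      r = R ⟨otimes ℱ t μ Q D, Q, D, h, rfl⟩ (condEL0 P ℱ t Q (discountedFuture t D X.1)).toBar}
    = range fun Z : MD P ℱ t μ q => R Z (pairing P ℱ t μ Z.1 (after t X.1)).toBar := by
  ext r
  constructor
  · rintro ⟨Q, D, h, rfl⟩
    exact ⟨⟨otimes ℱ t μ Q D, Q, D, h, rfl⟩, by rw [condEL0_discountedFuture hμ h X]⟩
  · rintro ⟨⟨_, Q, D, h, rfl⟩, rfl⟩
    exact ⟨Q, D, h, by rw [condEL0_discountedFuture hμ h X]⟩

end

end PathAI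

end

theorem mainTheorem7 {Ω : Type*} {mΩ : MeasurableSpace Ω} (P : Measure Ω) [IsProbabilityMeasure P]
    (T : ℕ) (ℱ : Filtration (Fin (T + 1)) mΩ) (t : Fin (T + 1))
    (μ : Fin (T + 1) → ℝ) (hμ : ∀ s, t ≤ s → 0 < μ s)
    (p q : ℝ≥0∞) [ENNReal.HolderConjugate p q]
    (α : PathAI.XSpace P ℱ t μ p → PathAI.L0bar P ℱ t)
    (hα : PathAI.IsUSCPathDependentAI α) :
    ∃! R : PathAI.Past P ℱ t → PathAI.MD P ℱ t μ q → PathAI.L0bar P ℱ t → PathAI.L0bar P ℱ t,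
      (∀ x, PathAI.IsMinimalRiskFunction p (R x)) ∧
      ∀ X : PathAI.XSpace P ℱ t μ p,
        IsGLB {r | ∃ (Q : Measure Ω) (D : PathAI.Proc T P) (h : PathAI.Admissible ℱ t μ q Q D),
            r = R (PathAI.pastOf X) ⟨PathAI.otimes ℱ t μ Q D, Q, D, h, rfl⟩
              (PathAI.condEL0 P ℱ t Q (PathAI.discountedFuture t D X.1)).toBar}
          (α X) := by
  refine ⟨fun x => PathAI.riskOf fun Y => α (PathAI.concat x Y),
    ⟨fun x => PathAI.isMinimalRiskFunction_riskOf hμ _, fun X => ?_⟩, fun R' hR' => ?_⟩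
  · rw [PathAI.setOf_risk_eq_range hμ]
    have := PathAI.isGLB_riskOf (q := q) hμ (hα (PathAI.pastOf X)) ⟨PathAI.after t X.1, X.2.2⟩
    rwa [PathAI.concat_pastOf] at this
  · funext x
    -- For a fixed past x, the representation at all continuations of x is a representation of one
    -- function on L^{t,p}, which determines the risk function.
    refine PathAI.eq_riskOf hμ (hR'.1 x) fun Y => ?_
    have := hR'.2 (PathAI.concat x Y)
    rwa [PathAI.setOf_risk_eq_range hμ, PathAI.pastOf_concat, PathAI.after_concat] at this
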